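/- **Conventions.** A topological disc is a simply connected domain in $\mathbb C$ whose boundary is a Jordan curve. For a family of sets $X_\lambda\subset\mathbb C$, $\lambda\in D$, write $\mathbb X=\{(\lambda,z):\lambda\in D,\ z\in X_\lambda\}\subset\mathbb C^2$. It is a (topological) bidisc over $D$ if the pair (closure of $\mathbb X$ in $D\times\mathbb C$, $\mathbb X$) is homeomorphic over $D$ to $(D\times\overline{\mathbb D},D\times\mathbb D)$. It extends to the boundary if the closure $\overline{\mathbb X}$ of $\mathbb X$ in $\mathbb C^2$ is homeomorphic over $\overline D$ to $\overline D\times\overline{\mathbb D}$; then it is also regarded as a fibration of open discs over $\overline D$, and its frame is the union over $\lambda\in\partial D$ of the boundaries of its fibers. A holomorphic motion of a set $X\subset\mathbb C$ over $D$ with base point $*\in D$ is a family of injections $h_\lambda:X\to\mathbb C$, $\lambda\in D$, with $h_*=\mathrm{id}$ and $\lambda\mapsto h_\lambda(z)$ holomorphic on $D$ for every $z\in X$. **Families.** A holomorphic family $(\mathbf g,\mathbf h)$ of generalized quadratic-like maps over a topological disc $D$ with base point $*\in D$ consists of bidiscs $\mathbb U$ and $\mathbb V_i$ ($i\in\mathcal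 I\ni 0$) over $D$, a fiberwise map $\mathbf g:\bigcup_i\mathbb V_i\to\mathbb U$ and a holomorphic motion $\mathbf h$ over $D$ with base point $*$ such that: * for every $\lambda\in D$ the discs $V_{i,\lambda}$ are pairwise disjoint, $\overline{V_{i,\lambda}}\subset U_\lambda$, and $U_\lambda$, $V_{i,\lambda}$ are bounded by quasicircles; * for each $i$, $\mathbf g|\mathbb V_i$ extends holomorphically to a neighborhood of the closure of $\mathbb V_i$ in $D\times\mathbb C$ (the extensions for different $i$ need not agree); * for every $\lambda\in D$, $g_\lambda:V_{0,\lambda}\to U_\lambda$ is a branched double covering whose only critical point is $0\in V_{0,\lambda}$, and $g_\lambda:V_{i,\lambda}\to U_\lambda$ is a conformal isomorphism for $i\ne0$; * $h_\lambda$ is defined on $\partial U_*\cup\bigcup_i\partial V_{i,*}$, maps $\partial U_*$ onto $\partial U_\lambda$ and $\partial V_{i,*}$ onto $\partial V_{i,\lambda}$, and satisfies $h_\lambda(g_*(z))=g_\lambda(h_\lambda(z))$ for $z\in\partial V_{i,*}$ (with the extensions of $\mathbf g|\mathbb V_i$). Let $\phi(\lambda)=g_\lambda(0)$. The family is proper if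 $\mathbb U$ extends to the boundary of $D$, the closure of each $\mathbb V_i$ in $\mathbb C^2$ is contained in the fibration of open discs of $\mathbb U$ over $\overline D$, and $\phi$ extends continuously to $\overline D$ in such a way that $(\lambda,\phi(\lambda))$ lies in the frame of $\mathbb U$ for $\lambda\in\partial D$. Its winding number is then the winding number about $0$ of $\phi(\lambda)$ as $\lambda$ goes once around $\partial D$ in the positive direction. **Generalized renormalization.** For a finite, possibly empty, sequence $\bar i=(i_0,\dots,i_{l-1})$ in $\mathcal I\setminus\{0\}$ let $\mathbb L_{\bar i}$ be the tube with fibers $$L_{\bar i,\lambda}=\{z:\ g_\lambda^k(z)\in V_{i_k,\lambda}\ (0\le k<l),\ g_\lambda^l(z)\in V_{0,\lambda}\}.$$ Suppose that the orbit of the critical value of $g_*$ lands in $V_{0,*}$, and let $\bar i_*$ be its itinerary until the first landing, so that $\phi(*)\in L_{\bar i_*,*}$. Let $D'$ be the connected component containing $*$ of $\{\lambda\in D:\phi(\lambda)\in L_{\bar i_*,\lambda}\}$. Over $D'$ (with base point $*$) put $\mathbb U'=\mathbb V_0|D'$, let the tubes $\mathbb V'_j$ be the connected components of the sets $(\mathbf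 g|\mathbb V_0)^{-1}(\mathbb L_{\bar i}|D')$, for all $\bar i$ (the tube $\mathbb V'_0$ being the one that contains $(*,0)$), and let $\mathbf g'=\mathbf g^{|\bar i|+1}$ on the components of $(\mathbf g|\mathbb V_0)^{-1}(\mathbb L_{\bar i}|D')$; this is the first return map to $\mathbb V_0$. Let $\mathbf h'$ be the motion over $D'$ which equals $\mathbf h$ on $\partial V_{0,*}$ and which on $\bigcup_j\partial V'_{j,*}$ is obtained by pulling $\mathbf h|\partial V_{0,*}$ back, first to the boundaries $\partial L_{\bar i,*}$ by $\mathbf g^{|\bar i|}$ and then to the boundaries $\partial V'_{j,*}$ by $\mathbf g|\mathbb V_0$. **Lemma (generalized renormalization).** Let $(\mathbf g,\mathbf h)$ be a proper holomorphic family of generalized quadratic-like maps over $D$ with winding number $1$ such that the orbit of the critical value of $g_*$ lands in $V_{0,*}$. Then the motion $\mathbf h'$ exists, the generalized renormalization $(\mathbf g',\mathbf h')$ is a holomorphic family of generalized quadratic-like maps over $D'$ (in particular, $D'$ is a topological disc), this family is proper, and its winding number is $1$. -/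

import Mathlib

/-! Planar topology: Jordan curves, topological discs, quasicircles, winding numbers. -/

/-- `γ : [0,1] → ℂ` parametrizes the set `J` as a Jordan curve. -/
def IsJordanParam (γ : ℝ → ℂ) (J : Set ℂ) : Prop :=
  ContinuousOn γ (Set.Icc 0 1) ∧ Set.InjOn γ (Set.Ico 0 1) ∧ γ 0 = γ 1 ∧
    γ '' Set.Icc 0 1 = J

/-- A topological disc: a simply connected domain in `ℂ` whose boundary is a Jordan curve. -/
def IsTopDisc (D : Set ℂ) : Prop :=
  IsOpen D ∧ IsSimplyConnected D ∧ ∃ γ : ℝ → ℂ, IsJordanParam γ (frontier D)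

/-- A quasicircle: a Jordan curve of bounded turning, that is, any two of its points `x`, `y` lie
in a subarc (equivalently, in a connected subset) of diameter at most `C * |x - y|`. -/
def IsQuasicircle (J : Set ℂ) : Prop :=
  (∃ γ : ℝ → ℂ, IsJordanParam γ J) ∧
    ∃ C : ℝ, ∀ x ∈ J, ∀ y ∈ J, ∃ A ⊆ J, IsConnected A ∧ x ∈ A ∧ y ∈ A ∧
      Metric.diam A ≤ C * dist x y

/-- The curve `c : [0,1] → ℂ \ {0}` has winding number `n` about the origin: the increment of
a continuous branch `L` of `log c` along `[0,1]` is `2 π i n`. -/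
def HasWinding (c : ℝ → ℂ) (n : ℤ) : Prop :=
  ∃ L : ℝ → ℂ, ContinuousOn L (Set.Icc 0 1) ∧
    (∀ t ∈ Set.Icc (0 : ℝ) 1, Complex.exp (L t) = c t) ∧
    L 1 - L 0 = 2 * Real.pi * Complex.I * n

/-- `γ` goes once around the boundary of `D` in the positive direction. -/
def IsPositiveBoundary (γ : ℝ → ℂ) (D : Set ℂ) : Prop :=
  IsJordanParam γ (frontier D) ∧ ∀ a ∈ D, HasWinding (fun t => γ t - a) 1

/-- The winding number, along `∂D`, of the boundary values of `ψ₁` about `ψ₂` equals `n`. -/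
def HasBoundaryWinding (D : Set ℂ) (ψ₁ ψ₂ : ℂ → ℂ) (n : ℤ) : Prop :=
  ∃ γ : ℝ → ℂ, IsPositiveBoundary γ D ∧ HasWinding (fun t => ψ₁ (γ t) - ψ₂ (γ t)) n

/-! Bidiscs. A family of fibers `X : ℂ → Set ℂ` over `D` is identified with its total space. -/

/-- The total space over `D` of a family of fibers. -/
def tube (D : Set ℂ) (X : ℂ → Set ℂ) : Set (ℂ × ℂ) :=
  {p | p.1 ∈ D ∧ p.2 ∈ X p.1}

/-- The family `X` is a topological bidisc over `D`: over `D`, the pair (closure of the total space,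
total space) is homeomorphic to the pair (`D × closed disc`, `D × open disc`).
The map `(l, z) ↦ (l, F l z)` is such a homeomorphism: being continuous, injective and proper
over `D`, it is a homeomorphism onto a relatively closed subset of `D × ℂ`. -/
def IsBidisc (D : Set ℂ) (X : ℂ → Set ℂ) : Prop :=
  ∃ F : ℂ → ℂ → ℂ,
    ContinuousOn (fun p : ℂ × ℂ => F p.1 p.2) (D ×ˢ Metric.closedBall 0 1) ∧
    ∀ l ∈ D, Set.InjOn (F l) (Metric.closedBall 0 1) ∧ F l '' Metric.ball 0 1 = X l

/-- The fibration extends to the boundary of `D`: the closure of the total space in `ℂ²` is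
homeomorphic to `closure D × closed disc` over `closure D`. -/
def ExtendsToBoundary (D : Set ℂ) (X : ℂ → Set ℂ) : Prop :=
  ∃ F : ℂ → ℂ → ℂ,
    ContinuousOn (fun p : ℂ × ℂ => F p.1 p.2) (closure D ×ˢ Metric.closedBall 0 1) ∧
    (∀ l ∈ closure D, Set.InjOn (F l) (Metric.closedBall 0 1)) ∧
    ∀ l ∈ D, F l '' Metric.ball 0 1 = X l

/-- The fiber over `l` (in the closure of `D`) of the closed bidisc, the closure of the total space
in `ℂ²`. If the fibration extends to the boundary, its interior is the open disc fiber over `l`,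
and, for `l ∈ ∂D`, its frontier is the part of the frame over `l`. -/
def closedFiber (D : Set ℂ) (X : ℂ → Set ℂ) (l : ℂ) : Set ℂ :=
  {z | (l, z) ∈ closure (tube D X)}

/-- A holomorphic motion of `X` over `D` with base point `b`. -/
def IsHolomorphicMotion (D : Set ℂ) (b : ℂ) (X : Set ℂ) (h : ℂ → ℂ → ℂ) : Prop :=
  (∀ l ∈ D, Set.InjOn (h l) X) ∧ (∀ z ∈ X, h b z = z) ∧
    ∀ z ∈ X, DifferentiableOn ℂ (fun l => h l z) D

/-- `f : V → U` is a double covering branched at the point `0` only. -/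
structure IsDoubleBranchedCover (f : ℂ → ℂ) (V U : Set ℂ) : Prop where
  mapsTo : Set.MapsTo f V U
  isProper : ∀ K ⊆ U, IsCompact K → IsCompact (V ∩ f ⁻¹' K)
  crit : deriv f 0 = 0
  fiber_crit : V ∩ f ⁻¹' {f 0} = {0}
  fiber : ∀ w ∈ U, w ≠ f 0 → (V ∩ f ⁻¹' {w}).ncard = 2

/-- The maps `g i`, holomorphic near the closures of the discs `V i`, form a generalized
quadratic-like map from the union of the `V i` to `U` with critical point `0 ∈ V o`. -/
structure IsGenQuadraticLike {ι : Type*} (o : ι) (V : ι → Set ℂ) (U : Set ℂ)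
    (g : ι → ℂ → ℂ) : Prop where
  compactly_inside : ∀ i, closure (V i) ⊆ U
  disjoint : ∀ i j, i ≠ j → Disjoint (V i) (V j)
  holo : ∀ i, AnalyticOnNhd ℂ (g i) (closure (V i))
  central : IsDoubleBranchedCover (g o) (V o) U
  univalent : ∀ i, i ≠ o → Set.BijOn (g i) (V i) U

/-- The data of a fiberwise map from a union of tubes to a tube, over a parameter domain `D` with
base point `base`. The index of the central tube is `o`. The map on the tube `V i` is `g i` (its
values near the boundary of `V i` are those of its holomorphic extension; the extensions for
different `i` need not agree where the neighborhoods overlap). -/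
structure FiberMap (ι : Type*) where
  D : Set ℂ
  base : ℂ
  U : ℂ → Set ℂ
  V : ι → ℂ → Set ℂ
  o : ι
  g : ι → ℂ → ℂ → ℂ

namespace FiberMap

variable {ι : Type*}

/-- The critical value function. -/
def critVal (G : FiberMap ι) (l : ℂ) : ℂ := G.g G.o l 0

/-- The set whose motion is part of a holomorphic family: the union of the boundaries of the discs
`U` and `V i` over the base point. -/
def boundarySet (G : FiberMap ι) : Set ℂ :=
  frontier (G.U G.base) ∪ ⋃ i, frontier (G.V i G.base)

/-- `(G, h)` is a holomorphic family of generalized quadratic-like maps over `G.D`. -/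
structure IsHolomorphicFamily (G : FiberMap ι) (h : ℂ → ℂ → ℂ) : Prop where
  disc : IsTopDisc G.D
  base_mem : G.base ∈ G.D
  bidisc_U : IsBidisc G.D G.U
  bidisc_V : ∀ i, IsBidisc G.D (G.V i)
  quasicircle_U : ∀ l ∈ G.D, IsQuasicircle (frontier (G.U l))
  quasicircle_V : ∀ i, ∀ l ∈ G.D, IsQuasicircle (frontier (G.V i l))
  holo : ∀ i, AnalyticOnNhd ℂ (fun p : ℂ × ℂ => G.g i p.1 p.2)
    (tube G.D (fun l => closure (G.V i l)))
  fiber : ∀ l ∈ G.D, IsGenQuadraticLike G.o (fun i => G.V i l) (G.U l) (fun i => G.g i l)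
  motion : IsHolomorphicMotion G.D G.base G.boundarySet h
  motion_U : ∀ l ∈ G.D, h l '' frontier (G.U G.base) = frontier (G.U l)
  motion_V : ∀ i, ∀ l ∈ G.D, h l '' frontier (G.V i G.base) = frontier (G.V i l)
  equivariant : ∀ i, ∀ l ∈ G.D, ∀ z ∈ frontier (G.V i G.base),
    h l (G.g i G.base z) = G.g i l (h l z)

/-- `φ` is the continuous extension of the critical value function to the closure of `G.D`. -/
def IsBoundaryExtension (G : FiberMap ι) (φ : ℂ → ℂ) : Prop :=
  ContinuousOn φ (closure G.D) ∧ Set.EqOn φ G.critVal G.D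

/-- Properness: the fibration `U` extends to the boundary of `D`, the closure of each tube `V i` in
`ℂ²` lies in the fibration of open discs over `closure D`, and the critical value is a proper
section: it is continuous up to the boundary and maps the boundary of `D` into the frame. -/
structure IsProper (G : FiberMap ι) : Prop where
  extends_U : ExtendsToBoundary G.D G.U
  closure_V : ∀ i, ∀ p ∈ closure (tube G.D (G.V i)), p.2 ∈ interior (closedFiber G.D G.U p.1)
  section_proper : ∃ φ : ℂ → ℂ, G.IsBoundaryExtension φ ∧
    ∀ l ∈ frontier G.D, φ l ∈ frontier (closedFiber G.D G.U l)

/-- The winding number of the critical value about the critical point `0` is `n`. -/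
def HasWindingNumber (G : FiberMap ι) (n : ℤ) : Prop :=
  ∃ φ : ℂ → ℂ, G.IsBoundaryExtension φ ∧ HasBoundaryWinding G.D φ (fun _ => 0) n

/-! Generalized renormalization. -/

/-- The composition of the maps `g i` along the word `s`. -/
def iter (G : FiberMap ι) : List ι → ℂ → ℂ → ℂ
  | [], _, z => z
  | i :: s, l, z => G.iter s l (G.g i l z)

/-- The tube `L s`: the points whose orbit passes through the tubes `V i` prescribed by the word
`s` and lands in the central tube immediately afterwards. -/
def landing (G : FiberMap ι) : List ι → ℂ → Set ℂ
  | [], l => G.V G.o l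
  | i :: s, l => {z | z ∈ G.V i l ∧ G.g i l z ∈ G.landing s l}

/-- The word `s` in non-central symbols is the itinerary of the critical value at the base point
until its first landing in the central tube. -/
def IsBaseItinerary (G : FiberMap ι) (s : List ι) : Prop :=
  (∀ i ∈ s, i ≠ G.o) ∧ G.critVal G.base ∈ G.landing s G.base

/-- The renormalized parameter domain. -/
def renormDomain (G : FiberMap ι) (s : List ι) : Set ℂ :=
  connectedComponentIn {l | l ∈ G.D ∧ G.critVal l ∈ G.landing s l} G.base

/-- The preimage of `L t`, restricted to the renormalized parameter domain, under the map on the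
central tube. -/
def pullback (G : FiberMap ι) (s t : List ι) : Set (ℂ × ℂ) :=
  {p | p.1 ∈ G.renormDomain s ∧ p.2 ∈ G.V G.o p.1 ∧ G.g G.o p.1 p.2 ∈ G.landing t p.1}

/-- The labels of the tubes of the renormalized map: pairs of a word `t` in non-central symbols and
a connected component of the preimage of `L t`. -/
def RenormIndex (G : FiberMap ι) (s : List ι) :=
  {j : List ι × Set (ℂ × ℂ) // (∀ i ∈ j.1, i ≠ G.o) ∧
    ∃ p ∈ G.pullback s j.1, j.2 = connectedComponentIn (G.pullback s j.1) p}

theorem base_mem_pullback {G : FiberMap ι} {s : List ι} (hs : G.IsBaseItinerary s)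
    (hb : G.base ∈ G.D) (h0 : (0 : ℂ) ∈ G.V G.o G.base) :
    (G.base, (0 : ℂ)) ∈ G.pullback s s :=
  ⟨mem_connectedComponentIn ⟨hb, hs.2⟩, h0, hs.2⟩

/-- The generalized renormalization: the first return map to the central tube over the
renormalized parameter domain. Its tubes are the components of the preimages of the tubes `L t`
in the central tube, and its central tube is the one that contains the critical point. -/
def renorm (G : FiberMap ι) (s : List ι) (hs : G.IsBaseItinerary s)
    (hb : G.base ∈ G.D) (h0 : (0 : ℂ) ∈ G.V G.o G.base) : FiberMap (G.RenormIndex s) where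
  D := G.renormDomain s
  base := G.base
  U := G.V G.o
  V := fun j l => {z | (l, z) ∈ j.1.2}
  o := ⟨(s, connectedComponentIn (G.pullback s s) (G.base, 0)), hs.1,
    (G.base, 0), base_mem_pullback hs hb h0, rfl⟩
  g := fun j l z => G.iter j.1.1 l (G.g G.o l z)

/-- `k` is the motion obtained from `h` by restricting it to the boundary of the central disc, and
by pulling it back from there, first to the boundaries of the discs `L t` by the composition of the
maps along `t`, then to the boundaries of the new discs by the map on the central disc. -/
def IsLiftedMotion (G : FiberMap ι) (s : List ι) (hs : G.IsBaseItinerary s)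
    (hb : G.base ∈ G.D) (h0 : (0 : ℂ) ∈ G.V G.o G.base) (h k : ℂ → ℂ → ℂ) : Prop :=
  ∀ l ∈ G.renormDomain s,
    (∀ z ∈ frontier (G.V G.o G.base), k l z = h l z) ∧
    ∀ j : G.RenormIndex s, ∀ z ∈ frontier ((G.renorm s hs hb h0).V j G.base),
      k l z ∈ frontier ((G.renorm s hs hb h0).V j l) ∧
      G.g G.o l (k l z) ∈ frontier (G.landing j.1.1 l) ∧
      G.iter j.1.1 l (G.g G.o l (k l z)) =
        h l (G.iter j.1.1 G.base (G.g G.o G.base z))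

theorem IsHolomorphicFamily.zero_mem {G : FiberMap ι} {h : ℂ → ℂ → ℂ}
    (H : G.IsHolomorphicFamily h) : (0 : ℂ) ∈ G.V G.o G.base :=
  ((H.fiber G.base H.base_mem).central.fiber_crit.ge rfl).1

end FiberMap

/-! The critical value φ is a section of the tube 𝕌 that goes once round the frame as the parameter
goes once round ∂D. The argument principle then makes φ meet every holomorphic section with values
in a closed tube `V i` exactly once and transversally (`exists_root`). For the zero section this is
the winding number hypothesis. Any other such section is joined to the zero section inside a smaller
concentric tube, which φ avoids near ∂D, so the count does not change.

Let s be the itinerary of the critical value at the base point. The boundary of `L s` moves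
holomorphically: a point y of ∂V₀ over the base point traces the section σ(y), the inverse branch
along s applied to the motion of y. So φ meets σ(y) at a unique parameter χ(y). The map χ is
continuous and injective, hence Γ = χ(∂V₀) is a Jordan curve, and it consists of the parameters at
which φ lies on the boundary of `L s`. In the factorization φ(l) - σ_l(y) = (l - χ(y)) q_y(l) the
loop y ↦ q_y(l) has winding number 0, so Γ winds ±1 times about each landing parameter l. Therefore
Γ bounds D' and D' is a topological disc (`exists_renormDisc`). Inside D' the renormalized critical
value vanishes only at the parameter e where φ meets the center of `L s`; this zero is simple, so
the new winding number is 1 (`hasWinding_critVal`).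

On the central tube g = φ + η² for a global coordinate η (`exists_sqrt`). A tube `L t` with t ≠ s
misses φ, so its preimage splits into two univalent copies (`exists_lifts`); the preimage of `L s`
is one tube, a branched double cover (`exists_central_lift`). The motion lifts through the coverings
by continuing roots over the simply connected D', and a continuous lift through a local
biholomorphism is holomorphic. Bounded turning pulls back under maps that are univalent near the
curve. Properness is inherited because the closure of D' lies in D.

The plane topology rests on one device: nonvanishing functions are glued across a frontier, given a
logarithm on the plane, and compared by winding numbers. This yields invariance of domain and what
is needed about Jordan curves. Simple connectivity of D' comes from Koebe's square root method. -/

section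

open Set Filter Topology Metric Complex

/-! ### Continuous logarithms -/

/-- Homotopy lifting through the exponential. -/
theorem exists_log_homotopy {Y : Type*} [TopologicalSpace Y] {S : Set Y} {H : ℝ → Y → ℂ}
    (hH : ContinuousOn (fun p : ℝ × Y => H p.1 p.2) (Icc 0 1 ×ˢ S))
    (h0 : ∀ t ∈ Icc (0 : ℝ) 1, ∀ y ∈ S, H t y ≠ 0) :
    ∃ M : Y → ℂ, ContinuousOn M S ∧ ∀ y ∈ S, H 1 y = H 0 y * exp (M y) := by
  classical
  have hc0 : Continuous fun p : unitInterval × S => H p.1 p.2 := by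
    have := hH.comp_continuous (f := fun p : unitInterval × S => ((p.1 : ℝ), (p.2 : Y)))
      (by fun_prop) (fun p => ⟨p.1.2, p.2.2⟩)
    exact this
  have hne : ∀ p : unitInterval × S, H p.1 p.2 / H 0 p.2 ≠ 0 := fun p =>
    div_ne_zero (h0 _ p.1.2 _ p.2.2) (h0 _ (by simp) _ p.2.2)
  have hcont : Continuous fun p : unitInterval × S => H p.1 p.2 / H 0 p.2 :=
    hc0.div (hc0.comp (f := fun p : unitInterval × S => ((0 : unitInterval), p.2)) (by fun_prop))
      (fun p => h0 _ (by simp) _ p.2.2)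
  -- Dividing by the initial values lets the lift start at the constant `0`, so `H 0` itself need
  -- not have a logarithm.
  let G : C(unitInterval × S, {z : ℂ // z ≠ 0}) :=
    ⟨fun p => ⟨H p.1 p.2 / H 0 p.2, hne p⟩, hcont.subtype_mk _⟩
  have hG0 : ∀ a : S, G (0, a) = (fun z : ℂ ↦ (⟨_, z.exp_ne_zero⟩ : {z : ℂ // z ≠ 0}))
      ((ContinuousMap.const S (0 : ℂ)) a) := by
    intro a
    apply Subtype.ext
    simp [G, div_self (h0 0 (by simp) _ a.2)]
  let K := isCoveringMap_exp.liftHomotopy G (ContinuousMap.const S (0 : ℂ)) hG0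
  have hK : ∀ p, exp (K p) = H p.1 p.2 / H 0 p.2 := by
    intro p
    have := congrFun (isCoveringMap_exp.liftHomotopy_lifts G (ContinuousMap.const S (0 : ℂ)) hG0) p
    exact congrArg Subtype.val this
  refine ⟨fun y => if hy : y ∈ S then K (1, ⟨y, hy⟩) else 0, ?_, ?_⟩
  · rw [continuousOn_iff_continuous_domRestrict]
    have : Continuous fun y : S => K (1, y) := by fun_prop
    convert this using 1
    ext y
    simp
  · intro y hy
    simp only [hy, dite_true, hK]
    have := h0 0 (by simp) y hy
    field_simp
    simp

/-- Radial contraction is a homotopy to `g` from the constant `g x`, which has a logarithm. -/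
theorem exists_log_starConvex {E : Type*} [AddCommGroup E] [Module ℝ E] [TopologicalSpace E]
    [IsTopologicalAddGroup E] [ContinuousSMul ℝ E] {S : Set E} {x : E} (hS : StarConvex ℝ x S)
    (hx : x ∈ S) {g : E → ℂ} (hg : ContinuousOn g S) (h0 : ∀ y ∈ S, g y ≠ 0) :
    ∃ L : E → ℂ, ContinuousOn L S ∧ ∀ y ∈ S, exp (L y) = g y := by
  have hmem : ∀ t ∈ Icc (0 : ℝ) 1, ∀ y ∈ S, x + t • (y - x) ∈ S := by
    intro t ht y hy
    have := hS hy (sub_nonneg.2 ht.2) ht.1 (by ring : 1 - t + t = 1)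
    convert this using 1
    module
  obtain ⟨M, hM, hM'⟩ := exists_log_homotopy (S := S) (H := fun t y => g (x + t • (y - x)))
    (hg.comp (by fun_prop) (fun p hp => hmem _ hp.1 _ hp.2))
    (fun t ht y hy => h0 _ (hmem t ht y hy))
  refine ⟨fun y => M y + log (g x), by fun_prop, fun y hy => ?_⟩
  rw [exp_add, exp_log (h0 x hx)]
  simpa [mul_comm] using (hM' y hy).symm

theorem exists_log_plane {g : ℂ → ℂ} (hg : Continuous g) (h0 : ∀ y, g y ≠ 0) :
    ∃ L : ℂ → ℂ, Continuous L ∧ ∀ y, exp (L y) = g y := by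
  obtain ⟨L, h1, h2⟩ := exists_log_starConvex (x := (0 : ℂ)) (starConvex_univ 0)
    (mem_univ _) hg.continuousOn (fun y _ => h0 y)
  exact ⟨L, continuousOn_univ.1 h1, fun y => h2 y (mem_univ _)⟩

theorem exists_log_of_isSimplyConnected {X : Type*} [TopologicalSpace X]
    [LocallyPathConnectedSpace X] {U : Set X} (hUc : IsSimplyConnected U) (hUo : IsOpen U)
    {g : X → ℂ} (hg : ContinuousOn g U) (h0 : ∀ x ∈ U, g x ≠ 0) :
    ∃ L : X → ℂ, ContinuousOn L U ∧ ∀ x ∈ U, exp (L x) = g x :=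
  exists_continuousOn_eqOn_exp_comp hUc hUo hg (by rintro ⟨x, hx, h⟩; exact h0 x hx h)

theorem exists_int_of_exp_eq {z w : ℂ} (h : exp z = exp w) :
    ∃ k : ℤ, z - w = 2 * Real.pi * I * k := by
  obtain ⟨k, hk⟩ := exp_eq_exp_iff_exists_int.1 h
  exact ⟨k, by rw [hk]; ring⟩

theorem two_pi_I_mul_int_injective {k l : ℤ}
    (h : (2 * Real.pi * I * k : ℂ) = 2 * Real.pi * I * l) : k = l := by
  have := mul_left_cancel₀ two_pi_I_ne_zero h
  exact_mod_cast this

/-- The tube lemma in filter form: finitely many local statements cover `K`. -/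
theorem IsCompact.eventually_forall_of_filter {X Y : Type*} [TopologicalSpace Y] {K : Set Y}
    (hK : IsCompact K) {l : Filter X} {P : X → Y → Prop}
    (h : ∀ y ∈ K, ∀ᶠ p : X × Y in l ×ˢ 𝓝[K] y, P p.1 p.2) : ∀ᶠ x in l, ∀ y ∈ K, P x y := by
  refine hK.induction_on (p := fun T => ∀ᶠ x in l, ∀ y ∈ T, P x y) (by simp)
    (fun s t hst ht => ht.mono fun x hx y hy => hx y (hst hy))
    (fun s t hs ht => (hs.and ht).mono fun x hx y hy => hy.elim (hx.1 y) (hx.2 y)) fun y hy => ?_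
  obtain ⟨pa, ha, pb, hb, hab⟩ := eventually_prod_iff.1 (h y hy)
  exact ⟨{y | pb y}, hb, ha.mono fun x hx y hy => hab hx hy⟩

/-- A continuous integer-valued function on a preconnected set is constant. -/
theorem IsPreconnected.exists_int_of_continuousOn {X : Type*} [TopologicalSpace X] {S : Set X}
    (hS : IsPreconnected S) {f : X → ℂ} (hf : ContinuousOn f S)
    (hk : ∀ x ∈ S, ∃ k : ℤ, f x = 2 * Real.pi * I * k) :
    ∃ k : ℤ, ∀ x ∈ S, f x = 2 * Real.pi * I * k := by
  have hmul : ∀ x ∈ S, ∀ y ∈ S, f x = f y := by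
    intro x hx y hy
    have hc : IsPreconnected ((fun z => f z / (2 * Real.pi * I)) '' S) :=
      hS.image _ (hf.div_const _)
    have hsub : ((fun z => f z / (2 * Real.pi * I)) '' S) ⊆ range ((↑) : ℤ → ℂ) := by
      rintro _ ⟨z, hz, rfl⟩
      obtain ⟨k, hk⟩ := hk z hz
      exact ⟨k, by simp only [hk]; field_simp [two_pi_I_ne_zero]⟩
    have hT : IsTotallyDisconnected (range ((↑) : ℤ → ℂ)) :=
      (countable_range _).isTotallyDisconnected
    have := hT _ hsub hc ⟨x, hx, rfl⟩ ⟨y, hy, rfl⟩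
    simp only at this
    have h2 := two_pi_I_ne_zero
    rwa [div_left_inj' h2] at this
  rcases S.eq_empty_or_nonempty with rfl | ⟨x, hx⟩
  · exact ⟨0, by simp⟩
  · obtain ⟨k, hk⟩ := hk x hx
    exact ⟨k, fun y hy => (hmul y hy x hx).trans hk⟩

theorem IsPreconnected.exists_int_of_exp_eq {X : Type*} [TopologicalSpace X] {S : Set X}
    (hS : IsPreconnected S) {f g : X → ℂ} (hf : ContinuousOn f S) (hg : ContinuousOn g S)
    (h : ∀ x ∈ S, exp (f x) = exp (g x)) : ∃ k : ℤ, ∀ x ∈ S, f x - g x = 2 * Real.pi * I * k :=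
  hS.exists_int_of_continuousOn (hf.sub hg) (fun x hx => _root_.exists_int_of_exp_eq (h x hx))

/-! ### Winding numbers -/

namespace HasWinding

variable {c d : ℝ → ℂ} {n m : ℤ}

theorem closed (h : HasWinding c n) : c 0 = c 1 := by
  obtain ⟨L, -, h2, h3⟩ := h
  rw [← h2 0 (by simp), ← h2 1 (by simp), eq_comm, exp_eq_exp_iff_exists_int]
  exact ⟨n, by rw [sub_eq_iff_eq_add.1 h3]; ring⟩

theorem continuousOn (h : HasWinding c n) : ContinuousOn c (Icc 0 1) := by
  obtain ⟨L, h1, h2, -⟩ := h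
  exact (continuous_exp.comp_continuousOn h1).congr (fun t ht => (h2 t ht).symm)

theorem unique (h : HasWinding c n) (h' : HasWinding c m) : n = m := by
  obtain ⟨L, h1, h2, h3⟩ := h
  obtain ⟨L', h1', h2', h3'⟩ := h'
  obtain ⟨k, hk⟩ := isPreconnected_Icc.exists_int_of_exp_eq h1 h1'
    (fun t ht => (h2 t ht).trans (h2' t ht).symm)
  have e0 := hk 0 (by simp)
  have e1 := hk 1 (by simp)
  apply two_pi_I_mul_int_injective
  rw [← h3, ← h3']
  linear_combination e1 - e0

theorem congr (h : HasWinding c n) (hcd : ∀ t ∈ Icc (0 : ℝ) 1, d t = c t) : HasWinding d n := by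
  obtain ⟨L, h1, h2, h3⟩ := h
  exact ⟨L, h1, fun t ht => (h2 t ht).trans (hcd t ht).symm, h3⟩

theorem mul (h : HasWinding c n) (h' : HasWinding d m) :
    HasWinding (fun t => c t * d t) (n + m) := by
  obtain ⟨L, h1, h2, h3⟩ := h
  obtain ⟨L', h1', h2', h3'⟩ := h'
  refine ⟨fun t => L t + L' t, h1.add h1', fun t ht => by rw [exp_add, h2 t ht, h2' t ht], ?_⟩
  push_cast
  linear_combination h3 + h3'

theorem inv (h : HasWinding c n) : HasWinding (fun t => (c t)⁻¹) (-n) := by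
  obtain ⟨L, h1, h2, h3⟩ := h
  refine ⟨fun t => -L t, h1.neg, fun t ht => by rw [exp_neg, h2 t ht], ?_⟩
  push_cast
  linear_combination -h3

theorem prod {ι : Type*} (s : Finset ι) {c : ι → ℝ → ℂ} {n : ι → ℤ}
    (h : ∀ i ∈ s, HasWinding (c i) (n i)) :
    HasWinding (fun t => ∏ i ∈ s, c i t) (∑ i ∈ s, n i) := by
  classical
  induction s using Finset.induction_on with
  | empty => exact ⟨fun _ => 0, continuousOn_const, by simp, by simp⟩
  | insert a s ha ih =>
    simp only [Finset.prod_insert ha, Finset.sum_insert ha]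
    exact (h a (by simp)).mul (ih fun i hi => h i (by simp [hi]))

theorem pow (h : HasWinding c n) (k : ℕ) : HasWinding (fun t => c t ^ k) (k * n) := by
  simpa using HasWinding.prod (Finset.range k) (fun _ _ => h)

theorem zpow (h : HasWinding c n) (k : ℤ) : HasWinding (fun t => c t ^ k) (k * n) := by
  obtain ⟨L, h1, h2, h3⟩ := h
  refine ⟨fun t => k * L t, by fun_prop, fun t ht => by rw [exp_int_mul, h2 t ht], ?_⟩
  push_cast
  linear_combination k * h3

theorem of_log {L : ℝ → ℂ} (hL : ContinuousOn L (Icc 0 1)) (h : L 0 = L 1)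
    (hc : ∀ t ∈ Icc (0 : ℝ) 1, exp (L t) = c t) : HasWinding c 0 :=
  ⟨L, hL, hc, by simp [h]⟩

/-- Along a closed curve in a set on which `f` has a continuous logarithm. -/
theorem of_log_comp {X : Type*} [TopologicalSpace X] {S : Set X} {f L : X → ℂ} {γ : ℝ → X}
    (hL : ContinuousOn L S) (hf : ∀ x ∈ S, exp (L x) = f x) (hγ : ContinuousOn γ (Icc 0 1))
    (hγS : MapsTo γ (Icc 0 1) S) (h : γ 0 = γ 1) : HasWinding (fun t => f (γ t)) 0 :=
  of_log (L := L ∘ γ) (hL.comp hγ hγS) (by simp [h]) (fun t ht => hf _ (hγS ht))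

theorem exists_of_closed (hc : ContinuousOn c (Icc 0 1)) (h0 : ∀ t ∈ Icc (0 : ℝ) 1, c t ≠ 0)
    (h : c 0 = c 1) : ∃ n, HasWinding c n := by
  obtain ⟨L, h1, h2⟩ := exists_log_starConvex (x := (0 : ℝ))
    ((convex_Icc (0 : ℝ) 1).starConvex (by simp)) (by simp) hc h0
  obtain ⟨k, hk⟩ := _root_.exists_int_of_exp_eq
    ((h2 1 (by simp)).trans (h.symm.trans (h2 0 (by simp)).symm))
  exact ⟨k, L, h1, h2, hk⟩

theorem reverse (h : HasWinding c n) : HasWinding (fun t => c (1 - t)) (-n) := by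
  obtain ⟨L, h1, h2, h3⟩ := h
  refine ⟨fun t => L (1 - t), h1.comp (by fun_prop) (fun t ht => ⟨by linarith [ht.2], by linarith [ht.1]⟩),
    fun t ht => h2 _ ⟨by linarith [ht.2], by linarith [ht.1]⟩, ?_⟩
  simp only [sub_self, sub_zero]
  push_cast
  linear_combination -h3

theorem neg (h : HasWinding c n) : HasWinding (fun t => -c t) n := by
  obtain ⟨L, h1, h2, h3⟩ := h
  exact ⟨fun t => L t + Real.pi * I, by fun_prop,
    fun t ht => by rw [exp_add, h2 t ht, exp_pi_mul_I]; ring, by linear_combination h3⟩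

/-- A logarithm exists on the whole square. The increments of its slices at fixed `s` are integer
multiples of `2πi` and depend continuously on `s`, so they all agree. -/
theorem of_homotopy {H : ℝ → ℝ → ℂ}
    (hH : ContinuousOn (fun p : ℝ × ℝ => H p.1 p.2) (Icc 0 1 ×ˢ Icc 0 1))
    (h0 : ∀ s ∈ Icc (0 : ℝ) 1, ∀ t ∈ Icc (0 : ℝ) 1, H s t ≠ 0)
    (hcl : ∀ s ∈ Icc (0 : ℝ) 1, H s 0 = H s 1)
    (h : HasWinding (H 0) n) : HasWinding (H 1) n := by
  obtain ⟨L, h1, h2⟩ := exists_log_starConvex (x := ((0, 0) : ℝ × ℝ)) (S := Icc 0 1 ×ˢ Icc 0 1)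
    (((convex_Icc (0 : ℝ) 1).prod (convex_Icc (0 : ℝ) 1)).starConvex (by simp)) (by simp) hH
    (fun p hp => h0 _ hp.1 _ hp.2)
  have key : ∃ k : ℤ, ∀ s ∈ Icc (0 : ℝ) 1, L (s, 1) - L (s, 0) = 2 * Real.pi * I * k := by
    apply isPreconnected_Icc.exists_int_of_exp_eq (f := fun s => L (s, 1)) (g := fun s => L (s, 0))
    · exact h1.comp (by fun_prop) (fun s hs => ⟨hs, by simp⟩)
    · exact h1.comp (by fun_prop) (fun s hs => ⟨hs, by simp⟩)
    · intro s hs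
      rw [h2 (s, 1) ⟨hs, by simp⟩, h2 (s, 0) ⟨hs, by simp⟩]
      exact (hcl s hs).symm
  obtain ⟨k, hk⟩ := key
  have hw : ∀ s ∈ Icc (0 : ℝ) 1, HasWinding (H s) k := fun s hs =>
    ⟨fun t => L (s, t), h1.comp (by fun_prop) (fun t ht => ⟨hs, ht⟩),
      fun t ht => h2 (s, t) ⟨hs, ht⟩, hk s hs⟩
  rw [h.unique (hw 0 (by simp))]
  exact hw 1 (by simp)

/-- Winding numbers are stable under small perturbations. -/
theorem of_norm_sub_lt (h : HasWinding c n) (hd : ContinuousOn d (Icc 0 1)) (hcl : d 0 = d 1)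
    (hlt : ∀ t ∈ Icc (0 : ℝ) 1, ‖d t - c t‖ < ‖c t‖) : HasWinding d n := by
  have hc := h.continuousOn
  -- The segment from `c t` to `d t` is shorter than the distance from `c t` to `0`, so the
  -- straight-line homotopy avoids `0`.
  have := of_homotopy (n := n) (H := fun s t => c t + s * (d t - c t)) ?_ ?_ ?_
    (h.congr (by simp))
  · exact this.congr (by simp)
  · have h1 : ContinuousOn (fun p : ℝ × ℝ => c p.2) (Icc 0 1 ×ˢ Icc 0 1) :=
      hc.comp (by fun_prop) (fun p hp => hp.2)
    have h2 : ContinuousOn (fun p : ℝ × ℝ => d p.2) (Icc 0 1 ×ˢ Icc 0 1) :=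
      hd.comp (by fun_prop) (fun p hp => hp.2)
    have h3 : ContinuousOn (fun p : ℝ × ℝ => (p.1 : ℂ)) (Icc 0 1 ×ˢ Icc 0 1) := by fun_prop
    exact h1.add (h3.mul (h2.sub h1))
  · intro s hs t ht h0
    have : c t = -(s * (d t - c t)) := by linear_combination h0
    have h2 := hlt t ht
    have h3 : ‖c t‖ ≤ ‖d t - c t‖ := by
      conv_lhs => rw [this]
      rw [norm_neg, norm_mul, norm_real, Real.norm_of_nonneg hs.1]
      exact mul_le_of_le_one_left (norm_nonneg _) hs.2
    linarith
  · intro s _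
    simp only [h.closed, hcl]

/-- The winding number is constant in connected families. -/
theorem of_isPreconnected {X : Type*} [TopologicalSpace X] {S : Set X} (hS : IsPreconnected S)
    {H : X → ℝ → ℂ} (hH : ContinuousOn (fun p : X × ℝ => H p.1 p.2) (S ×ˢ Icc 0 1))
    (h0 : ∀ x ∈ S, ∀ t ∈ Icc (0 : ℝ) 1, H x t ≠ 0) (hcl : ∀ x ∈ S, H x 0 = H x 1) {a b : X}
    (ha : a ∈ S) (hb : b ∈ S) (h : HasWinding (H a) n) : HasWinding (H b) n := by
  classical
  have hcont : ∀ x ∈ S, ContinuousOn (H x) (Icc 0 1) := fun x hx =>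
    hH.comp (f := fun t : ℝ => (x, t)) (by fun_prop) (fun t ht => ⟨hx, ht⟩)
  have hex : ∀ x ∈ S, ∃ n, HasWinding (H x) n := fun x hx =>
    exists_of_closed (hcont x hx) (h0 x hx) (hcl x hx)
  choose! w hw using hex
  have hloc : ∀ x ∈ S, ∀ᶠ y in 𝓝[S] x, w y = w x := by
    intro x hx
    have hev : ∀ t ∈ Icc (0 : ℝ) 1, ∀ᶠ p : X × ℝ in 𝓝[S] x ×ˢ 𝓝[Icc 0 1] t,
        ‖H p.1 p.2 - H x p.2‖ < ‖H x p.2‖ := by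
      intro t ht
      have e : 𝓝[S] x ×ˢ 𝓝[Icc 0 1] t = 𝓝[S ×ˢ Icc 0 1] (x, t) := (nhdsWithin_prod_eq _ _ _ _).symm
      rw [e]
      have c1 := hH (x, t) ⟨hx, ht⟩
      have c2 : ContinuousWithinAt (fun p : X × ℝ => H x p.2) (S ×ˢ Icc 0 1) (x, t) :=
        ((hcont x hx) t ht).comp (t := Icc 0 1) (by fun_prop) (fun p hp => hp.2)
      have c3 := (c1.sub c2).norm
      have c4 := c2.norm
      refine c3.eventually_lt c4 ?_
      simpa using h0 x hx t ht
    have := isCompact_Icc.eventually_forall_of_filter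
      (P := fun y t => ‖H y t - H x t‖ < ‖H x t‖) hev
    filter_upwards [this, self_mem_nhdsWithin] with y hy hyS
    exact ((hw y hyS).unique ((hw x hx).of_norm_sub_lt (hcont y hyS) (hcl y hyS) hy))
  have hwc : ContinuousOn w S := fun x hx =>
    (tendsto_const_nhds (x := w x)).congr' (EventuallyEq.symm (hloc x hx))
  have e1 := hS.constant hwc ha hb
  rw [h.unique (hw a ha), e1]
  exact hw b hb

end HasWinding

/-! ### Extension and gluing of continuous functions in the plane -/

theorem IsClosed.exists_continuous_eqOn {A : Set ℂ} (hA : IsClosed A) {m : ℂ → ℂ}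
    (hm : ContinuousOn m A) : ∃ M : ℂ → ℂ, Continuous M ∧ EqOn M m A := by
  obtain ⟨g, hg⟩ := ContinuousMap.exists_restrict_eq hA
    (⟨A.domRestrict m, continuousOn_iff_continuous_domRestrict.1 hm⟩ : C(A, ℂ))
  exact ⟨g, g.continuous, fun z hz => congrArg (fun f : C(A, ℂ) => f ⟨z, hz⟩) hg⟩

open Classical in
theorem ContinuousOn.piecewise_of_frontier {X Y : Type*} [TopologicalSpace X]
    [TopologicalSpace Y] {A : Set X} {f g : X → Y}
    (hf : ContinuousOn f (closure A)) (hg : ContinuousOn g (closure Aᶜ))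
    (h : ∀ z ∈ frontier A, f z = g z) : Continuous (A.piecewise f g) :=
  continuous_piecewise h hf hg

/-- Functions on the image of a compact set are continuous if their pullbacks are. -/
theorem IsCompact.exists_continuousOn_factor {X Y Z : Type*} [TopologicalSpace X]
    [TopologicalSpace Y] [TopologicalSpace Z] [T2Space Y] [Nonempty X] {T : Set X}
    (hT : IsCompact T) {c : X → Y} (hc : ContinuousOn c T) {L : X → Z} (hL : ContinuousOn L T)
    (h : ∀ s ∈ T, ∀ t ∈ T, c s = c t → L s = L t) :
    ∃ m : Y → Z, ContinuousOn m (c '' T) ∧ ∀ t ∈ T, m (c t) = L t := by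
  classical
  have hi : ∀ y ∈ c '' T, ∃ x ∈ T, c x = y := fun y hy => hy
  choose! σ hσ1 hσ2 using hi
  have key : ∀ t ∈ T, L (σ (c t)) = L t := fun t ht =>
    h _ (hσ1 _ ⟨t, ht, rfl⟩) _ ht (hσ2 _ ⟨t, ht, rfl⟩)
  refine ⟨L ∘ σ, ?_, key⟩
  rw [continuousOn_iff_isClosed]
  intro C hC
  obtain ⟨u, hu, hu'⟩ := continuousOn_iff_isClosed.1 hL C hC
  -- The preimage of a closed set is the image of a compact set, hence closed in a Hausdorff space.
  refine ⟨c '' (T ∩ u), ((hT.inter_right hu).image_of_continuousOn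
    (hc.mono inter_subset_left)).isClosed, ?_⟩
  ext y
  constructor
  · rintro ⟨hy, t, ht, rfl⟩
    refine ⟨⟨t, ⟨ht, ?_⟩, rfl⟩, t, ht, rfl⟩
    have : t ∈ L ⁻¹' C ∩ T := ⟨by simpa [key t ht] using hy, ht⟩
    rw [hu'] at this
    exact this.1
  · rintro ⟨⟨t, ⟨ht, htu⟩, rfl⟩, hy⟩
    have : t ∈ u ∩ T := ⟨htu, ht⟩
    rw [← hu'] at this
    exact ⟨by simpa [key t ht] using this.1, hy⟩

/-- `z ↦ z - a` has no continuous logarithm near infinity. -/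
theorem not_exists_log_sub_of_norm_ge {a : ℂ} {R : ℝ} {L : ℂ → ℂ} (hL : Continuous L)
    (h : ∀ z, R ≤ ‖z‖ → exp (L z) = z - a) : False := by
  -- The circle of radius `ρ` about `a` stays in the region `R ≤ ‖z‖`.
  set ρ : ℝ := |R| + ‖a‖ + 1
  have hρ : 0 < ρ := by positivity
  have hw1 : HasWinding (fun t : ℝ => (a + ρ * exp (2 * Real.pi * I * t)) - a) 0 := by
    refine HasWinding.of_log_comp (S := {z | R ≤ ‖z‖}) (f := fun z => z - a) hL.continuousOn h
      (γ := fun t : ℝ => (a + ρ * exp (2 * Real.pi * I * t))) (by fun_prop) ?_ (by simp)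
    intro t _
    have h1 : ‖(ρ * exp (2 * Real.pi * I * t) : ℂ)‖ = ρ := by
      rw [norm_mul, show (2 * Real.pi * I * t : ℂ) = ((2 * Real.pi * t : ℝ) : ℂ) * I by push_cast; ring,
        norm_exp_ofReal_mul_I, norm_real, Real.norm_of_nonneg hρ.le, mul_one]
    have h2 := norm_sub_norm_le (ρ * exp (2 * Real.pi * I * t) : ℂ) (-a)
    rw [norm_neg, sub_neg_eq_add, h1, add_comm _ a] at h2
    show R ≤ _
    have := le_abs_self R
    linarith
  have hw2 : HasWinding (fun t : ℝ => (a + ρ * exp (2 * Real.pi * I * t)) - a) 1 := by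
    refine ⟨fun t => 2 * Real.pi * I * t + Real.log ρ, by fun_prop, fun t _ => ?_, by simp⟩
    rw [exp_add, ← ofReal_exp, Real.exp_log hρ]
    ring
  exact absurd (hw1.unique hw2) (by norm_num)

/-- If `z - a` has a continuous logarithm on the frontier of a bounded closed set, then `a` is not
an interior point of the set. -/
theorem IsCompact.not_exists_log_sub_on_frontier {X : Set ℂ} (hX : IsCompact X) {a : ℂ}
    (ha : a ∈ interior X) {m : ℂ → ℂ} (hm : ContinuousOn m (frontier X))
    (h : ∀ z ∈ frontier X, exp (m z) = z - a) : False := by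
  classical
  obtain ⟨M, hM, hMm⟩ := isClosed_frontier.exists_continuous_eqOn hm
  -- Borsuk's argument: `exp (M z)` replaces `z - a` on `X` and removes its only zero, so the glued
  -- function has a logarithm on the plane although it equals `z - a` near infinity.
  have hE : Continuous (X.piecewise (fun z => exp (M z)) (fun z => z - a)) :=
    ContinuousOn.piecewise_of_frontier (by fun_prop) (by fun_prop)
      (fun z hz => by rw [hMm hz, h z hz])
  obtain ⟨L, hL, hL'⟩ := exists_log_plane hE (fun z => by
    by_cases hz : z ∈ X
    · simp [hz]
    · simp only [hz, not_false_eq_true, piecewise_eq_of_notMem]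
      intro h0
      rw [sub_eq_zero.1 h0] at hz
      exact hz (interior_subset ha))
  obtain ⟨R, hR⟩ := hX.isBounded.exists_norm_le
  refine not_exists_log_sub_of_norm_ge (a := a) (R := R + 1) hL fun z hz => ?_
  have : z ∉ X := fun hzX => by linarith [hR z hzX]
  rw [hL' z, piecewise_eq_of_notMem _ _ _ this]

/-! ### Logarithms on Jordan curves -/

namespace IsJordanParam

variable {c : ℝ → ℂ} {J : Set ℂ}

theorem isCompact (h : IsJordanParam c J) : IsCompact J := by
  rw [← h.2.2.2]
  exact isCompact_Icc.image_of_continuousOn h.1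

theorem mem (h : IsJordanParam c J) {t : ℝ} (ht : t ∈ Icc (0 : ℝ) 1) : c t ∈ J :=
  h.2.2.2 ▸ mem_image_of_mem c ht

theorem nonempty (h : IsJordanParam c J) : J.Nonempty := ⟨c 0, h.mem (by simp)⟩

theorem isPreconnected (h : IsJordanParam c J) : IsPreconnected J := by
  rw [← h.2.2.2]
  exact isPreconnected_Icc.image _ h.1

theorem eq_or (h : IsJordanParam c J) {s t : ℝ} (hs : s ∈ Icc (0 : ℝ) 1)
    (ht : t ∈ Icc (0 : ℝ) 1) (hst : c s = c t) : s = t ∨ s = 0 ∧ t = 1 ∨ s = 1 ∧ t = 0 := by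
  rcases hs.2.eq_or_lt with rfl | hs'
  · rcases ht.2.eq_or_lt with rfl | ht'
    · exact Or.inl rfl
    · rw [← h.2.2.1] at hst
      have := h.2.1 ⟨le_rfl, zero_lt_one⟩ ⟨ht.1, ht'⟩ hst
      exact Or.inr (Or.inr ⟨rfl, this.symm⟩)
  · rcases ht.2.eq_or_lt with rfl | ht'
    · rw [← h.2.2.1] at hst
      have := h.2.1 ⟨hs.1, hs'⟩ ⟨le_rfl, zero_lt_one⟩ hst
      exact Or.inr (Or.inl ⟨this, rfl⟩)
    · exact Or.inl (h.2.1 ⟨hs.1, hs'⟩ ⟨ht.1, ht'⟩ hst)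

theorem reverse (h : IsJordanParam c J) : IsJordanParam (fun t => c (1 - t)) J := by
  have hI : ∀ t ∈ Icc (0 : ℝ) 1, 1 - t ∈ Icc (0 : ℝ) 1 := fun t ht =>
    ⟨by linarith [ht.2], by linarith [ht.1]⟩
  refine ⟨h.1.comp (by fun_prop) hI, fun s hs t ht hst => ?_, by simp [h.2.2.1], ?_⟩
  · rcases h.eq_or (hI s (Ico_subset_Icc_self hs)) (hI t (Ico_subset_Icc_self ht)) hst with h | h | h
    · linarith
    · linarith [h.1, hs.2]
    · linarith [h.2, ht.2]
  · rw [← h.2.2.2]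
    ext z
    constructor
    · rintro ⟨t, ht, rfl⟩
      exact ⟨1 - t, hI t ht, rfl⟩
    · rintro ⟨t, ht, rfl⟩
      exact ⟨1 - t, hI t ht, by simp⟩

theorem comp {K : Set ℂ} (h : IsJordanParam c J) {f : ℂ → ℂ} (hf : ContinuousOn f J)
    (hi : InjOn f J) (hK : f '' J = K) : IsJordanParam (f ∘ c) K := by
  refine ⟨hf.comp h.1 (fun t ht => h.mem ht), fun s hs t ht hst => h.2.1 hs ht
    (hi (h.mem (Ico_subset_Icc_self hs)) (h.mem (Ico_subset_Icc_self ht)) hst),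
    by simp [h.2.2.1], ?_⟩
  rw [image_comp, h.2.2.2, hK]

/-- A nonvanishing function on a Jordan curve of winding number `0` has a logarithm. -/
theorem exists_log (h : IsJordanParam c J) {f : ℂ → ℂ}
    (hw : HasWinding (fun t => f (c t)) 0) :
    ∃ m : ℂ → ℂ, ContinuousOn m J ∧ ∀ z ∈ J, exp (m z) = f z := by
  obtain ⟨L, h1, h2, h3⟩ := hw
  have h3' : L 1 = L 0 := by simpa [sub_eq_zero] using h3
  obtain ⟨m, hm, hm'⟩ := isCompact_Icc.exists_continuousOn_factor h.1 h1 (fun s hs t ht hst => by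
    rcases h.eq_or hs ht hst with rfl | ⟨rfl, rfl⟩ | ⟨rfl, rfl⟩
    · rfl
    · exact h3'.symm
    · exact h3')
  rw [h.2.2.2] at hm
  refine ⟨m, hm, fun z hz => ?_⟩
  rw [← h.2.2.2] at hz
  obtain ⟨t, ht, rfl⟩ := hz
  rw [hm' t ht, h2 t ht]

/-- On a proper closed subset of a Jordan curve all nonvanishing functions have logarithms. -/
theorem exists_log_of_ssubset (h : IsJordanParam c J) {A : Set ℂ} (hA : IsClosed A)
    (hAJ : A ⊆ J) {p : ℂ} (hp : p ∈ J) (hpA : p ∉ A) {f : ℂ → ℂ} (hf : ContinuousOn f J)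
    (h0 : ∀ z ∈ J, f z ≠ 0) : ∃ m : ℂ → ℂ, ContinuousOn m A ∧ ∀ z ∈ A, exp (m z) = f z := by
  obtain ⟨t₀, ht₀, rfl⟩ : ∃ t₀ ∈ Icc (0 : ℝ) 1, c t₀ = p := by
    rw [← h.2.2.2] at hp
    exact hp
  obtain ⟨n, L, h1, h2, h3⟩ := HasWinding.exists_of_closed (c := fun t => f (c t))
    (hf.comp h.1 (fun t ht => h.mem ht)) (fun t ht => h0 _ (h.mem ht)) (by simp [h.2.2.1])
  set T : Set ℝ := Icc 0 1 ∩ c ⁻¹' A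
  have hT : IsCompact T := by
    have : IsClosed T := h.1.preimage_isClosed_of_isClosed isClosed_Icc hA
    exact isCompact_Icc.of_isClosed_subset this inter_subset_left
  have htT : ∀ t ∈ T, t ≠ t₀ := by
    rintro t ht rfl
    exact hpA ht.2
  have hcT : c '' T = A := by
    ext z
    constructor
    · rintro ⟨t, ht, rfl⟩
      exact ht.2
    · intro hz
      have := hAJ hz
      rw [← h.2.2.2] at this
      obtain ⟨t, ht, rfl⟩ := this
      exact ⟨t, ⟨ht, hz⟩, rfl⟩
  -- Beyond the missing point the branch is lowered by its monodromy, so its values at the endpoints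
  -- `0` and `1` agree and it descends to the cut curve.
  have hL' : ContinuousOn (fun t => if t < t₀ then L t else L t - (L 1 - L 0)) T := by
    intro t ht
    rcases lt_or_gt_of_ne (htT t ht) with hlt | hlt
    · refine ((h1.mono inter_subset_left) t ht).congr_of_eventuallyEq ?_ (by simp [hlt])
      filter_upwards [mem_nhdsWithin_of_mem_nhds (Iio_mem_nhds hlt)] with s hs
      simp [mem_Iio.1 hs]
    · refine (((h1.mono inter_subset_left) t ht).sub
        (continuousWithinAt_const (b := L 1 - L 0))).congr_of_eventuallyEq ?_ (by simp [hlt.le])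
      filter_upwards [mem_nhdsWithin_of_mem_nhds (Ioi_mem_nhds hlt)] with s hs
      simp [(mem_Ioi.1 hs).le]
  obtain ⟨m, hm, hm'⟩ := hT.exists_continuousOn_factor (h.1.mono inter_subset_left) hL'
    (fun s hs t ht hst => by
      rcases h.eq_or hs.1 ht.1 hst with rfl | ⟨rfl, rfl⟩ | ⟨rfl, rfl⟩
      · rfl
      · have e1 : (0 : ℝ) < t₀ := lt_of_le_of_ne ht₀.1 (htT 0 hs)
        simp [e1, ht₀.2.not_gt]
      · have e1 : (0 : ℝ) < t₀ := lt_of_le_of_ne ht₀.1 (htT 0 ht)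
        simp [e1, ht₀.2.not_gt])
  rw [hcT] at hm
  refine ⟨m, hm, fun z hz => ?_⟩
  rw [← hcT] at hz
  obtain ⟨t, ht, rfl⟩ := hz
  rw [hm' t ht]
  have hexp : exp (L 1 - L 0) = 1 := by
    rw [h3, exp_eq_one_iff]
    exact ⟨n, by ring⟩
  split_ifs with hlt
  · exact h2 t ht.1
  · rw [exp_sub, hexp, div_one, h2 t ht.1]

/-- A nonvanishing function on a compact set bounded by a Jordan curve of winding number `±1`
about an interior point has a logarithm. -/
theorem exists_log_of_isCompact {X : Set ℂ} (hX : IsCompact X) (hXJ : frontier X ⊆ J)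
    (hJX : J ⊆ X) (h : IsJordanParam c J) {a : ℂ} (ha : a ∈ interior X) {ε : ℤ}
    (hε : ε * ε = 1) (hw : HasWinding (fun t => c t - a) ε) {f : ℂ → ℂ} (hf : ContinuousOn f X)
    (h0 : ∀ z ∈ X, f z ≠ 0) : ∃ L : ℂ → ℂ, ContinuousOn L X ∧ ∀ z ∈ X, exp (L z) = f z := by
  classical
  obtain ⟨n, hn⟩ := HasWinding.exists_of_closed (c := fun t => f (c t))
    ((hf.mono hJX).comp h.1 (fun t ht => h.mem ht)) (fun t ht => h0 _ (hJX (h.mem ht)))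
    (by simp [h.2.2.1])
  -- Since `ε * ε = 1`, the power of `z - a` has winding number `-n` along the curve and cancels
  -- that of `f`.
  have hq : HasWinding (fun t => (fun z => f z * (z - a) ^ (-(ε * n))) (c t)) 0 := by
    have := hn.mul (hw.zpow (-(ε * n)))
    convert this using 1
    linear_combination n * hε
  obtain ⟨m, hm, hm'⟩ := h.exists_log
    (f := fun z => f z * (z - a) ^ (-(ε * n))) hq
  obtain ⟨M, hM, hMm⟩ := h.isCompact.isClosed.exists_continuous_eqOn hm
  have hac : ∀ z, z ∈ closure Xᶜ → z - a ≠ 0 := by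
    intro z hz h0
    rw [sub_eq_zero.1 h0, closure_compl] at hz
    exact hz ha
  -- The extension of `f` by this formula has no zero outside `X`, because `a` is interior to `X`;
  -- so it has a logarithm on the plane.
  have hE : Continuous (X.piecewise f (fun z => exp (M z) * (z - a) ^ (ε * n))) := by
    refine ContinuousOn.piecewise_of_frontier (by rwa [hX.isClosed.closure_eq]) ?_ ?_
    · refine ContinuousOn.mul (by fun_prop) ?_
      exact ContinuousOn.zpow₀ (by fun_prop) _ (fun z hz => Or.inl (hac z hz))
    · intro z hz
      have hza := hac z (by rw [frontier_eq_closure_inter_closure] at hz; exact hz.2)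
      rw [hMm (hXJ hz), hm' z (hXJ hz), mul_assoc, ← zpow_add₀ hza]
      simp
  obtain ⟨L, hL, hL'⟩ := exists_log_plane hE (fun z => by
    by_cases hz : z ∈ X
    · simpa [hz] using h0 z hz
    · simp only [hz, not_false_eq_true, piecewise_eq_of_notMem]
      exact mul_ne_zero (exp_ne_zero _) (zpow_ne_zero _ (hac z (subset_closure hz))))
  exact ⟨L, hL.continuousOn, fun z hz => by rw [hL' z, piecewise_eq_of_mem _ _ _ hz]⟩

/-- A compact set with an interior point, whose frontier is contained in a Jordan curve, is bounded
by the whole curve. -/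
theorem frontier_eq (h : IsJordanParam c J) {X : Set ℂ} (hX : IsCompact X) {a : ℂ}
    (ha : a ∈ interior X) (hXJ : frontier X ⊆ J) (haJ : a ∉ J) : frontier X = J := by
  refine hXJ.antisymm fun p hp => ?_
  by_contra hpX
  -- A missed point would cut the curve open; then `z - a` has a logarithm on the frontier, which is
  -- impossible around an interior point.
  obtain ⟨m, hm, hm'⟩ := h.exists_log_of_ssubset isClosed_frontier hXJ hp hpX
    (f := fun z => z - a) (by fun_prop)
    (fun z hz h0 => haJ (by rwa [← sub_eq_zero.1 h0]))
  exact hX.not_exists_log_sub_on_frontier ha hm hm'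

end IsJordanParam

/-! ### Invariance of domain in the plane -/

theorem isPreconnected_sphere_complex (z : ℂ) (r : ℝ) : IsPreconnected (sphere z r) :=
  isPreconnected_sphere (by rw [rank_real_complex]; norm_num) z r

/-- For an injective continuous function `f` on the closed unit disc, `f - f 0` has no continuous
logarithm on the unit circle. -/
theorem Set.InjOn.not_exists_log_sphere {f : ℂ → ℂ} (hf : ContinuousOn f (closedBall 0 1))
    (hi : InjOn f (closedBall 0 1)) {L : ℂ → ℂ} (hL : ContinuousOn L (sphere 0 1))
    (h : ∀ w ∈ sphere (0 : ℂ) 1, exp (L w) = f w - f 0) : False := by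
  have hball : ∀ s : ℝ, |s| ≤ 1 → ∀ w ∈ sphere (0 : ℂ) 1, (s : ℂ) * w ∈ closedBall (0 : ℂ) 1 := by
    intro s hs w hw
    rw [mem_sphere_zero_iff_norm] at hw
    simpa [hw] using hs
  have hb1 : ∀ t ∈ Icc (0 : ℝ) 1, |1 / (1 + t)| ≤ 1 := by
    intro t ht
    rw [abs_of_nonneg (by have := ht.1; positivity), div_le_one (by linarith [ht.1])]
    linarith [ht.1]
  have hb2 : ∀ t ∈ Icc (0 : ℝ) 1, |-t / (1 + t)| ≤ 1 := by
    intro t ht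
    rw [neg_div, abs_neg, abs_of_nonneg (by have := ht.1; positivity),
      div_le_one (by linarith [ht.1])]
    linarith [ht.1]
  have hsc : ∀ u : ℝ → ℝ, ContinuousOn u (Icc 0 1) → (∀ t ∈ Icc (0 : ℝ) 1, |u t| ≤ 1) →
      ContinuousOn (fun p : ℝ × ℂ => f ((u p.1 : ℝ) * p.2)) (Icc 0 1 ×ˢ sphere 0 1) := by
    intro u hu hu1
    refine hf.comp ?_ (fun p hp => hball _ (hu1 _ hp.1) _ hp.2)
    have : ContinuousOn (fun p : ℝ × ℂ => u p.1) (Icc 0 1 ×ˢ sphere 0 1) :=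
      hu.comp (by fun_prop) (fun p hp => hp.1)
    exact (continuous_ofReal.comp_continuousOn this).mul (by fun_prop)
  -- The two arguments always differ by `w`, so injectivity keeps the difference from vanishing. It
  -- deforms `f w - f 0` into the odd function `f (w / 2) - f (-w / 2)`.
  have hH1 : ContinuousOn (fun p : ℝ × ℂ => f ((1 / (1 + p.1) : ℝ) * p.2) -
      f ((-p.1 / (1 + p.1) : ℝ) * p.2)) (Icc 0 1 ×ˢ sphere 0 1) :=
    (hsc (fun t => 1 / (1 + t)) (ContinuousOn.div (by fun_prop) (by fun_prop)
      (fun t ht => by linarith [ht.1])) hb1).sub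
      (hsc (fun t => -t / (1 + t)) (ContinuousOn.div (by fun_prop) (by fun_prop)
      (fun t ht => by linarith [ht.1])) hb2)
  have hH2 : ∀ t ∈ Icc (0 : ℝ) 1, ∀ w ∈ sphere (0 : ℂ) 1,
      f ((1 / (1 + t) : ℝ) * w) - f ((-t / (1 + t) : ℝ) * w) ≠ 0 := by
    intro t ht w hw h0
    have e := hi (hball _ (hb1 t ht) w hw) (hball _ (hb2 t ht) w hw) (sub_eq_zero.1 h0)
    have hw0 : w ≠ 0 := by
      rintro rfl
      simp at hw
    have e2 := mul_right_cancel₀ hw0 e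
    have e3 : 1 / (1 + t) = -t / (1 + t) := by exact_mod_cast e2
    have e4 : (1 + t) ≠ 0 := by linarith [ht.1]
    rw [div_left_inj' e4] at e3
    linarith [ht.1]
  obtain ⟨M, hM, hM'⟩ := exists_log_homotopy (S := sphere (0 : ℂ) 1)
    (H := fun t w => f ((1 / (1 + t) : ℝ) * w) - f ((-t / (1 + t) : ℝ) * w)) hH1 hH2
  have hG : ∀ w ∈ sphere (0 : ℂ) 1, exp (L w + M w) =
      f ((1 / (1 + 1) : ℝ) * w) - f ((-1 / (1 + 1) : ℝ) * w) := by
    intro w hw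
    rw [exp_add, h w hw, hM' w hw]
    simp
  have hneg : ∀ w ∈ sphere (0 : ℂ) 1, -w ∈ sphere (0 : ℂ) 1 := fun w hw => by
    simpa using hw
  have hLM : ContinuousOn (fun w => L w + M w) (sphere 0 1) := hL.add hM
  -- A logarithm of an odd function changes by a fixed odd multiple of `πi` under `w ↦ -w`. Applying
  -- this at `1` and at `-1` gives `2 * k + 1 = 0`.
  obtain ⟨k, hk⟩ := (isPreconnected_sphere_complex 0 1).exists_int_of_exp_eq
    (f := fun w => L (-w) + M (-w)) (g := fun w => L w + M w + Real.pi * I)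
    (hLM.comp (f := fun w : ℂ => -w) (by fun_prop) hneg) (by fun_prop) (by
      intro w hw
      rw [hG _ (hneg w hw), exp_add, hG w hw, exp_pi_mul_I]
      have e1 : ((1 / (1 + 1) : ℝ) : ℂ) * -w = ((-1 / (1 + 1) : ℝ) : ℂ) * w := by push_cast; ring
      have e2 : ((-1 / (1 + 1) : ℝ) : ℂ) * -w = ((1 / (1 + 1) : ℝ) : ℂ) * w := by push_cast; ring
      rw [e1, e2]
      ring)
  have h1 := hk 1 (by simp)
  have h2 := hk (-1) (by simp)
  simp only [neg_neg] at h2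
  have h3 : (2 * Real.pi * I) * ((2 * k + 1 : ℤ) : ℂ) = (2 * Real.pi * I) * ((0 : ℤ) : ℂ) := by
    push_cast
    linear_combination -h1 - h2
  have := two_pi_I_mul_int_injective h3
  omega

/-- Stability of the values of an injective map: nearby maps take nearby values. -/
theorem Set.InjOn.exists_stable_value {f : ℂ → ℂ} {w₀ : ℂ} {r : ℝ} (hr : 0 < r)
    (hf : ContinuousOn f (closedBall w₀ r)) (hi : InjOn f (closedBall w₀ r)) :
    ∃ ε > 0, ∀ g : ℂ → ℂ, ContinuousOn g (closedBall w₀ r) →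
      (∀ w ∈ sphere w₀ r, ‖g w - f w‖ < ε) → ∀ z, ‖z - f w₀‖ < ε → ∃ w ∈ ball w₀ r, g w = z := by
  have hmap : MapsTo (fun w : ℂ => w₀ + r * w) (closedBall 0 1) (closedBall w₀ r) := by
    intro w hw
    rw [mem_closedBall_zero_iff] at hw
    simp only [mem_closedBall, dist_self_add_left, norm_mul, norm_real, Real.norm_of_nonneg hr.le]
    nlinarith
  have hmaps : MapsTo (fun w : ℂ => w₀ + r * w) (sphere 0 1) (sphere w₀ r) := by
    intro w hw
    rw [mem_sphere_zero_iff_norm] at hw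
    simp [hw, abs_of_pos hr]
  have hsub : sphere w₀ r ⊆ closedBall w₀ r := sphere_subset_closedBall
  obtain ⟨δ, hδ, hδ'⟩ : ∃ δ > 0, ∀ w ∈ sphere w₀ r, δ ≤ ‖f w - f w₀‖ := by
    have hne : (sphere w₀ r).Nonempty := (NormedSpace.sphere_nonempty).2 hr.le
    obtain ⟨w, hw, hw'⟩ := (isCompact_sphere w₀ r).exists_isMinOn hne
      (f := fun w => ‖f w - f w₀‖) ((hf.mono hsub).sub continuousOn_const).norm
    refine ⟨‖f w - f w₀‖, ?_, fun v hv => hw' hv⟩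
    refine norm_pos_iff.2 (sub_ne_zero.2 fun h => ?_)
    have := hi (hsub hw) (mem_closedBall_self hr.le) h
    rw [this] at hw
    simp [hr.ne] at hw
  -- The errors in `g` and in `z` add up to less than `δ`, the distance from `f w₀` to the image of
  -- the sphere.
  refine ⟨δ / 2, by positivity, fun g hg hgf z hz => ?_⟩
  by_contra! hcon
  have hclose : ∀ w ∈ sphere w₀ r, ‖(g w - z) - (f w - f w₀)‖ < ‖f w - f w₀‖ := by
    intro w hw
    have h1 : (g w - z) - (f w - f w₀) = (g w - f w) - (z - f w₀) := by ring
    rw [h1]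
    calc _ ≤ ‖g w - f w‖ + ‖z - f w₀‖ := norm_sub_le _ _
      _ < δ / 2 + δ / 2 := add_lt_add (hgf w hw) hz
      _ = δ := by ring
      _ ≤ _ := hδ' w hw
  have hgz : ∀ w ∈ closedBall w₀ r, g w - z ≠ 0 := by
    intro w hw h0
    rcases (mem_closedBall.1 hw).lt_or_eq with h | h
    · exact hcon w (mem_ball.2 h) (sub_eq_zero.1 h0)
    · have := hclose w h
      rw [h0, zero_sub, norm_neg] at this
      exact lt_irrefl _ this
  -- If `g` misses `z`, then `g - z` has a logarithm on the disc. On the sphere its ratio to `f - f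
  -- w₀` is within distance `1` of `1`, so the principal logarithm of the ratio yields a logarithm
  -- of `f - f w₀`, which cannot exist.
  obtain ⟨L, hL, hL'⟩ := exists_log_starConvex
    ((convex_closedBall (0 : ℂ) 1).starConvex (mem_closedBall_self zero_le_one))
    (mem_closedBall_self zero_le_one) (g := fun w => g (w₀ + r * w) - z)
    ((hg.comp (by fun_prop) hmap).sub continuousOn_const) (fun w hw => hgz _ (hmap hw))
  refine Set.InjOn.not_exists_log_sphere (f := fun w => f (w₀ + r * w))
    (L := fun w => L w - log ((g (w₀ + r * w) - z) / (f (w₀ + r * w) - f w₀)))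
    (hf.comp (by fun_prop) hmap) ?_ ?_ ?_
  · intro v hv w hw hvw
    have := hi (hmap hv) (hmap hw) hvw
    have hr' : (r : ℂ) ≠ 0 := by exact_mod_cast hr.ne'
    exact mul_left_cancel₀ hr' (add_left_cancel this)
  · refine (hL.mono sphere_subset_closedBall).sub (ContinuousOn.clog ?_ ?_)
    · refine ContinuousOn.div ?_ ?_ ?_
      · exact (hg.comp (by fun_prop) (fun w hw => hsub (hmaps hw))).sub continuousOn_const
      · exact (hf.comp (by fun_prop) (fun w hw => hsub (hmaps hw))).sub continuousOn_const
      · intro w hw h0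
        have := hδ' _ (hmaps hw)
        rw [h0, norm_zero] at this
        linarith
    · intro w hw
      have h1 := hclose _ (hmaps hw)
      have h2 : f (w₀ + r * w) - f w₀ ≠ 0 := by
        intro h0
        have := hδ' _ (hmaps hw)
        rw [h0, norm_zero] at this
        linarith
      have h3 : ‖(g (w₀ + r * w) - z) / (f (w₀ + r * w) - f w₀) - 1‖ < 1 := by
        rw [div_sub_one h2, norm_div, div_lt_one (norm_pos_iff.2 h2)]
        exact h1
      have := mem_slitPlane_of_norm_lt_one h3
      simpa using this
  · intro w hw
    have h2 : f (w₀ + r * w) - f w₀ ≠ 0 := by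
      intro h0
      have := hδ' _ (hmaps hw)
      rw [h0, norm_zero] at this
      linarith
    have h4 := hgz _ (hsub (hmaps hw))
    rw [exp_sub, hL' w (sphere_subset_closedBall hw), exp_log (div_ne_zero h4 h2)]
    simp only [mul_zero, add_zero]
    field_simp

/-- Stability of values, applied with `g = f`. -/
theorem Set.InjOn.isOpen_image_complex {f : ℂ → ℂ} {O : Set ℂ} (hi : InjOn f O) (hO : IsOpen O)
    (hf : ContinuousOn f O) : IsOpen (f '' O) := by
  rw [isOpen_iff_mem_nhds]
  rintro _ ⟨w, hw, rfl⟩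
  obtain ⟨r, hr, hrO⟩ := nhds_basis_closedBall.mem_iff.1 (hO.mem_nhds hw)
  obtain ⟨ε, hε, h⟩ := Set.InjOn.exists_stable_value hr (hf.mono hrO) (hi.mono hrO)
  filter_upwards [ball_mem_nhds (f w) hε] with z hz
  obtain ⟨v, hv, rfl⟩ := h f (hf.mono hrO) (fun _ _ => by simpa using hε) z (by simpa [dist_eq] using hz)
  exact ⟨v, hrO (ball_subset_closedBall hv), rfl⟩

/-- The winding number of the image of the unit circle. -/
theorem Set.InjOn.exists_winding_circle {f : ℂ → ℂ} (hf : ContinuousOn f (closedBall 0 1))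
    (hi : InjOn f (closedBall 0 1)) :
    ∃ ε : ℤ, ε * ε = 1 ∧ HasWinding (fun t => f (exp (2 * Real.pi * I * t)) - f 0) ε := by
  -- The exponential covers the punctured closed disc by this half-plane, where `f ∘ exp - f 0` has
  -- a logarithm `M`. The translation by `2πi` changes `M` by a constant `2πi ε`, and `ε` is the
  -- required winding number.
  set S : Set ℂ := {u | u.re ≤ 0}
  have hS : Convex ℝ S := convex_halfSpace_re_le 0
  have hexpS : ∀ u ∈ S, exp u ∈ closedBall (0 : ℂ) 1 := by
    intro u hu
    rw [mem_closedBall_zero_iff, norm_exp, Real.exp_le_one_iff]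
    exact hu
  obtain ⟨M, hM, hM'⟩ := exists_log_starConvex (x := 0) (hS.starConvex (by simp [S]))
    (by simp [S]) (g := fun u => f (exp u) - f 0)
    ((hf.comp (by fun_prop) hexpS).sub continuousOn_const) (fun u hu h0 => by
      exact exp_ne_zero u (hi (hexpS u hu) (by simp) (sub_eq_zero.1 h0)))
  have hshift : ∀ k : ℤ, ∀ u ∈ S, u + 2 * Real.pi * I * k ∈ S := by
    intro k u hu
    simpa [S] using hu
  obtain ⟨ε, hε⟩ := hS.isPreconnected.exists_int_of_exp_eq
    (f := fun u => M (u + 2 * Real.pi * I * (1 : ℤ))) (g := M)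
    (hM.comp (by fun_prop) (hshift 1)) hM (by
      intro u hu
      rw [hM' u hu, hM' _ (hshift 1 u hu), exp_add]
      simp [exp_two_pi_mul_I])
  have hεk : ∀ k : ℤ, ∀ u ∈ S, M (u + 2 * Real.pi * I * k) - M u = 2 * Real.pi * I * (k * ε) := by
    intro k
    induction k using Int.induction_on with
    | zero => simp
    | succ k ih =>
      intro u hu
      have h1 := ih u hu
      have h2 := hε _ (hshift k u hu)
      have e : u + 2 * Real.pi * I * ((k : ℤ) + 1 : ℤ) =
        u + 2 * Real.pi * I * (k : ℤ) + 2 * Real.pi * I * (1 : ℤ) := by push_cast; ring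
      rw [e]
      push_cast at h1 h2 ⊢
      linear_combination h1 + h2
    | pred k ih =>
      intro u hu
      have h1 := ih u hu
      have h2 := hε _ (hshift (-k - 1) u hu)
      have e : u + 2 * Real.pi * I * (-(k : ℤ) - 1 : ℤ) + 2 * Real.pi * I * (1 : ℤ) =
        u + 2 * Real.pi * I * (-(k : ℤ) : ℤ) := by push_cast; ring
      rw [e] at h2
      push_cast at h1 h2 ⊢
      linear_combination h1 - h2
  have hcirc : ∀ t : ℝ, 2 * Real.pi * I * t ∈ S := by
    intro t
    simp [S]
  refine ⟨ε, ?_, fun t => M (2 * Real.pi * I * t), hM.comp (by fun_prop) (fun t _ => hcirc t),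
    fun t _ => hM' _ (hcirc t), ?_⟩
  · -- a small circle about `f 0` is the image of a curve of winding number `δ` about `0`
    have hopen : IsOpen (f '' ball 0 1) :=
      Set.InjOn.isOpen_image_complex (hi.mono ball_subset_closedBall) isOpen_ball
        (hf.mono ball_subset_closedBall)
    obtain ⟨ρ, hρ, hρ'⟩ := nhds_basis_closedBall.mem_iff.1
      (hopen.mem_nhds (mem_image_of_mem f (mem_ball_self zero_lt_one)))
    obtain ⟨σ, hσ, hσ'⟩ := (isCompact_closedBall (0 : ℂ) 1).exists_continuousOn_factor hf
      (L := id) continuousOn_id (fun s hs t ht hst => hi hs ht hst)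
    have himg : f '' ball 0 1 ⊆ f '' closedBall 0 1 := image_mono ball_subset_closedBall
    set κ : ℝ → ℂ := fun t => f 0 + ρ * exp (2 * Real.pi * I * t)
    have hκ : ∀ t, κ t ∈ closedBall (f 0) ρ := by
      intro t
      simp only [κ, mem_closedBall, dist_self_add_left, norm_mul, norm_real,
        Real.norm_of_nonneg hρ.le]
      rw [show (2 * Real.pi * I * t : ℂ) = ((2 * Real.pi * t : ℝ) : ℂ) * I by push_cast; ring,
        norm_exp_ofReal_mul_I, mul_one]
    have hκne : ∀ t, κ t - f 0 ≠ 0 := by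
      intro t
      simp [κ, hρ.ne']
    have hσf : ∀ z ∈ f '' ball 0 1, σ z ∈ ball (0 : ℂ) 1 ∧ f (σ z) = z := by
      rintro _ ⟨w, hw, rfl⟩
      rw [hσ' w (ball_subset_closedBall hw)]
      exact ⟨hw, rfl⟩
    have hσκ := fun t => hσf _ (hρ' (hκ t))
    obtain ⟨δ, U, hU1, hU2, hU3⟩ := HasWinding.exists_of_closed (c := fun t => σ (κ t))
      (hσ.comp (by fun_prop) (fun t _ => himg (hρ' (hκ t)))) (fun t _ h0 => by
        have := (hσκ t).2
        rw [h0] at this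
        exact hκne t (by rw [← this, sub_self])) (by simp [κ])
    have hUS : ∀ t ∈ Icc (0 : ℝ) 1, U t ∈ S := by
      intro t ht
      have h1 := mem_ball_zero_iff.1 (hσκ t).1
      have h2 : exp (U t) = σ (κ t) := hU2 t ht
      rw [← h2, norm_exp, Real.exp_lt_one_iff] at h1
      exact h1.le
    have hw1 : ∀ t ∈ Icc (0 : ℝ) 1, exp (M (U t)) = κ t - f 0 := by
      intro t ht
      rw [hM' _ (hUS t ht), hU2 t ht, (hσκ t).2]
    have hend : U 1 = U 0 + 2 * Real.pi * I * δ := by rw [← hU3]; ring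
    have hw2 : HasWinding (fun t => κ t - f 0) (δ * ε) :=
      ⟨fun t => M (U t), hM.comp hU1 hUS, hw1, by
        show M (U 1) - M (U 0) = _
        rw [hend, hεk δ _ (hUS 0 (by simp))]
        push_cast
        ring⟩
    have hw3 : HasWinding (fun t => κ t - f 0) 1 := by
      refine ⟨fun t => 2 * Real.pi * I * t + Real.log ρ, by fun_prop, fun t _ => ?_, by simp⟩
      rw [exp_add, ← ofReal_exp, Real.exp_log hρ]
      simp only [κ]
      ring
    have := hw2.unique hw3
    rcases Int.eq_one_or_neg_one_of_mul_eq_one' this with h | h <;> simp [h.2]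
  · have := hε 0 (by simp [S])
    simpa using this

/-! ### A Harnack inequality -/

/-- The Cayley transform `w` sends the right half-plane to the disc and `f z₀` to `0`. By the
Schwarz lemma `‖w‖ ≤ 1/2` on the ball of half the radius, and this bound unwinds to the factor
`1/3`. -/
theorem re_div_three_le_of_re_pos {f : ℂ → ℂ} {z₀ : ℂ} {R : ℝ}
    (hf : DifferentiableOn ℂ f (ball z₀ R)) (hpos : ∀ z ∈ ball z₀ R, 0 < (f z).re) {z : ℂ}
    (hz : z ∈ ball z₀ (R / 2)) : (f z₀).re / 3 ≤ (f z).re := by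
  have hR : 0 < R := by linarith [dist_nonneg.trans_lt (mem_ball.1 hz)]
  have hz' : z ∈ ball z₀ R := ball_subset_ball (by linarith) hz
  have h0 := hpos z₀ (mem_ball_self hR)
  have hre : ∀ v ∈ ball z₀ R, 0 < (f v + (starRingEnd ℂ) (f z₀)).re := by
    intro v hv
    have := hpos v hv
    simp only [add_re, conj_re]
    linarith
  have hne : ∀ v ∈ ball z₀ R, f v + (starRingEnd ℂ) (f z₀) ≠ 0 := by
    intro v hv h
    have := hre v hv
    rw [h] at this
    simp at this
  have hlt : ∀ v ∈ ball z₀ R, ‖f v - f z₀‖ < ‖f v + (starRingEnd ℂ) (f z₀)‖ := by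
    intro v hv
    have := hpos v hv
    rw [← sq_lt_sq₀ (norm_nonneg _) (norm_nonneg _), ← normSq_eq_norm_sq, ← normSq_eq_norm_sq,
      normSq_apply, normSq_apply]
    simp only [sub_re, sub_im, add_re, add_im, conj_re, conj_im]
    nlinarith
  set w : ℂ → ℂ := fun v => (f v - f z₀) / (f v + (starRingEnd ℂ) (f z₀))
  have hw0 : w z₀ = 0 := by simp [w]
  have hw : DifferentiableOn ℂ w (ball z₀ R) :=
    (hf.sub_const _).div (hf.add_const _) hne
  have hmaps : MapsTo w (ball z₀ R) (ball (w z₀) 1) := by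
    intro v hv
    rw [hw0, mem_ball_zero_iff, norm_div, div_lt_one (norm_pos_iff.2 (hne v hv))]
    exact hlt v hv
  have h1 := dist_le_div_mul_dist_of_mapsTo_ball hw (hmaps.mono_right ball_subset_closedBall) hz'
  rw [hw0, dist_zero_right, norm_div] at h1
  have h2 : ‖f z - f z₀‖ / ‖f z + (starRingEnd ℂ) (f z₀)‖ ≤ 1 / 2 := by
    refine h1.trans ?_
    rw [mem_ball] at hz
    rw [one_div_mul_eq_div, div_le_div_iff₀ hR two_pos]
    linarith
  rw [div_le_div_iff₀ (norm_pos_iff.2 (hne z hz')) two_pos] at h2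
  have h3 : (‖f z - f z₀‖ * 2) ^ 2 ≤ (1 * ‖f z + (starRingEnd ℂ) (f z₀)‖) ^ 2 := by gcongr
  rw [mul_pow, one_mul, ← normSq_eq_norm_sq, ← normSq_eq_norm_sq, normSq_apply, normSq_apply] at h3
  simp only [sub_re, sub_im, add_re, add_im, conj_re, conj_im] at h3
  have := hpos z hz'
  nlinarith [sq_nonneg ((f z).im - (f z₀).im)]

/-- Propagation along a connected open set by balls of half the radius. -/
theorem IsPreconnected.forall_of_half_ball {D : Set ℂ} (hD : IsOpen D) (hc : IsPreconnected D)
    {P : ℂ → Prop} {a : ℂ} (ha : a ∈ D) (hPa : P a)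
    (h : ∀ z R, ball z R ⊆ D → P z → ∀ w ∈ ball z (R / 2), P w) : ∀ z ∈ D, P z := by
  have hsub : D ⊆ {z | z ∈ D ∧ P z} := by
    refine hc.subset_of_closure_inter_subset ?_ ⟨a, ha, ha, hPa⟩ ?_
    · rw [isOpen_iff_mem_nhds]
      rintro z ⟨hz, hPz⟩
      obtain ⟨R, hR, hRD⟩ := Metric.isOpen_iff.1 hD z hz
      filter_upwards [hD.mem_nhds hz, ball_mem_nhds z (half_pos hR)] with w hw hw'
      exact ⟨hw, h z R hRD hPz w hw'⟩
    · rintro z ⟨hz, hzD⟩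
      obtain ⟨R, hR, hRD⟩ := Metric.isOpen_iff.1 hD z hzD
      obtain ⟨w, ⟨hw, hPw⟩, hwz⟩ := Metric.mem_closure_iff.1 hz (R / 4) (by linarith)
      refine ⟨hzD, h w (R / 2) (fun v hv => hRD ?_) hPw z ?_⟩
      · rw [mem_ball] at hv ⊢
        have := dist_triangle v w z
        rw [dist_comm w z] at this
        linarith
      · rw [mem_ball]
        linarith
  exact fun z hz => (hsub hz).2

/-! ### Simply connected domains -/

namespace KoebeClass

/-- Continuous injections of `X` into the unit disc that are holomorphic on `D` and vanish
at `a`. -/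
structure _root_.KoebeClass (D X : Set ℂ) (a : ℂ) (ψ : ℂ → ℂ) : Prop where
  continuousOn : ContinuousOn ψ X
  injOn : InjOn ψ X
  differentiableOn : DifferentiableOn ℂ ψ D
  mapsTo : MapsTo ψ X (ball 0 1)
  zero : ψ a = 0

variable {D X : Set ℂ} {a : ℂ}

theorem mobius_ne_zero {b z : ℂ} (hb : ‖b‖ < 1) (hz : ‖z‖ < 1) :
    1 - (starRingEnd ℂ) b * z ≠ 0 := by
  intro h
  have h1 : (starRingEnd ℂ) b * z = 1 := by linear_combination -h
  have h2 : ‖b‖ * ‖z‖ = 1 := by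
    rw [← norm_conj b, ← norm_mul, h1, norm_one]
  nlinarith [norm_nonneg b, norm_nonneg z]

theorem norm_mobius_lt_one {b z : ℂ} (hb : ‖b‖ < 1) (hz : ‖z‖ < 1) :
    ‖(z - b) / (1 - (starRingEnd ℂ) b * z)‖ < 1 := by
  rw [norm_div, div_lt_one (norm_pos_iff.2 (mobius_ne_zero hb hz)),
    ← sq_lt_sq₀ (norm_nonneg _) (norm_nonneg _), ← normSq_eq_norm_sq, ← normSq_eq_norm_sq]
  have h1 : normSq b < 1 := by
    rw [normSq_eq_norm_sq]; nlinarith [norm_nonneg b]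
  have h2 : normSq z < 1 := by
    rw [normSq_eq_norm_sq]; nlinarith [norm_nonneg z]
  rw [normSq_apply] at h1 h2 ⊢
  rw [normSq_apply]
  simp only [sub_re, sub_im, mul_re, mul_im, conj_re, conj_im, one_re, one_im]
  nlinarith [mul_pos (sub_pos.2 h1) (sub_pos.2 h2)]

theorem mobius_injOn {b : ℂ} (hb : ‖b‖ < 1) :
    InjOn (fun z => (z - b) / (1 - (starRingEnd ℂ) b * z)) (ball 0 1) := by
  intro z hz w hw h
  rw [mem_ball_zero_iff] at hz hw
  simp only at h
  rw [div_eq_div_iff (mobius_ne_zero hb hz) (mobius_ne_zero hb hw)] at h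
  have h1 : (z - w) * (1 - (starRingEnd ℂ) b * b) = 0 := by linear_combination h
  rcases mul_eq_zero.1 h1 with h2 | h2
  · exact sub_eq_zero.1 h2
  · exact absurd h2 (mobius_ne_zero hb hb)

/-- Composition with a Möbius transformation. -/
theorem mobius {ψ : ℂ → ℂ} {b : ℂ} (hc : ContinuousOn ψ X) (hi : InjOn ψ X)
    (hd : DifferentiableOn ℂ ψ D) (hm : MapsTo ψ X (ball 0 1)) (hDX : D ⊆ X) (hb : ψ a = b)
    (hb1 : ‖b‖ < 1) :
    KoebeClass D X a (fun z => (ψ z - b) / (1 - (starRingEnd ℂ) b * ψ z)) := by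
  have hm' : ∀ z ∈ X, ‖ψ z‖ < 1 := fun z hz => mem_ball_zero_iff.1 (hm hz)
  refine ⟨(hc.sub continuousOn_const).div (continuousOn_const.sub (continuousOn_const.mul hc))
    fun z hz => mobius_ne_zero hb1 (hm' z hz), fun z hz w hw h =>
      hi hz hw (mobius_injOn hb1 (hm hz) (hm hw) h),
    (hd.sub_const _).div ((differentiableOn_const 1).sub (hd.const_mul _))
    fun z hz => mobius_ne_zero hb1 (hm' z (hDX hz)), fun z hz => ?_, by simp [hb]⟩
  exact mem_ball_zero_iff.2 (norm_mobius_lt_one hb1 (hm' z hz))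

theorem hasDerivAt_mobius {ψ : ℂ → ℂ} {ψ' : ℂ} {b : ℂ} (hd : HasDerivAt ψ ψ' a)
    (h : 1 - (starRingEnd ℂ) b * ψ a ≠ 0) :
    HasDerivAt (fun z => (ψ z - b) / (1 - (starRingEnd ℂ) b * ψ z))
      (ψ' * (1 - (starRingEnd ℂ) b * b) / (1 - (starRingEnd ℂ) b * ψ a) ^ 2) a := by
  have := (hd.sub_const b).div ((hasDerivAt_const a (1 : ℂ)).sub (hd.const_mul ((starRingEnd ℂ) b))) h
  exact this.congr_deriv (by simp only [Pi.sub_apply]; ring)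

/-- Koebe's square root transformation increases the derivative. -/
theorem exists_larger_deriv (hD : IsOpen D) (hDX : D ⊆ X) (ha : a ∈ D)
    (hlog : ∀ f : ℂ → ℂ, ContinuousOn f X → (∀ z ∈ X, f z ≠ 0) →
      ∃ L : ℂ → ℂ, ContinuousOn L X ∧ ∀ z ∈ X, exp (L z) = f z)
    {ψ : ℂ → ℂ} (hψ : KoebeClass D X a ψ) {b : ℂ} (hb : ‖b‖ < 1) (hbX : b ∉ ψ '' X) :
    ∃ χ, KoebeClass D X a χ ∧
      ‖deriv χ a‖ * (2 * √‖b‖) = ‖deriv ψ a‖ * (1 + ‖b‖) := by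
  have hm' : ∀ z ∈ X, ‖ψ z‖ < 1 := fun z hz => mem_ball_zero_iff.1 (hψ.mapsTo hz)
  -- The omitted value `b` is moved to `0`, so `T` has a square root `s`, which is again injective;
  -- a second Möbius map moves `s a` back to `0`.
  set T : ℂ → ℂ := fun z => (ψ z - b) / (1 - (starRingEnd ℂ) b * ψ z) with hT
  have hTc : ContinuousOn T X := (hψ.continuousOn.sub continuousOn_const).div
    (continuousOn_const.sub (continuousOn_const.mul hψ.continuousOn))
    fun z hz => mobius_ne_zero hb (hm' z hz)
  have hTd : DifferentiableOn ℂ T D := (hψ.differentiableOn.sub_const _).div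
    ((differentiableOn_const 1).sub (hψ.differentiableOn.const_mul _))
    fun z hz => mobius_ne_zero hb (hm' z (hDX hz))
  have hTi : InjOn T X := fun z hz w hw h =>
      hψ.injOn hz hw (mobius_injOn hb (hψ.mapsTo hz) (hψ.mapsTo hw) h)
  have hT0 : ∀ z ∈ X, T z ≠ 0 := fun z hz h0 => by
    rcases div_eq_zero_iff.1 h0 with h | h
    · exact hbX ⟨z, hz, sub_eq_zero.1 h⟩
    · exact mobius_ne_zero hb (hm' z hz) h
  obtain ⟨L, hL, hL'⟩ := hlog T hTc hT0
  set s : ℂ → ℂ := fun z => exp (L z / 2)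
  have hs2 : ∀ z ∈ X, s z ^ 2 = T z := by
    intro z hz
    rw [← hL' z hz, ← exp_nat_mul]
    congr 1
    push_cast
    ring
  have hsc : ContinuousOn s X := continuous_exp.comp_continuousOn (hL.div_const 2)
  have hs0 : ∀ z, s z ≠ 0 := fun z => exp_ne_zero _
  have hsT : ∀ z ∈ X, ‖s z‖ ^ 2 = ‖T z‖ := fun z hz => by rw [← norm_pow, hs2 z hz]
  have hs1 : MapsTo s X (ball 0 1) := by
    intro z hz
    rw [mem_ball_zero_iff, ← sq_lt_one_iff₀ (norm_nonneg _), hsT z hz]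
    exact norm_mobius_lt_one hb (hm' z hz)
  have hsd : ∀ z ∈ D, HasDerivAt s (deriv T z / (2 * s z)) z := by
    intro z hz
    have h1 : HasDerivAt (fun z : ℂ => z ^ 2) (2 * s z) (s z) := by
      simpa using hasDerivAt_pow 2 (s z)
    have h2 : ContinuousAt s z := (hsc.mono hDX).continuousAt (hD.mem_nhds hz)
    have h3 : HasDerivAt T (deriv T z) z :=
      ((hTd z hz).differentiableAt (hD.mem_nhds hz)).hasDerivAt
    exact HasDerivAt.of_comp_left h2 h1 h3 (by simpa using hs0 z) (by
      filter_upwards [hD.mem_nhds hz] with w hw using hs2 w (hDX hw))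
  have hsdd : DifferentiableOn ℂ s D := fun z hz => (hsd z hz).differentiableAt.differentiableWithinAt
  have hsi : InjOn s X := fun z hz w hw h => hTi hz hw (by rw [← hs2 z hz, ← hs2 w hw, h])
  have hsa : ‖s a‖ < 1 := mem_ball_zero_iff.1 (hs1 (hDX ha))
  -- Since `‖s a‖ ^ 2 = ‖b‖`, the derivative at `a` is multiplied in modulus by `(1 - ‖b‖²) / (2
  -- √‖b‖ (1 - ‖b‖))`, which is `(1 + ‖b‖) / (2 √‖b‖)`.
  refine ⟨_, mobius hsc hsi hsdd hs1 hDX rfl hsa, ?_⟩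
  have hTa : T a = -b := by simp [T, hψ.zero]
  have hsa2 : ‖s a‖ ^ 2 = ‖b‖ := by rw [hsT a (hDX ha), hTa, norm_neg]
  have hsb : √‖b‖ = ‖s a‖ := by rw [← hsa2, Real.sqrt_sq (norm_nonneg _)]
  have hdψ : HasDerivAt ψ (deriv ψ a) a :=
    ((hψ.differentiableOn a ha).differentiableAt (hD.mem_nhds ha)).hasDerivAt
  have hdT := (hasDerivAt_mobius (b := b) hdψ (mobius_ne_zero hb (hm' a (hDX ha)))).deriv
  rw [(hasDerivAt_mobius (b := s a) (hsd a ha) (mobius_ne_zero hsa hsa)).deriv]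
  rw [hdT, hψ.zero, hsb]
  have e1 : ∀ w : ℂ, (starRingEnd ℂ) w * w = ((‖w‖ ^ 2 : ℝ) : ℂ) := by
    intro w
    rw [← normSq_eq_norm_sq, mul_comm, mul_conj]
  have hp : (0 : ℝ) < ‖s a‖ := norm_pos_iff.2 (hs0 a)
  have hp2 : (0 : ℝ) < 1 - ‖s a‖ ^ 2 := by nlinarith
  have e2 : (1 - (starRingEnd ℂ) (s a) * s a) = ((1 - ‖s a‖ ^ 2 : ℝ) : ℂ) := by
    rw [e1]; push_cast; ring
  have e3 : (1 - (starRingEnd ℂ) b * b) = ((1 - (‖s a‖ ^ 2) ^ 2 : ℝ) : ℂ) := by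
    rw [e1, hsa2]; push_cast; ring
  have hp3 : (0 : ℝ) ≤ 1 - (‖s a‖ ^ 2) ^ 2 := by nlinarith
  rw [e2, e3]
  simp only [norm_div, norm_mul, norm_pow, norm_real, mul_zero, sub_zero, Complex.norm_ofNat,
    one_pow, div_one, Real.norm_of_nonneg hp2.le, Real.norm_of_nonneg hp3]
  rw [← hsa2]
  field_simp
  ring

end KoebeClass

namespace KoebeClass

variable {D X : Set ℂ} {a : ℂ}

theorem exists_of_isBounded (hX : Bornology.IsBounded X) : ∃ ψ, KoebeClass D X a ψ ∧
    deriv ψ a ≠ 0 := by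
  obtain ⟨R, hR⟩ := hX.exists_norm_le
  set r : ℝ := |R| + ‖a‖ + 1
  have hr : 0 < r := by positivity
  have hrc : (r : ℂ) ≠ 0 := by exact_mod_cast hr.ne'
  refine ⟨fun z => (z - a) / r, ⟨by fun_prop, fun z _ w _ h => ?_, by fun_prop, fun z hz => ?_,
    by simp⟩, ?_⟩
  · exact sub_left_injective ((div_left_inj' hrc).1 h)
  · rw [mem_ball_zero_iff, norm_div, norm_real, Real.norm_of_nonneg hr.le, div_lt_one hr]
    have := norm_sub_le z a
    have := hR z hz
    have := le_abs_self R
    simp only [r]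
    linarith
  · have : HasDerivAt (fun z : ℂ => (z - a) / r) (1 / r) a :=
      ((hasDerivAt_id a).sub_const a).div_const _
    rw [this.deriv]
    exact div_ne_zero one_ne_zero hrc

/-- Maps of the class with almost maximal derivative have almost full image. -/
theorem exists_ball_subset_image (hD : IsOpen D) (hDX : D ⊆ X) (ha : a ∈ D) (hX : IsCompact X)
    (hlog : ∀ f : ℂ → ℂ, ContinuousOn f X → (∀ z ∈ X, f z ≠ 0) →
      ∃ L : ℂ → ℂ, ContinuousOn L X ∧ ∀ z ∈ X, exp (L z) = f z) {ρ : ℝ} (hρ0 : 0 < ρ)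
    (hρ : ρ < 1) : ∃ ψ, KoebeClass D X a ψ ∧ ball 0 ρ ⊆ ψ '' X := by
  obtain ⟨δ, hδ, hδD⟩ := Metric.isOpen_iff.1 hD a ha
  set A : Set ℝ := {x | ∃ ψ, KoebeClass D X a ψ ∧ ‖deriv ψ a‖ = x}
  have hA : BddAbove A := by
    refine ⟨1 / δ, ?_⟩
    rintro _ ⟨ψ, hψ, rfl⟩
    refine norm_deriv_le_div_of_mapsTo_ball (hψ.differentiableOn.mono hδD) (fun z hz => ?_) hδ
    rw [hψ.zero]
    exact ball_subset_closedBall (hψ.mapsTo (hDX (hδD hz)))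
  obtain ⟨ψ₀, hψ₀, hψ₀'⟩ := exists_of_isBounded (D := D) (a := a) hX.isBounded
  have hM : 0 < sSup A := (norm_pos_iff.2 hψ₀').trans_le (le_csSup hA ⟨ψ₀, hψ₀, rfl⟩)
  -- This is the Koebe gain for an omitted value of modulus `ρ`. The gain decreases on `(0, 1)`, so
  -- a map whose derivative exceeds `sSup A / κ` cannot omit a value of smaller modulus. The
  -- supremum need not be attained.
  set κ : ℝ := (1 + ρ) / (2 * √ρ)
  have hsρ : 0 < √ρ := Real.sqrt_pos.2 hρ0
  have hκ : 1 < κ := by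
    rw [one_lt_div (by positivity)]
    have h1 : √ρ < 1 := by rw [Real.sqrt_lt' one_pos]; simpa using hρ
    have h2 := Real.sq_sqrt hρ0.le
    nlinarith
  obtain ⟨_, ⟨ψ, hψ, rfl⟩, hlt⟩ := exists_lt_of_lt_csSup (s := A) ⟨_, ψ₀, hψ₀, rfl⟩
    (show sSup A / κ < sSup A by rw [div_lt_iff₀ (by linarith)]; nlinarith)
  refine ⟨ψ, hψ, fun b hb => ?_⟩
  by_contra hbX
  rw [mem_ball_zero_iff] at hb
  obtain ⟨χ, hχ, hχ'⟩ := exists_larger_deriv hD hDX ha hlog hψ (hb.trans hρ) hbX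
  have hb0 : 0 < ‖b‖ := by
    rw [norm_pos_iff]
    rintro rfl
    exact hbX ⟨a, hDX ha, hψ.zero⟩
  have hle : ‖deriv χ a‖ ≤ sSup A := le_csSup hA ⟨χ, hχ, rfl⟩
  have hsb : 0 < √‖b‖ := Real.sqrt_pos.2 hb0
  have hκb : κ ≤ (1 + ‖b‖) / (2 * √‖b‖) := by
    rw [div_le_div_iff₀ (by positivity) (by positivity)]
    have h1 : √‖b‖ ≤ √ρ := Real.sqrt_le_sqrt hb.le
    have h2 := Real.sq_sqrt hρ0.le
    have h3 := Real.sq_sqrt hb0.le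
    have h4 : √ρ < 1 := by rw [Real.sqrt_lt' one_pos]; simpa using hρ
    have h5 : √‖b‖ * √ρ ≤ 1 := by nlinarith
    rw [← h2, ← h3]
    simp only [Real.sqrt_sq hsρ.le, Real.sqrt_sq hsb.le]
    nlinarith [mul_nonneg (sub_nonneg.2 h1) (sub_nonneg.2 h5)]
  have h1 : ‖deriv χ a‖ = ‖deriv ψ a‖ * ((1 + ‖b‖) / (2 * √‖b‖)) := by
    field_simp
    linarith
  rw [div_lt_iff₀ (by linarith)] at hlt
  have h2 : ‖deriv ψ a‖ * κ ≤ ‖deriv χ a‖ := by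
    rw [h1]
    gcongr
  linarith

/-- Maps of the class are uniformly bounded away from the unit circle on compact sets. -/
theorem exists_norm_le_on_compact (hD : IsOpen D) (hDX : D ⊆ X) (hDc : IsPreconnected D)
    (ha : a ∈ D) {C : Set ℂ} (hC : IsCompact C) (hCD : C ⊆ D) :
    ∃ ρ : ℝ, ρ < 1 ∧ ∀ ψ, KoebeClass D X a ψ → ∀ z ∈ C, ‖ψ z‖ ≤ ρ := by
  have key : ∀ z₀ R, ball z₀ R ⊆ D → ∀ ψ, KoebeClass D X a ψ → ∀ z ∈ ball z₀ (R / 2),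
      (1 - ‖ψ z₀‖) / 3 ≤ 1 - ‖ψ z‖ := by
    intro z₀ R hR ψ hψ z hz
    -- After this rotation the real part of `1 - u * ψ` at `z` is the distance of `ψ z` to the unit
    -- circle, so the Harnack inequality applies to it.
    obtain ⟨u, hu, hu'⟩ : ∃ u : ℂ, ‖u‖ = 1 ∧ u * ψ z = ‖ψ z‖ := by
      by_cases h0 : ψ z = 0
      · exact ⟨1, by simp, by simp [h0]⟩
      · refine ⟨(starRingEnd ℂ) (ψ z) / ‖ψ z‖, ?_, ?_⟩
        · simp [h0]
        · have : (‖ψ z‖ : ℂ) ≠ 0 := by simpa using h0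
          rw [div_mul_eq_mul_div, mul_comm, mul_conj, normSq_eq_norm_sq]
          push_cast
          field_simp
    have hm : ∀ v ∈ ball z₀ R, ‖u * ψ v‖ < 1 := fun v hv => by
      rw [norm_mul, hu, one_mul]
      exact mem_ball_zero_iff.1 (hψ.mapsTo (hDX (hR hv)))
    have h1 := re_div_three_le_of_re_pos (f := fun v => 1 - u * ψ v) (z₀ := z₀) (R := R)
      ((differentiableOn_const 1).sub ((hψ.differentiableOn.mono hR).const_mul u)) (fun v hv => by
        have := (re_le_norm (u * ψ v)).trans_lt (hm v hv)
        simp only [sub_re, one_re]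
        linarith) hz
    simp only [hu', sub_re, one_re, ofReal_re] at h1
    have h2 : (u * ψ z₀).re ≤ ‖ψ z₀‖ := by
      have := re_le_norm (u * ψ z₀)
      rwa [norm_mul, hu, one_mul] at this
    linarith
  have hpt : ∀ z ∈ D, ∃ ε > 0, ∀ ψ, KoebeClass D X a ψ → ε ≤ 1 - ‖ψ z‖ := by
    refine IsPreconnected.forall_of_half_ball hD hDc ha ⟨1, one_pos, fun ψ hψ => by
      simp [hψ.zero]⟩ ?_
    rintro z R hR ⟨ε, hε, h⟩ w hw
    exact ⟨ε / 3, by positivity, fun ψ hψ => by linarith [key z R hR ψ hψ w hw, h ψ hψ]⟩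
  refine hC.induction_on (p := fun S => ∃ ρ : ℝ, ρ < 1 ∧ ∀ ψ, KoebeClass D X a ψ →
    ∀ z ∈ S, ‖ψ z‖ ≤ ρ) ⟨0, one_pos, by simp⟩ ?_ ?_ ?_
  · rintro s t hst ⟨ρ, hρ, h⟩
    exact ⟨ρ, hρ, fun ψ hψ z hz => h ψ hψ z (hst hz)⟩
  · rintro s t ⟨ρ, hρ, h⟩ ⟨ρ', hρ', h'⟩
    refine ⟨max ρ ρ', max_lt hρ hρ', fun ψ hψ z hz => ?_⟩
    rcases hz with hz | hz
    · exact (h ψ hψ z hz).trans (le_max_left _ _)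
    · exact (h' ψ hψ z hz).trans (le_max_right _ _)
  · intro z hz
    obtain ⟨R, hR, hRD⟩ := Metric.isOpen_iff.1 hD z (hCD hz)
    obtain ⟨ε, hε, h⟩ := hpt z (hCD hz)
    exact ⟨ball z (R / 2), mem_nhdsWithin_of_mem_nhds (ball_mem_nhds _ (half_pos hR)), 1 - ε / 3,
      by linarith, fun ψ hψ w hw => by linarith [key z R hRD ψ hψ w hw, h ψ hψ]⟩

end KoebeClass

/-- A bounded domain is simply connected if nonvanishing functions on its closure have
logarithms and it has the same boundary as its closure. -/
theorem IsPreconnected.isSimplyConnected_of_exists_log {D : Set ℂ} (hD : IsOpen D)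
    (hDc : IsPreconnected D) {a : ℂ} (ha : a ∈ D) (hX : IsCompact (closure D))
    (hfr : frontier (closure D) = frontier D)
    (hlog : ∀ f : ℂ → ℂ, ContinuousOn f (closure D) → (∀ z ∈ closure D, f z ≠ 0) →
      ∃ L : ℂ → ℂ, ContinuousOn L (closure D) ∧ ∀ z ∈ closure D, exp (L z) = f z) :
    IsSimplyConnected D := by
  have hDX : D ⊆ closure D := subset_closure
  have hint : interior (closure D) = D := by
    refine (interior_maximal hDX hD).antisymm' fun z hz => ?_
    by_contra hzD
    have h1 : z ∈ frontier D := ⟨interior_subset hz, fun h => hzD (interior_subset h)⟩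
    rw [← hfr] at h1
    exact h1.2 hz
  rw [isSimplyConnected_iff_exists_homotopy_refl_forall_mem]
  refine ⟨(hD.isConnected_iff_isPathConnected).1 ⟨⟨a, ha⟩, hDc⟩, fun x p hp => ?_⟩
  -- The bound on the loop holds for all maps of the class, so the radius `r` can be fixed before
  -- `ψ`, whose image is then required to contain the disc of radius `r`. The loop is contracted
  -- along segments in that disc; a Riemann map of `D` is not needed.
  obtain ⟨ρ, hρ, h⟩ := KoebeClass.exists_norm_le_on_compact (a := a) hD hDX hDc ha
    (isCompact_range p.continuous) (range_subset_iff.2 hp)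
  have hmax : max ρ 0 < 1 := max_lt hρ one_pos
  obtain ⟨r, hr, hr1⟩ := exists_between hmax
  have hr0 : 0 < r := (le_max_right _ _).trans_lt hr
  obtain ⟨ψ, hψ, hball⟩ := KoebeClass.exists_ball_subset_image hD hDX ha hX hlog hr0 hr1
  obtain ⟨σ, hσ, hσ'⟩ := hX.exists_continuousOn_factor hψ.continuousOn
    (L := id) continuousOn_id (fun s hs t ht hst => hψ.injOn hs ht hst)
  have hσi : InjOn σ (ball 0 r) := by
    intro z hz w hw hzw
    obtain ⟨z', hz', rfl⟩ := hball hz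
    obtain ⟨w', hw', rfl⟩ := hball hw
    rw [hσ' _ hz', hσ' _ hw'] at hzw
    exact congrArg ψ hzw
  have hσo : IsOpen (σ '' ball 0 r) := hσi.isOpen_image_complex isOpen_ball (hσ.mono hball)
  -- By invariance of domain the image of the disc is an open subset of `closure D`, and the
  -- interior of `closure D` is `D`.
  have hσD : ∀ z ∈ ball (0 : ℂ) r, σ z ∈ D := by
    intro z hz
    have h1 : σ '' ball 0 r ⊆ interior (closure D) := by
      refine interior_maximal ?_ hσo
      rintro _ ⟨w, hw, rfl⟩
      obtain ⟨w', hw', rfl⟩ := hball hw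
      rw [hσ' _ hw']
      exact hw'
    rw [hint] at h1
    exact h1 ⟨z, hz, rfl⟩
  have hψp : ∀ t, ψ (p t) ∈ ball (0 : ℂ) r := fun t => by
    rw [mem_ball_zero_iff]
    exact (h ψ hψ _ ⟨t, rfl⟩).trans_lt ((le_max_left _ _).trans_lt hr)
  have hψx : ψ x ∈ ball (0 : ℂ) r := by simpa using hψp 0
  have hxD : x ∈ D := by simpa using hp 0
  have hseg : ∀ q : unitInterval × unitInterval,
      (1 - (q.1 : ℝ)) • ψ (p q.2) + (q.1 : ℝ) • ψ x ∈ ball (0 : ℂ) r := fun q =>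
    (convex_ball (0 : ℂ) r) (hψp q.2) hψx (by linarith [q.1.2.2]) q.1.2.1 (by ring)
  have hψc : Continuous fun t => ψ (p t) :=
    hψ.continuousOn.comp_continuous p.continuous (fun t => hDX (hp t))
  refine ⟨{
    toFun := fun q => σ ((1 - (q.1 : ℝ)) • ψ (p q.2) + (q.1 : ℝ) • ψ x)
    continuous_toFun := ?_
    map_zero_left := fun t => by simp [hσ' _ (hDX (hp t))]
    map_one_left := fun t => by simp [hσ' _ (hDX hxD)]
    prop' := fun s t ht => ?_ }, fun q => hσD _ (hseg q)⟩
  · refine (hσ.mono hball).comp_continuous ?_ hseg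
    have : Continuous fun q : unitInterval × unitInterval => ψ (p q.2) :=
      hψc.comp continuous_snd
    have hq : Continuous fun q : unitInterval × unitInterval => (q.1 : ℝ) := by fun_prop
    exact ((continuous_const.sub hq).smul this).add (hq.smul continuous_const)
  · have hpt : p t = x := by
      rcases ht with rfl | ht
      · simp
      · rw [mem_singleton_iff.1 ht]
        simp
    simp only [ContinuousMap.coe_mk, hpt, ← add_smul, sub_add_cancel,
      one_smul]
    rw [hσ' _ (hDX hxD)]
    simp [hpt]

/-! ### Holomorphic functions of one variable -/

/-- The exponential has nonzero derivative, so a continuous branch of the logarithm inherits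
differentiability. -/
theorem differentiableOn_of_exp_eq {D : Set ℂ} (hD : IsOpen D) {L f : ℂ → ℂ}
    (hf : DifferentiableOn ℂ f D) (hL : ContinuousOn L D) (h : ∀ z ∈ D, exp (L z) = f z) :
    DifferentiableOn ℂ L D := fun z hz =>
  (HasDerivAt.of_comp_left (hL.continuousAt (hD.mem_nhds hz)) (hasDerivAt_exp (L z))
    ((hf z hz).differentiableAt (hD.mem_nhds hz)).hasDerivAt (exp_ne_zero _)
    (by filter_upwards [hD.mem_nhds hz] with w hw using h w hw)).differentiableAt.differentiableWithinAt

/-- The local form of a nonconstant holomorphic function. -/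
theorem AnalyticAt.exists_pow_eq {f : ℂ → ℂ} {z₀ : ℂ} (hf : AnalyticAt ℂ f z₀)
    (hc : ¬ ∀ᶠ z in 𝓝 z₀, f z = f z₀) :
    ∃ (n : ℕ) (h : ℂ → ℂ), 0 < n ∧ (deriv f z₀ = 0 → 2 ≤ n) ∧ AnalyticAt ℂ h z₀ ∧ h z₀ ≠ 0 ∧
      ∀ᶠ z in 𝓝 z₀, f z = f z₀ + ((z - z₀) * h z) ^ n := by
  have hf1 : AnalyticAt ℂ (fun z => f z - f z₀) z₀ := hf.sub analyticAt_const
  obtain ⟨n, g, hg, hg0, hfg⟩ := hf1.exists_eventuallyEq_pow_smul_nonzero_iff.2 (by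
    intro h
    apply hc
    filter_upwards [h] with z hz using sub_eq_zero.1 hz)
  simp only [smul_eq_mul] at hfg
  have hn1 : n ≠ 0 := by
    rintro rfl
    have := hfg.self_of_nhds
    simp only [sub_self, pow_zero, one_mul] at this
    exact absurd this.symm hg0
  have hn2 : deriv f z₀ = 0 → 2 ≤ n := by
    intro hd
    rcases n with _ | _ | n
    · exact absurd rfl hn1
    · have h1 : HasDerivAt (fun z => (z - z₀) ^ (0 + 1) * g z) (g z₀) z₀ := by
        have := ((hasDerivAt_id z₀).sub_const z₀).mul hg.differentiableAt.hasDerivAt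
        exact (this.congr_deriv (by simp)).congr_of_eventuallyEq (by simp [Pi.mul_def])
      have h2 : HasDerivAt (fun z => f z - f z₀) (deriv f z₀) z₀ :=
        hf.differentiableAt.hasDerivAt.sub_const _
      have := (h1.congr_of_eventuallyEq hfg).unique h2
      exact absurd (this.trans hd) hg0
    · omega
  have hn0 : (n : ℂ) ≠ 0 := by exact_mod_cast hn1
  set κ : ℂ := g z₀ ^ (1 / n : ℂ)
  have hκ : κ ^ n = g z₀ := by
    rw [← cpow_mul_nat, div_mul_cancel₀ _ hn0, cpow_one]
  have hκ0 : κ ≠ 0 := by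
    intro h0
    rw [h0, zero_pow (by omega)] at hκ
    exact hg0 hκ.symm
  set h : ℂ → ℂ := fun z => κ * Complex.exp (Complex.log (g z / g z₀) / n)
  have hquot : AnalyticAt ℂ (fun z => g z / g z₀) z₀ := hg.div analyticAt_const hg0
  have hh : AnalyticAt ℂ h z₀ := by
    refine analyticAt_const.mul (AnalyticAt.cexp ?_)
    refine AnalyticAt.div (AnalyticAt.clog hquot ?_) analyticAt_const hn0
    simp [div_self hg0]
  refine ⟨n, h, Nat.pos_of_ne_zero hn1, hn2, hh, mul_ne_zero hκ0 (Complex.exp_ne_zero _), ?_⟩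
  filter_upwards [hg.continuousAt.eventually_ne hg0, hfg] with z hz hz'
  have h1 : h z ^ n = g z := by
    simp only [h]
    rw [mul_pow, hκ, ← Complex.exp_nat_mul, mul_div_cancel₀ _ hn0,
      Complex.exp_log (div_ne_zero hz hg0)]
    field_simp
  rw [mul_pow, h1, ← hz']
  ring

/-- Near a zero of order `n`, small values are attained at the `n` points given by the roots. -/
theorem eventually_exists_preimages {h : ℂ → ℂ} {z₀ : ℂ} (hh : AnalyticAt ℂ h z₀)
    (hh0 : h z₀ ≠ 0) {n : ℕ} (hn : 0 < n) {N : Set ℂ} (hN : N ∈ 𝓝 z₀) :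
    ∀ᶠ w in 𝓝[≠] (0 : ℂ), ∃ x : ℕ → ℂ, InjOn x (Iio n) ∧
      ∀ k < n, x k ∈ N ∧ ((x k - z₀) * h (x k)) ^ n = w := by
  have hn0 : (n : ℂ) ≠ 0 := by exact_mod_cast hn.ne'
  set ρ : ℂ → ℂ := fun z => (z - z₀) * h z
  have hρ : HasStrictDerivAt ρ (h z₀) z₀ := by
    have h1 : AnalyticAt ℂ ρ z₀ := (analyticAt_id.sub analyticAt_const).mul hh
    have h2 : HasDerivAt ρ (h z₀) z₀ := by
      have := ((hasDerivAt_id z₀).sub_const z₀).mul hh.differentiableAt.hasDerivAt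
      exact this.congr_deriv (by simp)
    have := h1.hasStrictDerivAt
    rwa [h2.deriv] at this
  have himg : ρ '' N ∈ 𝓝 (0 : ℂ) := by
    have := hρ.map_nhds_eq hh0
    rw [show ρ z₀ = 0 by simp [ρ]] at this
    rw [← this]
    exact image_mem_map hN
  obtain ⟨δ, hδ, hδ'⟩ := Metric.mem_nhds_iff.1 himg
  have hζ := isPrimitiveRoot_exp n hn.ne'
  set ζ := exp (2 * Real.pi * I / n)
  have hev : ∀ᶠ w in 𝓝[≠] (0 : ℂ), ‖w‖ < δ ^ n := by
    refine eventually_nhdsWithin_of_eventually_nhds ?_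
    filter_upwards [ball_mem_nhds (0 : ℂ) (pow_pos hδ n)] with w hw
    rwa [mem_ball_zero_iff] at hw
  filter_upwards [hev, self_mem_nhdsWithin] with w hw hw0
  set u : ℂ := w ^ (1 / n : ℂ)
  have hu : u ^ n = w := by
    rw [← cpow_mul_nat, div_mul_cancel₀ _ hn0, cpow_one]
  have hu0 : u ≠ 0 := by
    intro h0
    rw [h0, zero_pow hn.ne'] at hu
    exact hw0 hu.symm
  have huδ : ‖u‖ < δ := by
    rw [← hu, norm_pow] at hw
    exact lt_of_pow_lt_pow_left₀ n hδ.le hw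
  -- All `n` roots of `w` have the same small modulus, so the local biholomorphism `ρ` attains each
  -- of them in `N`.
  have hex : ∀ k : ℕ, ∃ x ∈ N, ρ x = ζ ^ k * u := fun k => hδ' (mem_ball_zero_iff.2 (by
    rw [norm_mul, norm_pow, hζ.norm'_eq_one hn.ne', one_pow, one_mul]
    exact huδ))
  choose x hxN hx using hex
  refine ⟨x, fun k hk m hm hkm => ?_, fun k _ => ⟨hxN k, ?_⟩⟩
  · have h1 := hx k
    rw [hkm, hx m] at h1
    exact (hζ.pow_inj hm hk (mul_right_cancel₀ hu0 h1)).symm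
  · show ρ (x k) ^ n = w
    rw [hx k, mul_pow, ← pow_mul, mul_comm k n, pow_mul, hζ.pow_eq_one, one_pow, one_mul, hu]

/-- Near a critical point a nonconstant holomorphic function is not injective. -/
theorem not_injOn_of_deriv_eq_zero {f : ℂ → ℂ} {z₀ : ℂ}
    (hf : AnalyticAt ℂ f z₀) (hd : deriv f z₀ = 0) (hc : ¬ ∀ᶠ z in 𝓝 z₀, f z = f z₀)
    {N : Set ℂ} (hN : N ∈ 𝓝 z₀) : ¬ InjOn f N := by
  intro hi
  obtain ⟨n, h, hn, hn2, hh, hh0, hfh⟩ := hf.exists_pow_eq hc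
  obtain ⟨w, x, hxi, hx⟩ :=
    (eventually_exists_preimages hh hh0 hn (inter_mem hN hfh)).exists
  have h0 := hx 0 hn
  have h1 := hx 1 (hn2 hd)
  have h2 : x 0 = x 1 := hi h0.1.1 h1.1.1 (by rw [h0.1.2, h1.1.2, h0.2, h1.2])
  exact absurd (hxi hn (hn2 hd) h2) (by norm_num)

theorem Set.InjOn.deriv_ne_zero {f : ℂ → ℂ} {O : Set ℂ} (hi : InjOn f O) (hO : IsOpen O)
    {z₀ : ℂ} (hz : z₀ ∈ O) (hf : AnalyticAt ℂ f z₀) : deriv f z₀ ≠ 0 := by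
  intro hd
  have hc : ¬ ∀ᶠ z in 𝓝 z₀, f z = f z₀ := by
    intro h
    have h1 : ∀ᶠ z in 𝓝[≠] z₀, z = z₀ := by
      filter_upwards [nhdsWithin_le_nhds h, nhdsWithin_le_nhds (hO.mem_nhds hz)] with z hz1 hz2
      exact hi hz2 hz hz1
    obtain ⟨z, hz1, hz2⟩ := (h1.and self_mem_nhdsWithin).exists
    exact hz2 hz1
  exact not_injOn_of_deriv_eq_zero hf hd hc (hO.mem_nhds hz) hi

/-- Factorization of a holomorphic function whose zeros lie in a compact set. -/
theorem DifferentiableOn.exists_factorization {D K : Set ℂ} (hD : IsOpen D)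
    (hc : IsPreconnected D) (hK : IsCompact K) (hKD : K ⊆ D) {f : ℂ → ℂ}
    (hf : DifferentiableOn ℂ f D) (hz : ∀ z ∈ D, f z = 0 → z ∈ K)
    (hne : ∃ z ∈ D, f z ≠ 0) :
    ∃ (Z : Finset ℂ) (n : ℂ → ℕ) (q : ℂ → ℂ), (↑Z ⊆ K) ∧ (∀ a ∈ Z, 0 < n a) ∧
      DifferentiableOn ℂ q D ∧ (∀ z ∈ D, q z ≠ 0) ∧
      ∀ z ∈ D, f z = (∏ a ∈ Z, (z - a) ^ n a) * q z := by
  classical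
  have key : ∀ (Z : Finset ℂ) (f : ℂ → ℂ), DifferentiableOn ℂ f D → (∃ z ∈ D, f z ≠ 0) →
      (∀ z ∈ D, f z = 0 ↔ z ∈ Z) → (↑Z ⊆ D) → ∃ (n : ℂ → ℕ) (q : ℂ → ℂ), (∀ a ∈ Z, 0 < n a) ∧
      DifferentiableOn ℂ q D ∧ (∀ z ∈ D, q z ≠ 0) ∧
      ∀ z ∈ D, f z = (∏ a ∈ Z, (z - a) ^ n a) * q z := by
    intro Z
    induction Z using Finset.induction_on with
    | empty => exact fun f hf _ hfZ _ => ⟨fun _ => 0, f, by simp, hf,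
        fun z hz h0 => by simpa using (hfZ z hz).1 h0, by simp⟩
    | insert a Z ha ih =>
      intro f hf hne hfZ hZD
      have haD : a ∈ D := hZD (by simp)
      have hfa := hf.analyticOnNhd hD
      obtain ⟨n, g, hg, hg0, hfg⟩ := (hfa a haD).exists_eventuallyEq_pow_smul_nonzero_iff.2 (by
        intro h
        obtain ⟨z, hz, hfz⟩ := hne
        exact hfz (hfa.eqOn_zero_of_preconnected_of_eventuallyEq_zero hc haD h hz))
      simp only [smul_eq_mul] at hfg
      have hn : 0 < n := by
        rcases Nat.eq_zero_or_pos n with rfl | h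
        · have h1 := hfg.self_of_nhds
          rw [(hfZ a haD).2 (by simp)] at h1
          simp only [pow_zero, one_mul] at h1
          exact absurd h1.symm hg0
        · exact h
      -- The removable singularity at `a` is filled with the value of the local cofactor `g`.
      set f₁ : ℂ → ℂ := Function.update (fun z => f z / (z - a) ^ n) a (g a) with hf₁
      have hf₁a : f₁ a = g a := by simp [f₁]
      have hf₁z : ∀ z, z ≠ a → f₁ z = f z / (z - a) ^ n := fun z hz => by simp [f₁, hz]
      have hpow : ∀ z, z ≠ a → (z - a) ^ n ≠ 0 := fun z hz => pow_ne_zero _ (sub_ne_zero.2 hz)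
      have heq : f₁ =ᶠ[𝓝 a] g := by
        filter_upwards [hfg] with z hz
        by_cases hza : z = a
        · rw [hza, hf₁a]
        · rw [hf₁z z hza, hz, mul_div_cancel_left₀ _ (hpow z hza)]
      have hd₁ : DifferentiableOn ℂ f₁ D := by
        intro z hz
        by_cases hza : z = a
        · rw [hza]
          exact (hg.differentiableAt.congr_of_eventuallyEq heq).differentiableWithinAt
        · have h1 : f₁ =ᶠ[𝓝 z] fun z => f z / (z - a) ^ n := by
            filter_upwards [isOpen_ne.mem_nhds hza] with w hw using hf₁z w hw
          refine (DifferentiableAt.congr_of_eventuallyEq ?_ h1).differentiableWithinAt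
          exact ((hf z hz).differentiableAt (hD.mem_nhds hz)).div (by fun_prop) (hpow z hza)
      have hff₁ : ∀ z ∈ D, f z = (z - a) ^ n * f₁ z := by
        intro z hz
        by_cases hza : z = a
        · rw [hza, (hfZ a haD).2 (by simp), sub_self, zero_pow hn.ne', zero_mul]
        · rw [hf₁z z hza, mul_div_cancel₀ _ (hpow z hza)]
      obtain ⟨m, q, hm, hq, hq0, hfq⟩ := ih f₁ hd₁ ⟨a, haD, by rwa [hf₁a]⟩ (by
        intro z hz
        by_cases hza : z = a
        · subst hza
          rw [hf₁a]
          simp [hg0, ha]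
        · rw [hf₁z z hza, div_eq_zero_iff, or_iff_left (hpow z hza), hfZ z hz]
          simp [hza]) (fun z hz => hZD (by simp only [Finset.coe_insert]; exact Or.inr hz))
      have hmod : ∀ z ∈ Z, Function.update m a n z = m z := fun z hz => by
        rw [Function.update_of_ne]
        rintro rfl
        exact ha hz
      refine ⟨Function.update m a n, q, ?_, hq, hq0, ?_⟩
      · intro b hb
        rcases Finset.mem_insert.1 hb with rfl | hb
        · simpa using hn
        · rw [hmod b hb]; exact hm b hb
      · intro z hz
        rw [Finset.prod_insert ha, hff₁ z hz, hfq z hz, Function.update_self,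
          Finset.prod_congr rfl (fun b hb => congrArg (fun k => (z - b) ^ k) (hmod b hb))]
        ring
  have hfa := hf.analyticOnNhd hD
  -- Infinitely many zeros would accumulate in the compact set `K`, inside `D`, and force `f = 0`.
  have hfin : {z ∈ D | f z = 0}.Finite := by
    by_contra hinf
    obtain ⟨z, hzK, hacc⟩ := Set.Infinite.exists_accPt_of_subset_isCompact hinf hK
      (fun z hz' => hz z hz'.1 hz'.2)
    obtain ⟨w, hw, hfw⟩ := hne
    refine hfw (hfa.eqOn_zero_of_preconnected_of_frequently_eq_zero hc (hKD hzK) ?_ hw)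
    rw [accPt_iff_frequently_nhdsNE] at hacc
    exact hacc.mono fun v hv => hv.2
  obtain ⟨n, q, h1, h2, h3, h4⟩ := key hfin.toFinset f hf hne (by
    intro z hz
    simp [hz]) (fun z hz => by simp at hz; exact hz.1)
  exact ⟨hfin.toFinset, n, q, fun z hz' => by simp at hz'; exact hz z hz'.1 hz'.2, h1, h2, h3, h4⟩

/-- Division by a moving zero is continuous. -/
theorem continuousOn_dslope_of_zero {Y : Type*} [TopologicalSpace Y] {D : Set ℂ} (hD : IsOpen D)
    {J : Set Y} {f : ℂ → Y → ℂ} (hf : ContinuousOn (fun p : ℂ × Y => f p.1 p.2) (D ×ˢ J))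
    (hd : ∀ y ∈ J, DifferentiableOn ℂ (fun l => f l y) D) {χ : Y → ℂ} (hχ : ContinuousOn χ J)
    (hχD : ∀ y ∈ J, χ y ∈ D) (hz : ∀ y ∈ J, f (χ y) y = 0) :
    ContinuousOn (fun p : ℂ × Y => dslope (fun l => f l p.2) (χ p.2) p.1) (D ×ˢ J) := by
  rintro ⟨l₀, y₀⟩ ⟨hl₀, hy₀⟩
  simp only at hl₀ hy₀
  obtain ⟨r₁, hr₁, hr₁D⟩ := nhds_basis_closedBall.mem_iff.1 (hD.mem_nhds hl₀)
  -- The circle has to avoid the zero `χ y₀`, so that the plain quotient formula is available on it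
  -- for nearby parameters; one of the radii `r₁`, `r₁ / 2` works.
  obtain ⟨r, hr, hrD, hrχ⟩ : ∃ r > 0, closedBall l₀ r ⊆ D ∧ χ y₀ ∉ sphere l₀ r := by
    by_cases h : dist (χ y₀) l₀ = r₁
    · refine ⟨r₁ / 2, by positivity, (closedBall_subset_closedBall (by linarith)).trans hr₁D, ?_⟩
      rw [mem_sphere, h]
      linarith
    · exact ⟨r₁, hr₁, hr₁D, h⟩
  set q : ℂ → Y → ℂ := fun l y => dslope (fun l => f l y) (χ y) l
  have hqd : ∀ y ∈ J, DifferentiableOn ℂ (fun l => q l y) D := fun y hy =>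
    (differentiableOn_dslope (hD.mem_nhds (hχD y hy))).2 (hd y hy)
  have hq : ∀ y ∈ J, ∀ l, l ≠ χ y → q l y = (l - χ y)⁻¹ * f l y := by
    intro y hy l hl
    simp only [q]
    rw [dslope_of_ne _ hl, slope_def_module, hz y hy, sub_zero, smul_eq_mul]
  show Tendsto (fun p : ℂ × Y => q p.1 p.2) (𝓝[D ×ˢ J] (l₀, y₀)) (𝓝 (q l₀ y₀))
  rw [Metric.tendsto_nhds]
  intro ε hε
  have hsD : sphere l₀ r ⊆ D := sphere_subset_closedBall.trans hrD
  have hsph : ∀ᶠ y in 𝓝[J] y₀, ∀ l ∈ sphere l₀ r, ‖q l y - q l y₀‖ < ε / 2 := by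
    refine (isCompact_sphere l₀ r).eventually_forall_of_filter
      (P := fun y l => ‖q l y - q l y₀‖ < ε / 2) fun l hl => ?_
    have hlχ : l ≠ χ y₀ := fun h => hrχ (h ▸ hl)
    have hc1 : Tendsto (fun p : Y × ℂ => (p.2 - χ p.1)⁻¹ * f p.2 p.1)
        (𝓝[J] y₀ ×ˢ 𝓝[sphere l₀ r] l) (𝓝 ((l - χ y₀)⁻¹ * f l y₀)) := by
      have t1 : Tendsto (fun p : Y × ℂ => χ p.1) (𝓝[J] y₀ ×ˢ 𝓝[sphere l₀ r] l) (𝓝 (χ y₀)) :=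
        (hχ y₀ hy₀).tendsto.comp tendsto_fst
      have t2 : Tendsto (fun p : Y × ℂ => p.2) (𝓝[J] y₀ ×ˢ 𝓝[sphere l₀ r] l) (𝓝 l) :=
        (tendsto_nhdsWithin_iff.1 tendsto_snd).1
      have t3 : Tendsto (fun p : Y × ℂ => f p.2 p.1) (𝓝[J] y₀ ×ˢ 𝓝[sphere l₀ r] l)
          (𝓝 (f l y₀)) := by
        refine (hf (l, y₀) ⟨hsD hl, hy₀⟩).tendsto.comp (f := fun p : Y × ℂ => (p.2, p.1)) ?_
        rw [nhdsWithin_prod_eq]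
        exact (tendsto_snd.mono_right (nhdsWithin_mono _ hsD)).prodMk tendsto_fst
      exact ((t2.sub t1).inv₀ (sub_ne_zero.2 hlχ)).mul t3
    have hc2 : Tendsto (fun p : Y × ℂ => q p.2 y₀) (𝓝[J] y₀ ×ˢ 𝓝[sphere l₀ r] l)
        (𝓝 (q l y₀)) :=
      ((((hqd y₀ hy₀).continuousOn.mono hsD) l hl).tendsto).comp tendsto_snd
    have hc3 := (hc1.sub hc2).norm
    rw [hq y₀ hy₀ l hlχ, sub_self, norm_zero] at hc3
    have t1 : Tendsto (fun p : Y × ℂ => p.2 - χ p.1) (𝓝[J] y₀ ×ˢ 𝓝[sphere l₀ r] l)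
        (𝓝 (l - χ y₀)) :=
      (tendsto_nhdsWithin_iff.1 tendsto_snd).1.sub ((hχ y₀ hy₀).tendsto.comp tendsto_fst)
    have hJ : ∀ᶠ p : Y × ℂ in 𝓝[J] y₀ ×ˢ 𝓝[sphere l₀ r] l, p.1 ∈ J :=
      tendsto_fst.eventually self_mem_nhdsWithin
    filter_upwards [hc3.eventually (gt_mem_nhds (half_pos hε)),
      t1.eventually_ne (sub_ne_zero.2 hlχ), hJ] with p hp1 hp2 hp3
    rwa [hq p.1 hp3 p.2 (sub_ne_zero.1 hp2)]
  -- The maximum principle carries the estimate from the circle across the moving zero.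
  have hball : ∀ᶠ y in 𝓝[J] y₀, ∀ l ∈ closedBall l₀ r, ‖q l y - q l y₀‖ ≤ ε / 2 := by
    filter_upwards [hsph, self_mem_nhdsWithin] with y hy hyJ l hl
    have hdiff : DiffContOnCl ℂ (fun l => q l y - q l y₀) (ball l₀ r) := by
      refine DifferentiableOn.diffContOnCl ?_
      rw [closure_ball l₀ hr.ne']
      exact ((hqd y hyJ).sub (hqd y₀ hy₀)).mono hrD
    refine norm_le_of_forall_mem_frontier_norm_le isBounded_ball hdiff (fun z hz => ?_) ?_
    · rw [frontier_ball l₀ hr.ne'] at hz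
      exact (hy z hz).le
    · rwa [closure_ball l₀ hr.ne']
  have hc : ∀ᶠ l in 𝓝 l₀, ‖q l y₀ - q l₀ y₀‖ < ε / 2 := by
    have := ((hqd y₀ hy₀).continuousOn.continuousAt (hD.mem_nhds hl₀))
    have h2 := Metric.tendsto_nhds.1 this _ (half_pos hε)
    simpa [dist_eq] using h2
  rw [nhdsWithin_prod_eq]
  have e1 : ∀ᶠ p : ℂ × Y in 𝓝[D] l₀ ×ˢ 𝓝[J] y₀, ∀ l ∈ closedBall l₀ r, ‖q l p.2 - q l y₀‖ ≤ ε / 2 :=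
    tendsto_snd.eventually hball
  have e2 : ∀ᶠ p : ℂ × Y in 𝓝[D] l₀ ×ˢ 𝓝[J] y₀, ‖q p.1 y₀ - q l₀ y₀‖ < ε / 2 :=
    tendsto_fst.eventually (nhdsWithin_le_nhds hc)
  have e3 : ∀ᶠ p : ℂ × Y in 𝓝[D] l₀ ×ˢ 𝓝[J] y₀, p.1 ∈ closedBall l₀ r :=
    tendsto_fst.eventually (nhdsWithin_le_nhds (closedBall_mem_nhds l₀ hr))
  filter_upwards [e1, e2, e3] with p h1 h2 h3
  rw [dist_eq]
  calc ‖q p.1 p.2 - q l₀ y₀‖ = ‖(q p.1 p.2 - q p.1 y₀) + (q p.1 y₀ - q l₀ y₀)‖ := by congr 1; ring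
    _ ≤ _ := norm_add_le _ _
    _ < ε / 2 + ε / 2 := add_lt_add_of_le_of_lt (h1 _ h3) h2
    _ = ε := by ring

/-! ### Holomorphic motions -/

/-- A locally bounded holomorphic motion is jointly continuous. -/
theorem IsHolomorphicMotion.continuousOn {D J : Set ℂ} {b : ℂ} {h : ℂ → ℂ → ℂ}
    (hm : IsHolomorphicMotion D b J h) (hD : IsOpen D) (hc : IsPreconnected D) (hb : b ∈ D)
    (hbd : ∀ C ⊆ D, IsCompact C → ∃ M, ∀ l ∈ C, ∀ z ∈ J, ‖h l z‖ ≤ M) :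
    ContinuousOn (fun p : ℂ × ℂ => h p.1 p.2) (D ×ˢ J) := by
  obtain ⟨hinj, hbase, hhol⟩ := hm
  -- For `z ≠ z'` the normalized difference of the two orbits is nonvanishing and less than `1` in
  -- modulus. The Harnack factor `1/3` for the real part of `-log` of it turns into the exponent
  -- `3`.
  have est : ∀ l₀ R, 0 < R → closedBall l₀ R ⊆ D → ∃ M : ℝ, 0 < M ∧ ∀ z ∈ J, ∀ z' ∈ J,
      ∀ l ∈ ball l₀ (R / 2), ‖h l z - h l z'‖ ^ 3 ≤ M * ‖h l₀ z - h l₀ z'‖ := by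
    intro l₀ R hR hRD
    obtain ⟨M₀, hM₀⟩ := hbd _ hRD (isCompact_closedBall l₀ R)
    set M : ℝ := 4 * (|M₀| + 1)
    have hM : 0 < M := by positivity
    refine ⟨M ^ 2, by positivity, fun z hz z' hz' l hl => ?_⟩
    by_cases hzz : z = z'
    · simp [hzz]
    have hbR : ball l₀ R ⊆ closedBall l₀ R := ball_subset_closedBall
    have hbD : ball l₀ R ⊆ D := hbR.trans hRD
    set f : ℂ → ℂ := fun l => (h l z - h l z') / M
    have hMc : (M : ℂ) ≠ 0 := by exact_mod_cast hM.ne'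
    have hf : DifferentiableOn ℂ f (ball l₀ R) :=
      (((hhol z hz).sub (hhol z' hz')).div_const _).mono hbD
    have hf0 : ∀ v ∈ ball l₀ R, f v ≠ 0 := fun v hv h0 => by
      rcases div_eq_zero_iff.1 h0 with h1 | h1
      · exact hzz (hinj v (hbD hv) hz hz' (sub_eq_zero.1 h1))
      · exact hMc h1
    have hf1 : ∀ v ∈ ball l₀ R, ‖f v‖ < 1 := fun v hv => by
      simp only [f]
      rw [norm_div, norm_real, Real.norm_of_nonneg hM.le, div_lt_one hM]
      have h1 := norm_sub_le (h v z) (h v z')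
      have h2 := hM₀ v (hbR hv) z hz
      have h3 := hM₀ v (hbR hv) z' hz'
      have h4 := le_abs_self M₀
      simp only [M]
      linarith [abs_nonneg M₀]
    obtain ⟨L, hL, hL'⟩ := exists_log_starConvex
      ((convex_ball l₀ R).starConvex (mem_ball_self hR)) (mem_ball_self hR) hf.continuousOn hf0
    have hLd := differentiableOn_of_exp_eq isOpen_ball hf hL hL'
    have hre : ∀ v ∈ ball l₀ R, Real.exp ((L v).re) = ‖f v‖ := fun v hv => by
      rw [← hL' v hv, norm_exp]
    have hlog : ∀ v ∈ ball l₀ R, 0 < (-L v).re := fun v hv => by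
      have := hf1 v hv
      rw [← hre v hv, Real.exp_lt_one_iff] at this
      simpa using this
    have hl' : l ∈ ball l₀ R := ball_subset_ball (by linarith) hl
    have hH := re_div_three_le_of_re_pos (f := fun v => -L v) hLd.neg hlog hl
    simp only [neg_re] at hH
    have h1 : ‖f l‖ ^ 3 ≤ ‖f l₀‖ := by
      rw [← hre l hl', ← hre l₀ (mem_ball_self hR), ← Real.exp_nat_mul]
      apply Real.exp_le_exp.2
      push_cast
      linarith
    simp only [f] at h1
    rw [norm_div, norm_div, norm_real, Real.norm_of_nonneg hM.le, div_pow,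
      div_le_div_iff₀ (by positivity) hM] at h1
    have h2 : ‖h l z - h l z'‖ ^ 3 * M ≤ M ^ 2 * ‖h l₀ z - h l₀ z'‖ * M := by
      refine h1.trans (le_of_eq ?_)
      ring
    exact le_of_mul_le_mul_right h2 hM
  -- Continuity in `z` holds over the base point, where the motion is the identity, and the estimate
  -- propagates it along the connected set `D`.
  have hsmall : ∀ l ∈ D, ContinuousOn (h l) J := by
    refine IsPreconnected.forall_of_half_ball hD hc hb (continuousOn_id.congr hbase) ?_
    intro l₀ R hRD hl₀ l hl
    have hd : 2 * dist l l₀ < R := by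
      rw [mem_ball] at hl
      linarith
    obtain ⟨R', hR1, hR2⟩ := exists_between hd
    have hR' : 0 < R' := lt_of_le_of_lt (by positivity) hR1
    obtain ⟨M, hM, hest⟩ := est l₀ R' hR' ((closedBall_subset_ball hR2).trans hRD)
    intro z hz
    have hl' : l ∈ ball l₀ (R' / 2) := by
      rw [mem_ball]
      linarith
    rw [ContinuousWithinAt, Metric.tendsto_nhds]
    intro ε hε
    filter_upwards [Metric.tendsto_nhds.1 (hl₀ z hz) (ε ^ 3 / M) (by positivity),
      self_mem_nhdsWithin] with w hw hwJ
    rw [dist_eq] at hw ⊢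
    have h1 := hest w hwJ z hz l hl'
    rw [lt_div_iff₀ hM, mul_comm] at hw
    exact lt_of_pow_lt_pow_left₀ 3 hε.le (h1.trans_lt hw)
  rintro ⟨l₀, z₀⟩ ⟨hl₀, hz₀⟩
  simp only at hl₀ hz₀
  obtain ⟨R, hR, hRD⟩ := nhds_basis_closedBall.mem_iff.1 (hD.mem_nhds hl₀)
  obtain ⟨M, hM, hest⟩ := est l₀ R hR hRD
  rw [ContinuousWithinAt, nhdsWithin_prod_eq, Metric.tendsto_nhds]
  intro ε hε
  have e1 : ∀ᶠ p : ℂ × ℂ in 𝓝[D] l₀ ×ˢ 𝓝[J] z₀, dist (h l₀ p.2) (h l₀ z₀) < (ε / 2) ^ 3 / M :=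
    tendsto_snd.eventually
      (Metric.tendsto_nhds.1 (hsmall l₀ hl₀ z₀ hz₀) ((ε / 2) ^ 3 / M) (by positivity))
  have e2 : ∀ᶠ p : ℂ × ℂ in 𝓝[D] l₀ ×ˢ 𝓝[J] z₀, dist (h p.1 z₀) (h l₀ z₀) < ε / 2 :=
    tendsto_fst.eventually
      (Metric.tendsto_nhds.1 ((hhol z₀ hz₀).continuousOn l₀ hl₀) (ε / 2) (by positivity))
  have e3 : ∀ᶠ p : ℂ × ℂ in 𝓝[D] l₀ ×ˢ 𝓝[J] z₀, p.1 ∈ ball l₀ (R / 2) :=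
    tendsto_fst.eventually (nhdsWithin_le_nhds (ball_mem_nhds _ (half_pos hR)))
  have e4 : ∀ᶠ p : ℂ × ℂ in 𝓝[D] l₀ ×ˢ 𝓝[J] z₀, p.2 ∈ J :=
    tendsto_snd.eventually self_mem_nhdsWithin
  filter_upwards [e1, e2, e3, e4] with p h1 h2 h3 h4
  have h5 := hest p.2 h4 z₀ hz₀ p.1 h3
  rw [dist_eq, lt_div_iff₀ hM, mul_comm] at h1
  have h6 : dist (h p.1 p.2) (h p.1 z₀) < ε / 2 := by
    rw [dist_eq]
    exact lt_of_pow_lt_pow_left₀ 3 (by positivity) (h5.trans_lt h1)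
  exact (dist_triangle _ _ _).trans_lt (by linarith : _ < ε)

/-! ### Trivialized tubes -/

/-- `F` trivializes the tube with fibers `X l`. -/
structure IsTrivialization (D : Set ℂ) (X : ℂ → Set ℂ) (F : ℂ → ℂ → ℂ) : Prop where
  continuousOn : ContinuousOn (fun p : ℂ × ℂ => F p.1 p.2) (D ×ˢ closedBall 0 1)
  injOn : ∀ l ∈ D, InjOn (F l) (closedBall 0 1)
  image_ball : ∀ l ∈ D, F l '' ball 0 1 = X l

theorem isBidisc_iff {D : Set ℂ} {X : ℂ → Set ℂ} :
    IsBidisc D X ↔ ∃ F, IsTrivialization D X F :=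
  ⟨fun ⟨F, h1, h2⟩ => ⟨F, h1, fun l hl => (h2 l hl).1, fun l hl => (h2 l hl).2⟩,
    fun ⟨F, h⟩ => ⟨F, h.1, fun l hl => ⟨h.2 l hl, h.3 l hl⟩⟩⟩

namespace IsTrivialization

variable {D : Set ℂ} {X : ℂ → Set ℂ} {F : ℂ → ℂ → ℂ} {l : ℂ}

theorem mono (h : IsTrivialization D X F) {D' : Set ℂ} (hD : D' ⊆ D) : IsTrivialization D' X F :=
  ⟨h.1.mono (prod_mono hD Subset.rfl), fun l hl => h.2 l (hD hl), fun l hl => h.3 l (hD hl)⟩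

theorem continuousOn_fiber (h : IsTrivialization D X F) (hl : l ∈ D) :
    ContinuousOn (F l) (closedBall 0 1) :=
  h.1.comp (f := fun w => (l, w)) (by fun_prop) (fun _ hw => ⟨hl, hw⟩)

theorem closure_eq (h : IsTrivialization D X F) (hl : l ∈ D) :
    closure (X l) = F l '' closedBall 0 1 := by
  have hc := h.continuousOn_fiber hl
  rw [← h.3 l hl]
  refine subset_antisymm ?_ ?_
  · exact closure_minimal (image_mono ball_subset_closedBall)
      ((isCompact_closedBall 0 1).image_of_continuousOn hc).isClosed
  · rw [← closure_ball (0 : ℂ) one_ne_zero] at hc ⊢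
    exact hc.image_closure

theorem isOpen (h : IsTrivialization D X F) (hl : l ∈ D) : IsOpen (X l) := by
  rw [← h.3 l hl]
  exact ((h.2 l hl).mono ball_subset_closedBall).isOpen_image_complex isOpen_ball
    ((h.continuousOn_fiber hl).mono ball_subset_closedBall)

theorem mem (h : IsTrivialization D X F) (hl : l ∈ D) {w : ℂ} (hw : w ∈ ball (0 : ℂ) 1) :
    F l w ∈ X l := h.3 l hl ▸ mem_image_of_mem _ hw

theorem mem_iff (h : IsTrivialization D X F) (hl : l ∈ D) {w : ℂ}
    (hw : w ∈ closedBall (0 : ℂ) 1) : F l w ∈ X l ↔ w ∈ ball (0 : ℂ) 1 := by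
  refine ⟨fun hX => ?_, h.mem hl⟩
  rw [← h.3 l hl] at hX
  obtain ⟨v, hv, hvw⟩ := hX
  rwa [← h.2 l hl (ball_subset_closedBall hv) hw hvw]

theorem frontier_eq (h : IsTrivialization D X F) (hl : l ∈ D) :
    frontier (X l) = F l '' sphere 0 1 := by
  rw [(h.isOpen hl).frontier_eq, h.closure_eq hl]
  ext z
  constructor
  · rintro ⟨⟨w, hw, rfl⟩, hX⟩
    rw [h.mem_iff hl hw] at hX
    refine ⟨w, ?_, rfl⟩
    rw [← ball_union_sphere] at hw
    exact hw.resolve_left hX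
  · rintro ⟨w, hw, rfl⟩
    have hw' := sphere_subset_closedBall hw
    refine ⟨⟨w, hw', rfl⟩, ?_⟩
    rw [h.mem_iff hl hw', mem_ball, (mem_sphere.1 hw)]
    exact lt_irrefl _

theorem mem_frontier (h : IsTrivialization D X F) (hl : l ∈ D) {w : ℂ}
    (hw : w ∈ sphere (0 : ℂ) 1) : F l w ∈ frontier (X l) :=
  h.frontier_eq hl ▸ mem_image_of_mem _ hw

/-- By invariance of domain the inverse of `F l` takes the interior of the closed fiber to an open
subset of the closed unit disc, hence into the open disc. -/
theorem interior_closure (h : IsTrivialization D X F) (hl : l ∈ D) :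
    interior (closure (X l)) = X l := by
  refine (interior_maximal subset_closure (h.isOpen hl)).antisymm' fun z hz => ?_
  obtain ⟨σ, hσ, hσ'⟩ := (isCompact_closedBall (0 : ℂ) 1).exists_continuousOn_factor
    (h.continuousOn_fiber hl) (L := id) continuousOn_id (fun s hs t ht hst => h.2 l hl hs ht hst)
  rw [← h.closure_eq hl] at hσ
  have hmaps : ∀ v ∈ closure (X l), σ v ∈ closedBall (0 : ℂ) 1 ∧ F l (σ v) = v := by
    intro v hv
    rw [h.closure_eq hl] at hv
    obtain ⟨w, hw, rfl⟩ := hv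
    rw [hσ' w hw]
    exact ⟨hw, rfl⟩
  have hi : InjOn σ (interior (closure (X l))) := fun v hv w hw hvw => by
    rw [← (hmaps v (interior_subset hv)).2, ← (hmaps w (interior_subset hw)).2, hvw]
  have ho := hi.isOpen_image_complex isOpen_interior (hσ.mono interior_subset)
  have hsub : σ '' interior (closure (X l)) ⊆ ball 0 1 := by
    rw [← interior_closedBall (0 : ℂ) one_ne_zero]
    refine interior_maximal ?_ ho
    rintro _ ⟨v, hv, rfl⟩
    exact (hmaps v (interior_subset hv)).1
  rw [← (hmaps z (interior_subset hz)).2]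
  exact h.mem hl (hsub ⟨z, hz, rfl⟩)

theorem frontier_closure (h : IsTrivialization D X F) (hl : l ∈ D) :
    frontier (closure (X l)) = frontier (X l) := by
  rw [frontier, frontier, h.interior_closure hl, closure_closure, (h.isOpen hl).interior_eq]

/-- The inverse of a trivialization over an open or closed set is continuous. -/
theorem exists_inverse (h : IsTrivialization D X F)
    (hD : ∀ l ∈ D, ∃ C ⊆ D, IsCompact C ∧ C ∈ 𝓝[D] l) :
    ∃ W : ℂ × ℂ → ℂ, ContinuousOn W (tube D fun l => closure (X l)) ∧
      (∀ l ∈ D, ∀ w ∈ closedBall (0 : ℂ) 1, W (l, F l w) = w) ∧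
      ∀ l ∈ D, ∀ z ∈ closure (X l), W (l, z) ∈ closedBall (0 : ℂ) 1 ∧ F l (W (l, z)) = z := by
  classical
  have hex : ∀ p : ℂ × ℂ, p ∈ tube D (fun l => closure (X l)) →
      ∃ w ∈ closedBall (0 : ℂ) 1, F p.1 w = p.2 := by
    rintro p ⟨hp1, hp2⟩
    change p.2 ∈ closure (X p.1) at hp2
    rw [h.closure_eq hp1] at hp2
    exact hp2
  choose! W hW1 hW2 using hex
  have hWF : ∀ l ∈ D, ∀ w ∈ closedBall (0 : ℂ) 1, W (l, F l w) = w := by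
    intro l hl w hw
    have hm : (l, F l w) ∈ tube D (fun l => closure (X l)) :=
      ⟨hl, by simp only [h.closure_eq hl]; exact mem_image_of_mem _ hw⟩
    exact h.2 l hl (hW1 _ hm) hw (hW2 _ hm)
  refine ⟨W, ?_, hWF, fun l hl z hz => ⟨hW1 (l, z) ⟨hl, hz⟩, hW2 (l, z) ⟨hl, hz⟩⟩⟩
  rintro ⟨l₀, z₀⟩ hp
  obtain ⟨C, hCD, hC, hCn⟩ := hD l₀ hp.1
  obtain ⟨m, hm, hm'⟩ := (hC.prod (isCompact_closedBall (0 : ℂ) 1)).exists_continuousOn_factor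
    (c := fun p : ℂ × ℂ => (p.1, F p.1 p.2)) (L := fun p : ℂ × ℂ => p.2)
    (continuousOn_fst.prodMk (h.1.mono (prod_mono hCD Subset.rfl))) continuousOn_snd (by
      rintro ⟨l, w⟩ ⟨hl, hw⟩ ⟨l', w'⟩ ⟨hl', hw'⟩ hww
      simp only [Prod.mk.injEq] at hww hl hw hl' hw' ⊢
      obtain ⟨rfl, h2⟩ := hww
      exact h.2 l (hCD hl) hw hw' h2)
  set T := (fun p : ℂ × ℂ => (p.1, F p.1 p.2)) '' (C ×ˢ closedBall 0 1)
  have hT : T ∈ 𝓝[tube D fun l => closure (X l)] (l₀, z₀) := by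
    have h1 : Prod.fst ⁻¹' C ∈ 𝓝[tube D fun l => closure (X l)] (l₀, z₀) := by
      have : Tendsto Prod.fst (𝓝[tube D fun l => closure (X l)] (l₀, z₀)) (𝓝[D] l₀) :=
        tendsto_nhdsWithin_iff.2 ⟨continuous_fst.continuousAt.tendsto.mono_left nhdsWithin_le_nhds,
          by filter_upwards [self_mem_nhdsWithin] with p hp using hp.1⟩
      exact this hCn
    filter_upwards [h1, self_mem_nhdsWithin] with p hp1 hp2
    exact ⟨(p.1, W p), ⟨hp1, hW1 p hp2⟩, Prod.ext rfl (hW2 p hp2)⟩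
  have heq : ∀ p ∈ T, W p = m p := by
    rintro _ ⟨⟨l, w⟩, ⟨hl, hw⟩, rfl⟩
    rw [hm' (l, w) ⟨hl, hw⟩]
    exact hWF l (hCD hl) w hw
  have hT0 : (l₀, z₀) ∈ T := ⟨(l₀, W (l₀, z₀)), ⟨mem_of_mem_nhdsWithin hp.1 hCn, hW1 _ hp⟩,
    Prod.ext rfl (hW2 _ hp)⟩
  have := (hm (l₀, z₀) hT0).congr heq (heq _ hT0)
  exact (this.mono (s := T ∩ tube D fun l => closure (X l)) inter_subset_left).mono_of_mem_nhdsWithin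
    (inter_mem hT self_mem_nhdsWithin)

theorem _root_.IsOpen.exists_isCompact_nhdsWithin {D : Set ℂ} (hD : IsOpen D) :
    ∀ l ∈ D, ∃ C ⊆ D, IsCompact C ∧ C ∈ 𝓝[D] l := fun l hl => by
  obtain ⟨r, hr, hrD⟩ := nhds_basis_closedBall.mem_iff.1 (hD.mem_nhds hl)
  exact ⟨_, hrD, isCompact_closedBall l r, mem_nhdsWithin_of_mem_nhds (closedBall_mem_nhds l hr)⟩

/-- A point of the fiber is a stable value of `F l₀`: nearby maps `F l` take all nearby values on a
small disc. -/
theorem isOpen_tube (h : IsTrivialization D X F) (hD : IsOpen D) : IsOpen (tube D X) := by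
  rw [isOpen_iff_mem_nhds]
  rintro ⟨l₀, z₀⟩ ⟨hl₀, hz₀⟩
  simp only at hl₀ hz₀
  rw [← h.3 l₀ hl₀] at hz₀
  obtain ⟨w₀, hw₀, rfl⟩ := hz₀
  obtain ⟨r, hr, hrb⟩ := nhds_basis_closedBall.mem_iff.1 (isOpen_ball.mem_nhds hw₀)
  have hrc : closedBall w₀ r ⊆ closedBall 0 1 := hrb.trans ball_subset_closedBall
  obtain ⟨ε, hε, hst⟩ := Set.InjOn.exists_stable_value hr ((h.continuousOn_fiber hl₀).mono hrc)
    ((h.2 l₀ hl₀).mono hrc)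
  have hev : ∀ᶠ l in 𝓝[D] l₀, ∀ w ∈ sphere w₀ r, ‖F l w - F l₀ w‖ < ε := by
    refine (isCompact_sphere w₀ r).eventually_forall_of_filter
      (P := fun l w => ‖F l w - F l₀ w‖ < ε) fun w hw => ?_
    have hw' := hrc (sphere_subset_closedBall hw)
    have hmono : 𝓝[sphere w₀ r] w ≤ 𝓝[closedBall 0 1] w :=
      nhdsWithin_mono _ (sphere_subset_closedBall.trans hrc)
    have t1 : Tendsto (fun p : ℂ × ℂ => F p.1 p.2) (𝓝[D] l₀ ×ˢ 𝓝[sphere w₀ r] w) (𝓝 (F l₀ w)) := by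
      have := (h.1 (l₀, w) ⟨hl₀, hw'⟩).tendsto
      rw [nhdsWithin_prod_eq] at this
      exact this.mono_left (prod_mono le_rfl hmono)
    have t2 : Tendsto (fun p : ℂ × ℂ => F l₀ p.2) (𝓝[D] l₀ ×ˢ 𝓝[sphere w₀ r] w) (𝓝 (F l₀ w)) :=
      (((h.continuousOn_fiber hl₀) w hw').tendsto.mono_left hmono).comp tendsto_snd
    have := (t1.sub t2).norm
    rw [sub_self, norm_zero] at this
    exact this.eventually (gt_mem_nhds hε)
  rw [hD.nhdsWithin_eq hl₀] at hev
  rw [nhds_prod_eq]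
  filter_upwards [prod_mem_prod (inter_mem (hD.mem_nhds hl₀) hev)
    (ball_mem_nhds (F l₀ w₀) hε)] with p hp
  obtain ⟨⟨hp1, hp2⟩, hp3⟩ := hp
  rw [mem_ball, dist_eq] at hp3
  obtain ⟨w, hw, hw'⟩ := hst (F p.1) ((h.continuousOn_fiber hp1).mono hrc) hp2 p.2 hp3
  refine ⟨hp1, ?_⟩
  rw [← hw']
  exact h.mem hp1 (hrb (ball_subset_closedBall hw))

/-- Over a compact disc of parameters the closed tube is the image of a compact set, so limits stay
in the closed fibers. -/
theorem mem_closure_of_mem_closure_tube (h : IsTrivialization D X F) (hD : IsOpen D)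
    (hl : l ∈ D) {z : ℂ} (hz : (l, z) ∈ closure (tube D fun l => closure (X l))) :
    z ∈ closure (X l) := by
  obtain ⟨r, hr, hrD⟩ := nhds_basis_closedBall.mem_iff.1 (hD.mem_nhds hl)
  set T := (fun p : ℂ × ℂ => (p.1, F p.1 p.2)) '' (closedBall l r ×ˢ closedBall 0 1)
  have hT : IsClosed T := by
    refine (((isCompact_closedBall l r).prod (isCompact_closedBall 0 1)).image_of_continuousOn
      ?_).isClosed
    exact continuousOn_fst.prodMk (h.1.mono (prod_mono hrD Subset.rfl))
  have hzT : (l, z) ∈ T := by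
    rw [← hT.closure_eq]
    rw [mem_closure_iff_nhds] at hz ⊢
    intro N hN
    have hN' : N ∩ Prod.fst ⁻¹' closedBall l r ∈ 𝓝 (l, z) :=
      inter_mem hN (continuous_fst.continuousAt.preimage_mem_nhds (closedBall_mem_nhds l hr))
    obtain ⟨p, ⟨hpN, hp1⟩, hpD, hp2⟩ := hz _ hN'
    change p.2 ∈ closure (X p.1) at hp2
    rw [h.closure_eq hpD] at hp2
    obtain ⟨w, hw, hw'⟩ := hp2
    exact ⟨p, hpN, (p.1, w), ⟨hp1, hw⟩, Prod.ext rfl hw'⟩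
  obtain ⟨⟨l', w⟩, ⟨_, hw⟩, hlw⟩ := hzT
  simp only [Prod.mk.injEq] at hlw
  obtain ⟨rfl, rfl⟩ := hlw
  rw [h.closure_eq hl]
  exact mem_image_of_mem _ hw

theorem _root_.tube_closure_subset {D : Set ℂ} {X : ℂ → Set ℂ} :
    tube D (fun l => closure (X l)) ⊆ closure (tube D X) := by
  rintro ⟨l, z⟩ ⟨hl, hz⟩
  simp only at hl hz
  have : (fun z => (l, z)) '' closure (X l) ⊆ closure ((fun z => (l, z)) '' X l) :=
    image_closure_subset_closure_image (by fun_prop)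
  refine closure_mono ?_ (this ⟨z, hz, rfl⟩)
  rintro _ ⟨w, hw, rfl⟩
  exact ⟨hl, hw⟩

theorem exists_bound (h : IsTrivialization D X F) {C : Set ℂ} (hC : IsCompact C) (hCD : C ⊆ D) :
    ∃ M, ∀ l ∈ C, ∀ z ∈ closure (X l), ‖z‖ ≤ M := by
  obtain ⟨M, hM⟩ := ((hC.prod (isCompact_closedBall (0 : ℂ) 1)).image_of_continuousOn
    (h.1.mono (prod_mono hCD Subset.rfl))).isBounded.exists_norm_le
  refine ⟨M, fun l hl z hz => ?_⟩
  rw [h.closure_eq (hCD hl)] at hz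
  obtain ⟨w, hw, rfl⟩ := hz
  exact hM _ ⟨(l, w), ⟨hl, hw⟩, rfl⟩

theorem isPreconnected_tube (h : IsTrivialization D X F) (hD : IsPreconnected D) :
    IsPreconnected (tube D X) := by
  have : tube D X = (fun p : ℂ × ℂ => (p.1, F p.1 p.2)) '' (D ×ˢ ball 0 1) := by
    ext ⟨l, z⟩
    constructor
    · rintro ⟨hl, hz⟩
      simp only at hl hz
      rw [← h.3 l hl] at hz
      obtain ⟨w, hw, rfl⟩ := hz
      exact ⟨(l, w), ⟨hl, hw⟩, rfl⟩
    · rintro ⟨⟨l', w⟩, ⟨hl, hw⟩, hlw⟩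
      simp only [Prod.mk.injEq] at hlw
      obtain ⟨rfl, rfl⟩ := hlw
      exact ⟨hl, h.mem hl hw⟩
  rw [this]
  exact (hD.prod (convex_ball (0 : ℂ) 1).isPreconnected).image _
    (continuousOn_fst.prodMk (h.1.mono (prod_mono Subset.rfl ball_subset_closedBall)))

/-- The boundary of a fiber as a Jordan curve. -/
theorem isJordanParam (h : IsTrivialization D X F) (hl : l ∈ D) :
    IsJordanParam (fun t => F l (exp (2 * Real.pi * I * t))) (frontier (X l)) := by
  have hs : ∀ t : ℝ, exp (2 * Real.pi * I * t) ∈ sphere (0 : ℂ) 1 := fun t => by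
    rw [mem_sphere_zero_iff_norm, show (2 * Real.pi * I * t : ℂ) =
      ((2 * Real.pi * t : ℝ) : ℂ) * I by push_cast; ring, norm_exp_ofReal_mul_I]
  refine ⟨(h.continuousOn_fiber hl).comp (by fun_prop)
    (fun t _ => sphere_subset_closedBall (hs t)), fun t ht s hs' hts => ?_, by simp, ?_⟩
  · have := h.2 l hl (sphere_subset_closedBall (hs t)) (sphere_subset_closedBall (hs s)) hts
    obtain ⟨k, hk⟩ := _root_.exists_int_of_exp_eq this
    have h1 : (t : ℂ) - s = k := by
      have h2 := two_pi_I_ne_zero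
      apply mul_left_cancel₀ h2
      rw [← hk]
      ring
    have h2 : t - s = k := by exact_mod_cast h1
    have h3 : (-1 : ℝ) < k := by rw [← h2]; linarith [ht.1, hs'.2]
    have h4 : (k : ℝ) < 1 := by rw [← h2]; linarith [ht.2, hs'.1]
    have h5 : k = 0 := by
      have : (-1 : ℤ) < k := by exact_mod_cast h3
      have : k < (1 : ℤ) := by exact_mod_cast h4
      omega
    rw [h5] at h2
    simp only [Int.cast_zero] at h2
    linarith
  · rw [h.frontier_eq hl]
    ext z
    constructor
    · rintro ⟨t, _, rfl⟩
      exact ⟨_, hs t, rfl⟩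
    · rintro ⟨w, hw, rfl⟩
      have hw0 : w ≠ 0 := by
        rintro rfl
        simp at hw
      rw [mem_sphere_zero_iff_norm] at hw
      have hpi := Real.pi_pos
      have hexp : exp (arg w * I) = w := by
        have := norm_mul_exp_arg_mul_I w
        rwa [hw, ofReal_one, one_mul] at this
      have hπ : (Real.pi : ℂ) ≠ 0 := by exact_mod_cast hpi.ne'
      by_cases ha : 0 ≤ arg w
      · refine ⟨arg w / (2 * Real.pi), ⟨by positivity, ?_⟩, ?_⟩
        · rw [div_le_one (by positivity)]
          linarith [arg_le_pi w]
        · show F l _ = F l w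
          congr 1
          rw [← hexp]
          congr 1
          rw [hexp]
          push_cast
          field_simp
      · refine ⟨arg w / (2 * Real.pi) + 1, ⟨?_, ?_⟩, ?_⟩
        · have : -1 ≤ arg w / (2 * Real.pi) := by
            rw [le_div_iff₀ (by positivity)]
            linarith [neg_pi_lt_arg w]
          linarith
        · have : arg w / (2 * Real.pi) ≤ 0 :=
            div_nonpos_of_nonpos_of_nonneg (not_le.1 ha).le (by positivity)
          linarith
        · show F l _ = F l w
          congr 1
          have : (2 * Real.pi * I * ((arg w / (2 * Real.pi) + 1 : ℝ) : ℂ)) =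
              arg w * I + 2 * Real.pi * I := by
            push_cast
            field_simp
          rw [this, exp_add, hexp, exp_two_pi_mul_I, mul_one]

end IsTrivialization

/-! ### Fibered holomorphic maps -/

/-- The fibered map over the parameter line. -/
def fibered (g : ℂ → ℂ → ℂ) (p : ℂ × ℂ) : ℂ × ℂ := (p.1, g p.1 p.2)

theorem AnalyticAt.fiber {g : ℂ → ℂ → ℂ} {p : ℂ × ℂ}
    (hg : AnalyticAt ℂ (fun p : ℂ × ℂ => g p.1 p.2) p) : AnalyticAt ℂ (g p.1) p.2 :=
  hg.comp (f := fun z : ℂ => (p.1, z)) (x := p.2) (analyticAt_const.prod analyticAt_id)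

/-- A fibered map with nonzero fiber derivative has an invertible derivative. -/
theorem exists_equiv_hasStrictFDerivAt_fibered {g : ℂ → ℂ → ℂ} {p : ℂ × ℂ}
    (hg : AnalyticAt ℂ (fun p : ℂ × ℂ => g p.1 p.2) p) (hd : deriv (g p.1) p.2 ≠ 0) :
    ∃ e : (ℂ × ℂ) ≃L[ℂ] (ℂ × ℂ), HasStrictFDerivAt (fibered g) (e : ℂ × ℂ →L[ℂ] ℂ × ℂ) p := by
  have hs := hg.hasStrictFDerivAt
  set L := fderiv ℂ (fun p : ℂ × ℂ => g p.1 p.2) p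
  have hL : L (0, 1) = deriv (g p.1) p.2 := by
    have h1 : HasFDerivAt (fun z : ℂ => (p.1, z)) (ContinuousLinearMap.inr ℂ ℂ ℂ) p.2 :=
      hasFDerivAt_prodMk_right p.1 p.2
    have h2 := (HasFDerivAt.comp (x := p.2) (f := fun z : ℂ => (p.1, z))
      (g := fun p : ℂ × ℂ => g p.1 p.2) (g' := L) hs.hasFDerivAt h1).hasDerivAt
    have h3 : deriv (g p.1) p.2 = _ := h2.deriv
    rw [h3]
    simp
  set δ := deriv (g p.1) p.2
  have hLab : ∀ a b : ℂ, L (a, b) = L (a, 0) + b * δ := by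
    intro a b
    have : ((a, b) : ℂ × ℂ) = (a, 0) + b • (0, 1) := by simp
    rw [this, map_add, map_smul, hL, smul_eq_mul]
  set A : ℂ × ℂ →L[ℂ] ℂ × ℂ := (ContinuousLinearMap.fst ℂ ℂ ℂ).prod L
  set B : ℂ × ℂ →L[ℂ] ℂ × ℂ := (ContinuousLinearMap.fst ℂ ℂ ℂ).prod
    (δ⁻¹ • (ContinuousLinearMap.snd ℂ ℂ ℂ -
      L.comp ((ContinuousLinearMap.inl ℂ ℂ ℂ).comp (ContinuousLinearMap.fst ℂ ℂ ℂ))))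
  refine ⟨ContinuousLinearEquiv.equivOfInverse A B ?_ ?_, ?_⟩
  · rintro ⟨a, b⟩
    simp only [A, B, ContinuousLinearMap.prod_apply, ContinuousLinearMap.coe_fst',
      _root_.smul_apply, _root_.sub_apply, ContinuousLinearMap.coe_snd',
      ContinuousLinearMap.comp_apply, ContinuousLinearMap.inl_apply, Prod.mk.injEq, true_and,
      smul_eq_mul]
    rw [hLab a b]
    field_simp
    ring
  · rintro ⟨a, b⟩
    simp only [A, B, ContinuousLinearMap.prod_apply, ContinuousLinearMap.coe_fst',
      _root_.smul_apply, _root_.sub_apply, ContinuousLinearMap.coe_snd',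
      ContinuousLinearMap.comp_apply, ContinuousLinearMap.inl_apply, Prod.mk.injEq, true_and,
      smul_eq_mul]
    rw [hLab]
    field_simp
    ring
  · exact hasStrictFDerivAt_fst.prodMk hs

/-- The inverse function theorem for `(l, z) ↦ (l, g l z)`, whose derivative is triangular. -/
theorem map_nhds_fibered {g : ℂ → ℂ → ℂ} {p : ℂ × ℂ}
    (hg : AnalyticAt ℂ (fun p : ℂ × ℂ => g p.1 p.2) p) (hd : deriv (g p.1) p.2 ≠ 0) :
    map (fibered g) (𝓝 p) = 𝓝 (fibered g p) := by
  obtain ⟨e, he⟩ := exists_equiv_hasStrictFDerivAt_fibered hg hd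
  exact he.map_nhds_eq_of_equiv

/-- Continuous lifts of holomorphic functions through a fibered map are holomorphic. -/
theorem differentiableAt_of_fibered {E : Type*} [NormedAddCommGroup E] [NormedSpace ℂ E]
    {g : ℂ → ℂ → ℂ} {Λ κ q : E → ℂ} {x : E}
    (hg : AnalyticAt ℂ (fun p : ℂ × ℂ => g p.1 p.2) (Λ x, κ x)) (hd : deriv (g (Λ x)) (κ x) ≠ 0)
    (hΛ : DifferentiableAt ℂ Λ x) (hκ : ContinuousAt κ x) (hq : DifferentiableAt ℂ q x)
    (h : ∀ᶠ y in 𝓝 x, g (Λ y) (κ y) = q y) : DifferentiableAt ℂ κ x := by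
  obtain ⟨e, he⟩ := exists_equiv_hasStrictFDerivAt_fibered hg hd
  have h1 := HasFDerivAt.of_comp_of_leftInverse (g := fun y => (Λ y, κ y)) (f := fibered g)
    (h := fun y => (Λ y, q y)) (a := x) (f'symm := (e.symm : ℂ × ℂ →L[ℂ] ℂ × ℂ))
    (hΛ.continuousAt.prodMk hκ) he.hasFDerivAt
    (hΛ.hasFDerivAt.prodMk hq.hasFDerivAt) (by
      filter_upwards [h] with y hy
      simp [fibered, hy]) e.symm_apply_apply
  have h2 := h1.differentiableAt
  exact h2.snd

theorem differentiableOn_of_fibered {E : Type*} [NormedAddCommGroup E] [NormedSpace ℂ E]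
    {g : ℂ → ℂ → ℂ} {Λ κ q : E → ℂ} {O : Set E} (hO : IsOpen O)
    (hg : ∀ x ∈ O, AnalyticAt ℂ (fun p : ℂ × ℂ => g p.1 p.2) (Λ x, κ x))
    (hd : ∀ x ∈ O, deriv (g (Λ x)) (κ x) ≠ 0)
    (hΛ : DifferentiableOn ℂ Λ O) (hκ : ContinuousOn κ O) (hq : DifferentiableOn ℂ q O)
    (h : ∀ x ∈ O, g (Λ x) (κ x) = q x) : DifferentiableOn ℂ κ O := fun x hx =>
  (differentiableAt_of_fibered (hg x hx) (hd x hx) ((hΛ x hx).differentiableAt (hO.mem_nhds hx))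
    (hκ.continuousAt (hO.mem_nhds hx)) ((hq x hx).differentiableAt (hO.mem_nhds hx))
    (by filter_upwards [hO.mem_nhds hx] with y hy using h y hy)).differentiableWithinAt

theorem tube_fiber_isOpen {D : Set ℂ} {X : ℂ → Set ℂ} (h : IsOpen (tube D X)) {l : ℂ}
    (hl : l ∈ D) : IsOpen (X l) := by
  have : X l = (fun z => (l, z)) ⁻¹' tube D X := by
    ext z
    simp [tube, hl]
  rw [this]
  exact h.preimage (by fun_prop)

/-! ### Words, inverse branches and landing tubes -/

namespace FiberMap

variable {ι : Type*}

/-- The points whose orbit follows the word `t` and then lands in the range. -/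
def wordDomain (G : FiberMap ι) : List ι → ℂ → Set ℂ
  | [], l => G.U l
  | i :: t, l => {z | z ∈ G.V i l ∧ G.g i l z ∈ G.wordDomain t l}

/-- The inverse branch along the word `t`. -/
noncomputable def branch (G : FiberMap ι) (t : List ι) (l w : ℂ) : ℂ :=
  Function.invFunOn (G.iter t l) (G.wordDomain t l) w

namespace IsHolomorphicFamily

variable {G : FiberMap ι} {h : ℂ → ℂ → ℂ} {l : ℂ} {t : List ι}

theorem isOpen_D (H : G.IsHolomorphicFamily h) : IsOpen G.D := H.disc.1

theorem isPreconnected_D (H : G.IsHolomorphicFamily h) : IsPreconnected G.D :=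
  H.disc.2.1.isPathConnected.isConnected.isPreconnected

theorem exists_trivialization_U (H : G.IsHolomorphicFamily h) :
    ∃ F, IsTrivialization G.D G.U F := isBidisc_iff.1 H.bidisc_U

theorem exists_trivialization_V (H : G.IsHolomorphicFamily h) (i : ι) :
    ∃ F, IsTrivialization G.D (G.V i) F := isBidisc_iff.1 (H.bidisc_V i)

theorem isOpen_V (H : G.IsHolomorphicFamily h) (i : ι) (hl : l ∈ G.D) : IsOpen (G.V i l) := by
  obtain ⟨F, hF⟩ := H.exists_trivialization_V i
  exact hF.isOpen hl

theorem isOpen_U (H : G.IsHolomorphicFamily h) (hl : l ∈ G.D) : IsOpen (G.U l) := by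
  obtain ⟨F, hF⟩ := H.exists_trivialization_U
  exact hF.isOpen hl

theorem isOpen_tube_U (H : G.IsHolomorphicFamily h) : IsOpen (tube G.D G.U) := by
  obtain ⟨F, hF⟩ := H.exists_trivialization_U
  exact hF.isOpen_tube H.isOpen_D

theorem isOpen_tube_V (H : G.IsHolomorphicFamily h) (i : ι) : IsOpen (tube G.D (G.V i)) := by
  obtain ⟨F, hF⟩ := H.exists_trivialization_V i
  exact hF.isOpen_tube H.isOpen_D

theorem analyticAt_g (H : G.IsHolomorphicFamily h) {i : ι} (hl : l ∈ G.D) {z : ℂ}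
    (hz : z ∈ closure (G.V i l)) : AnalyticAt ℂ (fun p : ℂ × ℂ => G.g i p.1 p.2) (l, z) :=
  H.holo i (l, z) ⟨hl, hz⟩

theorem closure_V_subset (H : G.IsHolomorphicFamily h) (i : ι) (hl : l ∈ G.D) :
    closure (G.V i l) ⊆ G.U l := (H.fiber l hl).compactly_inside i

theorem V_subset (H : G.IsHolomorphicFamily h) (i : ι) (hl : l ∈ G.D) : G.V i l ⊆ G.U l :=
  subset_closure.trans (H.closure_V_subset i hl)

theorem zero_mem_V (H : G.IsHolomorphicFamily h) (hl : l ∈ G.D) : (0 : ℂ) ∈ G.V G.o l :=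
  ((H.fiber l hl).central.fiber_crit.ge rfl).1

theorem critVal_mem (H : G.IsHolomorphicFamily h) (hl : l ∈ G.D) : G.critVal l ∈ G.U l :=
  (H.fiber l hl).central.mapsTo (H.zero_mem_V hl)

theorem differentiableOn_critVal (H : G.IsHolomorphicFamily h) :
    DifferentiableOn ℂ G.critVal G.D := fun l hl => by
  have h1 := (H.analyticAt_g hl (subset_closure (H.zero_mem_V hl))).differentiableAt
  exact (DifferentiableAt.comp (f := fun l : ℂ => (l, (0 : ℂ))) l h1
    (by fun_prop)).differentiableWithinAt

/-- Every noncentral map is onto all of `U` and every word domain lies in `U`, so the univalent maps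
compose without loss. -/
theorem bijOn_iter (H : G.IsHolomorphicFamily h) (hl : l ∈ G.D) (ht : ∀ i ∈ t, i ≠ G.o) :
    BijOn (G.iter t l) (G.wordDomain t l) (G.U l) := by
  induction t with
  | nil => exact bijOn_id _
  | cons i t ih =>
    have ih' := ih (fun j hj => ht j (List.mem_cons_of_mem _ hj))
    have hb := (H.fiber l hl).univalent i (ht i List.mem_cons_self)
    have hW : G.wordDomain t l ⊆ G.U l := by
      cases t with
      | nil => exact Subset.rfl
      | cons j t => exact fun z hz => H.V_subset j hl hz.1
    refine ⟨fun z hz => ih'.1 hz.2, fun z hz w hw hzw => hb.injOn hz.1 hw.1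
      (ih'.injOn hz.2 hw.2 hzw), fun w hw => ?_⟩
    obtain ⟨v, hv, hvw⟩ := ih'.surjOn hw
    obtain ⟨z, hz, hzv⟩ := hb.surjOn (hW hv)
    exact ⟨z, ⟨hz, by simpa only [hzv] using hv⟩, by simpa only [iter, hzv] using hvw⟩

theorem wordDomain_subset (H : G.IsHolomorphicFamily h) (hl : l ∈ G.D) (t : List ι) :
    G.wordDomain t l ⊆ G.U l := by
  cases t with
  | nil => exact Subset.rfl
  | cons j t => exact fun z hz => H.V_subset j hl hz.1

/-- The word domain is the larger open set on which the iterate and its inverse branch continue past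
the boundary of the landing domain. -/
theorem landing_eq (H : G.IsHolomorphicFamily h) (hl : l ∈ G.D) (t : List ι) :
    G.landing t l = {z | z ∈ G.wordDomain t l ∧ G.iter t l z ∈ G.V G.o l} := by
  induction t with
  | nil =>
    ext z
    exact ⟨fun hz => ⟨H.V_subset _ hl hz, hz⟩, fun hz => hz.2⟩
  | cons i t ih =>
    ext z
    simp only [landing, wordDomain, iter, ih, mem_ofPred_eq, and_assoc]

theorem isOpen_tube_wordDomain (H : G.IsHolomorphicFamily h) (t : List ι) :
    IsOpen (tube G.D (G.wordDomain t)) := by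
  induction t with
  | nil => exact H.isOpen_tube_U
  | cons i t ih =>
    have hc : ContinuousOn (fibered (G.g i)) (tube G.D (G.V i)) := fun p hp =>
      (continuousAt_fst.prodMk (H.analyticAt_g (i := i) hp.1
        (subset_closure hp.2)).continuousAt).continuousWithinAt
    have := hc.isOpen_inter_preimage (H.isOpen_tube_V i) ih
    convert this using 1
    ext p
    simp only [tube, wordDomain, fibered, mem_ofPred_eq, mem_inter_iff, mem_preimage]
    tauto

theorem analyticAt_iter (H : G.IsHolomorphicFamily h) (hl : l ∈ G.D) {z : ℂ}
    (hz : z ∈ G.wordDomain t l) : AnalyticAt ℂ (fun p : ℂ × ℂ => G.iter t p.1 p.2) (l, z) := by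
  induction t generalizing z with
  | nil => exact analyticAt_snd
  | cons i t ih =>
    have h1 := H.analyticAt_g hl (subset_closure hz.1)
    exact (ih hz.2).comp₂ analyticAt_fst h1

theorem isOpen_wordDomain (H : G.IsHolomorphicFamily h) (hl : l ∈ G.D) (t : List ι) :
    IsOpen (G.wordDomain t l) := tube_fiber_isOpen (H.isOpen_tube_wordDomain t) hl

theorem deriv_iter_ne_zero (H : G.IsHolomorphicFamily h) (hl : l ∈ G.D)
    (ht : ∀ i ∈ t, i ≠ G.o) {z : ℂ} (hz : z ∈ G.wordDomain t l) : deriv (G.iter t l) z ≠ 0 :=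
  (H.bijOn_iter hl ht).injOn.deriv_ne_zero (H.isOpen_wordDomain hl t) hz
    (H.analyticAt_iter hl hz).fiber

theorem branch_mem (H : G.IsHolomorphicFamily h) (hl : l ∈ G.D) (ht : ∀ i ∈ t, i ≠ G.o) {w : ℂ}
    (hw : w ∈ G.U l) : G.branch t l w ∈ G.wordDomain t l :=
  Function.invFunOn_mem ((H.bijOn_iter hl ht).surjOn hw)

theorem iter_branch (H : G.IsHolomorphicFamily h) (hl : l ∈ G.D) (ht : ∀ i ∈ t, i ≠ G.o) {w : ℂ}
    (hw : w ∈ G.U l) : G.iter t l (G.branch t l w) = w :=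
  Function.invFunOn_eq ((H.bijOn_iter hl ht).surjOn hw)

theorem branch_iter (H : G.IsHolomorphicFamily h) (hl : l ∈ G.D) (ht : ∀ i ∈ t, i ≠ G.o) {z : ℂ}
    (hz : z ∈ G.wordDomain t l) : G.branch t l (G.iter t l z) = z :=
  (H.bijOn_iter hl ht).injOn (H.branch_mem hl ht ((H.bijOn_iter hl ht).mapsTo hz)) hz
    (H.iter_branch hl ht ((H.bijOn_iter hl ht).mapsTo hz))

/-- The fibered iterate is a local homeomorphism, and `branch` is its local inverse. -/
theorem continuousOn_branch (H : G.IsHolomorphicFamily h) (ht : ∀ i ∈ t, i ≠ G.o) :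
    ContinuousOn (fun p : ℂ × ℂ => G.branch t p.1 p.2) (tube G.D G.U) := by
  rintro ⟨l, w⟩ ⟨hl, hw⟩
  simp only at hl hw
  have hz := H.branch_mem hl ht hw
  have hm := map_nhds_fibered (g := G.iter t) (H.analyticAt_iter hl hz)
    (H.deriv_iter_ne_zero hl ht hz)
  have hfib : fibered (G.iter t) (l, G.branch t l w) = (l, w) := by
    simp [fibered, H.iter_branch hl ht hw]
  rw [hfib] at hm
  refine ContinuousAt.continuousWithinAt ?_
  show Tendsto (fun p : ℂ × ℂ => G.branch t p.1 p.2) (𝓝 (l, w)) (𝓝 (G.branch t l w))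
  rw [← hm, tendsto_map'_iff]
  have h1 : (fun p : ℂ × ℂ => p.2) =ᶠ[𝓝 (l, G.branch t l w)]
      (fun p : ℂ × ℂ => G.branch t p.1 p.2) ∘ fibered (G.iter t) := by
    filter_upwards [(H.isOpen_tube_wordDomain t).mem_nhds
      (show (l, G.branch t l w) ∈ tube G.D (G.wordDomain t) from ⟨hl, hz⟩)] with p hp
    exact (H.branch_iter hp.1 ht hp.2).symm
  exact (continuousAt_snd (p := (l, G.branch t l w))).tendsto.congr' h1

theorem differentiableOn_branch (H : G.IsHolomorphicFamily h) (ht : ∀ i ∈ t, i ≠ G.o) :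
    DifferentiableOn ℂ (fun p : ℂ × ℂ => G.branch t p.1 p.2) (tube G.D G.U) :=
  differentiableOn_of_fibered (g := G.iter t) (Λ := fun p : ℂ × ℂ => p.1) (q := fun p => p.2)
    H.isOpen_tube_U (fun _ hp => H.analyticAt_iter hp.1 (H.branch_mem hp.1 ht hp.2))
    (fun _ hp => H.deriv_iter_ne_zero hp.1 ht (H.branch_mem hp.1 ht hp.2))
    differentiableOn_fst (H.continuousOn_branch ht) differentiableOn_snd
    (fun _ hp => H.iter_branch hp.1 ht hp.2)

/-- A trivialization of the central tube lifts to the landing tubes. -/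
theorem trivialization_landing (H : G.IsHolomorphicFamily h) (ht : ∀ i ∈ t, i ≠ G.o)
    {F : ℂ → ℂ → ℂ} (hF : IsTrivialization G.D (G.V G.o) F) :
    IsTrivialization G.D (G.landing t) (fun l w => G.branch t l (F l w)) := by
  have hFU : ∀ l ∈ G.D, ∀ w ∈ closedBall (0 : ℂ) 1, F l w ∈ G.U l := fun l hl w hw =>
    H.closure_V_subset _ hl (by rw [hF.closure_eq hl]; exact mem_image_of_mem _ hw)
  refine ⟨(H.continuousOn_branch ht).comp (f := fun p : ℂ × ℂ => (p.1, F p.1 p.2))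
    (continuousOn_fst.prodMk hF.1) (fun p hp => ⟨hp.1, hFU _ hp.1 _ hp.2⟩),
    fun l hl w hw v hv hwv => ?_, fun l hl => ?_⟩
  · have := congrArg (G.iter t l) hwv
    simp only [H.iter_branch hl ht (hFU l hl w hw), H.iter_branch hl ht (hFU l hl v hv)] at this
    exact hF.2 l hl hw hv this
  · rw [H.landing_eq hl]
    ext z
    constructor
    · rintro ⟨w, hw, rfl⟩
      have hU := hFU l hl w (ball_subset_closedBall hw)
      exact ⟨H.branch_mem hl ht hU, by rw [H.iter_branch hl ht hU]; exact hF.mem hl hw⟩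
    · rintro ⟨hz1, hz2⟩
      rw [← hF.3 l hl] at hz2
      obtain ⟨w, hw, hwz⟩ := hz2
      exact ⟨w, hw, by simp only [hwz, H.branch_iter hl ht hz1]⟩

theorem closure_landing (H : G.IsHolomorphicFamily h) (ht : ∀ i ∈ t, i ≠ G.o) (hl : l ∈ G.D) :
    closure (G.landing t l) = {z | z ∈ G.wordDomain t l ∧ G.iter t l z ∈ closure (G.V G.o l)} := by
  obtain ⟨F, hF⟩ := H.exists_trivialization_V G.o
  rw [(H.trivialization_landing ht hF).closure_eq hl]
  have hFc := hF.closure_eq hl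
  ext z
  constructor
  · rintro ⟨w, hw, rfl⟩
    have hc : F l w ∈ closure (G.V G.o l) := by rw [hFc]; exact mem_image_of_mem _ hw
    have hU := H.closure_V_subset _ hl hc
    exact ⟨H.branch_mem hl ht hU, by rwa [H.iter_branch hl ht hU]⟩
  · rintro ⟨hz1, hz2⟩
    rw [hFc] at hz2
    obtain ⟨w, hw, hwz⟩ := hz2
    exact ⟨w, hw, by simp only [hwz, H.branch_iter hl ht hz1]⟩

theorem frontier_landing (H : G.IsHolomorphicFamily h) (ht : ∀ i ∈ t, i ≠ G.o) (hl : l ∈ G.D) :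
    frontier (G.landing t l) =
      {z | z ∈ G.wordDomain t l ∧ G.iter t l z ∈ frontier (G.V G.o l)} := by
  obtain ⟨F, hF⟩ := H.exists_trivialization_V G.o
  rw [((H.trivialization_landing ht hF).isOpen hl).frontier_eq, H.closure_landing ht hl,
    (H.isOpen_V _ hl).frontier_eq, H.landing_eq hl]
  ext z
  simp only [Set.mem_sdiff, mem_ofPred_eq]
  tauto

theorem isOpen_landing (H : G.IsHolomorphicFamily h) (ht : ∀ i ∈ t, i ≠ G.o) (hl : l ∈ G.D) :
    IsOpen (G.landing t l) := by
  obtain ⟨F, hF⟩ := H.exists_trivialization_V G.o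
  exact (H.trivialization_landing ht hF).isOpen hl

theorem closure_landing_subset_wordDomain (H : G.IsHolomorphicFamily h) (ht : ∀ i ∈ t, i ≠ G.o)
    (hl : l ∈ G.D) : closure (G.landing t l) ⊆ G.wordDomain t l := by
  rw [H.closure_landing ht hl]
  exact fun z hz => hz.1

theorem closure_landing_subset (H : G.IsHolomorphicFamily h) (ht : ∀ i ∈ t, i ≠ G.o)
    (hl : l ∈ G.D) : closure (G.landing t l) ⊆ G.U l :=
  (H.closure_landing_subset_wordDomain ht hl).trans (H.wordDomain_subset hl t)

/-- The closures of the landing domains are pairwise disjoint. -/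
theorem disjoint_closure_landing (H : G.IsHolomorphicFamily h) (hl : l ∈ G.D) {t t' : List ι}
    (ht : ∀ i ∈ t, i ≠ G.o) (ht' : ∀ i ∈ t', i ≠ G.o) (hne : t ≠ t') :
    Disjoint (closure (G.landing t l)) (closure (G.landing t' l)) := by
  have hnil : ∀ (i : ι) (s : List ι), (∀ j ∈ i :: s, j ≠ G.o) →
      Disjoint (closure (G.landing [] l)) (closure (G.landing (i :: s) l)) := by
    intro i s hs
    have h1 : Disjoint (G.V G.o l) (G.V i l) :=
      (H.fiber l hl).disjoint _ _ (hs i List.mem_cons_self).symm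
    -- The closures of two discs `V` may touch. But the closure of the central disc misses the open
    -- disc `V i`, and the closed landing domain of a nonempty word stays inside its first disc.
    exact (h1.closure_left (H.isOpen_V i hl)).mono_right
      (fun z hz => (H.closure_landing_subset_wordDomain hs hl hz).1)
  induction t generalizing t' with
  | nil =>
    cases t' with
    | nil => exact absurd rfl hne
    | cons i s => exact hnil i s ht'
  | cons i t ih =>
    cases t' with
    | nil => exact (hnil i t ht).symm
    | cons j s =>
      rw [Set.disjoint_left]
      intro z hz hz'
      have ht₁ : ∀ k ∈ t, k ≠ G.o := fun k hk => ht k (List.mem_cons_of_mem _ hk)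
      have hs₁ : ∀ k ∈ s, k ≠ G.o := fun k hk => ht' k (List.mem_cons_of_mem _ hk)
      rw [H.closure_landing ht hl] at hz
      rw [H.closure_landing ht' hl] at hz'
      by_cases hij : i = j
      · subst hij
        have hts : t ≠ s := fun h => hne (by rw [h])
        have h1 : G.g i l z ∈ closure (G.landing t l) := by
          rw [H.closure_landing ht₁ hl]
          exact ⟨hz.1.2, hz.2⟩
        have h2 : G.g i l z ∈ closure (G.landing s l) := by
          rw [H.closure_landing hs₁ hl]
          exact ⟨hz'.1.2, hz'.2⟩
        exact Set.disjoint_left.1 (ih ht₁ hs₁ hts) h1 h2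
      · exact Set.disjoint_left.1 ((H.fiber l hl).disjoint i j hij) hz.1.1 hz'.1.1

theorem exists_landing_subset (t : List ι) :
    ∃ i, ∀ l, G.landing t l ⊆ G.V i l := by
  cases t with
  | nil => exact ⟨G.o, fun l => Subset.rfl⟩
  | cons i t => exact ⟨i, fun l z hz => hz.1⟩

end IsHolomorphicFamily

end FiberMap

/-! ### Recentering and logarithms on tubes -/

theorem normSq_one_add_sub_normSq_add (b z : ℂ) :
    normSq (1 + (starRingEnd ℂ) b * z) - normSq (z + b) = (1 - normSq b) * (1 - normSq z) := by
  simp only [normSq_apply, add_re, add_im, mul_re, mul_im, one_re, one_im, conj_re, conj_im]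
  ring

theorem one_add_conj_mul_ne_zero {b z : ℂ} (hb : ‖b‖ < 1) (hz : ‖z‖ ≤ 1) :
    1 + (starRingEnd ℂ) b * z ≠ 0 := by
  intro h
  have h1 : ‖(starRingEnd ℂ) b * z‖ = 1 := by
    rw [eq_neg_of_add_eq_zero_right h, norm_neg, norm_one]
  rw [norm_mul, RCLike.norm_conj] at h1
  nlinarith [norm_nonneg b, norm_nonneg z]

theorem norm_moebius_le {b z : ℂ} (hb : ‖b‖ < 1) (hz : ‖z‖ ≤ 1) :
    ‖(z + b) / (1 + (starRingEnd ℂ) b * z)‖ ≤ 1 := by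
  have h0 := one_add_conj_mul_ne_zero hb hz
  rw [norm_div, div_le_one (norm_pos_iff.2 h0), ← sq_le_sq₀ (norm_nonneg _) (norm_nonneg _),
    ← normSq_eq_norm_sq, ← normSq_eq_norm_sq]
  have h1 := normSq_one_add_sub_normSq_add b z
  rw [normSq_eq_norm_sq b, normSq_eq_norm_sq z] at h1
  have h2 : 0 ≤ (1 - ‖b‖ ^ 2) * (1 - ‖z‖ ^ 2) :=
    mul_nonneg (by nlinarith [norm_nonneg b]) (by nlinarith [norm_nonneg z])
  linarith

theorem norm_moebius_lt {b z : ℂ} (hb : ‖b‖ < 1) (hz : ‖z‖ < 1) :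
    ‖(z + b) / (1 + (starRingEnd ℂ) b * z)‖ < 1 := by
  have h0 := one_add_conj_mul_ne_zero hb hz.le
  rw [norm_div, div_lt_one (norm_pos_iff.2 h0), ← sq_lt_sq₀ (norm_nonneg _) (norm_nonneg _),
    ← normSq_eq_norm_sq, ← normSq_eq_norm_sq]
  have h1 := normSq_one_add_sub_normSq_add b z
  rw [normSq_eq_norm_sq b, normSq_eq_norm_sq z] at h1
  have h2 : 0 < (1 - ‖b‖ ^ 2) * (1 - ‖z‖ ^ 2) :=
    mul_pos (by nlinarith [norm_nonneg b]) (by nlinarith [norm_nonneg z])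
  linarith

theorem moebius_moebius {b z : ℂ} (hb : ‖b‖ < 1) (hz : ‖z‖ ≤ 1) :
    ((z + b) / (1 + (starRingEnd ℂ) b * z) + -b) /
      (1 + (starRingEnd ℂ) (-b) * ((z + b) / (1 + (starRingEnd ℂ) b * z))) = z := by
  have h0 := one_add_conj_mul_ne_zero hb hz
  have h1 := one_add_conj_mul_ne_zero (b := -b) (by rwa [norm_neg]) (norm_moebius_le hb hz)
  rw [div_eq_iff h1, map_neg]
  set m := (z + b) / (1 + (starRingEnd ℂ) b * z) with hm
  have := (eq_div_iff h0).1 hm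
  linear_combination this

/-- A trivialization can be chosen with a given section as the center. -/
theorem IsTrivialization.exists_recenter {D : Set ℂ} {X : ℂ → Set ℂ} {F : ℂ → ℂ → ℂ}
    (h : IsTrivialization D X F) (hD : IsOpen D) {σ : ℂ → ℂ} (hσ : ContinuousOn σ D)
    (hσX : ∀ l ∈ D, σ l ∈ X l) :
    ∃ F', IsTrivialization D X F' ∧ ∀ l ∈ D, F' l 0 = σ l := by
  obtain ⟨W, hW, hWF, hFW⟩ := h.exists_inverse hD.exists_isCompact_nhdsWithin
  set b : ℂ → ℂ := fun l => W (l, σ l)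
  have hbc : ContinuousOn b D := hW.comp (continuousOn_id.prodMk hσ)
    (fun l hl => ⟨hl, subset_closure (hσX l hl)⟩)
  have hFb : ∀ l ∈ D, F l (b l) = σ l := fun l hl => (hFW l hl _ (subset_closure (hσX l hl))).2
  have hb : ∀ l ∈ D, ‖b l‖ < 1 := fun l hl => by
    rw [← mem_ball_zero_iff, ← h.mem_iff hl (hFW l hl _ (subset_closure (hσX l hl))).1, hFb l hl]
    exact hσX l hl
  -- A disc automorphism that depends continuously on `l` takes `0` to the coordinate `b l` of the
  -- section.
  refine ⟨fun l z => F l ((z + b l) / (1 + (starRingEnd ℂ) (b l) * z)), ⟨?_, ?_, ?_⟩, ?_⟩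
  · have hb' : ContinuousOn (fun p : ℂ × ℂ => b p.1) (D ×ˢ closedBall 0 1) :=
      hbc.comp continuousOn_fst (fun p hp => hp.1)
    refine h.1.comp (f := fun p : ℂ × ℂ => (p.1, (p.2 + b p.1) / (1 + (starRingEnd ℂ) (b p.1) * p.2)))
      (continuousOn_fst.prodMk (ContinuousOn.div (continuousOn_snd.add hb')
        (continuousOn_const.add ((continuous_conj.comp_continuousOn hb').mul continuousOn_snd))
        fun p hp => one_add_conj_mul_ne_zero (hb _ hp.1) (mem_closedBall_zero_iff.1 hp.2)))
      fun p hp => ⟨hp.1, mem_closedBall_zero_iff.2 (norm_moebius_le (hb _ hp.1)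
        (mem_closedBall_zero_iff.1 hp.2))⟩
  · intro l hl z hz w hw hzw
    rw [mem_closedBall_zero_iff] at hz hw
    have := h.2 l hl (mem_closedBall_zero_iff.2 (norm_moebius_le (hb l hl) hz))
      (mem_closedBall_zero_iff.2 (norm_moebius_le (hb l hl) hw)) hzw
    rw [← moebius_moebius (hb l hl) hz, ← moebius_moebius (hb l hl) hw, this]
  · intro l hl
    rw [← h.3 l hl]
    ext z
    constructor
    · rintro ⟨w, hw, rfl⟩
      exact ⟨_, mem_ball_zero_iff.2 (norm_moebius_lt (hb l hl) (mem_ball_zero_iff.1 hw)), rfl⟩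
    · rintro ⟨w, hw, rfl⟩
      rw [mem_ball_zero_iff] at hw
      have hb' : ‖-b l‖ < 1 := by rw [norm_neg]; exact hb l hl
      refine ⟨_, mem_ball_zero_iff.2 (norm_moebius_lt hb' hw), ?_⟩
      have := moebius_moebius hb' hw.le
      rw [neg_neg] at this
      simp only [this]
  · intro l hl
    simp [hFb l hl]

/-- Scaling contracts the star-shaped factor to `0`; over the remaining slice the simple
connectivity of `D` gives the logarithm. -/
theorem exists_log_prod {D S : Set ℂ} (hD : IsOpen D) (hDs : IsSimplyConnected D)
    (hS : StarConvex ℝ 0 S) (h0S : (0 : ℂ) ∈ S) {f : ℂ × ℂ → ℂ} (hf : ContinuousOn f (D ×ˢ S))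
    (h0 : ∀ p ∈ D ×ˢ S, f p ≠ 0) :
    ∃ L : ℂ × ℂ → ℂ, ContinuousOn L (D ×ˢ S) ∧ ∀ p ∈ D ×ˢ S, exp (L p) = f p := by
  have hmem : ∀ t ∈ Icc (0 : ℝ) 1, ∀ z ∈ S, (t : ℂ) * z ∈ S := fun t ht z hz => by
    have := hS hz (sub_nonneg.2 ht.2) ht.1 (by ring)
    simpa using this
  obtain ⟨M, hM, hM'⟩ := exists_log_homotopy (S := D ×ˢ S)
    (H := fun t p => f (p.1, (t : ℂ) * p.2))
    (hf.comp (f := fun p : ℝ × (ℂ × ℂ) => (p.2.1, (p.1 : ℂ) * p.2.2)) (by fun_prop)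
      (fun p hp => ⟨hp.2.1, hmem _ hp.1 _ hp.2.2⟩))
    (fun t ht p hp => h0 _ ⟨hp.1, hmem t ht _ hp.2⟩)
  obtain ⟨L, hL, hL'⟩ := exists_log_of_isSimplyConnected hDs hD (g := fun l => f (l, 0))
    (hf.comp (by fun_prop) (fun l hl => ⟨hl, h0S⟩)) (fun l hl => h0 _ ⟨hl, h0S⟩)
  refine ⟨fun p => L p.1 + M p, (hL.comp continuousOn_fst fun p hp => hp.1).add hM, fun p hp => ?_⟩
  have := hM' p hp
  simp only [ofReal_one, one_mul, ofReal_zero, zero_mul] at this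
  rw [exp_add, hL' _ hp.1, ← this]

theorem IsTrivialization.exists_log {D : Set ℂ} {X : ℂ → Set ℂ} {F : ℂ → ℂ → ℂ}
    (h : IsTrivialization D X F) (hD : IsOpen D) (hDs : IsSimplyConnected D) {f : ℂ × ℂ → ℂ}
    (hf : ContinuousOn f (tube D X)) (h0 : ∀ p ∈ tube D X, f p ≠ 0) :
    ∃ L : ℂ × ℂ → ℂ, ContinuousOn L (tube D X) ∧ ∀ p ∈ tube D X, exp (L p) = f p := by
  obtain ⟨W, hW, hWF, hFW⟩ := h.exists_inverse hD.exists_isCompact_nhdsWithin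
  obtain ⟨L, hL, hL'⟩ := exists_log_prod hD hDs
    ((convex_ball (0 : ℂ) 1).starConvex (mem_ball_self one_pos)) (mem_ball_self one_pos)
    (f := fun p => f (p.1, F p.1 p.2))
    (hf.comp (continuousOn_fst.prodMk (h.1.mono (prod_mono Subset.rfl ball_subset_closedBall)))
      (fun p hp => ⟨hp.1, h.mem hp.1 hp.2⟩)) (fun p hp => h0 _ ⟨hp.1, h.mem hp.1 hp.2⟩)
  have hWb : ∀ p ∈ tube D X, (p.1, W p) ∈ D ×ˢ ball (0 : ℂ) 1 := fun p hp => by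
    refine ⟨hp.1, ?_⟩
    have h1 := hFW _ hp.1 _ (subset_closure hp.2)
    rw [← h.mem_iff hp.1 h1.1, h1.2]
    exact hp.2
  refine ⟨fun p => L (p.1, W p), hL.comp (continuousOn_fst.prodMk
    (hW.mono fun p hp => ⟨hp.1, subset_closure hp.2⟩)) hWb, fun p hp => ?_⟩
  rw [hL' _ (hWb p hp), (hFW _ hp.1 _ (subset_closure hp.2)).2]

/-- A fiber of a tube with a point removed is connected. -/
theorem IsTrivialization.isPreconnected_diff_singleton {D : Set ℂ} {X : ℂ → Set ℂ}
    {F : ℂ → ℂ → ℂ} (h : IsTrivialization D X F) {l : ℂ} (hl : l ∈ D) :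
    IsPreconnected (X l \ {F l 0}) := by
  have h0 : (0 : ℂ) ∈ closedBall (0 : ℂ) 1 := mem_closedBall_self zero_le_one
  have hexp : ∀ u : ℂ, u.re < 0 → exp u ∈ ball (0 : ℂ) 1 := fun u hu => by
    rw [mem_ball_zero_iff, norm_exp, Real.exp_lt_one_iff]
    exact hu
  have : X l \ {F l 0} = (fun u => F l (exp u)) '' {u | u.re < 0} := by
    ext z
    constructor
    · rintro ⟨hz, hz0⟩
      rw [← h.3 l hl] at hz
      obtain ⟨w, hw, rfl⟩ := hz
      have hw0 : w ≠ 0 := fun h0 => hz0 (by rw [h0]; rfl)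
      refine ⟨Complex.log w, ?_, by simp only [exp_log hw0]⟩
      show (Complex.log w).re < 0
      rw [log_re]
      exact Real.log_neg (norm_pos_iff.2 hw0) (mem_ball_zero_iff.1 hw)
    · rintro ⟨u, hu, rfl⟩
      exact ⟨h.mem hl (hexp u hu), fun h1 => exp_ne_zero u
        (h.2 l hl (ball_subset_closedBall (hexp u hu)) h0 h1)⟩
  rw [this]
  exact (convex_halfSpace_re_lt 0).isPreconnected.image _ ((h.continuousOn_fiber hl).comp
    (by fun_prop) fun u hu => ball_subset_closedBall (hexp u hu))

/-! ### Square root coordinates on the central tube -/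

theorem isOpenMap_add_sq (a : ℂ) : IsOpenMap fun w : ℂ => a + w ^ 2 := by
  refine ((AnalyticOnNhd.is_constant_or_isOpenMap (g := fun w : ℂ => a + w ^ 2)
    (fun w _ => by fun_prop)).resolve_left ?_)
  rintro ⟨b, hb⟩
  have h0 := hb 0
  have h1 := hb 1
  rw [← h0] at h1
  norm_num at h1

namespace IsDoubleBranchedCover

variable {f : ℂ → ℂ} {V U : Set ℂ}

theorem zero_mem (hf : IsDoubleBranchedCover f V U) : (0 : ℂ) ∈ V := (hf.fiber_crit.ge rfl).1

theorem eq_zero (hf : IsDoubleBranchedCover f V U) {z : ℂ} (hz : z ∈ V) (h : f z = f 0) : z = 0 :=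
  hf.fiber_crit.le ⟨hz, h⟩

theorem not_eventually_eq (hf : IsDoubleBranchedCover f V U) (hV : IsOpen V) {z₀ : ℂ}
    (hz₀ : z₀ ∈ V) : ¬ ∀ᶠ z in 𝓝 z₀, f z = f z₀ := by
  intro h
  have hfin : (V ∩ f ⁻¹' {f z₀}).Finite := by
    by_cases h0 : f z₀ = f 0
    · rw [h0, hf.fiber_crit]
      exact finite_singleton 0
    · exact finite_of_ncard_ne_zero (by rw [hf.fiber _ (hf.mapsTo hz₀) h0]; norm_num)
  exact infinite_of_mem_nhds z₀ (inter_mem (hV.mem_nhds hz₀) h) hfin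

theorem eq_or_eq_of_mem (hf : IsDoubleBranchedCover f V U) {a b c : ℂ} (ha : a ∈ V) (hb : b ∈ V)
    (hc : c ∈ V) (hab : f a = f b) (hac : f a = f c) : a = b ∨ a = c ∨ b = c := by
  by_contra! h
  by_cases h0 : f a = f 0
  · exact h.1 ((hf.eq_zero ha h0).trans (hf.eq_zero hb (hab.symm.trans h0)).symm)
  · have h2 := hf.fiber _ (hf.mapsTo ha) h0
    have hfin : (V ∩ f ⁻¹' {f a}).Finite := finite_of_ncard_ne_zero (by rw [h2]; norm_num)
    have := (two_lt_ncard_iff hfin).2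
      ⟨a, b, c, ⟨ha, rfl⟩, ⟨hb, hab.symm⟩, ⟨hc, hac.symm⟩, h.1, h.2.1, h.2.2⟩
    omega

/-- The critical point has local degree two. -/
theorem exists_local_sqrt (hf : IsDoubleBranchedCover f V U) (hV : IsOpen V)
    (ha : AnalyticAt ℂ f 0) :
    ∃ h : ℂ → ℂ, AnalyticAt ℂ h 0 ∧ h 0 ≠ 0 ∧ ∀ᶠ z in 𝓝 0, f z = f 0 + (z * h z) ^ 2 := by
  obtain ⟨n, h, hn, hn2, hh, hh0, hfh⟩ := ha.exists_pow_eq (hf.not_eventually_eq hV hf.zero_mem)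
  have h2 := hn2 hf.crit
  rcases h2.eq_or_lt with rfl | h3
  · exact ⟨h, hh, hh0, by simpa using hfh⟩
  · exfalso
    obtain ⟨w, x, hxi, hx⟩ := (eventually_exists_preimages hh hh0 hn
      (inter_mem (hV.mem_nhds hf.zero_mem) hfh)).exists
    have hv : ∀ k < n, x k ∈ V ∧ f (x k) = f 0 + w := fun k hk =>
      ⟨(hx k hk).1.1, by rw [(hx k hk).1.2, (hx k hk).2]⟩
    have e0 := hv 0 hn
    have e1 := hv 1 (by omega)
    have e2 := hv 2 h3
    rcases hf.eq_or_eq_of_mem e0.1 e1.1 e2.1 (e0.2.trans e1.2.symm) (e0.2.trans e2.2.symm)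
      with h | h | h
    · exact absurd (hxi hn (show 1 < n by omega) h) (by norm_num)
    · exact absurd (hxi hn h3 h) (by norm_num)
    · exact absurd (hxi (show 1 < n by omega) h3 h) (by norm_num)

/-- Near `z` the values of `f` stay in a compact disc in `U`. Its preimage in `V` is compact, so it
contains the limit point `z`. -/
theorem mem_of_mem_closure (hf : IsDoubleBranchedCover f V U) (hU : IsOpen U) {z : ℂ}
    (hz : z ∈ closure V) (hc : ContinuousAt f z) (hzU : f z ∈ U) : z ∈ V := by
  obtain ⟨r, hr, hrU⟩ := nhds_basis_closedBall.mem_iff.1 (hU.mem_nhds hzU)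
  have hT := (hf.isProper _ hrU (isCompact_closedBall _ _)).isClosed
  have : z ∈ closure (V ∩ f ⁻¹' closedBall (f z) r) := by
    rw [mem_closure_iff_nhds] at hz ⊢
    intro N hN
    obtain ⟨v, ⟨hvN, hvr⟩, hvV⟩ := hz _ (inter_mem hN (hc (closedBall_mem_nhds _ hr)))
    exact ⟨v, hvN, hvV, hvr⟩
  rw [hT.closure_eq] at this
  exact this.1

/-- A holomorphic square root of a double branched cover is a bijection. -/
theorem bijOn_sqrt (hf : IsDoubleBranchedCover f V U) (hV : IsOpen V) (hU : IsOpen U)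
    (hUc : IsPreconnected (U \ {f 0})) {η : ℂ → ℂ} (hη : DifferentiableOn ℂ η V)
    (hηf : ∀ z ∈ V, f z = f 0 + η z ^ 2) :
    BijOn η V {w | f 0 + w ^ 2 ∈ U} := by
  have han : ∀ z ∈ V, AnalyticAt ℂ η z := fun z hz => hη.analyticAt (hV.mem_nhds hz)
  have hη0 : η 0 = 0 := by
    have := hηf 0 hf.zero_mem
    simpa using this
  have hopen : IsOpen (η '' V) := by
    rw [isOpen_iff_mem_nhds]
    rintro _ ⟨z, hz, rfl⟩
    have := (han z hz).eventually_constant_or_nhds_le_map_nhds.resolve_left (fun h =>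
      hf.not_eventually_eq hV hz (by
        filter_upwards [h, hV.mem_nhds hz] with v hv hvV
        rw [hηf v hvV, hv, hηf z hz]))
    exact this (image_mem_map (hV.mem_nhds hz))
  -- The roots that are not attained also form an open set: by properness the attained roots over a
  -- small closed disc are a compact set.
  have hcl : IsOpen {w | f 0 + w ^ 2 ∈ U ∧ w ∉ η '' V} := by
    rw [isOpen_iff_mem_nhds]
    rintro w ⟨hwU, hw⟩
    obtain ⟨r, hr, hrU⟩ := nhds_basis_closedBall.mem_iff.1 (hU.mem_nhds hwU)
    have hT : IsClosed (η '' (V ∩ f ⁻¹' closedBall (f 0 + w ^ 2) r)) :=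
      ((hf.isProper _ hrU (isCompact_closedBall _ _)).image_of_continuousOn
        (hη.continuousOn.mono inter_subset_left)).isClosed
    have hwT : w ∉ η '' (V ∩ f ⁻¹' closedBall (f 0 + w ^ 2) r) :=
      fun h => hw (image_mono inter_subset_left h)
    have hc : ContinuousAt (fun w : ℂ => f 0 + w ^ 2) w := by fun_prop
    filter_upwards [hT.isOpen_compl.mem_nhds hwT, hc (closedBall_mem_nhds _ hr)] with v hv hvr
    refine ⟨hrU hvr, ?_⟩
    rintro ⟨z, hz, rfl⟩
    exact hv ⟨z, ⟨hz, by rw [mem_preimage, hηf z hz]; exact hvr⟩, rfl⟩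
  -- These are the attained roots whose negatives are attained too. If some nonzero root were
  -- outside `A`, the connected set `U \ {f 0}` would split into two open pieces.
  set A := η '' V ∩ (fun w => -w) ⁻¹' (η '' V)
  have hA : IsOpen A := hopen.inter (hopen.preimage continuous_neg)
  have h0A : (0 : ℂ) ∈ A := by
    have : (0 : ℂ) ∈ η '' V := ⟨0, hf.zero_mem, hη0⟩
    exact ⟨this, by simpa using this⟩
  have hsub : U \ {f 0} ⊆ (fun w => f 0 + w ^ 2) '' A := by
    refine hUc.subset_left_of_subset_union (isOpenMap_add_sq _ _ hA)
      (isOpenMap_add_sq (f 0) _ hcl) ?_ ?_ ?_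
    · rw [Set.disjoint_left]
      rintro _ ⟨a, ha, rfl⟩ ⟨b, hb, hab⟩
      rcases sq_eq_sq_iff_eq_or_eq_neg.1 (add_left_cancel hab) with rfl | rfl
      · exact hb.2 ha.1
      · exact hb.2 ha.2
    · rintro u ⟨hu, -⟩
      obtain ⟨w, hw⟩ := IsAlgClosed.exists_pow_nat_eq (u - f 0) (n := 2) (by norm_num)
      have hwu : f 0 + w ^ 2 = u := by rw [hw]; ring
      by_cases h1 : w ∈ η '' V
      · by_cases h2 : -w ∈ η '' V
        · exact Or.inl ⟨w, ⟨h1, h2⟩, hwu⟩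
        · exact Or.inr ⟨-w, ⟨by rw [neg_sq, hwu]; exact hu, h2⟩, by
            simp only [neg_sq]; exact hwu⟩
      · exact Or.inr ⟨w, ⟨by rw [hwu]; exact hu, h1⟩, hwu⟩
    · have hne : ∃ w ∈ A ∩ {w | f 0 + w ^ 2 ∈ U}, w ≠ 0 := by
        have hc : ContinuousAt (fun w : ℂ => f 0 + w ^ 2) 0 := by fun_prop
        have hN : A ∩ {w | f 0 + w ^ 2 ∈ U} ∈ 𝓝[≠] (0 : ℂ) := nhdsWithin_le_nhds
          (inter_mem (hA.mem_nhds h0A) (hc (hU.mem_nhds (by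
            simpa using hf.mapsTo hf.zero_mem))))
        obtain ⟨w, hw, hw0⟩ := (inter_mem hN self_mem_nhdsWithin : _ ∈ 𝓝[≠] (0 : ℂ)) |>
          (NormedField.nhdsNE_neBot (0 : ℂ)).nonempty_of_mem
        exact ⟨w, hw, hw0⟩
      obtain ⟨w, ⟨hwA, hwU⟩, hw0⟩ := hne
      exact ⟨f 0 + w ^ 2, ⟨hwU, by simpa using hw0⟩, w, hwA, rfl⟩
  have hboth : ∀ w, f 0 + w ^ 2 ∈ U → w ≠ 0 → w ∈ A := by
    intro w hw hw0
    obtain ⟨a, ha, haw⟩ := hsub ⟨hw, by simpa using hw0⟩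
    rcases sq_eq_sq_iff_eq_or_eq_neg.1 (add_left_cancel haw) with rfl | rfl
    · exact ha
    · exact ⟨by simpa using ha.2, by simpa using ha.1⟩
  refine ⟨fun z hz => ?_, fun z hz z' hz' hzz => ?_, fun w hw => ?_⟩
  · show f 0 + η z ^ 2 ∈ U
    rw [← hηf z hz]
    exact hf.mapsTo hz
  · by_cases h0 : η z = 0
    · rw [hf.eq_zero hz (by rw [hηf z hz, h0]; ring),
        hf.eq_zero hz' (by rw [hηf z' hz', ← hzz, h0]; ring)]
    · obtain ⟨v, hv, hvz⟩ := (hboth (η z) (by rw [← hηf z hz]; exact hf.mapsTo hz) h0).2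
      have e1 : f z = f z' := by rw [hηf z hz, hηf z' hz', hzz]
      have e2 : f z = f v := by rw [hηf z hz, hηf v hv, hvz, neg_sq]
      have hzv : ∀ u, η u = η z → u ≠ v := by
        rintro u hu rfl
        rw [hvz] at hu
        apply h0
        linear_combination (-1 / 2 : ℂ) * hu
      rcases hf.eq_or_eq_of_mem hz hz' hv e1 e2 with h | h | h
      · exact h
      · exact absurd h (hzv z rfl)
      · exact absurd h (hzv z' hzz.symm)
  · by_cases h0 : w = 0
    · exact ⟨0, hf.zero_mem, by rw [hη0, h0]⟩
    · exact (hboth w hw h0).1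

end IsDoubleBranchedCover

namespace FiberMap

variable {ι : Type*}

/-- The fibers of the range in the square root coordinate centered at the critical value. -/
def sqrtFiber (G : FiberMap ι) (l : ℂ) : Set ℂ := {w | G.critVal l + w ^ 2 ∈ G.U l}

namespace IsHolomorphicFamily

variable {G : FiberMap ι} {h : ℂ → ℂ → ℂ} {l : ℂ} {t : List ι}

theorem central (H : G.IsHolomorphicFamily h) (hl : l ∈ G.D) :
    IsDoubleBranchedCover (G.g G.o l) (G.V G.o l) (G.U l) := (H.fiber l hl).central

theorem differentiableOn_central (H : G.IsHolomorphicFamily h) (hl : l ∈ G.D) :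
    DifferentiableOn ℂ (G.g G.o l) (G.V G.o l) := fun _ hz =>
  (H.analyticAt_g hl (subset_closure hz)).fiber.differentiableAt.differentiableWithinAt

theorem isPreconnected_diff_critVal (H : G.IsHolomorphicFamily h) (hl : l ∈ G.D) :
    IsPreconnected (G.U l \ {G.critVal l}) := by
  obtain ⟨F, hF⟩ := H.exists_trivialization_U
  obtain ⟨F', hF', hF0⟩ := hF.exists_recenter H.isOpen_D H.differentiableOn_critVal.continuousOn
    (fun l hl => H.critVal_mem hl)
  rw [← hF0 l hl]
  exact hF'.isPreconnected_diff_singleton hl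

/-- The order-two zero at the critical point is divided out by two divided differences. Near `z = 0`
joint continuity is that of divided differences at the constant zero, with `l` as the parameter; at
`z = 0` the quotient is nonzero because the local degree is exactly two. -/
theorem exists_quotient (H : G.IsHolomorphicFamily h) :
    ∃ q : ℂ × ℂ → ℂ, ContinuousOn q (tube G.D (G.V G.o)) ∧ (∀ p ∈ tube G.D (G.V G.o), q p ≠ 0) ∧
      ∀ l ∈ G.D, DifferentiableOn ℂ (fun z => q (l, z)) (G.V G.o l) ∧
        ∀ z, G.g G.o l z = G.critVal l + z ^ 2 * q (l, z) := by
  set f : ℂ → ℂ → ℂ := fun z l => G.g G.o l z - G.critVal l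
  set f₁ : ℂ → ℂ → ℂ := fun z l => dslope (fun z => f z l) 0 z
  set q : ℂ × ℂ → ℂ := fun p => dslope (fun z => f₁ z p.1) 0 p.2
  have hdf : ∀ l ∈ G.D, DifferentiableOn ℂ (fun z => f z l) (G.V G.o l) := fun l hl =>
    (H.differentiableOn_central hl).sub_const _
  have hnhd : ∀ l ∈ G.D, G.V G.o l ∈ 𝓝 (0 : ℂ) := fun l hl =>
    (H.isOpen_V _ hl).mem_nhds (H.zero_mem_V hl)
  have hdf₁ : ∀ l ∈ G.D, DifferentiableOn ℂ (fun z => f₁ z l) (G.V G.o l) := fun l hl =>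
    (differentiableOn_dslope (hnhd l hl)).2 (hdf l hl)
  have hdq : ∀ l ∈ G.D, DifferentiableOn ℂ (fun z => q (l, z)) (G.V G.o l) := fun l hl =>
    (differentiableOn_dslope (hnhd l hl)).2 (hdf₁ l hl)
  have hf₁0 : ∀ l ∈ G.D, f₁ 0 l = 0 := fun l hl => by
    simp only [f₁, f, dslope_same, deriv_sub_const]
    exact (H.central hl).crit
  have heq : ∀ l ∈ G.D, ∀ z, G.g G.o l z = G.critVal l + z ^ 2 * q (l, z) := fun l hl z => by
    have h1 := sub_smul_dslope (fun z => f z l) 0 z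
    have h2 := sub_smul_dslope (fun z => f₁ z l) 0 z
    simp only [smul_eq_mul, sub_zero] at h1 h2
    have h3 : f 0 l = 0 := by simp [f, critVal]
    have h4 := hf₁0 l hl
    change z * f₁ z l = f z l - f 0 l at h1
    change z * q (l, z) = f₁ z l - f₁ 0 l at h2
    rw [h3] at h1
    rw [h4] at h2
    simp only [f] at h1
    linear_combination -h1 - z * h2
  refine ⟨q, ?_, ?_, fun l hl => ⟨hdq l hl, heq l hl⟩⟩
  · rintro ⟨l₀, z₀⟩ ⟨hl₀, hz₀⟩
    refine ContinuousAt.continuousWithinAt ?_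
    simp only at hl₀ hz₀
    by_cases h0 : z₀ = 0
    · subst h0
      obtain ⟨A, hA, B, hB, hAB⟩ := mem_nhds_prod_iff.1
        ((H.isOpen_tube_V G.o).mem_nhds (show (l₀, (0 : ℂ)) ∈ tube G.D (G.V G.o) from ⟨hl₀, hz₀⟩))
      obtain ⟨r, hr, hrB⟩ := Metric.mem_nhds_iff.1 hB
      have hAD : ∀ l ∈ A, l ∈ G.D := fun l hl => (hAB (mk_mem_prod hl (mem_of_mem_nhds hB))).1
      have hV : ∀ l ∈ A, ball 0 r ⊆ G.V G.o l := fun l hl z hz => (hAB (mk_mem_prod hl (hrB hz))).2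
      have h0r : (0 : ℂ) ∈ ball (0 : ℂ) r := mem_ball_self hr
      have hfc : ContinuousOn (fun p : ℂ × ℂ => f p.1 p.2) (ball 0 r ×ˢ A) := by
        rintro ⟨z, l⟩ ⟨hz, hl⟩
        simp only at hz hl
        have h1 := (H.analyticAt_g (hAD l hl) (subset_closure (hV l hl hz))).continuousAt
        have h2 := (H.differentiableOn_critVal.continuousOn).continuousAt
          (H.isOpen_D.mem_nhds (hAD l hl))
        refine ContinuousAt.continuousWithinAt (ContinuousAt.sub ?_ ?_)
        · exact ContinuousAt.comp (f := fun p : ℂ × ℂ => (p.2, p.1)) (x := (z, l)) h1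
            (by fun_prop)
        · exact ContinuousAt.comp (f := fun p : ℂ × ℂ => p.2) (x := (z, l)) h2 (by fun_prop)
      have hc₁ : ContinuousOn (fun p : ℂ × ℂ => f₁ p.1 p.2) (ball 0 r ×ˢ A) :=
        continuousOn_dslope_of_zero isOpen_ball hfc
          (fun l hl => (hdf l (hAD l hl)).mono (hV l hl)) (χ := fun _ => 0) continuousOn_const
          (fun _ _ => h0r) (fun l _ => by simp [f, critVal])
      have hc₂ := continuousOn_dslope_of_zero isOpen_ball hc₁
          (fun l hl => (hdf₁ l (hAD l hl)).mono (hV l hl)) (χ := fun _ => 0) continuousOn_const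
          (fun _ _ => h0r) (fun l hl => hf₁0 l (hAD l hl))
      have hc₃ := hc₂.continuousAt (x := ((0 : ℂ), l₀)) (prod_mem_nhds (ball_mem_nhds _ hr) hA)
      exact ContinuousAt.comp (f := fun p : ℂ × ℂ => (p.2, p.1)) (x := (l₀, 0)) hc₃ (by fun_prop)
    · have hev : q =ᶠ[𝓝 (l₀, z₀)] fun p => (G.g G.o p.1 p.2 - G.critVal p.1) / p.2 ^ 2 := by
        filter_upwards [(H.isOpen_D.preimage continuous_fst).mem_nhds hl₀,
          continuousAt_snd.eventually_ne h0] with p hp hp0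
        have := heq p.1 hp p.2
        rw [eq_div_iff (pow_ne_zero 2 hp0)]
        rw [Prod.mk.eta] at this
        linear_combination -this
      refine ContinuousAt.congr ?_ hev.symm
      have h1 := (H.analyticAt_g hl₀ (subset_closure hz₀)).continuousAt
      have h2 := (H.differentiableOn_critVal.continuousOn).continuousAt (H.isOpen_D.mem_nhds hl₀)
      have h3 : ContinuousAt (fun p : ℂ × ℂ => G.critVal p.1) (l₀, z₀) :=
        ContinuousAt.comp (f := fun p : ℂ × ℂ => p.1) (x := (l₀, z₀)) h2 (by fun_prop)
      exact (h1.sub h3).div (by fun_prop) (pow_ne_zero 2 h0)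
  · rintro ⟨l, z⟩ ⟨hl, hz⟩
    simp only at hl hz
    by_cases h0 : z = 0
    · subst h0
      obtain ⟨k, hk, hk0, hev⟩ := (H.central hl).exists_local_sqrt (H.isOpen_V _ hl)
        (H.analyticAt_g hl (subset_closure hz)).fiber
      have h1 : Tendsto (fun z => q (l, z)) (𝓝[≠] 0) (𝓝 (q (l, 0))) :=
        ((hdq l hl).continuousOn.continuousAt (hnhd l hl)).tendsto.mono_left nhdsWithin_le_nhds
      have h2 : Tendsto (fun z => k z ^ 2) (𝓝[≠] 0) (𝓝 (k 0 ^ 2)) :=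
        (hk.continuousAt.pow 2).tendsto.mono_left nhdsWithin_le_nhds
      have h3 : q (l, 0) = k 0 ^ 2 := by
        refine tendsto_nhds_unique (h1.congr' ?_) h2
        filter_upwards [nhdsWithin_le_nhds hev, self_mem_nhdsWithin] with z hz hz0
        have := heq l hl z
        refine mul_left_cancel₀ (pow_ne_zero 2 hz0) ?_
        have e : G.g G.o l 0 = G.critVal l := rfl
        rw [e] at hz
        linear_combination hz - this
      rw [h3]
      exact pow_ne_zero 2 hk0
    · intro hq
      refine h0 ((H.central hl).eq_zero hz ?_)
      rw [heq l hl z, hq]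
      simp [critVal]

/-- A global square root coordinate on the central tube. -/
theorem exists_sqrt (H : G.IsHolomorphicFamily h) :
    ∃ η : ℂ × ℂ → ℂ, ContinuousOn η (tube G.D (G.V G.o)) ∧
      ∀ l ∈ G.D, DifferentiableOn ℂ (fun z => η (l, z)) (G.V G.o l) ∧ η (l, 0) = 0 ∧
        (∀ z ∈ G.V G.o l, G.g G.o l z = G.critVal l + η (l, z) ^ 2) ∧
        BijOn (fun z => η (l, z)) (G.V G.o l) (G.sqrtFiber l) := by
  obtain ⟨q, hq, hq0, hqd⟩ := H.exists_quotient
  obtain ⟨F, hF⟩ := H.exists_trivialization_V G.o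
  -- The coordinate `z * exp (M / 2)` is a square root of `z ^ 2 * q`, defined on the whole tube
  -- because the tube is simply connected.
  obtain ⟨M, hM, hM'⟩ := hF.exists_log H.isOpen_D H.disc.2.1 hq hq0
  have hMd : ∀ l ∈ G.D, DifferentiableOn ℂ (fun z => M (l, z)) (G.V G.o l) := fun l hl =>
    differentiableOn_of_exp_eq (H.isOpen_V _ hl) (hqd l hl).1
      (hM.comp (by fun_prop) fun z hz => ⟨hl, hz⟩) (fun z hz => hM' (l, z) ⟨hl, hz⟩)
  have hηd : ∀ l ∈ G.D, DifferentiableOn ℂ (fun z => z * exp (M (l, z) / 2)) (G.V G.o l) :=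
    fun l hl => differentiableOn_id.mul ((hMd l hl).div_const 2).cexp
  have hηf : ∀ l ∈ G.D, ∀ z ∈ G.V G.o l,
      G.g G.o l z = G.critVal l + (z * exp (M (l, z) / 2)) ^ 2 := fun l hl z hz => by
    rw [(hqd l hl).2 z, mul_pow, ← exp_nat_mul, Nat.cast_ofNat, mul_div_cancel₀ _ two_ne_zero,
      hM' (l, z) ⟨hl, hz⟩]
  refine ⟨fun p => p.2 * exp (M p / 2), by fun_prop, fun l hl => ⟨hηd l hl, by simp, hηf l hl, ?_⟩⟩
  exact (H.central hl).bijOn_sqrt (H.isOpen_V _ hl) (H.isOpen_U hl)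
    (H.isPreconnected_diff_critVal hl) (hηd l hl) (hηf l hl)

/-- In `g = critVal + η ^ 2` the coordinate `η` is univalent and vanishes only at `0`. -/
theorem deriv_central_ne_zero (H : G.IsHolomorphicFamily h) (hl : l ∈ G.D) {z : ℂ}
    (hz : z ∈ G.V G.o l) (h0 : z ≠ 0) : deriv (G.g G.o l) z ≠ 0 := by
  obtain ⟨η, -, hη⟩ := H.exists_sqrt
  obtain ⟨hd, hη0, hηf, hb⟩ := hη l hl
  have hn := (H.isOpen_V G.o hl).mem_nhds hz
  have h1 := hb.injOn.deriv_ne_zero (H.isOpen_V _ hl) hz (hd.analyticAt hn)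
  have h2 : HasDerivAt (fun z => G.critVal l + η (l, z) ^ 2)
      (2 * η (l, z) * deriv (fun z => η (l, z)) z) z := by
    have := ((hd.differentiableAt hn).hasDerivAt.pow 2).const_add (G.critVal l)
    exact this.congr_deriv (by simp)
  have h3 : G.g G.o l =ᶠ[𝓝 z] fun z => G.critVal l + η (l, z) ^ 2 := by
    filter_upwards [hn] with v hv using hηf v hv
  rw [h3.deriv_eq, h2.deriv]
  refine mul_ne_zero (mul_ne_zero two_ne_zero fun h => h0 ?_) h1
  exact hb.injOn hz (H.zero_mem_V hl) (h.trans hη0.symm)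

theorem mem_V_of_mem_closure (H : G.IsHolomorphicFamily h) (hl : l ∈ G.D) {z : ℂ}
    (hz : z ∈ closure (G.V G.o l)) (hzU : G.g G.o l z ∈ G.U l) : z ∈ G.V G.o l :=
  (H.central hl).mem_of_mem_closure (H.isOpen_U hl) hz (H.analyticAt_g hl hz).fiber.continuousAt hzU

/-- The inverse of the square root coordinate. -/
theorem exists_sqrt_inverse (H : G.IsHolomorphicFamily h) :
    ∃ κ : ℂ × ℂ → ℂ, ContinuousOn κ (tube G.D G.sqrtFiber) ∧
      ∀ l ∈ G.D, κ (l, 0) = 0 ∧ BijOn (fun w => κ (l, w)) (G.sqrtFiber l) (G.V G.o l) ∧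
        ∀ w ∈ G.sqrtFiber l, G.g G.o l (κ (l, w)) = G.critVal l + w ^ 2 := by
  obtain ⟨η, hηc, hη⟩ := H.exists_sqrt
  obtain ⟨F, hF⟩ := H.exists_trivialization_V G.o
  have hex : ∀ p : ℂ × ℂ, p ∈ tube G.D G.sqrtFiber → ∃ z ∈ G.V G.o p.1, η (p.1, z) = p.2 :=
    fun p hp => (hη p.1 hp.1).2.2.2.surjOn hp.2
  choose! κ hκV hκη using hex
  have hinv : ∀ l ∈ G.D, ∀ z ∈ G.V G.o l, κ (l, η (l, z)) = z := fun l hl z hz => by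
    have hm : (l, η (l, z)) ∈ tube G.D G.sqrtFiber := ⟨hl, (hη l hl).2.2.2.mapsTo hz⟩
    exact (hη l hl).2.2.2.injOn (hκV _ hm) hz (hκη _ hm)
  have hgκ : ∀ l ∈ G.D, ∀ w ∈ G.sqrtFiber l, G.g G.o l (κ (l, w)) = G.critVal l + w ^ 2 :=
    fun l hl w hw => by
      rw [(hη l hl).2.2.1 _ (hκV (l, w) ⟨hl, hw⟩)]
      exact congrArg (fun v => G.critVal l + v ^ 2) (hκη (l, w) ⟨hl, hw⟩)
  refine ⟨κ, ?_, fun l hl => ⟨?_, ⟨fun w hw => hκV (l, w) ⟨hl, hw⟩, fun w hw v hv hwv => ?_,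
    fun z hz => ⟨η (l, z), (hη l hl).2.2.2.mapsTo hz, hinv l hl z hz⟩⟩, hgκ l hl⟩⟩
  · rintro ⟨l₀, w₀⟩ hp₀
    have hl₀ : l₀ ∈ G.D := hp₀.1
    -- The values of `κ` are locally bounded, so they converge along an ultrafilter to a point `z`
    -- of the closed disc. Its image lies in `U`, so properness puts `z` in the open disc, where `η`
    -- identifies it.
    rw [ContinuousWithinAt, tendsto_iff_ultrafilter]
    intro u hu
    have hu1 : Tendsto (fun p : ℂ × ℂ => p.1) u (𝓝 l₀) :=
      (continuous_fst.tendsto' _ _ rfl).mono_left (hu.trans nhdsWithin_le_nhds)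
    have hu2 : Tendsto (fun p : ℂ × ℂ => p.2) u (𝓝 w₀) :=
      (continuous_snd.tendsto' _ _ rfl).mono_left (hu.trans nhdsWithin_le_nhds)
    have huT : ∀ᶠ p in (u : Filter (ℂ × ℂ)), p ∈ tube G.D G.sqrtFiber := hu self_mem_nhdsWithin
    obtain ⟨r, hr, hrD⟩ := nhds_basis_closedBall.mem_iff.1 (H.isOpen_D.mem_nhds hl₀)
    obtain ⟨M, hM⟩ := hF.exists_bound (isCompact_closedBall l₀ r) hrD
    have hb : ∀ᶠ p in (u : Filter (ℂ × ℂ)), κ p ∈ closedBall (0 : ℂ) M := by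
      filter_upwards [huT, hu1 (closedBall_mem_nhds l₀ hr)] with p hp hpr
      exact mem_closedBall_zero_iff.2 (hM _ hpr _ (subset_closure (hκV p hp)))
    obtain ⟨z, -, hz⟩ := isCompact_iff_ultrafilter_le_nhds'.1 (isCompact_closedBall 0 M) (u.map κ) hb
    have hz' : Tendsto κ u (𝓝 z) := hz
    have hpz : Tendsto (fun p => (p.1, κ p)) u (𝓝 (l₀, z)) := hu1.prodMk_nhds hz'
    have hzcl : z ∈ closure (G.V G.o l₀) := by
      refine hF.mem_closure_of_mem_closure_tube H.isOpen_D hl₀ (mem_closure_of_tendsto hpz ?_)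
      filter_upwards [huT] with p hp
      exact ⟨hp.1, subset_closure (hκV p hp)⟩
    have hg : G.g G.o l₀ z = G.critVal l₀ + w₀ ^ 2 := by
      have h1 : Tendsto (fun p : ℂ × ℂ => G.g G.o p.1 (κ p)) u (𝓝 (G.g G.o l₀ z)) :=
        (H.analyticAt_g hl₀ hzcl).continuousAt.tendsto.comp hpz
      have h2 : Tendsto (fun p : ℂ × ℂ => G.critVal p.1 + p.2 ^ 2) u (𝓝 (G.critVal l₀ + w₀ ^ 2)) :=
        (((H.differentiableOn_critVal.continuousOn).continuousAt
          (H.isOpen_D.mem_nhds hl₀)).tendsto.comp hu1).add (hu2.pow 2)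
      refine tendsto_nhds_unique h1 (h2.congr' ?_)
      filter_upwards [huT] with p hp
      exact (hgκ p.1 hp.1 p.2 hp.2).symm
    have hzV : z ∈ G.V G.o l₀ := H.mem_V_of_mem_closure hl₀ hzcl (by rw [hg]; exact hp₀.2)
    have h3 : Tendsto (fun p : ℂ × ℂ => η (p.1, κ p)) u (𝓝 (η (l₀, z))) :=
      (hηc.continuousAt ((H.isOpen_tube_V G.o).mem_nhds ⟨hl₀, hzV⟩)).tendsto.comp hpz
    have h4 : η (l₀, z) = w₀ := by
      refine tendsto_nhds_unique h3 (hu2.congr' ?_)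
      filter_upwards [huT] with p hp
      exact (hκη p hp).symm
    have h5 : κ (l₀, w₀) = z := by rw [← h4]; exact hinv l₀ hl₀ z hzV
    rw [h5]
    exact hz
  · have := hinv l hl 0 (H.zero_mem_V hl)
    rwa [(hη l hl).2.1] at this
  · have h1 := hκη (l, w) ⟨hl, hw⟩
    have h2 := hκη (l, v) ⟨hl, hv⟩
    simp only at h1 h2 hwv
    rw [← h1, ← h2, hwv]

end IsHolomorphicFamily

end FiberMap

/-! ### Degree of the critical value relative to a section -/

theorem hasWinding_circle {a : ℂ} {ρ : ℝ} (ha : ‖a‖ < ρ) :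
    HasWinding (fun t : ℝ => ρ * exp (2 * Real.pi * I * t) - a) 1 := by
  have hρ : 0 < ρ := (norm_nonneg a).trans_lt ha
  have hρc : (ρ : ℂ) ≠ 0 := by exact_mod_cast hρ.ne'
  have h1 : HasWinding (fun t : ℝ => ρ * exp (2 * Real.pi * I * t)) 1 :=
    ⟨fun t => Complex.log ρ + 2 * Real.pi * I * t, by fun_prop,
      fun t _ => by rw [exp_add, exp_log hρc], by push_cast; ring⟩
  refine h1.of_norm_sub_lt (by fun_prop) (by simp) fun t _ => ?_
  have h2 : ‖exp (2 * Real.pi * I * t)‖ = 1 := by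
    rw [show (2 * Real.pi * I * t : ℂ) = ((2 * Real.pi * t : ℝ) : ℂ) * I by push_cast; ring,
      norm_exp_ofReal_mul_I]
  rw [norm_mul, h2, norm_real, Real.norm_of_nonneg hρ.le, mul_one]
  simpa using ha

/-- A product of linear factors that differs from one linear factor by an exponential, off a
compact set, is a linear factor. -/
theorem sum_eq_one_of_exists_log {D K : Set ℂ} (hD : IsOpen D) (hK : IsCompact K) (hKD : K ⊆ D)
    {Z : Finset ℂ} (hZ : ↑Z ⊆ K) {n : ℂ → ℕ} {b : ℂ} (hb : b ∈ K) {L : ℂ → ℂ}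
    (hL : ContinuousOn L (D \ K))
    (h : ∀ l ∈ D \ K, ∏ a ∈ Z, (l - a) ^ n a = (l - b) * exp (L l)) : ∑ a ∈ Z, n a = 1 := by
  classical
  obtain ⟨δ, hδ, hδD⟩ := hK.exists_cthickening_subset_open hD hKD
  set A := cthickening δ K
  have hKA : K ⊆ interior A := (self_subset_thickening hδ K).trans
    (interior_maximal (thickening_subset_cthickening δ K) isOpen_thickening)
  have hAc : IsClosed A := isClosed_cthickening
  have hfr : frontier A ⊆ D \ K := fun z hz => ⟨hδD (hAc.frontier_subset hz),
    fun hzK => hz.2 (hKA hzK)⟩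
  have hout : ∀ z ∈ closure Aᶜ, z ∉ K := fun z hz hzK => by
    rw [closure_compl] at hz
    exact hz (hKA hzK)
  obtain ⟨M, hM, hML⟩ := isClosed_frontier.exists_continuous_eqOn (hL.mono hfr)
  set R : ℂ → ℂ := fun l => (∏ a ∈ Z, (l - a) ^ n a) * (l - b)⁻¹
  have hsub : ∀ z, z ∉ K → z - b ≠ 0 := fun z hz h0 => hz (by rwa [sub_eq_zero.1 h0])
  -- All zeros and the pole of `R` lie in `K`, inside `A`; there `R` is replaced by an exponential,
  -- so the glued function has a logarithm on the plane.
  have hE : Continuous (A.piecewise (fun z => exp (M z)) R) := by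
    refine ContinuousOn.piecewise_of_frontier (by fun_prop) ?_ fun z hz => ?_
    · exact ContinuousOn.mul (by fun_prop)
        (ContinuousOn.inv₀ (by fun_prop) fun z hz => hsub z (hout z hz))
    · simp only [R]
      rw [hML hz, h z (hfr hz)]
      have := hsub z (hfr hz).2
      field_simp
  have hE0 : ∀ z, A.piecewise (fun z => exp (M z)) R z ≠ 0 := by
    intro z
    by_cases hz : z ∈ A
    · rw [piecewise_eq_of_mem _ _ _ hz]
      exact exp_ne_zero _
    · rw [piecewise_eq_of_notMem _ _ _ hz]
      have hzK := hout z (subset_closure hz)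
      refine mul_ne_zero (Finset.prod_ne_zero_iff.2 fun a ha => pow_ne_zero _ fun h0 => hzK ?_)
        (inv_ne_zero (hsub z hzK))
      rw [sub_eq_zero.1 h0]
      exact hZ ha
  obtain ⟨Λ, hΛ, hΛE⟩ := exists_log_plane hE hE0
  obtain ⟨ρ, hρ⟩ := hK.cthickening (r := δ) |>.isBounded.exists_norm_le
  have hlt : ∀ a ∈ A, ‖a‖ < |ρ| + 1 := fun a ha => by
    linarith [hρ a ha, le_abs_self ρ]
  set c : ℝ → ℂ := fun t => ((|ρ| + 1 : ℝ) : ℂ) * exp (2 * Real.pi * I * t)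
  have hcA : ∀ t, c t ∉ A := fun t ht => by
    have h1 := hlt _ ht
    have h2 : ‖exp (2 * Real.pi * I * t)‖ = 1 := by
      rw [show (2 * Real.pi * I * t : ℂ) = ((2 * Real.pi * t : ℝ) : ℂ) * I by push_cast; ring,
        norm_exp_ofReal_mul_I]
    simp only [c] at h1
    rw [norm_mul, h2, norm_real, Real.norm_of_nonneg (by positivity), mul_one] at h1
    exact lt_irrefl _ h1
  have w0 : HasWinding (fun t => R (c t)) 0 := by
    refine HasWinding.of_log (L := fun t => Λ (c t)) (by fun_prop) (by simp [c]) fun t _ => ?_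
    rw [hΛE, piecewise_eq_of_notMem _ _ _ (hcA t)]
  -- The circle `c` surrounds `A`, so each zero counts with its multiplicity and the pole `b` counts
  -- `-1`.
  have w1 : HasWinding (fun t => R (c t)) ((∑ a ∈ Z, (n a : ℤ) * 1) + -1) := by
    have hwK : ∀ a ∈ K, HasWinding (fun t => c t - a) 1 := fun a ha =>
      hasWinding_circle (hlt a (interior_subset (hKA ha)))
    exact (HasWinding.prod Z fun a ha => (hwK a (hZ ha)).pow (n a)).mul (hwK b hb).inv
  have := w0.unique w1
  have h3 : ((∑ a ∈ Z, n a : ℕ) : ℤ) = 1 := by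
    push_cast
    simp only [mul_one] at this
    omega
  exact_mod_cast h3

theorem Finset.exists_eq_singleton_of_sum_eq_one {α : Type*} {Z : Finset α} {n : α → ℕ}
    (hn : ∀ a ∈ Z, 0 < n a) (h : ∑ a ∈ Z, n a = 1) : ∃ a, Z = {a} ∧ n a = 1 := by
  have h1 : Z.card ≤ 1 := by
    rw [← h, Finset.card_eq_sum_ones]
    exact Finset.sum_le_sum fun a ha => hn a ha
  have h2 : Z.card ≠ 0 := fun h0 => by
    rw [Finset.card_eq_zero.1 h0] at h
    simp at h
  obtain ⟨a, rfl⟩ := Finset.card_eq_one.1 (by omega : Z.card = 1)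
  exact ⟨a, rfl, by simpa using h⟩

/-- A domain with a positive boundary is bounded. -/
theorem IsPositiveBoundary.isCompact_closure {γ : ℝ → ℂ} {D : Set ℂ}
    (h : IsPositiveBoundary γ D) : IsCompact (closure D) := by
  obtain ⟨hγ, hw⟩ := h
  obtain ⟨ρ, hρ⟩ := hγ.isCompact.isBounded.exists_norm_le
  have hDb : ∀ a ∈ D, ‖a‖ ≤ ρ := by
    intro a ha
    by_contra! hlt
    have ha0 : -a ≠ 0 := neg_ne_zero.2 (norm_pos_iff.1
      (((norm_nonneg _).trans (hρ _ hγ.nonempty.some_mem)).trans_lt hlt))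
    -- A point farther out than the whole curve is not encircled: there `γ - a` is a small
    -- perturbation of the constant `-a`.
    have h0 : HasWinding (fun _ : ℝ => -a) 0 :=
      HasWinding.of_log (L := fun _ => Complex.log (-a)) continuousOn_const rfl
        fun _ _ => exp_log ha0
    have h1 : HasWinding (fun t => γ t - a) 0 := by
      refine h0.of_norm_sub_lt (hγ.1.sub continuousOn_const) (by simp [hγ.2.2.1]) fun t ht => ?_
      rw [sub_neg_eq_add, sub_add_cancel, norm_neg]
      exact (hρ _ (hγ.mem ht)).trans_lt hlt
    exact absurd (h1.unique (hw a ha)) (by norm_num)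
  exact (isBounded_iff_forall_norm_le.2 ⟨ρ, hDb⟩).isCompact_closure

/-- The closed fibers of a fibration that extends to the boundary. -/
theorem closedFiber_eq {D : Set ℂ} {X : ℂ → Set ℂ} {F : ℂ → ℂ → ℂ} (hD : IsCompact (closure D))
    (hF : ContinuousOn (fun p : ℂ × ℂ => F p.1 p.2) (closure D ×ˢ closedBall 0 1))
    (hX : ∀ l ∈ D, F l '' ball 0 1 = X l) :
    closure (tube D X) = (fun p : ℂ × ℂ => (p.1, F p.1 p.2)) '' (closure D ×ˢ closedBall 0 1) := by
  have hc : ContinuousOn (fun p : ℂ × ℂ => (p.1, F p.1 p.2)) (closure D ×ˢ closedBall 0 1) :=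
    continuousOn_fst.prodMk hF
  refine (closure_minimal ?_ ((hD.prod (isCompact_closedBall 0 1)).image_of_continuousOn
    hc).isClosed).antisymm ?_
  · rintro ⟨l, z⟩ ⟨hl, hz⟩
    simp only at hl hz
    rw [← hX l hl] at hz
    obtain ⟨w, hw, rfl⟩ := hz
    exact ⟨(l, w), ⟨subset_closure hl, ball_subset_closedBall hw⟩, rfl⟩
  · have h1 : closure D ×ˢ closedBall (0 : ℂ) 1 = closure (D ×ˢ ball (0 : ℂ) 1) := by
      rw [closure_prod_eq, closure_ball _ one_ne_zero]
    rw [h1] at hc ⊢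
    refine hc.image_closure.trans (closure_mono ?_)
    rintro _ ⟨⟨l, w⟩, ⟨hl, hw⟩, rfl⟩
    exact ⟨hl, by rw [← hX l hl]; exact mem_image_of_mem _ hw⟩

namespace FiberMap

variable {ι : Type*}

/-- The boundary behavior of a proper family of winding number one. -/
structure BoundaryData (G : FiberMap ι) (φ : ℂ → ℂ) (γ : ℝ → ℂ) (F : ℂ → ℂ → ℂ) : Prop where
  isCompact : IsCompact (closure G.D)
  boundary : IsPositiveBoundary γ G.D
  continuousOn : ContinuousOn φ (closure G.D)
  eqOn : EqOn φ G.critVal G.D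
  winding : HasWinding (fun t => φ (γ t)) 1
  trivialization : IsTrivialization (closure G.D) (fun l => F l '' ball 0 1) F
  image_ball : ∀ l ∈ G.D, F l '' ball 0 1 = G.U l
  closure_V : ∀ i, ∀ p ∈ closure (tube G.D (G.V i)), p.1 ∈ closure G.D ∧ p.2 ∈ F p.1 '' ball 0 1
  mem_sphere : ∀ l ∈ frontier G.D, φ l ∈ F l '' sphere 0 1

/-- The critical value extends to the boundary in only one way, by density, so the extension that
meets the frame is also the one whose winding number is given. Interior and frontier of a closed
fiber are read off in the trivialization. -/
theorem IsProper.exists_boundaryData {G : FiberMap ι} (hP : G.IsProper)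
    (hw : G.HasWindingNumber 1) : ∃ φ γ F, G.BoundaryData φ γ F := by
  obtain ⟨φ, ⟨hφ, hφ'⟩, hφs⟩ := hP.section_proper
  obtain ⟨ψ, ⟨hψ, hψ'⟩, γ, hγ, hψw⟩ := hw
  obtain ⟨F, hF, hFi, hFU⟩ := hP.extends_U
  have hT : IsTrivialization (closure G.D) (fun l => F l '' ball 0 1) F := ⟨hF, hFi, fun _ _ => rfl⟩
  have hcpt := hγ.isCompact_closure
  have hcf := closedFiber_eq hcpt hF hFU
  have hcl : ∀ l ∈ closure G.D, closedFiber G.D G.U l = closure (F l '' ball 0 1) := by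
    intro l hl
    rw [hT.closure_eq hl]
    ext z
    simp only [closedFiber, hcf]
    constructor
    · rintro ⟨⟨l', w⟩, ⟨_, hw⟩, hlw⟩
      simp only [Prod.mk.injEq] at hlw
      obtain ⟨rfl, rfl⟩ := hlw
      exact ⟨w, hw, rfl⟩
    · rintro ⟨w, hw, rfl⟩
      exact ⟨(l, w), ⟨hl, hw⟩, rfl⟩
  have hφψ : EqOn φ ψ (closure G.D) := by
    intro l hl
    have := mem_closure_iff_nhdsWithin_neBot.1 hl
    refine tendsto_nhds_unique ((hφ l hl).mono subset_closure) (((hψ l hl).mono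
      subset_closure).congr' ?_)
    filter_upwards [self_mem_nhdsWithin] with v hv
    rw [hφ' hv, hψ' hv]
  refine ⟨φ, γ, F, hcpt, hγ, hφ, hφ', ?_, hT, hFU, fun i p hp => ?_, fun l hl => ?_⟩
  · refine hψw.congr fun t ht => ?_
    rw [sub_zero, hφψ (frontier_subset_closure (hγ.1.mem ht))]
  · have h1 : p.1 ∈ closure G.D := by
      have : MapsTo Prod.fst (tube G.D (G.V i)) G.D := fun q hq => hq.1
      exact this.closure continuous_fst hp
    have h2 := hP.closure_V i p hp
    rw [hcl _ h1, hT.interior_closure h1] at h2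
    exact ⟨h1, h2⟩
  · have h1 := frontier_subset_closure hl
    have h2 := hφs l hl
    rw [hcl l h1, hT.frontier_closure h1, hT.frontier_eq h1] at h2
    exact h2

namespace IsHolomorphicFamily

variable {G : FiberMap ι} {h : ℂ → ℂ → ℂ}

/-- The critical value takes the value of a holomorphic section exactly once. -/
theorem exists_root (H : G.IsHolomorphicFamily h) {φ : ℂ → ℂ} {γ : ℝ → ℂ} {F : ℂ → ℂ → ℂ}
    (B : G.BoundaryData φ γ F) (i : ι) :
    ∃ K ⊆ G.D, IsCompact K ∧ (∀ l ∈ G.D, G.critVal l ∈ closure (G.V i l) → l ∈ K) ∧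
      ∀ σ : ℂ → ℂ, DifferentiableOn ℂ σ G.D → (∀ l ∈ G.D, σ l ∈ closure (G.V i l)) →
        ∃ b ∈ K, ∃ q : ℂ → ℂ, DifferentiableOn ℂ q G.D ∧ (∀ l ∈ G.D, q l ≠ 0) ∧
          ∀ l ∈ G.D, G.critVal l - σ l = (l - b) * q l := by
  classical
  have hT := B.trivialization
  obtain ⟨W, hW, hWF, hFW⟩ := hT.exists_inverse
    (fun l _ => ⟨_, Subset.rfl, B.isCompact, self_mem_nhdsWithin⟩)
  -- In the trivializing coordinate `W` the closure of each tube is compact in the open unit disc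
  -- bundle over the closed domain.
  have hr : ∀ j, ∃ r < 1, ∀ p ∈ closure (tube G.D (G.V j)), ‖W p‖ ≤ r := by
    intro j
    have hsub : closure (tube G.D (G.V j)) ⊆ tube (closure G.D) fun l => closure (F l '' ball 0 1) :=
      fun p hp => ⟨(B.closure_V j p hp).1, subset_closure (B.closure_V j p hp).2⟩
    have hcpt : IsCompact (closure (tube G.D (G.V j))) := by
      refine ((B.isCompact.prod (isCompact_closedBall (0 : ℂ) 1)).image_of_continuousOn
        (continuousOn_fst.prodMk hT.1)).of_isClosed_subset isClosed_closure fun p hp => ?_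
      have := hsub hp
      exact ⟨(p.1, W p), ⟨this.1, (hFW _ this.1 _ this.2).1⟩, Prod.ext rfl (hFW _ this.1 _ this.2).2⟩
    rcases (closure (tube G.D (G.V j))).eq_empty_or_nonempty with he | hne
    · exact ⟨0, one_pos, by simp [he]⟩
    · obtain ⟨p, hp, hmax⟩ := hcpt.exists_isMaxOn hne (hW.mono hsub).norm
      refine ⟨‖W p‖, ?_, fun q hq => hmax hq⟩
      have h1 := B.closure_V j p hp
      have h2 := hFW _ h1.1 _ (subset_closure h1.2)
      rw [← mem_ball_zero_iff, ← hT.mem_iff h1.1 h2.1, h2.2]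
      exact h1.2
  obtain ⟨r₁, hr₁, hWr₁⟩ := hr i
  obtain ⟨r₀, hr₀, hWr₀⟩ := hr G.o
  set r := max r₁ r₀
  have hr1 : r < 1 := max_lt hr₁ hr₀
  have hφX : ∀ l ∈ closure G.D, φ l ∈ closure (F l '' ball 0 1) := by
    intro l hl
    by_cases hlD : l ∈ G.D
    · rw [B.eqOn hlD, B.image_ball l hlD]
      exact subset_closure (H.critVal_mem hlD)
    · rw [hT.closure_eq hl]
      exact image_mono sphere_subset_closedBall
        (B.mem_sphere l ⟨hl, by rwa [H.isOpen_D.interior_eq]⟩)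
  set b : ℂ → ℂ := fun l => W (l, φ l)
  have hbc : ContinuousOn b (closure G.D) := hW.comp (continuousOn_id.prodMk B.continuousOn)
    (fun l hl => ⟨hl, hφX l hl⟩)
  have hFb : ∀ l ∈ closure G.D, F l (b l) = φ l := fun l hl => (hFW l hl _ (hφX l hl)).2
  have hb1 : ∀ l ∈ closure G.D, b l ∈ closedBall (0 : ℂ) 1 := fun l hl => (hFW l hl _ (hφX l hl)).1
  -- These are the parameters at which the critical value is in the concentric tube of radius `r`.
  -- On the boundary of `G.D` its coordinate `b` has modulus `1`, so `K` stays inside `G.D`.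
  set K : Set ℂ := closure G.D ∩ b ⁻¹' closedBall 0 r
  have hKc : IsCompact K := B.isCompact.of_isClosed_subset
    (hbc.preimage_isClosed_of_isClosed isClosed_closure isClosed_closedBall) inter_subset_left
  have hKD : K ⊆ G.D := by
    rintro l ⟨hl, hlr⟩
    by_contra hlD
    obtain ⟨w, hw, hwl⟩ := B.mem_sphere l ⟨hl, by rwa [H.isOpen_D.interior_eq]⟩
    have : b l = w := by
      simp only [b]
      rw [← hwl]
      exact hWF l hl w (sphere_subset_closedBall hw)
    rw [mem_preimage, this, mem_closedBall, (mem_sphere.1 hw)] at hlr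
    exact absurd hlr (not_le.2 hr1)
  have hne : ∃ l ∈ G.D, l ∉ K := by
    have hp := B.boundary.1.nonempty.some_mem
    set p := B.boundary.1.nonempty.some
    have hpK : p ∉ K := fun h => by
      have := hp.2
      rw [H.isOpen_D.interior_eq] at this
      exact this (hKD h)
    obtain ⟨l, hl1, hl2⟩ := mem_closure_iff.1 hp.1 _ hKc.isClosed.isOpen_compl hpK
    exact ⟨l, hl2, hl1⟩
  have hmemcl : ∀ {j l z}, l ∈ G.D → z ∈ closure (G.V j l) → (l, z) ∈ closure (tube G.D (G.V j)) :=
    fun hl hz => tube_closure_subset ⟨hl, hz⟩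
  have hWsec : ∀ σ : ℂ → ℂ, ∀ j, ContinuousOn σ G.D → (∀ l ∈ G.D, σ l ∈ closure (G.V j l)) →
      ContinuousOn (fun l => W (l, σ l)) G.D := fun σ j hσ hσV =>
    hW.comp (continuousOn_id.prodMk hσ) fun l hl => ⟨subset_closure hl,
      subset_closure (B.closure_V j _ (hmemcl hl (hσV l hl))).2⟩
  have hFWsec : ∀ j l z, l ∈ G.D → z ∈ closure (G.V j l) → F l (W (l, z)) = z :=
    fun j l z hl hz => (hFW l (subset_closure hl) z
      (subset_closure (B.closure_V j _ (hmemcl hl hz)).2)).2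
  have hφF : ∀ l ∈ G.D, ∀ v : ℂ, ‖v‖ ≤ r → G.critVal l = F l v → l ∈ K := by
    intro l hl v hv hlv
    have hlc := subset_closure hl
    refine ⟨hlc, ?_⟩
    have : b l = v := by
      simp only [b]
      rw [B.eqOn hl, hlv]
      exact hWF l hlc v (mem_closedBall_zero_iff.2 (hv.trans hr1.le))
    rw [mem_preimage, this, mem_closedBall_zero_iff]
    exact hv
  have hWr : ∀ l ∈ G.D, ∀ z ∈ closure (G.V i l), ‖W (l, z)‖ ≤ r := fun l hl z hz =>
    (hWr₁ _ (hmemcl hl hz)).trans (le_max_left _ _)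
  have hWr' : ∀ l ∈ G.D, ∀ z ∈ closure (G.V G.o l), ‖W (l, z)‖ ≤ r := fun l hl z hz =>
    (hWr₀ _ (hmemcl hl hz)).trans (le_max_right _ _)
  have hz0 : ∀ l ∈ G.D, (0 : ℂ) ∈ closure (G.V G.o l) := fun l hl => subset_closure (H.zero_mem_V hl)
  have hlogD : ∀ q : ℂ → ℂ, DifferentiableOn ℂ q G.D → (∀ z ∈ G.D, q z ≠ 0) →
      ∃ v : ℂ → ℂ, ContinuousOn v G.D ∧ ∀ z ∈ G.D, exp (v z) = q z := fun q hq hq0 =>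
    exists_log_of_isSimplyConnected H.disc.2.1 H.isOpen_D hq.continuousOn hq0
  have hφK : ∀ l ∈ G.D, G.critVal l = 0 → l ∈ K := fun l hl h0 =>
    hφF l hl _ (hWr' l hl 0 (hz0 l hl)) (by rw [h0, hFWsec _ l 0 hl (hz0 l hl)])
  -- The zero section comes first, since its root count is what the winding number hypothesis gives.
  obtain ⟨e, heK, q₀, hq₀, hq₀0, hφe⟩ : ∃ e ∈ K, ∃ q : ℂ → ℂ, DifferentiableOn ℂ q G.D ∧
      (∀ l ∈ G.D, q l ≠ 0) ∧ ∀ l ∈ G.D, G.critVal l = (l - e) * q l := by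
    obtain ⟨Z, n, q, hZK, hn, hq, hq0, hfac⟩ := H.differentiableOn_critVal.exists_factorization
      H.isOpen_D H.isPreconnected_D hKc hKD hφK
      (by obtain ⟨l, hl, hlK⟩ := hne; exact ⟨l, hl, fun h0 => hlK (hφK l hl h0)⟩)
    have hprod : ∀ l, l ∉ K → ∏ a ∈ Z, (l - a) ^ n a ≠ 0 := fun l hl =>
      Finset.prod_ne_zero_iff.2 fun a ha => pow_ne_zero _ fun h0 => hl (by
        rw [sub_eq_zero.1 h0]; exact hZK ha)
    -- This extends the nonvanishing cofactor to the closed domain, where it has a logarithm. Along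
    -- `γ` it therefore contributes nothing, and the multiplicities add up to the winding number `1`
    -- of `φ`.
    set Q : ℂ → ℂ := fun l => if l ∈ G.D then q l else φ l / ∏ a ∈ Z, (l - a) ^ n a
    have hQoff : ∀ l, l ∉ K → Q l = φ l / ∏ a ∈ Z, (l - a) ^ n a := by
      intro l hl
      by_cases hlD : l ∈ G.D
      · simp only [Q, if_pos hlD]
        rw [B.eqOn hlD, hfac l hlD, mul_div_cancel_left₀ _ (hprod l hl)]
      · simp only [Q, if_neg hlD]
    have hφ0 : ∀ l ∈ closure G.D, l ∉ G.D → φ l ≠ 0 := by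
      intro l hl hlD h0
      have hfr : l ∈ frontier G.D := ⟨hl, by rwa [H.isOpen_D.interior_eq]⟩
      have h1 : (l, (0 : ℂ)) ∈ closure (tube G.D (G.V G.o)) := by
        have hm : MapsTo (fun l : ℂ => (l, (0 : ℂ))) G.D (tube G.D (G.V G.o)) :=
          fun v hv => ⟨hv, H.zero_mem_V hv⟩
        exact hm.closure (by fun_prop) hl
      obtain ⟨w, hw, hw0⟩ := (B.closure_V G.o _ h1).2
      obtain ⟨v, hv, hv0⟩ := B.mem_sphere l hfr
      have := hT.2 l hl (ball_subset_closedBall hw) (sphere_subset_closedBall hv)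
        (hw0.trans (h0.symm.trans hv0.symm))
      rw [this, mem_ball, mem_sphere.1 hv] at hw
      exact lt_irrefl _ hw
    have hQc : ContinuousOn Q (closure G.D) := by
      intro l hl
      by_cases hlK : l ∈ K
      · have h1 := (hq l (hKD hlK)).continuousWithinAt.continuousAt (H.isOpen_D.mem_nhds (hKD hlK))
        refine (h1.congr ?_).continuousWithinAt
        filter_upwards [H.isOpen_D.mem_nhds (hKD hlK)] with v hv
        simp only [Q, if_pos hv]
      · have h1 : ContinuousWithinAt (fun l => φ l / ∏ a ∈ Z, (l - a) ^ n a) (closure G.D) l :=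
          (B.continuousOn l hl).div (Continuous.continuousWithinAt
            (continuous_finsetProd _ fun a _ => by fun_prop)) (hprod l hlK)
        refine h1.congr_of_eventuallyEq ?_ (hQoff l hlK)
        filter_upwards [nhdsWithin_le_nhds (hKc.isClosed.isOpen_compl.mem_nhds hlK)] with v hv
        exact hQoff v hv
    have hQ0 : ∀ l ∈ closure G.D, Q l ≠ 0 := by
      intro l hl
      by_cases hlD : l ∈ G.D
      · simp only [Q, if_pos hlD]
        exact hq0 l hlD
      · simp only [Q, if_neg hlD]
        exact div_ne_zero (hφ0 l hl hlD) (hprod l fun h => hlD (hKD h))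
    obtain ⟨L, hL, hL'⟩ := IsJordanParam.exists_log_of_isCompact B.isCompact
      frontier_closure_subset frontier_subset_closure B.boundary.1
      (interior_mono subset_closure (by rw [H.isOpen_D.interior_eq]; exact H.base_mem))
      (by norm_num) (B.boundary.2 _ H.base_mem) hQc hQ0
    have w1 := HasWinding.of_log_comp hL hL' B.boundary.1.1
      (fun t ht => frontier_subset_closure (B.boundary.1.mem ht)) B.boundary.1.2.2.1
    have w2 := HasWinding.prod Z (fun a ha => (B.boundary.2 a (hKD (hZK ha))).pow (n a))
    have w3 := (w2.mul w1).unique (B.winding.congr fun t ht => by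
      have hγ := B.boundary.1.mem ht
      have hγK : γ t ∉ K := fun h => by
        have := hγ.2
        rw [H.isOpen_D.interior_eq] at this
        exact this (hKD h)
      rw [hQoff _ hγK, mul_div_cancel₀ _ (hprod _ hγK)])
    have hsum : ∑ a ∈ Z, n a = 1 := by
      simp only [mul_one, add_zero] at w3
      exact_mod_cast w3
    obtain ⟨a, rfl, ha⟩ := Finset.exists_eq_singleton_of_sum_eq_one hn hsum
    exact ⟨a, hZK (by simp), q, hq, hq0, fun l hl => by rw [hfac l hl]; simp [ha]⟩
  obtain ⟨v₀, hv₀, hv₀'⟩ := hlogD q₀ hq₀ hq₀0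
  refine ⟨K, hKD, hKc, fun l hl hcl => hφF l hl _ (hWr l hl _ hcl) (hFWsec _ l _ hl hcl).symm,
    fun σ hσ hσV => ?_⟩
  have hz : ∀ l ∈ G.D, G.critVal l - σ l = 0 → l ∈ K := fun l hl h0 =>
    hφF l hl _ (hWr l hl _ (hσV l hl)) (by rw [sub_eq_zero.1 h0, hFWsec _ l _ hl (hσV l hl)])
  obtain ⟨Z, n, q, hZK, hn, hq, hq0, hfac⟩ :=
    (H.differentiableOn_critVal.sub hσ).exists_factorization
      H.isOpen_D H.isPreconnected_D hKc hKD hz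
      (by obtain ⟨l, hl, hlK⟩ := hne; exact ⟨l, hl, fun h0 => hlK (hz l hl h0)⟩)
  obtain ⟨v, hv, hv'⟩ := hlogD q hq hq0
  have hnorm : ∀ t ∈ Icc (0 : ℝ) 1, ∀ l ∈ G.D,
      ‖W (l, 0) + (t : ℂ) * (W (l, σ l) - W (l, 0))‖ ≤ r := by
    intro t ht l hl
    have h1 := (convex_closedBall (0 : ℂ) r) (mem_closedBall_zero_iff.2 (hWr' l hl 0 (hz0 l hl)))
      (mem_closedBall_zero_iff.2 (hWr l hl _ (hσV l hl))) (sub_nonneg.2 ht.2) ht.1 (by ring)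
    rw [mem_closedBall_zero_iff] at h1
    have h2 : (1 - t) • W (l, 0) + t • W (l, σ l) =
        W (l, 0) + (t : ℂ) * (W (l, σ l) - W (l, 0)) := by
      rw [real_smul, real_smul]
      push_cast
      ring
    rwa [h2] at h1
  have hc0 := hWsec (fun _ => 0) G.o continuousOn_const hz0
  have hcσ := hWsec σ i hσ.continuousOn hσV
  have hsnd : ∀ {f : ℂ → ℂ}, ContinuousOn f G.D →
      ContinuousOn (fun p : ℝ × ℂ => f p.2) (Icc 0 1 ×ˢ (G.D \ K)) := fun hf =>
    hf.comp continuousOn_snd fun p hp => hp.2.1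
  -- Segments in the coordinate disc of radius `r` join the zero section to `σ`; off `K` the
  -- critical value avoids all of them. So the two differences agree there up to an exponential
  -- factor, and the root count for `σ` is also one.
  obtain ⟨M, hM, hM'⟩ := exists_log_homotopy (S := G.D \ K)
    (H := fun t l => G.critVal l - F l (W (l, 0) + (t : ℂ) * (W (l, σ l) - W (l, 0))))
    (by
      refine (hsnd H.differentiableOn_critVal.continuousOn).sub ?_
      refine hT.1.comp (f := fun p : ℝ × ℂ =>
        (p.2, W (p.2, 0) + (p.1 : ℂ) * (W (p.2, σ p.2) - W (p.2, 0)))) ?_ ?_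
      · exact continuousOn_snd.prodMk ((hsnd hc0).add ((by fun_prop : Continuous fun p : ℝ × ℂ =>
          (p.1 : ℂ)).continuousOn.mul ((hsnd hcσ).sub (hsnd hc0))))
      · exact fun p hp => ⟨subset_closure hp.2.1, mem_closedBall_zero_iff.2
          ((hnorm p.1 hp.1 p.2 hp.2.1).trans hr1.le)⟩)
    (fun t ht l hl h0 => hl.2 (hφF l hl.1 _ (hnorm t ht l hl.1) (sub_eq_zero.1 h0)))
  have hsum : ∑ a ∈ Z, n a = 1 := by
    refine sum_eq_one_of_exists_log H.isOpen_D hKc hKD hZK heK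
      (L := fun l => v₀ l + M l - v l) (((hv₀.mono sdiff_subset).add hM).sub (hv.mono sdiff_subset))
      fun l hl => ?_
    have h1 := hM' l hl
    simp only [ofReal_one, one_mul, ofReal_zero, zero_mul, add_zero, add_sub_cancel] at h1
    rw [hFWsec _ l _ hl.1 (hσV l hl.1), hFWsec _ l _ hl.1 (hz0 l hl.1), sub_zero, hφe l hl.1] at h1
    have h2 := hfac l hl.1
    change G.critVal l - σ l = _ at h2
    rw [exp_sub, exp_add, hv₀' l hl.1, hv' l hl.1]
    rw [hφe l hl.1] at h2
    have h3 := hq0 l hl.1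
    rw [← mul_div_assoc, eq_div_iff h3, ← h2, h1]
    ring
  obtain ⟨a, rfl, ha⟩ := Finset.exists_eq_singleton_of_sum_eq_one hn hsum
  exact ⟨a, hZK (by simp), q, hq, hq0, fun l hl => by
    have := hfac l hl
    simpa [ha] using this⟩

end IsHolomorphicFamily

end FiberMap

/-! ### The renormalized parameter domain -/

theorem IsHolomorphicMotion.mono {D X Y : Set ℂ} {b : ℂ} {h : ℂ → ℂ → ℂ}
    (hm : IsHolomorphicMotion D b X h) (hYX : Y ⊆ X) : IsHolomorphicMotion D b Y h :=
  ⟨fun l hl => (hm.1 l hl).mono hYX, fun z hz => hm.2.1 z (hYX hz), fun z hz => hm.2.2 z (hYX hz)⟩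

/-- A function vanishing at one point only, to first order. -/
theorem dslope_eq_of_eq_mul {D : Set ℂ} (hD : IsOpen D) {f q : ℂ → ℂ} {b : ℂ} (hb : b ∈ D)
    (hq : DifferentiableOn ℂ q D) (hf : ∀ l ∈ D, f l = (l - b) * q l) {l : ℂ} (hl : l ∈ D) :
    dslope f b l = q l := by
  by_cases hlb : l = b
  · subst hlb
    rw [dslope_same]
    have h1 := ((hasDerivAt_id l).sub_const l).mul
      ((hq l hl).differentiableAt (hD.mem_nhds hl)).hasDerivAt
    have h2 : f =ᶠ[𝓝 l] fun v => (v - l) * q v := by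
      filter_upwards [hD.mem_nhds hl] with v hv using hf v hv
    rw [h2.deriv_eq]
    refine (h1.congr_deriv ?_).deriv
    simp
  · have h1 := sub_smul_dslope f b l
    rw [smul_eq_mul, hf l hl, hf b hb, sub_self, zero_mul, sub_zero] at h1
    exact mul_left_cancel₀ (sub_ne_zero.2 hlb) h1

/-- A family of functions with one zero each, to first order, in a fixed compact set: the zero
depends continuously on the parameter. -/
theorem continuousOn_root {D K J : Set ℂ} (hK : IsCompact K) (hKD : K ⊆ D)
    {f q : ℂ → ℂ → ℂ} {χ : ℂ → ℂ} (hf : ContinuousOn (fun p : ℂ × ℂ => f p.1 p.2) (D ×ˢ J))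
    (hχ : ∀ y ∈ J, χ y ∈ K) (hq : ∀ y ∈ J, ∀ l ∈ D, q y l ≠ 0)
    (hfq : ∀ y ∈ J, ∀ l ∈ D, f l y = (l - χ y) * q y l) : ContinuousOn χ J := by
  intro y₀ hy₀
  rw [ContinuousWithinAt, tendsto_iff_ultrafilter]
  intro u hu
  have huJ : ∀ᶠ y in (u : Filter ℂ), y ∈ J := hu self_mem_nhdsWithin
  have huK : ∀ᶠ y in (u : Filter ℂ), χ y ∈ K := huJ.mono hχ
  -- The zeros remain in the compact set `K`; a limit of them is a zero of the limit function, which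
  -- has only one.
  obtain ⟨b, hb, hub⟩ := isCompact_iff_ultrafilter_le_nhds'.1 hK (u.map χ) huK
  have hub' : Tendsto χ u (𝓝 b) := hub
  have h1 : Tendsto (fun y => (χ y, y)) u (𝓝[D ×ˢ J] (b, y₀)) := by
    refine tendsto_nhdsWithin_iff.2 ⟨hub'.prodMk_nhds
      (tendsto_id.mono_left (hu.trans nhdsWithin_le_nhds)), ?_⟩
    filter_upwards [huJ] with y hy using ⟨hKD (hχ y hy), hy⟩
  have h2 : Tendsto (fun y => f (χ y) y) u (𝓝 (f b y₀)) := (hf (b, y₀) ⟨hKD hb, hy₀⟩).tendsto.comp h1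
  have h3 : f b y₀ = 0 := by
    refine tendsto_nhds_unique (h2.congr' ?_) tendsto_const_nhds
    filter_upwards [huJ] with y hy
    rw [hfq y hy _ (hKD (hχ y hy)), sub_self, zero_mul]
  rw [hfq y₀ hy₀ b (hKD hb)] at h3
  have h4 := (mul_eq_zero.1 h3).resolve_right (hq y₀ hy₀ b (hKD hb))
  rw [← sub_eq_zero.1 h4]
  exact hub

namespace FiberMap

variable {ι : Type*}

/-- The parameters for which the critical value follows the word `s` and lands. -/
def landingParameters (G : FiberMap ι) (s : List ι) : Set ℂ :=
  {l | l ∈ G.D ∧ G.critVal l ∈ G.landing s l}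

/-- The geometry of the renormalized parameter domain, bounded by the curve `c`; the point `e` is
the one where the critical point is periodic. -/
structure RenormDisc (G : FiberMap ι) (s : List ι) (c : ℝ → ℂ) (e : ℂ) (q : ℂ → ℂ) : Prop where
  isOpen : IsOpen (G.renormDomain s)
  subset : closure (G.renormDomain s) ⊆ G.D
  isCompact : IsCompact (closure (G.renormDomain s))
  isTopDisc : IsTopDisc (G.renormDomain s)
  boundary : IsPositiveBoundary c (G.renormDomain s)
  critVal_mem_frontier : ∀ l ∈ frontier (G.renormDomain s),
    G.critVal l ∈ frontier (G.landing s l)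
  exists_log : ∀ f : ℂ → ℂ, ContinuousOn f (closure (G.renormDomain s)) →
    (∀ z ∈ closure (G.renormDomain s), f z ≠ 0) →
    ∃ L : ℂ → ℂ, ContinuousOn L (closure (G.renormDomain s)) ∧
      ∀ z ∈ closure (G.renormDomain s), exp (L z) = f z
  root_mem : e ∈ G.renormDomain s
  differentiableOn : DifferentiableOn ℂ q G.D
  ne_zero : ∀ l ∈ G.D, q l ≠ 0
  critVal_sub : ∀ l ∈ G.D, G.critVal l - G.branch s l 0 = (l - e) * q l

namespace IsHolomorphicFamily

variable {G : FiberMap ι} {h : ℂ → ℂ → ℂ} {l : ℂ} {s t : List ι}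

theorem frontier_subset_boundarySet (i : ι) : frontier (G.V i G.base) ⊆ G.boundarySet :=
  fun _ hz => Or.inr (mem_iUnion.2 ⟨i, hz⟩)

theorem motion_mem (H : G.IsHolomorphicFamily h) (i : ι) (hl : l ∈ G.D) {y : ℂ}
    (hy : y ∈ frontier (G.V i G.base)) : h l y ∈ frontier (G.V i l) :=
  H.motion_V i l hl ▸ mem_image_of_mem _ hy

theorem frontier_V_subset (H : G.IsHolomorphicFamily h) (i : ι) (hl : l ∈ G.D) :
    frontier (G.V i l) ⊆ G.U l := frontier_subset_closure.trans (H.closure_V_subset i hl)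

/-- The closed tubes are bounded over compact sets of parameters, so the motion is locally bounded
and the continuity theorem for motions applies. -/
theorem continuousOn_motion (H : G.IsHolomorphicFamily h) (i : ι) :
    ContinuousOn (fun p : ℂ × ℂ => h p.1 p.2) (G.D ×ˢ frontier (G.V i G.base)) := by
  refine (H.motion.mono (frontier_subset_boundarySet i)).continuousOn H.isOpen_D H.isPreconnected_D
    H.base_mem fun C hCD hC => ?_
  obtain ⟨F, hF⟩ := H.exists_trivialization_V i
  obtain ⟨M, hM⟩ := hF.exists_bound hC hCD
  exact ⟨M, fun l hl z hz => hM l hl _ (frontier_subset_closure (H.motion_mem i (hCD hl) hz))⟩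

theorem isOpen_landingParameters (H : G.IsHolomorphicFamily h) (ht : ∀ i ∈ t, i ≠ G.o) :
    IsOpen (G.landingParameters t) := by
  obtain ⟨F, hF⟩ := H.exists_trivialization_V G.o
  have h1 := (H.trivialization_landing ht hF).isOpen_tube H.isOpen_D
  have h2 := (continuousOn_id.prodMk H.differentiableOn_critVal.continuousOn).isOpen_inter_preimage
    H.isOpen_D h1
  convert h2 using 1
  ext l
  simp only [landingParameters, tube, mem_inter_iff, mem_preimage, mem_ofPred_eq, id]
  tauto

theorem frontier_landing_eq_image (H : G.IsHolomorphicFamily h) (hl : l ∈ G.D)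
    (ht : ∀ i ∈ t, i ≠ G.o) {z : ℂ} : z ∈ frontier (G.landing t l) ↔
      ∃ y ∈ frontier (G.V G.o G.base), G.branch t l (h l y) = z := by
  rw [H.frontier_landing ht hl]
  constructor
  · rintro ⟨hz, hz'⟩
    rw [← H.motion_V G.o l hl] at hz'
    obtain ⟨y, hy, hyz⟩ := hz'
    exact ⟨y, hy, by rw [hyz, H.branch_iter hl ht hz]⟩
  · rintro ⟨y, hy, rfl⟩
    have h1 := H.motion_mem G.o hl hy
    have h2 := H.frontier_V_subset _ hl h1
    exact ⟨H.branch_mem hl ht h2, by rwa [H.iter_branch hl ht h2]⟩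

/-- The boundary of the landing tube is foliated by the holomorphic sections `σ · y`, each met by
the critical value at one parameter `χ y`. This transfers the Jordan curve `J` of the dynamical
plane to the curve `Γ` in the parameter plane. -/
theorem exists_renormDisc (H : G.IsHolomorphicFamily h) {φ : ℂ → ℂ} {γ : ℝ → ℂ} {F₀ : ℂ → ℂ → ℂ}
    (B : G.BoundaryData φ γ F₀) (hs : G.IsBaseItinerary s) :
    ∃ c e q, G.RenormDisc s c e q := by
  obtain ⟨hso, hsb⟩ := hs
  obtain ⟨i, hi⟩ := exists_landing_subset (G := G) s
  obtain ⟨K, hKD, hK, hVK, hroot⟩ := H.exists_root B i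
  obtain ⟨F, hF⟩ := H.exists_trivialization_V G.o
  have hFL := H.trivialization_landing hso hF
  set FL : ℂ → ℂ → ℂ := fun l w => G.branch s l (F l w)
  set J := frontier (G.V G.o G.base)
  have hJ := hF.isJordanParam H.base_mem
  set γ₀ : ℝ → ℂ := fun t => F G.base (exp (2 * Real.pi * I * t))
  set σ : ℂ → ℂ → ℂ := fun l y => G.branch s l (h l y)
  have hU : ∀ l ∈ G.D, ∀ y ∈ J, h l y ∈ G.U l := fun l hl y hy =>
    H.frontier_V_subset _ hl (H.motion_mem G.o hl hy)
  have hσfr : ∀ l ∈ G.D, ∀ y ∈ J, σ l y ∈ frontier (G.landing s l) := fun l hl y hy =>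
    (H.frontier_landing_eq_image hl hso).2 ⟨y, hy, rfl⟩
  have hσV : ∀ l ∈ G.D, ∀ y ∈ J, σ l y ∈ closure (G.V i l) := fun l hl y hy =>
    closure_mono (hi l) (frontier_subset_closure (hσfr l hl y hy))
  have hσd : ∀ y ∈ J, DifferentiableOn ℂ (fun l => σ l y) G.D := fun y hy =>
    (H.differentiableOn_branch hso).comp (f := fun l => (l, h l y))
      (differentiableOn_id.prodMk (H.motion.2.2 y (frontier_subset_boundarySet _ hy)))
      fun l hl => ⟨hl, hU l hl y hy⟩
  have hσc : ContinuousOn (fun p : ℂ × ℂ => σ p.1 p.2) (G.D ×ˢ J) :=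
    (H.continuousOn_branch hso).comp (f := fun p : ℂ × ℂ => (p.1, h p.1 p.2))
      (continuousOn_fst.prodMk (H.continuousOn_motion G.o)) fun p hp => ⟨hp.1, hU _ hp.1 _ hp.2⟩
  choose! χ hχK q hqd hq0 hfq using fun y hy =>
    hroot (fun l => σ l y) (hσd y hy) (fun l hl => hσV l hl y hy)
  set f : ℂ → ℂ → ℂ := fun l y => G.critVal l - σ l y
  have hfc : ContinuousOn (fun p : ℂ × ℂ => f p.1 p.2) (G.D ×ˢ J) :=
    (H.differentiableOn_critVal.continuousOn.comp continuousOn_fst fun p hp => hp.1).sub hσc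
  have hχc : ContinuousOn χ J := continuousOn_root hK hKD hfc hχK hq0 hfq
  have hχD : ∀ y ∈ J, χ y ∈ G.D := fun y hy => hKD (hχK y hy)
  have hχ0 : ∀ y ∈ J, f (χ y) y = 0 := fun y hy => by
    show G.critVal (χ y) - σ (χ y) y = 0
    rw [hfq y hy _ (hχD y hy), sub_self, zero_mul]
  have hχeq : ∀ y ∈ J, ∀ l ∈ G.D, f l y = 0 → l = χ y := fun y hy l hl h0 => by
    change G.critVal l - σ l y = 0 at h0
    rw [hfq y hy l hl] at h0
    exact sub_eq_zero.1 ((mul_eq_zero.1 h0).resolve_right (hq0 y hy l hl))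
  -- The cofactors come from separate existence statements for each `y`; as divided differences they
  -- are determined, hence jointly continuous.
  have hQc : ContinuousOn (fun p : ℂ × ℂ => q p.2 p.1) (G.D ×ˢ J) :=
    (continuousOn_dslope_of_zero H.isOpen_D hfc
      (fun y hy => H.differentiableOn_critVal.sub (hσd y hy)) hχc hχD hχ0).congr fun p hp =>
        (dslope_eq_of_eq_mul H.isOpen_D (hχD _ hp.2) (hqd _ hp.2) (hfq _ hp.2) hp.1).symm
  have hχi : InjOn χ J := by
    intro y hy y' hy' hyy
    have h1 : σ (χ y) y = σ (χ y) y' := by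
      have e1 := hχ0 y hy
      have e2 := hχ0 y' hy'
      rw [← hyy] at e2
      exact (sub_eq_zero.1 e1).symm.trans (sub_eq_zero.1 e2)
    have hl := hχD y hy
    have h2 := congrArg (G.iter s (χ y)) h1
    simp only [σ] at h2
    rw [H.iter_branch hl hso (hU _ hl y hy), H.iter_branch hl hso (hU _ hl y' hy')] at h2
    exact H.motion.1 _ hl (frontier_subset_boundarySet _ hy) (frontier_subset_boundarySet _ hy') h2
  set Γ := χ '' J
  have hΓ : ∀ l ∈ G.D, (l ∈ Γ ↔ G.critVal l ∈ frontier (G.landing s l)) := by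
    intro l hl
    constructor
    · rintro ⟨y, hy, rfl⟩
      rw [sub_eq_zero.1 (hχ0 y hy)]
      exact hσfr _ hl y hy
    · intro hfr
      obtain ⟨y, hy, hyl⟩ := (H.frontier_landing_eq_image hl hso).1 hfr
      exact ⟨y, hy, (hχeq y hy l hl (sub_eq_zero.2 hyl.symm)).symm⟩
  have hc : IsJordanParam (χ ∘ γ₀) Γ := hJ.comp hχc hχi rfl
  have hγJ : ∀ t ∈ Icc (0 : ℝ) 1, γ₀ t ∈ J := fun t ht => hJ.mem ht
  have hcK : ∀ t ∈ Icc (0 : ℝ) 1, χ (γ₀ t) ∈ K := fun t ht => hχK _ (hγJ t ht)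
  have hcurve : ∀ {g : ℂ × ℂ → ℂ}, ContinuousOn g (G.D ×ˢ J) →
      ContinuousOn (fun p : ℂ × ℝ => g (p.1, γ₀ p.2)) (G.D ×ˢ Icc 0 1) := fun hg =>
    hg.comp (continuousOn_fst.prodMk (hJ.1.comp continuousOn_snd fun p hp => hp.2))
      fun p hp => ⟨hp.1, hγJ _ hp.2⟩
  have hslice : ∀ {g : ℂ × ℂ → ℂ} {a : ℂ}, ContinuousOn g (G.D ×ˢ J) → a ∈ G.D →
      ContinuousOn (fun t : ℝ => g (a, γ₀ t)) (Icc 0 1) := fun hg ha =>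
    hg.comp (continuousOn_const.prodMk hJ.1) fun t ht => ⟨ha, hγJ _ ht⟩
  have hγcl : γ₀ 0 = γ₀ 1 := hJ.2.2.1
  -- the winding number of the quotients vanishes
  have hQw : ∀ a ∈ G.D, HasWinding (fun t => q (γ₀ t) a) 0 := by
    obtain ⟨p, hp⟩ := B.boundary.1.nonempty
    have hpD : p ∉ G.D := fun h => by
      have := hp.2
      rw [H.isOpen_D.interior_eq] at this
      exact this h
    -- The winding number is computed at a parameter `a` outside `K`, close to a boundary point `p`.
    -- The curve does not wind about `p`, which lies outside the simply connected domain, hence not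
    -- about `a`. The critical value at `a` lies outside the closed disc of `V i`, so the loop of
    -- the `σ a y` does not wind about it either.
    obtain ⟨δ, hδ, hδK⟩ := Metric.mem_nhds_iff.1
      (hK.isClosed.isOpen_compl.mem_nhds fun h => hpD (hKD h) : Kᶜ ∈ 𝓝 p)
    obtain ⟨a, haD, hap⟩ := Metric.mem_closure_iff.1 (frontier_subset_closure hp) δ hδ
    have haK : a ∉ K := hδK (by rwa [mem_ball, dist_comm])
    obtain ⟨L, hL, hL'⟩ := exists_log_of_isSimplyConnected H.disc.2.1 H.isOpen_D
      (g := fun z => z - p) (by fun_prop) fun z hz h0 => hpD (by rwa [← sub_eq_zero.1 h0])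
    have w1 : HasWinding (fun t => χ (γ₀ t) - p) 0 :=
      HasWinding.of_log_comp (f := fun z => z - p) hL hL' hc.1 (fun t ht => hKD (hcK t ht)) hc.2.2.1
    have w2 : HasWinding (fun t => χ (γ₀ t) - a) 0 := by
      refine w1.of_norm_sub_lt (hc.1.sub continuousOn_const) (by simp [hγcl]) fun t ht => ?_
      have e1 : p - a = (χ (γ₀ t) - a) - (χ (γ₀ t) - p) := by ring
      rw [← e1, ← dist_eq]
      refine hap.trans_le ?_
      by_contra! hlt
      exact hδK (by rwa [mem_ball, dist_eq]) (hcK t ht)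
    obtain ⟨Fi, hFi⟩ := H.exists_trivialization_V i
    have hcl := hFi.closure_eq haD
    obtain ⟨Λ, hΛ, hΛ'⟩ := exists_log_starConvex (x := (0 : ℂ)) (S := closedBall (0 : ℂ) 1)
      ((convex_closedBall _ _).starConvex (mem_closedBall_self zero_le_one))
      (mem_closedBall_self zero_le_one) (g := fun w => G.critVal a - Fi a w)
      (continuousOn_const.sub (hFi.continuousOn_fiber haD)) fun w hw h0 => haK
        (hVK a haD (by rw [hcl, sub_eq_zero.1 h0]; exact mem_image_of_mem _ hw))
    obtain ⟨m, hm, hm'⟩ := (isCompact_closedBall (0 : ℂ) 1).exists_continuousOn_factor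
      (hFi.continuousOn_fiber haD) hΛ fun w hw v hv hwv => by rw [hFi.2 a haD hw hv hwv]
    have w3 : HasWinding (fun t => G.critVal a - σ a (γ₀ t)) 0 := by
      refine HasWinding.of_log_comp (S := Fi a '' closedBall 0 1)
        (f := fun z => G.critVal a - z) hm ?_ (hslice hσc haD) ?_ (by simp only [hγcl])
      · rintro _ ⟨w, hw, rfl⟩
        rw [hm' w hw, hΛ' w hw]
      · intro t ht
        rw [← hcl]
        exact hσV a haD _ (hγJ t ht)
    have w4 : HasWinding (fun t => q (γ₀ t) a) 0 := by
      refine (w3.mul (w2.neg.inv)).congr fun t ht => ?_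
      rw [hfq _ (hγJ t ht) a haD]
      have : a - χ (γ₀ t) ≠ 0 := fun h0 => haK (by rw [sub_eq_zero.1 h0]; exact hcK t ht)
      rw [neg_sub]
      field_simp
    intro b hb
    exact HasWinding.of_isPreconnected H.isPreconnected_D (H := fun a t => q (γ₀ t) a)
      (hcurve hQc) (fun a ha t ht => hq0 _ (hγJ t ht) a ha) (fun a _ => by simp only [hγcl])
      haD hb w4
  obtain ⟨ε, hε, hεw⟩ := Set.InjOn.exists_winding_circle (hFL.continuousOn_fiber H.base_mem)
    (hFL.2 _ H.base_mem)
  have h0b : (0 : ℂ) ∈ ball (0 : ℂ) 1 := mem_ball_self one_pos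
  have hnotmem : ∀ a ∈ G.D, ∀ x ∈ G.landing s a, x ∉ frontier (G.landing s a) := by
    intro a ha x hx hfr
    rw [(H.isOpen_landing hso ha).frontier_eq] at hfr
    exact hfr.2 hx
  -- the winding number of the boundary curve about the landing parameters
  have hwind : ∀ a ∈ G.landingParameters s, HasWinding (fun t => χ (γ₀ t) - a) ε := by
    rintro a ⟨ha, haL⟩
    -- The center `FL a 0` never meets the moving boundary, so the winding number is that over the
    -- base point, namely `ε`.
    have w1 : HasWinding (fun t => σ a (γ₀ t) - FL a 0) ε := by
      refine HasWinding.of_isPreconnected H.isPreconnected_D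
        (H := fun a t => σ a (γ₀ t) - FL a 0) ?_ ?_ (fun a _ => by simp only [hγcl]) H.base_mem ha ?_
      · refine (hcurve hσc).sub ?_
        exact hFL.1.comp (f := fun p : ℂ × ℝ => (p.1, (0 : ℂ))) (by fun_prop)
          fun p hp => ⟨hp.1, ball_subset_closedBall h0b⟩
      · intro a ha t ht h0
        refine hnotmem a ha _ (hFL.mem ha h0b) ?_
        rw [← sub_eq_zero.1 h0]
        exact hσfr a ha _ (hγJ t ht)
      · refine hεw.congr fun t ht => ?_
        simp only [σ]
        rw [H.motion.2.1 _ (frontier_subset_boundarySet _ (hγJ t ht))]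
    have hLc : IsPreconnected (G.landing s a) := by
      rw [← hFL.3 a ha]
      exact (convex_ball (0 : ℂ) 1).isPreconnected.image _
        ((hFL.continuousOn_fiber ha).mono ball_subset_closedBall)
    -- The center is moved to the critical value inside the connected landing disc.
    have w2 : HasWinding (fun t => σ a (γ₀ t) - G.critVal a) ε := by
      refine HasWinding.of_isPreconnected hLc (H := fun x t => σ a (γ₀ t) - x) ?_ ?_
        (fun x _ => by simp only [hγcl]) (hFL.mem ha h0b) haL w1
      · exact ((hslice hσc ha).comp continuousOn_snd fun p hp => hp.2).sub continuousOn_fst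
      · intro x hx t ht h0
        refine hnotmem a ha x hx ?_
        rw [← sub_eq_zero.1 h0]
        exact hσfr a ha _ (hγJ t ht)
    have w3 := w2.mul (hQw a ha).inv
    simp only [neg_zero, add_zero] at w3
    refine w3.congr fun t ht => ?_
    have e1 := hfq _ (hγJ t ht) a ha
    have e2 := hq0 _ (hγJ t ht) a ha
    rw [← neg_sub (G.critVal a), e1]
    field_simp
    ring
  -- the domain
  have hΩ := H.isOpen_landingParameters hso
  have hbΩ : G.base ∈ G.landingParameters s := ⟨H.base_mem, hsb⟩
  set D' := G.renormDomain s
  have hD'o : IsOpen D' := hΩ.connectedComponentIn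
  have hbD' : G.base ∈ D' := mem_connectedComponentIn hbΩ
  have hD'Ω : D' ⊆ G.landingParameters s := connectedComponentIn_subset _ _
  have hD'K : closure D' ⊆ K := closure_minimal
    (fun l hl => hVK l (hD'Ω hl).1 (subset_closure (hi l (hD'Ω hl).2))) hK.isClosed
  have hD'D : closure D' ⊆ G.D := hD'K.trans hKD
  have hX : IsCompact (closure D') := hK.of_isClosed_subset isClosed_closure hD'K
  have hclL : ∀ l ∈ closure D', G.critVal l ∈ closure (G.landing s l) := by
    intro l hl
    have hlD := hD'D hl
    refine hFL.mem_closure_of_mem_closure_tube H.isOpen_D hlD ?_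
    have h1 : ContinuousWithinAt (fun l => (l, G.critVal l)) D' l :=
      continuousWithinAt_id.prodMk ((H.differentiableOn_critVal.continuousOn l hlD).mono
        (subset_closure.trans hD'D))
    have h2 : tube G.D (G.landing s) ⊆ tube G.D fun l => closure (G.landing s l) :=
      fun p hp => ⟨hp.1, subset_closure hp.2⟩
    exact closure_mono h2
      (h1.mem_closure hl (t := tube G.D (G.landing s)) fun v hv => hD'Ω hv)
  have hfrL : ∀ l ∈ frontier D', G.critVal l ∈ frontier (G.landing s l) := by
    intro l hl
    have hlD := hD'D hl.1
    rw [(H.isOpen_landing hso hlD).frontier_eq]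
    refine ⟨hclL l hl.1, fun hL => ?_⟩
    have hlΩ : l ∈ G.landingParameters s := ⟨hlD, hL⟩
    -- A frontier point that were a landing parameter would have an open component meeting `D'`,
    -- hence equal to `D'`.
    obtain ⟨v, hv, hv'⟩ := mem_closure_iff.1 hl.1 _ hΩ.connectedComponentIn
      (mem_connectedComponentIn hlΩ)
    have h1 := connectedComponentIn_eq hv
    have h2 : D' = connectedComponentIn (G.landingParameters s) v := connectedComponentIn_eq hv'
    have hl2 := hl.2
    rw [hD'o.interior_eq] at hl2
    apply hl2
    rw [h2, ← h1]
    exact mem_connectedComponentIn hlΩ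
  have hfrΓ : frontier D' ⊆ Γ := fun l hl => (hΓ l (hD'D hl.1)).2 (hfrL l hl)
  have hΩΓ : ∀ a ∈ G.landingParameters s, a ∉ Γ := fun a ha haΓ =>
    hnotmem a ha.1 _ ha.2 ((hΓ a ha.1).1 haΓ)
  have hbint : G.base ∈ interior (closure D') :=
    interior_mono subset_closure (by rwa [hD'o.interior_eq])
  have hfr1 : frontier (closure D') = Γ :=
    hc.frontier_eq hX hbint (frontier_closure_subset.trans hfrΓ) (hΩΓ _ hbΩ)
  have hfr2 : frontier D' = Γ := hfrΓ.antisymm (hfr1 ▸ frontier_closure_subset)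
  have hlog : ∀ f : ℂ → ℂ, ContinuousOn f (closure D') → (∀ z ∈ closure D', f z ≠ 0) →
      ∃ L : ℂ → ℂ, ContinuousOn L (closure D') ∧ ∀ z ∈ closure D', exp (L z) = f z :=
    fun f hf hf0 => IsJordanParam.exists_log_of_isCompact hX hfr1.subset
      (hfr2 ▸ frontier_subset_closure) hc hbint hε (hwind _ hbΩ) hf hf0
  have hsc : IsSimplyConnected D' := isPreconnected_connectedComponentIn.isSimplyConnected_of_exists_log
    hD'o hbD' hX (hfr1.trans hfr2.symm) hlog
  -- The sign `ε` depends on the orientation of the trivialization; it is corrected by reversing the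
  -- curve.
  obtain ⟨c', hc', hw'⟩ : ∃ c', IsJordanParam c' Γ ∧
      ∀ a ∈ G.landingParameters s, HasWinding (fun t => c' t - a) 1 := by
    rcases mul_self_eq_one_iff.1 hε with rfl | rfl
    · exact ⟨_, hc, hwind⟩
    · exact ⟨_, hc.reverse, fun a ha => by simpa using (hwind a ha).reverse⟩
  have hz0 : ∀ l ∈ G.D, (0 : ℂ) ∈ G.U l := fun l hl => H.V_subset _ hl (H.zero_mem_V hl)
  have hσ0L : ∀ l ∈ G.D, G.branch s l 0 ∈ G.landing s l := fun l hl => by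
    rw [H.landing_eq hl]
    exact ⟨H.branch_mem hl hso (hz0 l hl), by
      rw [H.iter_branch hl hso (hz0 l hl)]; exact H.zero_mem_V hl⟩
  obtain ⟨e, heK, q₀, hq₀, hq₀0, hφe⟩ := hroot (fun l => G.branch s l 0)
    ((H.differentiableOn_branch hso).comp (f := fun l => (l, (0 : ℂ))) (by fun_prop)
      fun l hl => ⟨hl, hz0 l hl⟩) fun l hl => subset_closure (hi l (hσ0L l hl))
  have heΩ : e ∈ G.landingParameters s := by
    refine ⟨hKD heK, ?_⟩
    have := hφe e (hKD heK)
    rw [sub_self, zero_mul] at this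
    rw [sub_eq_zero.1 this]
    exact hσ0L e (hKD heK)
  -- The curve `Γ` winds once about every landing parameter, even outside `D'`, whereas it cannot
  -- wind about a point outside `closure D'`. So `e` lies in `D'`.
  have heD' : e ∈ D' := by
    by_contra heD'
    have hecl : e ∉ closure D' := fun h => by
      have h1 : e ∈ frontier D' := ⟨h, by rwa [hD'o.interior_eq]⟩
      exact hΩΓ e heΩ (hfrΓ h1)
    obtain ⟨L, hL, hL'⟩ := hlog (fun z => z - e) (by fun_prop)
      fun z hz h0 => hecl (by rwa [← sub_eq_zero.1 h0])
    have w1 : HasWinding (fun t => c' t - e) 0 := HasWinding.of_log_comp (f := fun z => z - e)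
      hL hL' hc'.1 (fun t ht => frontier_subset_closure (hfr2 ▸ hc'.mem ht)) hc'.2.2.1
    exact absurd (w1.unique (hw' e heΩ)) (by norm_num)
  exact ⟨c', e, q₀, hD'o, hD'D, hX, ⟨hD'o, hsc, c', hfr2 ▸ hc'⟩,
    ⟨hfr2 ▸ hc', fun a ha => hw' a (hD'Ω ha)⟩, hfrL, hlog, heD', hq₀, hq₀0, hφe⟩

end IsHolomorphicFamily

end FiberMap

/-! ### The renormalized critical value and the tubes of the renormalization -/

theorem connectedComponentIn_eq_of_isOpen {X : Type*} [TopologicalSpace X] {A B : Set X} {p : X}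
    (hA : IsOpen A) (hB : IsOpen B) (hAB : Disjoint A B) (hAc : IsPreconnected A) (hp : p ∈ A) :
    connectedComponentIn (A ∪ B) p = A :=
  (isPreconnected_connectedComponentIn.subset_left_of_subset_union hA hB hAB
    (connectedComponentIn_subset _ _)
    ⟨p, mem_connectedComponentIn (Or.inl hp), hp⟩).antisymm
    (hAc.subset_connectedComponentIn hp subset_union_left)

namespace FiberMap

variable {ι : Type*} {G : FiberMap ι} {h : ℂ → ℂ → ℂ} {l : ℂ} {s t : List ι} {c : ℝ → ℂ} {e : ℂ}
  {q : ℂ → ℂ}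

namespace RenormDisc

theorem subset_D (R : G.RenormDisc s c e q) : G.renormDomain s ⊆ G.D :=
  subset_closure.trans R.subset

theorem critVal_mem (hl : l ∈ G.renormDomain s) :
    G.critVal l ∈ G.landing s l :=
  (connectedComponentIn_subset _ _ hl : l ∈ G.landingParameters s).2

theorem critVal_mem_closure (R : G.RenormDisc s c e q) (hl : l ∈ closure (G.renormDomain s)) :
    G.critVal l ∈ closure (G.landing s l) := by
  by_cases hD : l ∈ G.renormDomain s
  · exact subset_closure (critVal_mem hD)
  · exact frontier_subset_closure (R.critVal_mem_frontier l ⟨hl, by rwa [R.isOpen.interior_eq]⟩)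

/-- The renormalized critical value vanishes only at `e`, to first order. Its divided difference at
`e` has a logarithm on the closed domain, so only the factor `l - e` contributes to the winding
number. -/
theorem hasWinding_critVal (R : G.RenormDisc s c e q) (H : G.IsHolomorphicFamily h)
    (hs : ∀ i ∈ s, i ≠ G.o) :
    ContinuousOn (fun l => G.iter s l (G.critVal l)) (closure (G.renormDomain s)) ∧
      HasWinding (fun t => G.iter s (c t) (G.critVal (c t))) 1 := by
  set ψ : ℂ → ℂ := fun l => G.iter s l (G.critVal l)
  set O : Set ℂ := {l | l ∈ G.D ∧ G.critVal l ∈ G.wordDomain s l}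
  have hO : IsOpen O := by
    convert (continuousOn_id.prodMk H.differentiableOn_critVal.continuousOn).isOpen_inter_preimage
      H.isOpen_D (H.isOpen_tube_wordDomain s) using 1
    ext l
    simp only [O, tube, mem_inter_iff, mem_preimage, mem_ofPred_eq, id]
    tauto
  have hφd : ∀ l ∈ G.D, DifferentiableAt ℂ G.critVal l := fun l hl =>
    (H.differentiableOn_critVal l hl).differentiableAt (H.isOpen_D.mem_nhds hl)
  have hψd : DifferentiableOn ℂ ψ O := fun l hl =>
    ((H.analyticAt_iter hl.1 hl.2).differentiableAt.comp (f := fun l => (l, G.critVal l)) l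
      (differentiableAt_id.prodMk (hφd l hl.1))).differentiableWithinAt
  have hcl : closure (G.renormDomain s) ⊆ O := fun l hl => ⟨R.subset hl,
    H.closure_landing_subset_wordDomain hs (R.subset hl) (R.critVal_mem_closure hl)⟩
  have hU0 : ∀ l ∈ G.D, (0 : ℂ) ∈ G.U l := fun l hl => H.V_subset _ hl (H.zero_mem_V hl)
  have heO : e ∈ O := hcl (subset_closure R.root_mem)
  have hφe : G.critVal e = G.branch s e 0 := by
    have := R.critVal_sub e heO.1
    rw [sub_self, zero_mul] at this
    exact sub_eq_zero.1 this
  have hψe : ψ e = 0 := by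
    simp only [ψ]
    rw [hφe, H.iter_branch heO.1 hs (hU0 e heO.1)]
  have hψ0 : ∀ l ∈ O, ψ l = 0 → l = e := by
    intro l hl h0
    have h1 := H.branch_iter hl.1 hs hl.2
    change G.branch s l (ψ l) = _ at h1
    rw [h0] at h1
    have h2 := R.critVal_sub l hl.1
    rw [h1, sub_self] at h2
    exact sub_eq_zero.1 ((mul_eq_zero.1 h2.symm).resolve_right (R.ne_zero l hl.1))
  have hψ' : deriv ψ e ≠ 0 := by
    -- If the derivative vanished, the graphs of the critical value and of `branch s · 0` would have
    -- the same image tangent `(1, 0)` under an invertible derivative, hence the same tangent at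
    -- `e`; but they cross transversally because `q e ≠ 0`.
    intro hd
    obtain ⟨E, hE⟩ := exists_equiv_hasStrictFDerivAt_fibered (H.analyticAt_iter heO.1 heO.2)
      (H.deriv_iter_ne_zero heO.1 hs heO.2)
    have h1 : HasDerivAt (fun l => (l, G.critVal l)) (1, deriv G.critVal e) e :=
      (hasDerivAt_id e).prodMk (hφd e heO.1).hasDerivAt
    have hσd : DifferentiableAt ℂ (fun l => G.branch s l 0) e :=
      ((H.differentiableOn_branch hs).differentiableAt
        (H.isOpen_tube_U.mem_nhds ⟨heO.1, hU0 e heO.1⟩)).comp (f := fun l => (l, (0 : ℂ))) e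
        (by fun_prop)
    have h2 : HasDerivAt (fun l => (l, G.branch s l 0)) (1, deriv (fun l => G.branch s l 0) e) e :=
      (hasDerivAt_id e).prodMk hσd.hasDerivAt
    have h3 : HasDerivAt (fun l => fibered (G.iter s) (l, G.critVal l))
        (E (1, deriv G.critVal e)) e :=
      HasFDerivAt.comp_hasDerivAt (f := fun l => (l, G.critVal l)) e hE.hasFDerivAt h1
    have h4 : HasDerivAt (fun l => fibered (G.iter s) (l, G.branch s l 0))
        (E (1, deriv (fun l => G.branch s l 0) e)) e := by
      rw [hφe] at hE
      exact HasFDerivAt.comp_hasDerivAt (f := fun l => (l, G.branch s l 0)) e hE.hasFDerivAt h2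
    have h5 : HasDerivAt (fun l => fibered (G.iter s) (l, G.critVal l)) (1, 0) e := by
      have := (hasDerivAt_id e).prodMk
        ((hψd e heO).differentiableAt (hO.mem_nhds heO)).hasDerivAt
      rw [hd] at this
      exact this
    have h6 : HasDerivAt (fun l => fibered (G.iter s) (l, G.branch s l 0)) (1, 0) e := by
      refine ((hasDerivAt_id e).prodMk (hasDerivAt_const e (0 : ℂ))).congr_of_eventuallyEq ?_
      filter_upwards [H.isOpen_D.mem_nhds heO.1] with l hl
      simp only [fibered, H.iter_branch hl hs (hU0 l hl), id]
    have h7 := E.injective ((h3.unique h5).trans (h4.unique h6).symm)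
    simp only [Prod.mk.injEq, true_and] at h7
    have h8 : HasDerivAt (fun l => G.critVal l - G.branch s l 0) 0 e :=
      ((hφd e heO.1).hasDerivAt.sub hσd.hasDerivAt).congr_deriv (by rw [h7, sub_self])
    have h9 : HasDerivAt (fun l => (l - e) * q l) (q e) e :=
      (((hasDerivAt_id e).sub_const e).mul ((R.differentiableOn e heO.1).differentiableAt
        (H.isOpen_D.mem_nhds heO.1)).hasDerivAt).congr_deriv (by simp)
    refine R.ne_zero e heO.1 ((h9.congr_of_eventuallyEq ?_).unique h8)
    filter_upwards [H.isOpen_D.mem_nhds heO.1] with l hl using R.critVal_sub l hl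
  have hQ : ContinuousOn (dslope ψ e) O :=
    ((differentiableOn_dslope (hO.mem_nhds heO)).2 hψd).continuousOn
  have hfac : ∀ l, ψ l = (l - e) * dslope ψ e l := fun l => by
    have := sub_smul_dslope ψ e l
    rw [smul_eq_mul, hψe, sub_zero] at this
    exact this.symm
  obtain ⟨L, hL, hL'⟩ := R.exists_log _ (hQ.mono hcl) fun l hl h0 => by
    by_cases hle : l = e
    · rw [hle, dslope_same] at h0
      exact hψ' h0
    · exact hle (hψ0 l (hcl hl) (by rw [hfac, h0, mul_zero]))
  have hc := R.boundary.1
  have w1 := HasWinding.of_log_comp hL hL' hc.1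
    (fun t ht => frontier_subset_closure (hc.mem ht)) hc.2.2.1
  have w2 := (R.boundary.2 e R.root_mem).mul w1
  rw [add_zero] at w2
  exact ⟨hψd.continuousOn.mono hcl, w2.congr fun t _ => hfac (c t)⟩

/-- The two lifts of a landing tube that avoids the critical value. -/
theorem exists_lifts (R : G.RenormDisc s c e q) (H : G.IsHolomorphicFamily h)
    (hs : ∀ i ∈ s, i ≠ G.o) (ht : ∀ i ∈ t, i ≠ G.o) (hts : t ≠ s) {F : ℂ → ℂ → ℂ}
    (hF : IsTrivialization (G.renormDomain s) (G.landing t) F) :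
    ∃ P : Bool → ℂ → ℂ → ℂ,
      (∀ b, IsTrivialization (G.renormDomain s) (fun l => P b l '' ball 0 1) (P b) ∧
        ∀ l ∈ G.renormDomain s, ∀ w ∈ closedBall (0 : ℂ) 1,
          P b l w ∈ G.V G.o l ∧ G.g G.o l (P b l w) = F l w) ∧
      (∀ l ∈ G.renormDomain s, ∀ w ∈ closedBall (0 : ℂ) 1, ∀ w' ∈ closedBall (0 : ℂ) 1,
        P true l w ≠ P false l w') ∧
      ∀ l ∈ G.renormDomain s, ∀ z ∈ G.V G.o l, ∀ w ∈ closedBall (0 : ℂ) 1,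
        G.g G.o l z = F l w → ∃ b, P b l w = z := by
  obtain ⟨κ, hκ, hκ'⟩ := H.exists_sqrt_inverse
  have hD := R.subset_D
  have hFcl : ∀ l ∈ G.renormDomain s, ∀ w ∈ closedBall (0 : ℂ) 1, F l w ∈ closure (G.landing t l) :=
    fun l hl w hw => by rw [hF.closure_eq hl]; exact mem_image_of_mem _ hw
  have hφc : ContinuousOn (fun p : ℂ × ℂ => G.critVal p.1) (G.renormDomain s ×ˢ closedBall 0 1) :=
    H.differentiableOn_critVal.continuousOn.comp continuousOn_fst fun p hp => hD hp.1
  -- The closed landing tube misses the critical value, so `F - critVal` has a continuous square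
  -- root; its two signs give the two lifts.
  obtain ⟨M, hM, hM'⟩ := exists_log_prod R.isOpen R.isTopDisc.2.1
    ((convex_closedBall (0 : ℂ) 1).starConvex (mem_closedBall_self zero_le_one))
    (mem_closedBall_self zero_le_one) (f := fun p => F p.1 p.2 - G.critVal p.1) (hF.1.sub hφc)
    fun p hp h0 => Set.disjoint_left.1 (H.disjoint_closure_landing (hD hp.1) ht hs hts)
      (hFcl _ hp.1 _ hp.2) (by
        rw [sub_eq_zero.1 h0]
        exact subset_closure (critVal_mem hp.1))
  set r : Bool → ℂ × ℂ → ℂ := fun b p => (if b then 1 else -1) * exp (M p / 2)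
  have hr2 : ∀ b, ∀ l ∈ G.renormDomain s, ∀ w ∈ closedBall (0 : ℂ) 1,
      G.critVal l + r b (l, w) ^ 2 = F l w := by
    intro b l hl w hw
    have h1 := hM' (l, w) ⟨hl, hw⟩
    have h2 : exp (M (l, w) / 2) ^ 2 = exp (M (l, w)) := by
      rw [← exp_nat_mul, Nat.cast_ofNat, mul_div_cancel₀ _ two_ne_zero]
    simp only [r]
    rw [mul_pow, h2, h1]
    cases b <;> simp
  have hrs : ∀ b, ∀ l ∈ G.renormDomain s, ∀ w ∈ closedBall (0 : ℂ) 1,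
      r b (l, w) ∈ G.sqrtFiber l := fun b l hl w hw => by
    show _ ∈ G.U l
    rw [hr2 b l hl w hw]
    exact H.closure_landing_subset ht (hD hl) (hFcl l hl w hw)
  have hrc : ∀ b, ContinuousOn (r b) (G.renormDomain s ×ˢ closedBall 0 1) := fun b =>
    continuousOn_const.mul (hM.div_const 2).cexp
  have hinj : ∀ b b', ∀ l ∈ G.renormDomain s, ∀ w ∈ closedBall (0 : ℂ) 1,
      ∀ w' ∈ closedBall (0 : ℂ) 1, κ (l, r b (l, w)) = κ (l, r b' (l, w')) →
        w = w' ∧ r b (l, w) = r b' (l, w') := by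
    intro b b' l hl w hw w' hw' hww
    have h1 := (hκ' l (hD hl)).2.1.injOn (hrs b l hl w hw) (hrs b' l hl w' hw') hww
    refine ⟨hF.2 l hl hw hw' ?_, h1⟩
    rw [← hr2 b l hl w hw, ← hr2 b' l hl w' hw', h1]
  refine ⟨fun b l w => κ (l, r b (l, w)), fun b => ⟨⟨?_, ?_, fun _ _ => rfl⟩, ?_⟩, ?_, ?_⟩
  · exact hκ.comp (f := fun p : ℂ × ℂ => (p.1, r b (p.1, p.2))) (continuousOn_fst.prodMk (hrc b))
      fun p hp => ⟨hD hp.1, hrs b _ hp.1 _ hp.2⟩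
  · exact fun l hl w hw w' hw' hww => (hinj b b l hl w hw w' hw' hww).1
  · intro l hl w hw
    exact ⟨(hκ' l (hD hl)).2.1.mapsTo (hrs b l hl w hw), by
      rw [(hκ' l (hD hl)).2.2 _ (hrs b l hl w hw), hr2 b l hl w hw]⟩
  · intro l hl w hw w' hw' hww
    obtain ⟨rfl, h2⟩ := hinj true false l hl w hw w' hw' hww
    simp only [r, if_true, one_mul, Bool.false_eq_true, if_false] at h2
    have h3 : exp (M (l, w) / 2) = 0 := by linear_combination (1 / 2 : ℂ) * h2
    exact exp_ne_zero _ h3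
  · intro l hl z hz w hw hzw
    obtain ⟨v, hv, rfl⟩ := (hκ' l (hD hl)).2.1.surjOn hz
    simp only at hzw
    rw [(hκ' l (hD hl)).2.2 v hv, ← hr2 true l hl w hw] at hzw
    rcases sq_eq_sq_iff_eq_or_eq_neg.1 (add_left_cancel hzw) with h1 | h1
    · exact ⟨true, by rw [h1]⟩
    · exact ⟨false, by rw [h1]; simp [r]⟩

/-- The lift of the landing tube that contains the critical value. -/
theorem exists_central_lift (R : G.RenormDisc s c e q) (H : G.IsHolomorphicFamily h)
    (hs : ∀ i ∈ s, i ≠ G.o) :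
    ∃ F P : ℂ → ℂ → ℂ, IsTrivialization (G.renormDomain s) (G.landing s) F ∧
      IsTrivialization (G.renormDomain s)
        (fun l => {z | z ∈ G.V G.o l ∧ G.g G.o l z ∈ G.landing s l}) P ∧
      ∀ l ∈ G.renormDomain s, F l 0 = G.critVal l ∧ ∀ w ∈ closedBall (0 : ℂ) 1,
          P l w ∈ G.V G.o l ∧ G.g G.o l (P l w) = F l (w ^ 2) := by
  obtain ⟨κ, hκ, hκ'⟩ := H.exists_sqrt_inverse
  have hD := R.subset_D
  obtain ⟨F₀, hF₀⟩ := H.exists_trivialization_V G.o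
  obtain ⟨F, hF, hF0⟩ := ((H.trivialization_landing hs hF₀).mono hD).exists_recenter R.isOpen
    (H.differentiableOn_critVal.continuousOn.mono hD) (fun l hl => critVal_mem hl)
  have hFcl : ∀ l ∈ G.renormDomain s, ∀ w ∈ closedBall (0 : ℂ) 1, F l w ∈ closure (G.landing s l) :=
    fun l hl w hw => by rw [hF.closure_eq hl]; exact mem_image_of_mem _ hw
  have h0c : (0 : ℂ) ∈ closedBall (0 : ℂ) 1 := mem_closedBall_self zero_le_one
  set S : Set ℂ := {u | u.re ≤ 0}
  have hSc : Convex ℝ S := convex_halfSpace_re_le 0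
  have hexp : ∀ u ∈ S, exp (2 * u) ∈ closedBall (0 : ℂ) 1 := fun u hu => by
    rw [mem_closedBall_zero_iff, norm_exp, Real.exp_le_one_iff]
    have : u.re ≤ 0 := hu
    simp only [mul_re, re_ofNat, im_ofNat, zero_mul, sub_zero]
    linarith
  have hFne : ∀ l ∈ G.renormDomain s, ∀ w ∈ closedBall (0 : ℂ) 1, F l w = G.critVal l → w = 0 :=
    fun l hl w hw hlw => hF.2 l hl hw h0c (hlw.trans (hF0 l hl).symm)
  -- With `w = exp u`, the square root of `F l (w ^ 2) - critVal l` is sought on the half-plane that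
  -- covers the punctured disc. The doubled exponent makes the translation by `πi` act as `w ↦ -w`.
  obtain ⟨M, hM, hM'⟩ := exists_log_prod R.isOpen R.isTopDisc.2.1 (S := S)
    (hSc.starConvex (by simp [S])) (by simp [S])
    (f := fun p => F p.1 (exp (2 * p.2)) - G.critVal p.1)
    ((hF.1.comp (f := fun p : ℂ × ℂ => (p.1, exp (2 * p.2))) (by fun_prop)
      fun p hp => ⟨hp.1, hexp _ hp.2⟩).sub
      (H.differentiableOn_critVal.continuousOn.comp continuousOn_fst fun p hp => hD hp.1))
    fun p hp h0 => exp_ne_zero _ (hFne _ hp.1 _ (hexp _ hp.2) (sub_eq_zero.1 h0))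
  have hDS : IsPreconnected (G.renormDomain s ×ˢ S) :=
    isPreconnected_connectedComponentIn.prod hSc.isPreconnected
  have hShift : ∀ u ∈ S, u + Real.pi * I ∈ S := fun u hu => by
    have : u.re ≤ 0 := hu
    simpa [S] using this
  obtain ⟨k, hk⟩ := hDS.exists_int_of_exp_eq (f := fun p => M (p.1, p.2 + Real.pi * I)) (g := M)
    (hM.comp (by fun_prop) fun p hp => ⟨hp.1, hShift _ hp.2⟩) hM (by
      rintro ⟨l, u⟩ ⟨hl, hu⟩
      rw [hM' (l, u + Real.pi * I) ⟨hl, hShift u hu⟩, hM' (l, u) ⟨hl, hu⟩]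
      simp only
      rw [mul_add, exp_add, show (2 : ℂ) * (Real.pi * I) = 2 * Real.pi * I by ring,
        exp_two_pi_mul_I, mul_one])
  have hlS : ∀ w ∈ closedBall (0 : ℂ) 1, Complex.log w ∈ S := fun w hw => by
    show (Complex.log w).re ≤ 0
    rw [log_re]
    exact Real.log_nonpos (norm_nonneg _) (mem_closedBall_zero_iff.1 hw)
  -- The shift `k` is the winding number of an embedded circle about the image of its center, so it
  -- is `±1`. Being odd, it makes the root change sign under `w ↦ -w`.
  have hkε : k * k = 1 := by
    have hb : e ∈ G.renormDomain s := R.root_mem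
    obtain ⟨ε, hε, hεw⟩ := Set.InjOn.exists_winding_circle (hF.continuousOn_fiber hb) (hF.2 e hb)
    have hSπ : ∀ t : ℝ, (Real.pi * I * t : ℂ) ∈ S := fun t => by simp [S]
    have w1 : HasWinding (fun t => F e (exp (2 * Real.pi * I * t)) - F e 0) k := by
      refine ⟨fun t => M (e, Real.pi * I * t), hM.comp (by fun_prop) fun t _ => ⟨hb, hSπ t⟩,
        fun t _ => ?_, ?_⟩
      · rw [hM' (e, Real.pi * I * t) ⟨hb, hSπ t⟩, hF0 e hb]
        simp only
        rw [show (2 : ℂ) * (Real.pi * I * t) = 2 * Real.pi * I * t by ring]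
      · have := hk (e, 0) ⟨hb, by simp [S]⟩
        simpa using this
    rw [w1.unique hεw]
    exact hε
  have hkodd : exp (Real.pi * I * k) = -1 := by
    rcases mul_self_eq_one_iff.1 hkε with rfl | rfl
    · simp [exp_pi_mul_I]
    · simp [exp_neg, exp_pi_mul_I]
  set E : ℂ → ℂ → ℂ := fun l u => exp (M (l, u) / 2)
  have hE1 : ∀ l ∈ G.renormDomain s, ∀ u ∈ S, E l (u + Real.pi * I) = -E l u := by
    intro l hl u hu
    have := hk (l, u) ⟨hl, hu⟩
    simp only [E]
    rw [sub_eq_iff_eq_add.1 this, show (2 * Real.pi * I * k + M (l, u)) / 2 =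
      Real.pi * I * k + M (l, u) / 2 by ring, exp_add, hkodd, neg_one_mul]
  have hE2 : ∀ l ∈ G.renormDomain s, ∀ u ∈ S, E l (u + 2 * Real.pi * I) = E l u := by
    intro l hl u hu
    rw [show u + 2 * Real.pi * I = u + Real.pi * I + Real.pi * I by ring,
      hE1 l hl _ (hShift u hu), hE1 l hl u hu, neg_neg]
  have hEnat : ∀ l ∈ G.renormDomain s, ∀ u ∈ S, ∀ n : ℕ,
      u + 2 * Real.pi * I * n ∈ S ∧ E l (u + 2 * Real.pi * I * n) = E l u := by
    intro l hl u hu n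
    have hSn : ∀ n : ℕ, u + 2 * Real.pi * I * n ∈ S := fun n => by
      have : u.re ≤ 0 := hu
      simpa [S] using this
    refine ⟨hSn n, ?_⟩
    induction n with
    | zero => simp
    | succ n ih =>
      rw [← ih, ← hE2 l hl _ (hSn n)]
      congr 1
      push_cast
      ring
  have hEper : ∀ l ∈ G.renormDomain s, ∀ u ∈ S, ∀ v ∈ S, exp u = exp v → E l u = E l v := by
    intro l hl u hu v hv huv
    obtain ⟨n, hn⟩ := _root_.exists_int_of_exp_eq huv
    obtain ⟨m, rfl | rfl⟩ := n.eq_nat_or_neg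
    · rw [sub_eq_iff_eq_add.1 hn, add_comm, Int.cast_natCast]
      exact (hEnat l hl v hv m).2
    · have : v = u + 2 * Real.pi * I * m := by
        push_cast at hn
        linear_combination -hn
      rw [this]
      exact (hEnat l hl u hu m).2.symm
  have hEsq : ∀ l ∈ G.renormDomain s, ∀ u ∈ S, G.critVal l + E l u ^ 2 = F l (exp (2 * u)) := by
    intro l hl u hu
    simp only [E]
    rw [← exp_nat_mul, Nat.cast_ofNat, mul_div_cancel₀ _ two_ne_zero, hM' (l, u) ⟨hl, hu⟩]
    simp
  -- By periodicity of `E` any logarithm of `w` gives the same value. Hence continuity away from `0`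
  -- can be checked with a branch centered at `w₀`, so the cut does not matter; at `0` it follows
  -- from that of the square.
  set ρ : ℂ × ℂ → ℂ := fun p => if p.2 = 0 then 0 else E p.1 (Complex.log p.2)
  have hρsq : ∀ l ∈ G.renormDomain s, ∀ w ∈ closedBall (0 : ℂ) 1,
      G.critVal l + ρ (l, w) ^ 2 = F l (w ^ 2) := by
    intro l hl w hw
    by_cases h0 : w = 0
    · simp [ρ, h0, hF0 l hl]
    · simp only [ρ, if_neg h0]
      rw [hEsq l hl _ (hlS w hw), two_mul, exp_add, exp_log h0, sq]
  have hρneg : ∀ l ∈ G.renormDomain s, ∀ w ∈ closedBall (0 : ℂ) 1, ρ (l, -w) = -ρ (l, w) := by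
    intro l hl w hw
    by_cases h0 : w = 0
    · simp [ρ, h0]
    · have hw' : -w ∈ closedBall (0 : ℂ) 1 := by simpa using hw
      simp only [ρ, if_neg h0, if_neg (neg_ne_zero.2 h0)]
      rw [← hE1 l hl _ (hlS w hw)]
      refine hEper l hl _ (hlS _ hw') _ (hShift _ (hlS w hw)) ?_
      rw [exp_add, exp_log h0, exp_log (neg_ne_zero.2 h0), exp_pi_mul_I]
      ring
  have hsqb : ∀ w ∈ closedBall (0 : ℂ) 1, w ^ 2 ∈ closedBall (0 : ℂ) 1 := fun w hw => by
    rw [mem_closedBall_zero_iff] at hw ⊢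
    rw [norm_pow]
    exact pow_le_one₀ (norm_nonneg _) hw
  have hρc : ContinuousOn ρ (G.renormDomain s ×ˢ closedBall 0 1) := by
    rintro ⟨l₀, w₀⟩ ⟨hl₀, hw₀⟩
    simp only at hl₀ hw₀
    by_cases h0 : w₀ = 0
    · subst h0
      have h1 : ContinuousWithinAt (fun p : ℂ × ℂ => F p.1 (p.2 ^ 2) - G.critVal p.1)
          (G.renormDomain s ×ˢ closedBall 0 1) (l₀, 0) :=
        ((hF.1.comp (f := fun p : ℂ × ℂ => (p.1, p.2 ^ 2)) (by fun_prop)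
          fun p hp => ⟨hp.1, hsqb _ hp.2⟩).sub
          (H.differentiableOn_critVal.continuousOn.comp continuousOn_fst
            fun p hp => hD hp.1)) (l₀, 0) ⟨hl₀, hw₀⟩
      have h2 : Tendsto (fun p => ρ p ^ 2) (𝓝[G.renormDomain s ×ˢ closedBall 0 1] (l₀, 0))
          (𝓝 0) := by
        have h3 := h1.tendsto
        simp only [ne_eq, OfNat.ofNat_ne_zero, not_false_eq_true, zero_pow, hF0 l₀ hl₀,
          sub_self] at h3
        refine h3.congr' ?_
        filter_upwards [self_mem_nhdsWithin] with p hp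
        rw [← hρsq p.1 hp.1 p.2 hp.2]
        simp
      have h4 : ρ (l₀, 0) = 0 := by simp [ρ]
      rw [ContinuousWithinAt, h4, tendsto_zero_iff_norm_tendsto_zero]
      have h5 := (Real.continuous_sqrt.tendsto' 0 0 Real.sqrt_zero).comp
        (tendsto_zero_iff_norm_tendsto_zero.1 h2)
      refine h5.congr fun p => ?_
      simp [Real.sqrt_sq (norm_nonneg _)]
    · have h1 : ContinuousAt (fun p : ℂ × ℂ => Complex.log (p.2 / w₀) + Complex.log w₀)
          (l₀, w₀) := by
        refine ContinuousAt.add (ContinuousAt.clog (by fun_prop) ?_) continuousAt_const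
        simp [div_self h0]
      have hex : ∀ p : ℂ × ℂ, p.2 ≠ 0 →
          exp (Complex.log (p.2 / w₀) + Complex.log w₀) = p.2 := fun p hp => by
        rw [exp_add, exp_log (div_ne_zero hp h0), exp_log h0, div_mul_cancel₀ _ h0]
      have hmS : ∀ p : ℂ × ℂ, p.2 ≠ 0 → p.2 ∈ closedBall (0 : ℂ) 1 →
          Complex.log (p.2 / w₀) + Complex.log w₀ ∈ S := fun p hp hpb => by
        have h2 := congrArg (‖·‖) (hex p hp)
        simp only [norm_exp] at h2
        rw [mem_closedBall_zero_iff, ← h2, Real.exp_le_one_iff] at hpb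
        exact hpb
      set T : Set (ℂ × ℂ) := G.renormDomain s ×ˢ closedBall 0 1 ∩ {p | p.2 ≠ 0}
      have hT0 : (l₀, w₀) ∈ T := ⟨⟨hl₀, hw₀⟩, h0⟩
      have h3 : ContinuousWithinAt
          (fun p : ℂ × ℂ => E p.1 (Complex.log (p.2 / w₀) + Complex.log w₀)) T (l₀, w₀) := by
        have h4 : ContinuousWithinAt
            (fun p : ℂ × ℂ => M (p.1, Complex.log (p.2 / w₀) + Complex.log w₀)) T (l₀, w₀) := by
          refine ContinuousWithinAt.comp (t := G.renormDomain s ×ˢ S)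
            (f := fun p : ℂ × ℂ => (p.1, Complex.log (p.2 / w₀) + Complex.log w₀))
            (hM _ ⟨hl₀, hmS (l₀, w₀) h0 hw₀⟩)
            (continuousWithinAt_fst.prodMk h1.continuousWithinAt)
            fun p hp => ⟨hp.1.1, hmS p hp.2 hp.1.2⟩
        exact (h4.div_const 2).cexp
      have heq : ∀ p ∈ T, ρ p = E p.1 (Complex.log (p.2 / w₀) + Complex.log w₀) := fun p hp => by
        have hp2 : p.2 ≠ 0 := hp.2
        simp only [ρ, if_neg hp2]
        exact hEper _ hp.1.1 _ (hlS _ hp.1.2) _ (hmS p hp2 hp.1.2)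
          (by rw [exp_log hp2, hex p hp2])
      refine (h3.congr heq (heq _ hT0)).mono_of_mem_nhdsWithin ?_
      exact inter_mem self_mem_nhdsWithin
        (nhdsWithin_le_nhds (continuousAt_snd.eventually_ne h0))
  have hρs : ∀ l ∈ G.renormDomain s, ∀ w ∈ closedBall (0 : ℂ) 1,
      ρ (l, w) ∈ G.sqrtFiber l := fun l hl w hw => by
    show _ ∈ G.U l
    rw [hρsq l hl w hw]
    exact H.closure_landing_subset hs (hD hl) (hFcl l hl _ (hsqb w hw))
  have hg : ∀ l ∈ G.renormDomain s, ∀ w ∈ closedBall (0 : ℂ) 1,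
      κ (l, ρ (l, w)) ∈ G.V G.o l ∧ G.g G.o l (κ (l, ρ (l, w))) = F l (w ^ 2) := fun l hl w hw =>
    ⟨(hκ' l (hD hl)).2.1.mapsTo (hρs l hl w hw), by
      rw [(hκ' l (hD hl)).2.2 _ (hρs l hl w hw), hρsq l hl w hw]⟩
  have hsqball : ∀ w : ℂ, w ^ 2 ∈ ball (0 : ℂ) 1 ↔ w ∈ ball (0 : ℂ) 1 := fun w => by
    rw [mem_ball_zero_iff, mem_ball_zero_iff, norm_pow]
    exact pow_lt_one_iff_of_nonneg (norm_nonneg _) two_ne_zero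
  refine ⟨F, fun l w => κ (l, ρ (l, w)), hF, ⟨?_, ?_, ?_⟩, fun l hl => ⟨hF0 l hl, hg l hl⟩⟩
  · exact hκ.comp (f := fun p : ℂ × ℂ => (p.1, ρ (p.1, p.2))) (continuousOn_fst.prodMk hρc)
      fun p hp => ⟨hD hp.1, hρs _ hp.1 _ hp.2⟩
  · intro l hl w hw w' hw' hww
    have h1 : ρ (l, w) = ρ (l, w') :=
      (hκ' l (hD hl)).2.1.injOn (hρs l hl w hw) (hρs l hl w' hw') hww
    have h2 : w ^ 2 = w' ^ 2 := by
      refine hF.2 l hl (hsqb w hw) (hsqb w' hw') ?_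
      rw [← hρsq l hl w hw, ← hρsq l hl w' hw', h1]
    -- Oddness of `ρ` separates `w` from `-w`, which have the same image under the squared
    -- coordinate.
    rcases sq_eq_sq_iff_eq_or_eq_neg.1 h2 with h3 | h3
    · exact h3
    · rw [h3, hρneg l hl w' hw'] at h1
      have h4 : ρ (l, w') = 0 := by linear_combination (-1 / 2 : ℂ) * h1
      have h5 := hρsq l hl w' hw'
      rw [h4] at h5
      have h6 := hFne l hl _ (hsqb w' hw') (by rw [← h5]; ring)
      have h7 : w' = 0 := by simpa using h6
      rw [h3, h7, neg_zero]
  · intro l hl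
    ext z
    constructor
    · rintro ⟨w, hw, rfl⟩
      have h1 := hg l hl w (ball_subset_closedBall hw)
      refine ⟨h1.1, ?_⟩
      show G.g G.o l (κ (l, ρ (l, w))) ∈ _
      rw [h1.2]
      exact hF.mem hl ((hsqball w).2 hw)
    · rintro ⟨hz, hzL⟩
      rw [← hF.3 l hl] at hzL
      obtain ⟨v, hv, hvz⟩ := hzL
      obtain ⟨w, rfl⟩ := IsAlgClosed.exists_pow_nat_eq v (n := 2) (by norm_num)
      have hw := (hsqball w).1 hv
      have hwc := ball_subset_closedBall hw
      obtain ⟨x, hx, rfl⟩ := (hκ' l (hD hl)).2.1.surjOn hz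
      simp only at hvz
      rw [(hκ' l (hD hl)).2.2 x hx, ← hρsq l hl w hwc] at hvz
      rcases sq_eq_sq_iff_eq_or_eq_neg.1 (add_left_cancel hvz) with h1 | h1
      · exact ⟨w, hw, by simp only [h1]⟩
      · exact ⟨-w, by simpa using hw, by simp only [hρneg l hl w hwc, h1, neg_neg]⟩

end RenormDisc

end FiberMap

namespace FiberMap

variable {ι : Type*} {G : FiberMap ι} {h : ℂ → ℂ → ℂ} {l : ℂ} {s t : List ι} {c : ℝ → ℂ} {e : ℂ}
  {q : ℂ → ℂ}

/-- The fibers of the renormalized tubes. -/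
def RenormIndex.fiber (j : G.RenormIndex s) (l : ℂ) : Set ℂ := {z | (l, z) ∈ j.1.2}

/-- `P` trivializes the tube with index `j`; it lifts a trivialization `F` of the landing tube up
to a power map. -/
structure RenormTube (j : G.RenormIndex s) (F P : ℂ → ℂ → ℂ) (d : ℕ) : Prop where
  ne_zero : d ≠ 0
  landing : IsTrivialization (G.renormDomain s) (G.landing j.1.1) F
  trivialization : IsTrivialization (G.renormDomain s) j.fiber P
  lift : ∀ l ∈ G.renormDomain s, ∀ w ∈ closedBall (0 : ℂ) 1,
    P l w ∈ G.V G.o l ∧ G.g G.o l (P l w) = F l (w ^ d)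

theorem RenormIndex.subset_pullback (j : G.RenormIndex s) : j.1.2 ⊆ G.pullback s j.1.1 := by
  obtain ⟨p, -, hp⟩ := j.2.2
  rw [hp]
  exact connectedComponentIn_subset _ _

namespace RenormDisc

/-- The preimage of the landing tube around the critical value is the image of one connected disc
bundle, so only one tube carries the word `s`. -/
theorem fiber_eq_of_word_eq (R : G.RenormDisc s c e q) (H : G.IsHolomorphicFamily h)
    (hs : ∀ i ∈ s, i ≠ G.o) {j : G.RenormIndex s} (hj : j.1.1 = s) :
    j.1.2 = G.pullback s s := by
  obtain ⟨F, P, -, hP, -⟩ := R.exists_central_lift H hs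
  obtain ⟨p, hp, hjp⟩ := j.2.2
  rw [hj] at hp hjp
  rw [hjp]
  refine (connectedComponentIn_subset _ _).antisymm ?_
  exact (hP.isPreconnected_tube isPreconnected_connectedComponentIn).subset_connectedComponentIn
    hp Subset.rfl

/-- A tube over a landing tube that avoids the critical value is one of the two lifts. -/
theorem eq_tube_of_lifts (R : G.RenormDisc s c e q) {F : ℂ → ℂ → ℂ} {P : Bool → ℂ → ℂ → ℂ}
    (hF : IsTrivialization (G.renormDomain s) (G.landing t) F)
    (hP : ∀ b, IsTrivialization (G.renormDomain s) (fun l => P b l '' ball 0 1) (P b) ∧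
      ∀ l ∈ G.renormDomain s, ∀ w ∈ closedBall (0 : ℂ) 1,
        P b l w ∈ G.V G.o l ∧ G.g G.o l (P b l w) = F l w)
    (hne : ∀ l ∈ G.renormDomain s, ∀ w ∈ closedBall (0 : ℂ) 1, ∀ w' ∈ closedBall (0 : ℂ) 1,
      P true l w ≠ P false l w')
    (hex : ∀ l ∈ G.renormDomain s, ∀ z ∈ G.V G.o l, ∀ w ∈ closedBall (0 : ℂ) 1,
      G.g G.o l z = F l w → ∃ b, P b l w = z) {j : G.RenormIndex s} (hj : j.1.1 = t) :
    ∃ b, j.1.2 = tube (G.renormDomain s) fun l => P b l '' ball 0 1 := by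
  set T : Bool → Set (ℂ × ℂ) := fun b => tube (G.renormDomain s) fun l => P b l '' ball 0 1
  have hT : G.pullback s t = T true ∪ T false := by
    ext ⟨l, z⟩
    constructor
    · rintro ⟨hl, hz, hzL⟩
      simp only at hl hz hzL
      rw [← hF.3 l hl] at hzL
      obtain ⟨w, hw, hwz⟩ := hzL
      obtain ⟨b, hb⟩ := hex l hl z hz w (ball_subset_closedBall hw) hwz.symm
      cases b
      · exact Or.inr ⟨hl, w, hw, hb⟩
      · exact Or.inl ⟨hl, w, hw, hb⟩
    · have key : ∀ b, (l, z) ∈ T b → (l, z) ∈ G.pullback s t := by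
        rintro b ⟨hl, w, hw, hwz⟩
        simp only at hl hwz
        have h1 := (hP b).2 l hl w (ball_subset_closedBall hw)
        rw [hwz] at h1
        exact ⟨hl, h1.1, by simp only; rw [h1.2]; exact hF.mem hl hw⟩
      rintro (h | h)
      · exact key _ h
      · exact key _ h
  have ho : ∀ b, IsOpen (T b) := fun b => (hP b).1.isOpen_tube R.isOpen
  have hc : ∀ b, IsPreconnected (T b) := fun b =>
    (hP b).1.isPreconnected_tube isPreconnected_connectedComponentIn
  have hd : Disjoint (T true) (T false) := by
    rw [Set.disjoint_left]
    rintro ⟨l, z⟩ ⟨hl, w, hw, hwz⟩ ⟨_, w', hw', hwz'⟩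
    exact hne l hl w (ball_subset_closedBall hw) w' (ball_subset_closedBall hw')
      (hwz.trans hwz'.symm)
  obtain ⟨p, hp, hjp⟩ := j.2.2
  rw [hj, hT] at hp hjp
  rcases hp with hp | hp
  · exact ⟨true, by rw [hjp, connectedComponentIn_eq_of_isOpen (ho _) (ho _) hd (hc _) hp]⟩
  · refine ⟨false, ?_⟩
    rw [hjp, union_comm, connectedComponentIn_eq_of_isOpen (ho _) (ho _) hd.symm (hc _) hp]

/-- The power `d` is the degree of the map from the tube onto its landing tube: `2` for the word
`s`, `1` for all others. -/
theorem exists_renormTube (R : G.RenormDisc s c e q) (H : G.IsHolomorphicFamily h)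
    (hs : ∀ i ∈ s, i ≠ G.o) (j : G.RenormIndex s) :
    ∃ F P d, RenormTube j F P d ∧ (j.1.1 ≠ s → d = 1) := by
  by_cases hj : j.1.1 = s
  · obtain ⟨F, P, hF, hP, hFP⟩ := R.exists_central_lift H hs
    refine ⟨F, P, 2, ⟨two_ne_zero, by rw [hj]; exact hF, ⟨hP.1, hP.2, fun l hl => ?_⟩,
      fun l hl => (hFP l hl).2⟩, fun h => absurd hj h⟩
    rw [hP.3 l hl]
    ext z
    simp only [RenormIndex.fiber, R.fiber_eq_of_word_eq H hs hj, pullback, mem_ofPred_eq, hl,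
      true_and]
  · obtain ⟨F₀, hF₀⟩ := H.exists_trivialization_V G.o
    have hF := (H.trivialization_landing j.2.1 hF₀).mono R.subset_D
    obtain ⟨P, hP, hne, hex⟩ := R.exists_lifts H hs j.2.1 hj hF
    obtain ⟨b, hb⟩ := R.eq_tube_of_lifts hF hP hne hex rfl
    refine ⟨_, P b, 1, ⟨one_ne_zero, hF, ⟨(hP b).1.1, (hP b).1.2, fun l hl => ?_⟩,
      fun l hl w hw => by rw [pow_one]; exact (hP b).2 l hl w hw⟩, fun _ => rfl⟩
    ext z
    simp only [RenormIndex.fiber, hb, tube, mem_ofPred_eq, hl, true_and]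

end RenormDisc

namespace RenormTube

variable {j : G.RenormIndex s} {F P : ℂ → ℂ → ℂ} {d : ℕ}

theorem pow_mem (hd : d ≠ 0) {w : ℂ} (hw : w ∈ closedBall (0 : ℂ) 1) :
    w ^ d ∈ closedBall (0 : ℂ) 1 ∧ (w ^ d ∈ sphere (0 : ℂ) 1 ↔ w ∈ sphere (0 : ℂ) 1) := by
  rw [mem_closedBall_zero_iff] at hw
  rw [mem_closedBall_zero_iff, mem_sphere_zero_iff_norm, mem_sphere_zero_iff_norm, norm_pow]
  exact ⟨pow_le_one₀ (norm_nonneg _) hw, pow_eq_one_iff_of_nonneg (norm_nonneg _) hd⟩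

theorem mem_of_mem_closure (T : RenormTube j F P d) (hl : l ∈ G.renormDomain s) {z : ℂ}
    (hz : z ∈ closure (j.fiber l)) :
    z ∈ G.V G.o l ∧ G.g G.o l z ∈ closure (G.landing j.1.1 l) := by
  rw [T.trivialization.closure_eq hl] at hz
  obtain ⟨w, hw, rfl⟩ := hz
  have h1 := T.lift l hl w hw
  refine ⟨h1.1, ?_⟩
  rw [h1.2, T.landing.closure_eq hl]
  exact mem_image_of_mem _ (pow_mem T.ne_zero hw).1

/-- In the trivializing coordinates the map is `w ↦ w ^ d`, under which only unit vectors go to unit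
vectors. -/
theorem mem_frontier_iff (T : RenormTube j F P d) (hl : l ∈ G.renormDomain s) {z : ℂ}
    (hz : z ∈ closure (j.fiber l)) :
    z ∈ frontier (j.fiber l) ↔ G.g G.o l z ∈ frontier (G.landing j.1.1 l) := by
  rw [T.trivialization.closure_eq hl] at hz
  obtain ⟨w, hw, rfl⟩ := hz
  have hw' := pow_mem T.ne_zero hw
  have key : ∀ {X : ℂ → Set ℂ} {Q : ℂ → ℂ → ℂ}, IsTrivialization (G.renormDomain s) X Q →
      ∀ v ∈ closedBall (0 : ℂ) 1, (Q l v ∈ frontier (X l) ↔ v ∈ sphere (0 : ℂ) 1) := by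
    intro X Q hQ v hv
    rw [hQ.frontier_eq hl]
    refine ⟨?_, mem_image_of_mem _⟩
    rintro ⟨u, hu, huv⟩
    rwa [← hQ.2 l hl (sphere_subset_closedBall hu) hv huv]
  rw [key T.trivialization w hw, (T.lift l hl w hw).2, key T.landing _ hw'.1, hw'.2]

theorem bijOn (T : RenormTube j F P d) (hd : d = 1) (hl : l ∈ G.renormDomain s) :
    BijOn (G.g G.o l) (j.fiber l) (G.landing j.1.1 l) := by
  subst hd
  have hb : ∀ w ∈ ball (0 : ℂ) 1, G.g G.o l (P l w) = F l w := fun w hw => by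
    rw [(T.lift l hl w (ball_subset_closedBall hw)).2, pow_one]
  rw [← T.trivialization.3 l hl, ← T.landing.3 l hl]
  refine ⟨?_, ?_, ?_⟩
  · rintro _ ⟨w, hw, rfl⟩
    exact ⟨w, hw, (hb w hw).symm⟩
  · rintro _ ⟨w, hw, rfl⟩ _ ⟨v, hv, rfl⟩ hwv
    rw [hb w hw, hb v hv] at hwv
    rw [T.landing.2 l hl (ball_subset_closedBall hw) (ball_subset_closedBall hv) hwv]
  · rintro _ ⟨w, hw, rfl⟩
    exact ⟨P l w, ⟨w, hw, rfl⟩, hb w hw⟩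

end RenormTube

namespace RenormDisc

/-- Different words have disjoint closed landing domains. For the same word the two tubes are
opposite square roots, which are disjoint even over closed discs; the word `s` has only one tube. -/
theorem disjoint_closure_fiber (R : G.RenormDisc s c e q) (H : G.IsHolomorphicFamily h)
    (hs : ∀ i ∈ s, i ≠ G.o) {j j' : G.RenormIndex s} (hjj : j ≠ j') (hl : l ∈ G.renormDomain s) :
    Disjoint (closure (j.fiber l)) (closure (j'.fiber l)) := by
  by_cases hw : j.1.1 = j'.1.1
  · have hne : j.1.2 ≠ j'.1.2 := fun h => hjj (Subtype.ext (Prod.ext hw h))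
    by_cases hj : j.1.1 = s
    · exact absurd ((R.fiber_eq_of_word_eq H hs hj).trans
        (R.fiber_eq_of_word_eq H hs (hw ▸ hj)).symm) hne
    · obtain ⟨F₀, hF₀⟩ := H.exists_trivialization_V G.o
      have hF := (H.trivialization_landing j.2.1 hF₀).mono R.subset_D
      obtain ⟨P, hP, hPne, hex⟩ := R.exists_lifts H hs j.2.1 hj hF
      obtain ⟨b, hb⟩ := R.eq_tube_of_lifts hF hP hPne hex (j := j) rfl
      obtain ⟨b', hb'⟩ := R.eq_tube_of_lifts hF hP hPne hex (j := j') hw.symm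
      have hbb : b ≠ b' := by
        rintro rfl
        exact hne (hb.trans hb'.symm)
      have hcl : ∀ (k : G.RenormIndex s) (b : Bool),
          k.1.2 = tube (G.renormDomain s) (fun l => P b l '' ball 0 1) →
          closure (k.fiber l) = P b l '' closedBall 0 1 := by
        intro k b hk
        rw [← (hP b).1.closure_eq hl]
        congr 1
        ext z
        simp only [RenormIndex.fiber, hk, tube, mem_ofPred_eq, hl, true_and]
      rw [hcl j b hb, hcl j' b' hb', Set.disjoint_left]
      rintro _ ⟨w, hw, rfl⟩ ⟨v, hv, hvw⟩
      cases b <;> cases b'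
      · exact hbb rfl
      · exact hPne l hl v hv w hw hvw
      · exact hPne l hl w hw v hv hvw.symm
      · exact hbb rfl
  · obtain ⟨F, P, d, T, -⟩ := R.exists_renormTube H hs j
    obtain ⟨F', P', d', T', -⟩ := R.exists_renormTube H hs j'
    rw [Set.disjoint_left]
    intro z hz hz'
    exact Set.disjoint_left.1 (H.disjoint_closure_landing (R.subset_D hl) j.2.1 j'.2.1 hw)
      (T.mem_of_mem_closure hl hz).2 (T'.mem_of_mem_closure hl hz').2

/-- Near the boundary of a tube, the points that map to the boundary of the landing tube lie on the
boundary of the tube. -/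
theorem eventually_mem_frontier (R : G.RenormDisc s c e q) (H : G.IsHolomorphicFamily h)
    (hs : ∀ i ∈ s, i ≠ G.o) {j : G.RenormIndex s} (hl : l ∈ G.renormDomain s) {p : ℂ}
    (hp : p ∈ frontier (j.fiber l)) :
    ∀ᶠ z in 𝓝 p, G.g G.o l z ∈ frontier (G.landing j.1.1 l) → z ∈ frontier (j.fiber l) := by
  have hlD := R.subset_D hl
  obtain ⟨F, P, d, T, -⟩ := R.exists_renormTube H hs j
  have hpV := (T.mem_of_mem_closure hl (frontier_subset_closure hp)).1
  by_cases hj : j.1.1 = s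
  · filter_upwards [(H.isOpen_V G.o hlD).mem_nhds hpV] with z hz hzf
    refine (T.mem_frontier_iff hl ?_).2 hzf
    obtain ⟨F', P', hF', hP', hFP'⟩ := R.exists_central_lift H hs
    have hfib : j.fiber l = {z | z ∈ G.V G.o l ∧ G.g G.o l z ∈ G.landing s l} := by
      ext z
      simp only [RenormIndex.fiber, R.fiber_eq_of_word_eq H hs hj, pullback, mem_ofPred_eq, hl,
        true_and]
    rw [hj] at hzf
    rw [hfib, mem_closure_iff_nhds]
    intro N hN
    have hcl := frontier_subset_closure hzf
    have hz0 : z ≠ 0 := by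
      rintro rfl
      have h1 : G.critVal l ∈ frontier (G.landing s l) := hzf
      rw [(H.isOpen_landing hs hlD).frontier_eq] at h1
      exact h1.2 (critVal_mem hl)
    have han := (H.analyticAt_g hlD (subset_closure hz)).fiber
    have hmap : map (G.g G.o l) (𝓝 z) = 𝓝 (G.g G.o l z) := by
      have h1 := han.hasStrictDerivAt
      exact h1.map_nhds_eq (H.deriv_central_ne_zero hlD hz hz0)
    -- The map is open at `z`, which is not critical, so points of the landing domain near the image
    -- have preimages near `z`.
    have him : G.g G.o l '' (N ∩ G.V G.o l) ∈ 𝓝 (G.g G.o l z) := by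
      rw [← hmap]
      exact image_mem_map (inter_mem hN ((H.isOpen_V G.o hlD).mem_nhds hz))
    obtain ⟨_, ⟨v, ⟨hvN, hvV⟩, rfl⟩, hvL⟩ := mem_closure_iff_nhds.1 hcl _ him
    exact ⟨v, hvN, hvV, hvL⟩
  · obtain ⟨F₀, hF₀⟩ := H.exists_trivialization_V G.o
    have hF := (H.trivialization_landing j.2.1 hF₀).mono R.subset_D
    obtain ⟨Q, hQ, hQne, hex⟩ := R.exists_lifts H hs j.2.1 hj hF
    obtain ⟨b, hb⟩ := R.eq_tube_of_lifts hF hQ hQne hex (j := j) rfl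
    have hcl : closure (j.fiber l) = Q b l '' closedBall 0 1 := by
      rw [← (hQ b).1.closure_eq hl]
      congr 1
      ext z
      simp only [RenormIndex.fiber, hb, tube, mem_ofPred_eq, hl, true_and]
    -- The other lift is closed and does not contain `p`, so near `p` all preimages of the closed
    -- landing domain belong to this tube.
    have hcpt : IsClosed (Q (!b) l '' closedBall 0 1) :=
      ((isCompact_closedBall (0 : ℂ) 1).image_of_continuousOn
        ((hQ (!b)).1.continuousOn_fiber hl)).isClosed
    have hpn : p ∉ Q (!b) l '' closedBall 0 1 := by
      have h1 := frontier_subset_closure hp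
      rw [hcl] at h1
      obtain ⟨w, hw, rfl⟩ := h1
      rintro ⟨v, hv, hvw⟩
      cases b
      · exact hQne l hl v hv w hw hvw
      · exact hQne l hl w hw v hv hvw.symm
    filter_upwards [(H.isOpen_V G.o hlD).mem_nhds hpV, hcpt.isOpen_compl.mem_nhds hpn]
      with z hz hzn hzf
    refine (T.mem_frontier_iff hl ?_).2 hzf
    have h2 := frontier_subset_closure hzf
    rw [hF.closure_eq hl] at h2
    obtain ⟨w, hw, hwz⟩ := h2
    obtain ⟨b', rfl⟩ := hex l hl z hz w hw hwz.symm
    by_cases hbb : b' = b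
    · rw [hcl, hbb]
      exact mem_image_of_mem _ hw
    · have : b' = !b := Bool.eq_not_of_ne hbb
      subst this
      exact (hzn ⟨w, hw, rfl⟩).elim

end RenormDisc

end FiberMap

/-! ### Pulling back quasicircles -/

/-- Near a point of nonvanishing strict derivative, bounded turning can be pulled back. -/
theorem IsQuasicircle.exists_local_turning {f : ℂ → ℂ} {J J' : Set ℂ} (hJ : IsQuasicircle J)
    {p f' : ℂ} (hf : HasStrictDerivAt f f' p) (hf' : f' ≠ 0) (hm : MapsTo f J' J)
    (hloc : ∀ᶠ z in 𝓝 p, f z ∈ J → z ∈ J') :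
    ∃ r > 0, ∃ K : ℝ, ∀ x ∈ J' ∩ ball p r, ∀ y ∈ J' ∩ ball p r,
      ∃ A ⊆ J', IsConnected A ∧ x ∈ A ∧ y ∈ A ∧ diam A ≤ K * dist x y := by
  obtain ⟨⟨γ, hγ⟩, C, hC⟩ := hJ
  have hJb : Bornology.IsBounded J := hγ.isCompact.isBounded
  set a : ℝ := ‖f'‖
  have ha : 0 < a := norm_pos_iff.2 hf'
  have hsub : ∀ᶠ z : ℂ × ℂ in 𝓝 (p, p),
      ‖f z.1 - f z.2 - f' * (z.1 - z.2)‖ ≤ a / 2 * ‖z.1 - z.2‖ := by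
    have h1 := hf.hasStrictFDerivAt.isLittleO.def (half_pos ha)
    filter_upwards [h1] with z hz
    simpa [mul_comm] using hz
  rw [nhds_prod_eq] at hsub
  obtain ⟨N, hN, hN'⟩ := (eventually_prod_self_iff (r := fun x y => ‖f x - f y - f' * (x - y)‖ ≤
    a / 2 * ‖x - y‖)).1 hsub
  obtain ⟨ρ, hρ, hρN⟩ := Metric.mem_nhds_iff.1 (inter_mem hN hloc)
  -- Strict differentiability makes `f` bilipschitz near `p`, with constants `a / 2` and `3a / 2`
  -- around the modulus `a` of the derivative.
  have hlow : ∀ x ∈ ball p ρ, ∀ y ∈ ball p ρ, a / 2 * dist x y ≤ dist (f x) (f y) := by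
    intro x hx y hy
    have h1 := hN' x (hρN hx).1 y (hρN hy).1
    have h2 := norm_sub_norm_le (f' * (x - y)) (f x - f y)
    rw [norm_mul, norm_sub_rev (f' * (x - y))] at h2
    rw [dist_eq, dist_eq]
    linarith
  have hup : ∀ x ∈ ball p ρ, ∀ y ∈ ball p ρ, dist (f x) (f y) ≤ 3 / 2 * a * dist x y := by
    intro x hx y hy
    have h1 := hN' x (hρN hx).1 y (hρN hy).1
    have h2 := norm_sub_norm_le (f x - f y) (f' * (x - y))
    rw [norm_mul] at h2
    rw [dist_eq, dist_eq]
    linarith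
  have hinj : InjOn f (ball p ρ) := fun x hx y hy hxy => by
    have := hlow x hx y hy
    rw [hxy, dist_self] at this
    exact dist_le_zero.1 (by nlinarith [dist_nonneg (x := x) (y := y)])
  have himg : f '' ball p ρ ∈ 𝓝 (f p) := by
    rw [← hf.map_nhds_eq hf']
    exact image_mem_map (ball_mem_nhds p hρ)
  obtain ⟨η, hη, hηf⟩ := Metric.mem_nhds_iff.1 himg
  set C' : ℝ := |C|
  have hC' : 0 ≤ C' := abs_nonneg C
  -- Small enough that the connecting set of two image points stays in the ball of radius `η`
  -- covered by `f`, where it can be lifted.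
  set r : ℝ := min ρ (η / (2 * a * (2 + 2 * C' * 2)))
  have hr : 0 < r := lt_min hρ (by positivity)
  have hra : 2 * a * (2 + 2 * C' * 2) * r ≤ η := by
    have := min_le_right ρ (η / (2 * a * (2 + 2 * C' * 2)))
    rwa [le_div_iff₀ (by positivity), mul_comm] at this
  -- The constant is `C'` times the ratio of the Lipschitz bounds, `(2 / a) * (3a / 2) = 3`.
  refine ⟨r, hr, 3 * C', fun x hx y hy => ?_⟩
  have hrρ : ball p r ⊆ ball p ρ := ball_subset_ball (min_le_left _ _)
  have hpρ := mem_ball_self (x := p) hρ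
  obtain ⟨A, hAJ, hAc, hxA, hyA, hAd⟩ := hC _ (hm hx.1) _ (hm hy.1)
  have hAb : Bornology.IsBounded A := hJb.subset hAJ
  have hxy : dist x y ≤ 2 * r := by
    have h1 := dist_triangle_right x y p
    have h2 := mem_ball.1 hx.2
    have h3 := mem_ball.1 hy.2
    linarith
  have hd0 : dist (f x) (f y) ≤ 3 / 2 * a * dist x y := hup x (hrρ hx.2) y (hrρ hy.2)
  have hAd' : diam A ≤ C' * (3 / 2 * a * dist x y) :=
    hAd.trans ((mul_le_mul_of_nonneg_right (le_abs_self C) dist_nonneg).trans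
      (mul_le_mul_of_nonneg_left hd0 hC'))
  have hAη : A ⊆ ball (f p) η := by
    intro w hw
    rw [mem_ball]
    have h1 := dist_triangle w (f x) (f p)
    have h2 := dist_le_diam_of_mem hAb hw hxA
    have h3 := hup x (hrρ hx.2) p hpρ
    have h4 := mem_ball.1 hx.2
    have h5 : C' * (3 / 2 * a * dist x y) ≤ C' * (3 / 2 * a * (2 * r)) := by gcongr
    have h6 : 3 / 2 * a * dist x p ≤ 3 / 2 * a * r := by gcongr
    have h7 : 0 < a * r := by positivity
    have h8 : 0 ≤ C' * (a * r) := by positivity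
    nlinarith
  have hex : ∀ w ∈ A, ∃ z ∈ ball p ρ, f z = w := fun w hw => hηf (hAη hw)
  choose! g hg hfg using hex
  have hgl : ∀ w ∈ A, ∀ v ∈ A, dist (g w) (g v) ≤ 2 / a * dist w v := by
    intro w hw v hv
    have := hlow _ (hg w hw) _ (hg v hv)
    rw [hfg w hw, hfg v hv] at this
    rw [div_mul_eq_mul_div, le_div_iff₀ ha]
    linarith
  have hgc : ContinuousOn g A := by
    have : LipschitzOnWith (Real.toNNReal (2 / a)) g A := LipschitzOnWith.of_dist_le_mul
      fun w hw v hv => by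
        rw [Real.coe_toNNReal _ (by positivity)]
        exact hgl w hw v hv
    exact this.continuousOn
  refine ⟨g '' A, ?_, hAc.image g hgc, ⟨f x, hxA, hinj (hg _ hxA) (hrρ hx.2) (hfg _ hxA)⟩,
    ⟨f y, hyA, hinj (hg _ hyA) (hrρ hy.2) (hfg _ hyA)⟩, ?_⟩
  · rintro _ ⟨w, hw, rfl⟩
    exact (hρN (hg w hw)).2 (by rw [hfg w hw]; exact hAJ hw)
  · refine diam_le_of_forall_dist_le (by positivity) ?_
    rintro _ ⟨w, hw, rfl⟩ _ ⟨v, hv, rfl⟩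
    refine (hgl w hw v hv).trans ?_
    have h1 := (dist_le_diam_of_mem hAb hw hv).trans hAd'
    calc 2 / a * dist w v ≤ 2 / a * (C' * (3 / 2 * a * dist x y)) := by gcongr
      _ = 3 * C' * dist x y := by field_simp

/-- The preimage of a quasicircle under a locally univalent map is a quasicircle. -/
theorem IsQuasicircle.pullback {f : ℂ → ℂ} {J J' : Set ℂ} {γ : ℝ → ℂ} (hJ : IsQuasicircle J)
    (hγ : IsJordanParam γ J') (hf : ∀ p ∈ J', AnalyticAt ℂ f p) (hd : ∀ p ∈ J', deriv f p ≠ 0)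
    (hm : MapsTo f J' J) (hloc : ∀ p ∈ J', ∀ᶠ z in 𝓝 p, f z ∈ J → z ∈ J') :
    IsQuasicircle J' := by
  have hcpt := hγ.isCompact
  choose! r hr K hK using fun p hp =>
    hJ.exists_local_turning (hf p hp).hasStrictDerivAt (hd p hp) hm (hloc p hp)
  obtain ⟨Z, hZ, hZc⟩ := hcpt.elim_nhds_subcover (fun p => ball p (r p / 2))
    fun p hp => ball_mem_nhds p (half_pos (hr p hp))
  have hne : Z.Nonempty := by
    rw [Finset.nonempty_iff_ne_empty]
    rintro rfl
    obtain ⟨x, hx⟩ := hγ.nonempty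
    simpa using hZc hx
  set δ : ℝ := Z.inf' hne fun p => r p / 2
  have hδ : 0 < δ := (Finset.lt_inf'_iff hne).2 fun p hp => half_pos (hr p (hZ p hp))
  set M : ℝ := Z.sup' hne K
  -- Points closer than `δ` share one of the finitely many local neighborhoods; for the others the
  -- whole curve serves as the connecting set.
  refine ⟨⟨γ, hγ⟩, max M (diam J' / δ), fun x hx y hy => ?_⟩
  by_cases hxy : dist x y < δ
  · obtain ⟨p, hp⟩ := mem_iUnion.1 (hZc hx)
    obtain ⟨hpZ, hxp⟩ := mem_iUnion.1 hp
    have hδp : δ ≤ r p / 2 := Finset.inf'_le (fun p => r p / 2) hpZ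
    have hrp := hr p (hZ p hpZ)
    have hyp : y ∈ ball p (r p) := by
      rw [mem_ball] at hxp ⊢
      have := dist_triangle_left y p x
      linarith
    obtain ⟨A, h1, h2, h3, h4, h5⟩ := hK p (hZ p hpZ) x
      ⟨hx, ball_subset_ball (by linarith) hxp⟩ y ⟨hy, hyp⟩
    exact ⟨A, h1, h2, h3, h4, h5.trans (mul_le_mul_of_nonneg_right
      ((Finset.le_sup' K hpZ).trans (le_max_left _ _)) dist_nonneg)⟩
  · refine ⟨J', Subset.rfl, ⟨hγ.nonempty, hγ.isPreconnected⟩, hx, hy, ?_⟩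
    calc diam J' = diam J' / δ * δ := by field_simp
      _ ≤ max M (diam J' / δ) * dist x y := mul_le_mul (le_max_right _ _) (not_lt.1 hxy) hδ.le
          ((div_nonneg diam_nonneg hδ.le).trans (le_max_right _ _))

namespace FiberMap

variable {ι : Type*} {G : FiberMap ι} {h : ℂ → ℂ → ℂ} {l : ℂ} {s t : List ι} {c : ℝ → ℂ} {e : ℂ}
  {q : ℂ → ℂ}

namespace RenormDisc

/-- The map on a renormalized tube is holomorphic near its closure. -/
theorem analyticAt_return (R : G.RenormDisc s c e q) (H : G.IsHolomorphicFamily h)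
    (hs : ∀ i ∈ s, i ≠ G.o) {j : G.RenormIndex s} (hl : l ∈ G.renormDomain s) {z : ℂ}
    (hz : z ∈ closure (j.fiber l)) :
    AnalyticAt ℂ (fun p : ℂ × ℂ => G.iter j.1.1 p.1 (G.g G.o p.1 p.2)) (l, z) := by
  obtain ⟨F, P, d, T, -⟩ := R.exists_renormTube H hs j
  have h1 := T.mem_of_mem_closure hl hz
  exact (H.analyticAt_iter (R.subset_D hl) (H.closure_landing_subset_wordDomain j.2.1
    (R.subset_D hl) h1.2)).comp₂ analyticAt_fst (H.analyticAt_g (R.subset_D hl)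
    (subset_closure h1.1))

theorem ne_zero_of_mem_frontier (R : G.RenormDisc s c e q) (H : G.IsHolomorphicFamily h)
    (hs : ∀ i ∈ s, i ≠ G.o) (hl : l ∈ G.renormDomain s) (ht : ∀ i ∈ t, i ≠ G.o) {z : ℂ}
    (hz : G.g G.o l z ∈ frontier (G.landing t l)) : z ≠ 0 := by
  rintro rfl
  have hlD := R.subset_D hl
  have h1 : G.critVal l ∈ frontier (G.landing t l) := hz
  have h2 : G.critVal l ∈ G.landing s l := critVal_mem hl
  by_cases hts : t = s
  · subst hts
    rw [(H.isOpen_landing ht hlD).frontier_eq] at h1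
    exact h1.2 h2
  · exact Set.disjoint_left.1 (H.disjoint_closure_landing hlD ht hs hts)
      (frontier_subset_closure h1) (subset_closure h2)

/-- The first return map takes the boundary to the quasicircle bounding the central disc. It is
locally univalent there, because the critical point is not on the boundary. -/
theorem isQuasicircle_fiber (R : G.RenormDisc s c e q) (H : G.IsHolomorphicFamily h)
    (hs : ∀ i ∈ s, i ≠ G.o) (j : G.RenormIndex s) (hl : l ∈ G.renormDomain s) :
    IsQuasicircle (frontier (j.fiber l)) := by
  obtain ⟨F, P, d, T, -⟩ := R.exists_renormTube H hs j
  have hlD := R.subset_D hl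
  have hfr : ∀ p ∈ frontier (j.fiber l), p ∈ G.V G.o l ∧
      G.g G.o l p ∈ frontier (G.landing j.1.1 l) := fun p hp =>
    ⟨(T.mem_of_mem_closure hl (frontier_subset_closure hp)).1,
      (T.mem_frontier_iff hl (frontier_subset_closure hp)).1 hp⟩
  have hfl := H.frontier_landing j.2.1 hlD
  refine (H.quasicircle_V G.o l hlD).pullback (f := fun z => G.iter j.1.1 l (G.g G.o l z))
    (T.trivialization.isJordanParam hl)
    (fun p hp => (R.analyticAt_return H hs hl (frontier_subset_closure hp)).fiber
      (g := fun l z => G.iter j.1.1 l (G.g G.o l z))) (fun p hp => ?_) (fun p hp => ?_)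
    (fun p hp => ?_)
  · have h1 := hfr p hp
    have h2 := h1.2
    rw [hfl] at h2
    have h3 := (H.analyticAt_iter hlD h2.1).fiber.differentiableAt.hasDerivAt
    have h4 := (H.analyticAt_g hlD (subset_closure h1.1)).fiber.differentiableAt.hasDerivAt
    have h5 : HasDerivAt (fun z => G.iter j.1.1 l (G.g G.o l z)) _ p := HasDerivAt.comp p h3 h4
    rw [h5.deriv]
    exact mul_ne_zero (H.deriv_iter_ne_zero hlD j.2.1 h2.1) (H.deriv_central_ne_zero hlD h1.1
      (R.ne_zero_of_mem_frontier H hs hl j.2.1 h1.2))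
  · have h2 := (hfr p hp).2
    rw [hfl] at h2
    exact h2.2
  · have h1 := hfr p hp
    have h2 := h1.2
    rw [hfl] at h2
    have hc := (H.analyticAt_g hlD (subset_closure h1.1)).fiber.continuousAt
    filter_upwards [R.eventually_mem_frontier H hs hl hp,
      hc ((H.isOpen_wordDomain hlD j.1.1).mem_nhds h2.1)] with z hz1 hz2 hz3
    refine hz1 ?_
    rw [hfl]
    exact ⟨hz2, hz3⟩

end RenormDisc

end FiberMap

/-! ### The lifted motion -/

namespace FiberMap

variable {ι : Type*} {G : FiberMap ι} {h : ℂ → ℂ → ℂ} {l : ℂ} {s t : List ι} {c : ℝ → ℂ} {e : ℂ}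
  {q : ℂ → ℂ}

namespace RenormDisc

/-- The lifted motion of the boundary of one tube. -/
theorem exists_motion_fiber (R : G.RenormDisc s c e q) (H : G.IsHolomorphicFamily h)
    (hs : ∀ i ∈ s, i ≠ G.o) (hb : G.base ∈ G.renormDomain s) (j : G.RenormIndex s) :
    ∃ k : ℂ → ℂ → ℂ, (∀ z ∈ frontier (j.fiber G.base), k G.base z = z ∧
        DifferentiableOn ℂ (fun l => k l z) (G.renormDomain s)) ∧
      ∀ l ∈ G.renormDomain s, InjOn (k l) (frontier (j.fiber G.base)) ∧
        k l '' frontier (j.fiber G.base) = frontier (j.fiber l) ∧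
        ∀ z ∈ frontier (j.fiber G.base),
          G.iter j.1.1 G.base (G.g G.o G.base z) ∈ frontier (G.V G.o G.base) ∧
          G.g G.o l (k l z) ∈ frontier (G.landing j.1.1 l) ∧
          G.iter j.1.1 l (G.g G.o l (k l z)) = h l (G.iter j.1.1 G.base (G.g G.o G.base z)) := by
  obtain ⟨F, P, d, T, -⟩ := R.exists_renormTube H hs j
  set t := j.1.1
  have ht : ∀ i ∈ t, i ≠ G.o := j.2.1
  set D' := G.renormDomain s
  have hD := R.subset_D
  set J := frontier (G.V G.o G.base)
  obtain ⟨W, hW, hWF, hFW⟩ := T.landing.exists_inverse R.isOpen.exists_isCompact_nhdsWithin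
  set σ : ℂ → ℂ → ℂ := fun l y => G.branch t l (h l y)
  have hU : ∀ l ∈ G.D, ∀ y ∈ J, h l y ∈ G.U l := fun l hl y hy =>
    H.frontier_V_subset _ hl (H.motion_mem G.o hl hy)
  have hσfr : ∀ l ∈ G.D, ∀ y ∈ J, σ l y ∈ frontier (G.landing t l) := fun l hl y hy =>
    (H.frontier_landing_eq_image hl ht).2 ⟨y, hy, rfl⟩
  have hσd : ∀ y ∈ J, DifferentiableOn ℂ (fun l => σ l y) G.D := fun y hy =>
    (H.differentiableOn_branch ht).comp (f := fun l => (l, h l y))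
      (differentiableOn_id.prodMk (H.motion.2.2 y (IsHolomorphicFamily.frontier_subset_boundarySet _ hy)))
      fun l hl => ⟨hl, hU l hl y hy⟩
  have hiterσ : ∀ l ∈ G.D, ∀ y ∈ J, G.iter t l (σ l y) = h l y := fun l hl y hy =>
    H.iter_branch hl ht (hU l hl y hy)
  have hhb : ∀ y ∈ J, h G.base y = y := fun y hy =>
    H.motion.2.1 y (IsHolomorphicFamily.frontier_subset_boundarySet _ hy)
  set w : ℂ → ℂ → ℂ := fun y l => W (l, σ l y)
  have hFw : ∀ y ∈ J, ∀ l ∈ D', F l (w y l) = σ l y := fun y hy l hl =>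
    (hFW l hl _ (frontier_subset_closure (hσfr l (hD hl) y hy))).2
  have hws : ∀ y ∈ J, ∀ l ∈ D', w y l ∈ sphere (0 : ℂ) 1 := by
    intro y hy l hl
    have h1 := hσfr l (hD hl) y hy
    have h2 := (hFW l hl _ (frontier_subset_closure h1)).1
    rw [T.landing.frontier_eq hl] at h1
    obtain ⟨v, hv, hvσ⟩ := h1
    have : w y l = v := by
      simp only [w]
      rw [← hvσ]
      exact hWF l hl v (sphere_subset_closedBall hv)
    rwa [this]
  have hw0 : ∀ y ∈ J, ∀ l ∈ D', w y l ≠ 0 := fun y hy l hl h0 => by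
    have := hws y hy l hl
    rw [h0] at this
    simp at this
  have hwc : ∀ y ∈ J, ContinuousOn (w y) D' := fun y hy =>
    hW.comp (continuousOn_id.prodMk ((hσd y hy).continuousOn.mono hD))
      fun l hl => ⟨hl, frontier_subset_closure (hσfr l (hD hl) y hy)⟩
  -- Simple connectivity of `D'` gives a logarithm of the moving coordinate relative to the base
  -- point; it provides the `d`-th roots below.
  have hlog : ∀ y ∈ J, ∃ Λ : ℂ → ℂ, ContinuousOn Λ D' ∧ Λ G.base = 0 ∧
      ∀ l ∈ D', w y l = w y G.base * exp (Λ l) := by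
    intro y hy
    obtain ⟨L, hL, hL'⟩ := exists_log_of_isSimplyConnected R.isTopDisc.2.1 R.isOpen
      (hwc y hy) (hw0 y hy)
    refine ⟨fun l => L l - L G.base, hL.sub continuousOn_const, sub_self _, fun l hl => ?_⟩
    rw [exp_sub, hL' l hl, hL' _ hb, mul_div_cancel₀ _ (hw0 y hy _ hb)]
  choose! Λ hΛc hΛb hΛ using hlog
  have hd0 : (d : ℂ) ≠ 0 := by exact_mod_cast T.ne_zero
  have hfr : ∀ l ∈ D', ∀ x ∈ frontier (j.fiber l), ∃ ξ ∈ sphere (0 : ℂ) 1, ∃ y ∈ J,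
      P l ξ = x ∧ ξ ^ d = w y l ∧ G.iter t l (G.g G.o l x) = h l y := by
    intro l hl x hx
    have hx' := hx
    rw [T.trivialization.frontier_eq hl] at hx
    obtain ⟨ξ, hξ, rfl⟩ := hx
    have hξc := sphere_subset_closedBall hξ
    have h1 := (T.mem_frontier_iff hl (frontier_subset_closure hx')).1 hx'
    obtain ⟨y, hy, hyσ⟩ := (H.frontier_landing_eq_image (hD hl) ht).1 h1
    have h2 : F l (ξ ^ d) = F l (w y l) := by
      rw [hFw y hy l hl, ← (T.lift l hl ξ hξc).2]
      exact hyσ.symm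
    refine ⟨ξ, hξ, y, hy, rfl, T.landing.2 l hl (RenormTube.pow_mem T.ne_zero hξc).1
      (sphere_subset_closedBall (hws y hy l hl)) h2, ?_⟩
    rw [← hyσ]
    exact hiterσ l (hD hl) y hy
  set y₀ : ℂ → ℂ := fun z => G.iter t G.base (G.g G.o G.base z)
  have hbase : ∀ z ∈ frontier (j.fiber G.base), ∃ ξ ∈ sphere (0 : ℂ) 1,
      P G.base ξ = z ∧ ξ ^ d = w (y₀ z) G.base ∧ y₀ z ∈ J := by
    intro z hz
    obtain ⟨ξ, hξ, y, hy, h1, h2, h3⟩ := hfr G.base hb z hz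
    rw [hhb y hy] at h3
    have h4 : y₀ z = y := h3
    exact ⟨ξ, hξ, h1, by rw [h4]; exact h2, by rw [h4]; exact hy⟩
  choose! ξ hξs hPξ hξd hyJ using hbase
  -- This is the `d`-th root of the coordinate of the landing point that starts at the given
  -- coordinate `ξ z` over the base point.
  set v : ℂ → ℂ → ℂ := fun l z => ξ z * exp (Λ (y₀ z) l / d)
  have hexpd : ∀ a : ℂ, exp (a / d) ^ d = exp a := fun a => by
    rw [← exp_nat_mul, mul_div_cancel₀ _ hd0]
  have hvd : ∀ z ∈ frontier (j.fiber G.base), ∀ l ∈ D', v l z ^ d = w (y₀ z) l := by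
    intro z hz l hl
    simp only [v]
    rw [mul_pow, hexpd, hξd z hz, ← hΛ _ (hyJ z hz) l hl]
  have hnorm : ∀ a : ℂ, a ^ d ∈ sphere (0 : ℂ) 1 → a ∈ sphere (0 : ℂ) 1 := fun a ha => by
    rw [mem_sphere_zero_iff_norm, norm_pow] at ha
    rw [mem_sphere_zero_iff_norm]
    exact (pow_eq_one_iff_of_nonneg (norm_nonneg _) T.ne_zero).1 ha
  have hvs : ∀ z ∈ frontier (j.fiber G.base), ∀ l ∈ D', v l z ∈ sphere (0 : ℂ) 1 :=
    fun z hz l hl => hnorm _ (by rw [hvd z hz l hl]; exact hws _ (hyJ z hz) l hl)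
  have hgv : ∀ z ∈ frontier (j.fiber G.base), ∀ l ∈ D', G.g G.o l (P l (v l z)) = σ l (y₀ z) :=
    fun z hz l hl => by
      rw [(T.lift l hl _ (sphere_subset_closedBall (hvs z hz l hl))).2, hvd z hz l hl,
        hFw _ (hyJ z hz) l hl]
  refine ⟨fun l z => P l (v l z), fun z hz => ⟨?_, ?_⟩, fun l hl => ⟨?_, ?_, fun z hz => ?_⟩⟩
  · simp only [v]
    rw [hΛb _ (hyJ z hz), zero_div, exp_zero, mul_one, hPξ z hz]
  · have hvc : ContinuousOn (fun l => v l z) D' :=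
      continuousOn_const.mul ((hΛc _ (hyJ z hz)).div_const _).cexp
    -- The lift is built only as a continuous function; holomorphy follows since it solves `g = σ`
    -- away from the critical point.
    refine differentiableOn_of_fibered (g := G.g G.o) (Λ := fun l => l) (q := fun l => σ l (y₀ z))
      R.isOpen (fun l hl => ?_) (fun l hl => ?_) differentiableOn_id
      (T.trivialization.1.comp (f := fun l => (l, v l z)) (continuousOn_id.prodMk hvc)
        fun l hl => ⟨hl, sphere_subset_closedBall (hvs z hz l hl)⟩)
      ((hσd _ (hyJ z hz)).mono hD) (fun l hl => hgv z hz l hl)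
    · exact H.analyticAt_g (hD hl) (subset_closure
        (T.lift l hl _ (sphere_subset_closedBall (hvs z hz l hl))).1)
    · refine H.deriv_central_ne_zero (hD hl)
        (T.lift l hl _ (sphere_subset_closedBall (hvs z hz l hl))).1
        (R.ne_zero_of_mem_frontier H hs hl ht ?_)
      rw [hgv z hz l hl]
      exact hσfr l (hD hl) _ (hyJ z hz)
  · intro z hz z' hz' hzz
    have h1 := T.trivialization.2 l hl (sphere_subset_closedBall (hvs z hz l hl))
      (sphere_subset_closedBall (hvs z' hz' l hl)) hzz
    have h2 : σ l (y₀ z) = σ l (y₀ z') := by rw [← hgv z hz l hl, ← hgv z' hz' l hl, h1]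
    have h3 : y₀ z = y₀ z' := by
      have := congrArg (G.iter t l) h2
      rw [hiterσ l (hD hl) _ (hyJ z hz), hiterσ l (hD hl) _ (hyJ z' hz')] at this
      exact H.motion.1 l (hD hl) (IsHolomorphicFamily.frontier_subset_boundarySet _ (hyJ z hz))
        (IsHolomorphicFamily.frontier_subset_boundarySet _ (hyJ z' hz')) this
    simp only [v, h3] at h1
    rw [← hPξ z hz, ← hPξ z' hz', mul_right_cancel₀ (exp_ne_zero _) h1]
  · refine Subset.antisymm ?_ fun x hx => ?_
    · rintro _ ⟨z, hz, rfl⟩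
      exact T.trivialization.mem_frontier hl (hvs z hz l hl)
    · obtain ⟨ζ, hζ, y, hy, rfl, hζy, -⟩ := hfr l hl x hx
      -- Running the root continuation backwards finds the boundary point over the base that moves
      -- to `x`.
      set ζ₀ := ζ * exp (-(Λ y l) / d)
      have h1 : ζ₀ ^ d = w y G.base := by
        simp only [ζ₀]
        rw [mul_pow, hexpd, hζy, hΛ y hy l hl, mul_assoc, ← exp_add, add_neg_cancel, exp_zero,
          mul_one]
      have hζ₀ : ζ₀ ∈ sphere (0 : ℂ) 1 := hnorm _ (by rw [h1]; exact hws y hy _ hb)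
      have hz : P G.base ζ₀ ∈ frontier (j.fiber G.base) := T.trivialization.mem_frontier hb hζ₀
      have h2 : y₀ (P G.base ζ₀) = y := by
        simp only [y₀]
        rw [(T.lift _ hb _ (sphere_subset_closedBall hζ₀)).2, h1, hFw y hy _ hb,
          hiterσ _ H.base_mem y hy, hhb y hy]
      have h3 : ξ (P G.base ζ₀) = ζ₀ := T.trivialization.2 _ hb
        (sphere_subset_closedBall (hξs _ hz)) (sphere_subset_closedBall hζ₀) (hPξ _ hz)
      refine ⟨_, hz, ?_⟩
      simp only [v]
      rw [h2, h3]
      simp only [ζ₀]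
      rw [mul_assoc, ← exp_add, neg_div, neg_add_cancel, exp_zero, mul_one]
  · refine ⟨hyJ z hz, ?_, ?_⟩
    · rw [hgv z hz l hl]
      exact hσfr l (hD hl) _ (hyJ z hz)
    · rw [hgv z hz l hl]
      exact hiterσ l (hD hl) _ (hyJ z hz)

end RenormDisc

end FiberMap

/-! ### The renormalized family -/

namespace FiberMap

variable {ι : Type*} {G : FiberMap ι} {h : ℂ → ℂ → ℂ} {l : ℂ} {s t : List ι} {c : ℝ → ℂ} {e : ℂ}
  {q : ℂ → ℂ}

/-- The first return map near the critical point is again a branched double cover. -/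
theorem IsHolomorphicFamily.isDoubleBranchedCover_return (H : G.IsHolomorphicFamily h)
    (hs : ∀ i ∈ s, i ≠ G.o) (hl : l ∈ G.D) (hc : G.critVal l ∈ G.landing s l) :
    IsDoubleBranchedCover (fun z => G.iter s l (G.g G.o l z))
      {z | z ∈ G.V G.o l ∧ G.g G.o l z ∈ G.landing s l} (G.V G.o l) := by
  have hVU := H.V_subset G.o hl
  have hle := H.landing_eq hl s
  -- Fibers and compact preimages of the return map are those of the central map over the image of
  -- the univalent inverse branch, so the covering properties are inherited.
  have key : ∀ K ⊆ G.V G.o l, {z | z ∈ G.V G.o l ∧ G.g G.o l z ∈ G.landing s l} ∩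
      (fun z => G.iter s l (G.g G.o l z)) ⁻¹' K =
        G.V G.o l ∩ G.g G.o l ⁻¹' (G.branch s l '' K) := by
    intro K hK
    ext z
    constructor
    · rintro ⟨⟨hz, hzL⟩, hzK⟩
      rw [hle] at hzL
      exact ⟨hz, _, hzK, H.branch_iter hl hs hzL.1⟩
    · rintro ⟨hz, w, hw, hwz⟩
      have h1 := H.iter_branch hl hs (hVU (hK hw))
      have h2 := H.branch_mem hl hs (hVU (hK hw))
      rw [hwz] at h1 h2
      refine ⟨⟨hz, ?_⟩, ?_⟩
      · rw [hle]
        exact ⟨h2, by rw [h1]; exact hK hw⟩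
      · simp only [mem_preimage, h1]
        exact hw
  have hcL : G.g G.o l 0 ∈ G.wordDomain s l ∧ G.iter s l (G.g G.o l 0) ∈ G.V G.o l := by
    rw [hle] at hc
    exact hc
  have hbc : G.branch s l (G.iter s l (G.g G.o l 0)) = G.g G.o l 0 := H.branch_iter hl hs hcL.1
  refine ⟨fun z hz => ?_, fun K hK hKc => ?_, ?_, ?_, fun w hw hwc => ?_⟩
  · have := hz.2
    rw [hle] at this
    exact this.2
  · rw [key K hK]
    refine (H.central hl).isProper _ ?_ (hKc.image_of_continuousOn ?_)
    · rintro _ ⟨w, hw, rfl⟩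
      exact H.wordDomain_subset hl s (H.branch_mem hl hs (hVU (hK hw)))
    · exact (H.continuousOn_branch hs).comp (f := fun w => (l, w)) (by fun_prop)
        fun w hw => ⟨hl, hVU (hK hw)⟩
  · have h1 := (H.analyticAt_iter hl hcL.1).fiber.differentiableAt
    have h2 := (H.analyticAt_g hl (subset_closure (H.zero_mem_V hl))).fiber.differentiableAt
    have := deriv_comp (h₂ := G.iter s l) (h := G.g G.o l) (0 : ℂ) h1 h2
    rw [(H.central hl).crit, mul_zero] at this
    exact this
  · rw [key _ (singleton_subset_iff.2 hcL.2), image_singleton, hbc]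
    exact (H.central hl).fiber_crit
  · rw [key _ (singleton_subset_iff.2 hw), image_singleton]
    refine (H.central hl).fiber _ (H.wordDomain_subset hl s (H.branch_mem hl hs (hVU hw))) ?_
    intro h1
    apply hwc
    rw [← H.iter_branch hl hs (hVU hw), h1]

namespace RenormDisc

theorem isGenQuadraticLike_renorm (R : G.RenormDisc s c e q) (H : G.IsHolomorphicFamily h)
    (hs : G.IsBaseItinerary s) (hl : l ∈ G.renormDomain s) :
    IsGenQuadraticLike (G.renorm s hs H.base_mem H.zero_mem).o (fun j : G.RenormIndex s => j.fiber l)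
      (G.V G.o l) fun j z => G.iter j.1.1 l (G.g G.o l z) := by
  have hlD := R.subset_D hl
  refine ⟨fun j z hz => ?_, fun i j hij => ?_, fun j z hz => ?_, ?_, fun j hj => ?_⟩
  · obtain ⟨F, P, d, T, -⟩ := R.exists_renormTube H hs.1 j
    exact (T.mem_of_mem_closure hl hz).1
  · exact (R.disjoint_closure_fiber H hs.1 hij hl).mono subset_closure subset_closure
  · exact AnalyticAt.fiber (g := fun l z => G.iter j.1.1 l (G.g G.o l z)) (p := (l, z))
      (R.analyticAt_return H hs.1 hl hz)
  · have hfib : RenormIndex.fiber (G.renorm s hs H.base_mem H.zero_mem).o l =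
        {z | z ∈ G.V G.o l ∧ G.g G.o l z ∈ G.landing s l} := by
      ext z
      simp only [RenormIndex.fiber,
        R.fiber_eq_of_word_eq H hs.1 (j := (G.renorm s hs H.base_mem H.zero_mem).o) rfl, pullback,
        mem_ofPred_eq, hl, true_and]
    simp only [hfib]
    exact H.isDoubleBranchedCover_return hs.1 hlD (critVal_mem hl)
  · obtain ⟨F, P, d, T, hd⟩ := R.exists_renormTube H hs.1 j
    -- Only the central tube carries the word `s`, so on any other tube the degree is one.
    have hjs : j.1.1 ≠ s := by
      intro hjs
      refine hj (Subtype.ext (Prod.ext hjs ?_))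
      rw [R.fiber_eq_of_word_eq H hs.1 hjs,
        R.fiber_eq_of_word_eq H hs.1 (j := (G.renorm s hs H.base_mem H.zero_mem).o) rfl]
    have h1 := T.bijOn (hd hjs) hl
    have hb := H.bijOn_iter hlD j.2.1
    have hle := H.landing_eq hlD j.1.1
    have h2 : BijOn (G.iter j.1.1 l) (G.landing j.1.1 l) (G.V G.o l) := by
      rw [hle]
      refine ⟨fun z hz => hz.2, hb.injOn.mono fun z hz => hz.1, fun w hw => ?_⟩
      have hw' := H.V_subset G.o hlD hw
      have h3 := H.iter_branch hlD j.2.1 hw'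
      exact ⟨_, ⟨H.branch_mem hlD j.2.1 hw', by rw [h3]; exact hw⟩, h3⟩
    exact h2.comp h1

/-- The boundaries of the new tubes are pairwise disjoint and lie in the open central disc, at every
parameter. So the separate motions combine without conflict and the union remains injective. -/
theorem exists_lifted_motion (R : G.RenormDisc s c e q) (H : G.IsHolomorphicFamily h)
    (hs : G.IsBaseItinerary s) :
    ∃ k : ℂ → ℂ → ℂ, G.IsLiftedMotion s hs H.base_mem H.zero_mem h k ∧
      IsHolomorphicMotion (G.renormDomain s) G.base
        (G.renorm s hs H.base_mem H.zero_mem).boundarySet k ∧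
      ∀ j : G.RenormIndex s, ∀ l ∈ G.renormDomain s,
        k l '' frontier (j.fiber G.base) = frontier (j.fiber l) ∧
        ∀ z ∈ frontier (j.fiber G.base),
          G.iter j.1.1 G.base (G.g G.o G.base z) ∈ frontier (G.V G.o G.base) := by
  classical
  have hb : G.base ∈ G.renormDomain s := mem_connectedComponentIn ⟨H.base_mem, hs.2⟩
  have hV : ∀ j : G.RenormIndex s, ∀ l ∈ G.renormDomain s, ∀ z ∈ frontier (j.fiber l),
      z ∉ frontier (G.V G.o l) := by
    intro j l hl z hz hz'
    obtain ⟨F, P, d, T, -⟩ := R.exists_renormTube H hs.1 j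
    rw [(H.isOpen_V G.o (R.subset_D hl)).frontier_eq] at hz'
    exact hz'.2 (T.mem_of_mem_closure hl (frontier_subset_closure hz)).1
  have huniq : ∀ l ∈ G.renormDomain s, ∀ j j' : G.RenormIndex s, ∀ z ∈ frontier (j.fiber l),
      z ∈ frontier (j'.fiber l) → j = j' := by
    intro l hl j j' z hz hz'
    by_contra hne
    exact Set.disjoint_left.1 (R.disjoint_closure_fiber H hs.1 hne hl)
      (frontier_subset_closure hz) (frontier_subset_closure hz')
  choose κ hκ hκ' using R.exists_motion_fiber H hs.1 hb
  set k : ℂ → ℂ → ℂ := fun l z => if z ∈ frontier (G.V G.o G.base) then h l z else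
    if hz : ∃ j : G.RenormIndex s, z ∈ frontier (j.fiber G.base) then κ hz.choose l z else z
  have hkV : ∀ z ∈ frontier (G.V G.o G.base), ∀ l, k l z = h l z := fun z hz l => if_pos hz
  have hkj : ∀ (j : G.RenormIndex s), ∀ z ∈ frontier (j.fiber G.base), ∀ l, k l z = κ j l z := by
    intro j z hz l
    have hex : ∃ j : G.RenormIndex s, z ∈ frontier (j.fiber G.base) := ⟨j, hz⟩
    simp only [k]
    rw [if_neg (hV j _ hb z hz), dif_pos hex, huniq _ hb _ _ z hex.choose_spec hz]
  have hVmem : ∀ z ∈ frontier (G.V G.o G.base), ∀ l ∈ G.renormDomain s,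
      k l z ∈ frontier (G.V G.o l) := fun z hz l hl => by
    rw [hkV z hz]
    exact H.motion_mem G.o (R.subset_D hl) hz
  have hjmem : ∀ (j : G.RenormIndex s), ∀ z ∈ frontier (j.fiber G.base),
      ∀ l ∈ G.renormDomain s, k l z ∈ frontier (j.fiber l) := fun j z hz l hl => by
    rw [hkj j z hz, ← (hκ' j l hl).2.1]
    exact mem_image_of_mem _ hz
  have hset : ∀ z ∈ (G.renorm s hs H.base_mem H.zero_mem).boundarySet,
      z ∈ frontier (G.V G.o G.base) ∨ ∃ j : G.RenormIndex s, z ∈ frontier (j.fiber G.base) :=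
    fun z hz => hz.imp id fun h => mem_iUnion.1 h
  have hmV := H.motion.mono (IsHolomorphicFamily.frontier_subset_boundarySet G.o)
  refine ⟨k, fun l hl => ⟨fun z hz => hkV z hz l, fun j z hz => ?_⟩,
    ⟨fun l hl z hz z' hz' hzz => ?_, fun z hz => ?_, fun z hz => ?_⟩,
    fun j l hl => ⟨?_, fun z hz => ((hκ' j l hl).2.2 z hz).1⟩⟩
  · have h1 := (hκ' j l hl).2.2 z hz
    refine ⟨hjmem j z hz l hl, ?_⟩
    rw [hkj j z hz]
    exact h1.2
  · rcases hset z hz with h1 | ⟨j, h1⟩ <;> rcases hset z' hz' with h2 | ⟨j', h2⟩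
    · rw [hkV z h1, hkV z' h2] at hzz
      exact hmV.1 l (R.subset_D hl) h1 h2 hzz
    · exact (hV j' l hl _ (hjmem j' z' h2 l hl) (hzz ▸ hVmem z h1 l hl)).elim
    · exact (hV j l hl _ (hjmem j z h1 l hl) (hzz ▸ hVmem z' h2 l hl)).elim
    · have hjj := huniq l hl j j' _ (hjmem j z h1 l hl) (hzz ▸ hjmem j' z' h2 l hl)
      subst hjj
      rw [hkj j z h1, hkj j z' h2] at hzz
      exact (hκ' j l hl).1 h1 h2 hzz
  · rcases hset z hz with h1 | ⟨j, h1⟩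
    · rw [hkV z h1]
      exact hmV.2.1 z h1
    · rw [hkj j z h1]
      exact (hκ j z h1).1
  · rcases hset z hz with h1 | ⟨j, h1⟩
    · simp only [hkV z h1]
      exact (hmV.2.2 z h1).mono R.subset_D
    · simp only [hkj j z h1]
      exact (hκ j z h1).2
  · rw [← (hκ' j l hl).2.1]
    exact image_congr fun z hz => hkj j z hz l

theorem isHolomorphicFamily_renorm (R : G.RenormDisc s c e q) (H : G.IsHolomorphicFamily h)
    (hs : G.IsBaseItinerary s) :
    ∃ k : ℂ → ℂ → ℂ, G.IsLiftedMotion s hs H.base_mem H.zero_mem h k ∧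
      (G.renorm s hs H.base_mem H.zero_mem).IsHolomorphicFamily k := by
  obtain ⟨k, hk, hm, hkj⟩ := R.exists_lifted_motion H hs
  refine ⟨k, hk, ?_⟩
  obtain ⟨F, hF⟩ := H.exists_trivialization_V G.o
  exact
    { disc := R.isTopDisc
      base_mem := mem_connectedComponentIn ⟨H.base_mem, hs.2⟩
      bidisc_U := isBidisc_iff.2 ⟨F, hF.mono R.subset_D⟩
      bidisc_V := fun j => by
        obtain ⟨F, P, d, T, -⟩ := R.exists_renormTube H hs.1 j
        exact isBidisc_iff.2 ⟨P, T.trivialization⟩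
      quasicircle_U := fun l hl => H.quasicircle_V G.o l (R.subset_D hl)
      quasicircle_V := fun j l hl => R.isQuasicircle_fiber H hs.1 j hl
      holo := fun j p hp => R.analyticAt_return H hs.1 hp.1 hp.2
      fiber := fun l hl => R.isGenQuadraticLike_renorm H hs hl
      motion := hm
      motion_U := fun l hl => (image_congr fun z hz => (hk l hl).1 z hz).trans
        (H.motion_V G.o l (R.subset_D hl))
      motion_V := fun j l hl => (hkj j l hl).1
      equivariant := fun j l hl z hz =>
        ((hk l hl).1 _ ((hkj j l hl).2 z hz)).trans ((hk l hl).2 j z hz).2.2.symm }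

/-- The closure of `D'` lies in `D`, so the trivialization of the central tube over `D` already
covers the closed parameter domain. A limit point of a new tube maps into a closed landing domain,
which lies in `U`, so it is in the open central disc. Over the frontier the critical value is on the
boundary of `L s`, which the iterate takes to the boundary of the central disc. -/
theorem isProper_renorm (R : G.RenormDisc s c e q) (H : G.IsHolomorphicFamily h)
    (hs : G.IsBaseItinerary s) : (G.renorm s hs H.base_mem H.zero_mem).IsProper := by
  obtain ⟨F, hF⟩ := H.exists_trivialization_V G.o
  have hF' := hF.mono R.subset
  have hcf : ∀ l ∈ closure (G.renormDomain s),
      closedFiber (G.renormDomain s) (G.V G.o) l = closure (G.V G.o l) := by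
    intro l hl
    rw [hF'.closure_eq hl]
    ext z
    rw [closedFiber, mem_ofPred_eq,
      closedFiber_eq R.isCompact hF'.1 (fun l hl => hF.3 l (R.subset_D hl))]
    constructor
    · rintro ⟨⟨l', w⟩, ⟨-, hw⟩, hlw⟩
      obtain ⟨rfl, rfl⟩ := Prod.mk.inj hlw
      exact ⟨w, hw, rfl⟩
    · rintro ⟨w, hw, rfl⟩
      exact ⟨(l, w), ⟨hl, hw⟩, rfl⟩
  refine ⟨⟨F, hF'.1, hF'.2, fun l hl => hF.3 l (R.subset_D hl)⟩, fun j p hp => ?_,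
    fun l => G.iter s l (G.critVal l), ⟨(R.hasWinding_critVal H hs.1).1, fun _ _ => rfl⟩,
    fun l hl => ?_⟩
  · obtain ⟨l, z⟩ := p
    have hsub : ∀ p ∈ tube (G.renormDomain s) j.fiber,
        p ∈ tube G.D (G.V G.o) ∧ fibered (G.g G.o) p ∈ tube G.D (G.landing j.1.1) := by
      rintro ⟨l, z⟩ ⟨hl, hz⟩
      have h1 := j.subset_pullback hz
      exact ⟨⟨R.subset_D hl, h1.2.1⟩, R.subset_D hl, h1.2.2⟩
    have hl : l ∈ closure (G.renormDomain s) :=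
      map_mem_closure continuous_fst hp fun p hp => hp.1
    have hlD := R.subset hl
    have hsub' : tube (G.renormDomain s) j.fiber ⊆ tube G.D fun l => closure (G.V G.o l) :=
      fun p hp => ⟨(hsub p hp).1.1, subset_closure (hsub p hp).1.2⟩
    have hz : z ∈ closure (G.V G.o l) :=
      hF.mem_closure_of_mem_closure_tube H.isOpen_D hlD (closure_mono hsub' hp)
    have hgz : G.g G.o l z ∈ closure (G.landing j.1.1 l) := by
      refine (H.trivialization_landing j.2.1 hF).mem_closure_of_mem_closure_tube H.isOpen_D hlD ?_
      have hc : ContinuousAt (fibered (G.g G.o)) (l, z) :=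
        continuousAt_fst.prodMk (H.analyticAt_g hlD hz).continuousAt
      have hm : MapsTo (fibered (G.g G.o)) (tube (G.renormDomain s) j.fiber)
          (tube G.D fun l => closure (G.landing j.1.1 l)) :=
        fun p hp => ⟨(hsub p hp).2.1, subset_closure (hsub p hp).2.2⟩
      exact hc.continuousWithinAt.mem_closure hp hm
    change z ∈ interior (closedFiber (G.renormDomain s) (G.V G.o) l)
    rw [hcf l hl, hF.interior_closure hlD]
    exact H.mem_V_of_mem_closure hlD hz (H.closure_landing_subset j.2.1 hlD hgz)
  · have hlc := frontier_subset_closure hl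
    have hlD := R.subset hlc
    change _ ∈ frontier (closedFiber (G.renormDomain s) (G.V G.o) l)
    rw [hcf l hlc, hF.frontier_closure hlD]
    have h1 := R.critVal_mem_frontier l hl
    rw [H.frontier_landing hs.1 hlD] at h1
    exact h1.2

theorem hasWindingNumber_renorm (R : G.RenormDisc s c e q) (H : G.IsHolomorphicFamily h)
    (hs : G.IsBaseItinerary s) :
    (G.renorm s hs H.base_mem H.zero_mem).HasWindingNumber 1 :=
  ⟨fun l => G.iter s l (G.critVal l), ⟨(R.hasWinding_critVal H hs.1).1, fun _ _ => rfl⟩, c,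
    R.boundary, by simpa only [sub_zero] using (R.hasWinding_critVal H hs.1).2⟩

end RenormDisc

end FiberMap

end

theorem mainTheorem5 {ι : Type*} (G : FiberMap ι) (h : ℂ → ℂ → ℂ)
    (hG : G.IsHolomorphicFamily h) (hproper : G.IsProper) (hw : G.HasWindingNumber 1)
    (s : List ι) (hs : G.IsBaseItinerary s) :
    ∃ k : ℂ → ℂ → ℂ,
      G.IsLiftedMotion s hs hG.base_mem hG.zero_mem h k ∧
      (G.renorm s hs hG.base_mem hG.zero_mem).IsHolomorphicFamily k ∧
      (G.renorm s hs hG.base_mem hG.zero_mem).IsProper ∧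
      (G.renorm s hs hG.base_mem hG.zero_mem).HasWindingNumber 1 := by
  obtain ⟨φ, γ, F, B⟩ := hproper.exists_boundaryData hw
  obtain ⟨c, e, q, R⟩ := hG.exists_renormDisc B hs
  obtain ⟨k, hk, hk'⟩ := R.isHolomorphicFamily_renorm hG hs
  exact ⟨k, hk, hk', R.isProper_renorm hG hs, R.hasWindingNumber_renorm hG hs⟩
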